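/- Let $\mathbb K$ be a field of characteristic $0$; all graded vector spaces are $\mathbb Z$-graded, $V[n]^m=V^{m+n}$, $s$ denotes the Koszul-signed swap, elements in formulas are homogeneous, and $\tilde i:=i-1$. **Homotopy Lie algebras.** Let $\mathfrak g$ be a finite-dimensional homotopy Lie algebra: a finite-dimensional graded vector space with graded skew-symmetric maps $\ell^i:\mathfrak g^{\otimes i}\to\mathfrak g[2-i]$, $i\ge 1$, such that for all $i\geq 1$ $$\sum_{\tilde j+k=i}\ \sum_{\sigma\in S_{k,\tilde j}}\varepsilon_\sigma(-1)^{\tilde j}\,\ell^j\big(\ell^k(x_{\sigma(1)},\dots,x_{\sigma(k)}),x_{\sigma(k+1)},\dots,x_{\sigma(i)}\big)=0 ,$$ where $S_{k,\tilde j}$ is the set of $(k,\tilde j)$-shuffles and $\varepsilon_\sigma$ is the product of $\mathrm{sgn}(\sigma)$ and the Koszul sign. Put $\Sigma_{j,k}=\sum_{\sigma\in S_{j,k}}\mathrm{sgn}(\sigma)\,\sigma$. **Representations.** An intertwiner $f:U\rightsquigarrow V[|f|]$ is a family of graded linear maps $f^i:\mathfrak g^{\otimes\tilde i}\otimes U\to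 V[|f|-\tilde i]$, $i\ge1$, graded skew-symmetric in the $\mathfrak g$-inputs. Define $$(gf)^i=\sum_{\tilde j+k=i}(-1)^{(|g|-\tilde j)\tilde k}\,g^j(1_{\tilde j}\otimes f^k)(\Sigma_{\tilde j,\tilde k}\otimes1_U),$$ $$(f\odot g)^i=\sum_{\tilde j+k=i}(-1)^{(|f|-\tilde j)\tilde k}\,(f^j\otimes g^k)(1_{\tilde j}\otimes s_{\mathfrak g^{\otimes\tilde k},U}\otimes 1_V)(\Sigma_{\tilde j,\tilde k}\otimes1_{U\otimes V}),$$ $\ell_U:U\rightsquigarrow(\mathfrak g\otimes U)[2]$ with $\ell_U^i=\ell^{\tilde i}\otimes 1_U$ ($\ell^0=0$), and $\varrho_f:\mathfrak g\otimes U\rightsquigarrow V[|f|-1]$ with $\varrho_f^i=(-1)^if^{i+1}$. A representation is a graded vector space $V$ with an intertwiner $\rho_V:V\rightsquigarrow V[1]$ such that $\rho_V\rho_V=\varrho_{\rho_V}\ell_V$. $\mathsf{Rep}(\mathfrak g)$ has as objects the representations, as morphisms of degree $n$ the intertwiners $U\rightsquigarrow V[n]$, as composition the juxtaposition $gf$,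 as units the identity maps, as hom-differential $f\mapsto\rho_Vf-(-1)^{|f|}f\rho_U-\varrho_f\ell_U$; its tensor product is $U\otimes V$ with $\rho_U\odot 1_V+1_U\odot\rho_V$ on objects and $\odot$ on morphisms, its unit is $\mathbb K$ with $\rho_{\mathbb K}=0$, and its braiding is $s_{U,V}$. **Chevalley–Eilenberg algebra and modules.** Let $(x_\alpha)$ be a homogeneous basis of $\mathfrak g$, let $\theta^\alpha$, $|\theta^\alpha|=1-|x_\alpha|$, be the corresponding generators of $\mathfrak g^*[-1]$, write $f_{\alpha_1,\dots,\alpha_k}(u)=f(x_{\alpha_1},\dots,x_{\alpha_k},u)$ and $\ell^i(x_{\alpha_1},\dots,x_{\alpha_i})=\ell^\alpha_{\alpha_1,\dots,\alpha_i}x_\alpha$, sum over repeated indices, and put $|x_{\alpha_1}\cdots x_{\alpha_k}|_{\rm rev}=\sum_{l}|x_{\alpha_l}|\,|x_{\alpha_{l+1}}\cdots x_{\alpha_k}|$. Let $\mathrm{CE}_{\mathfrak g}=\prod_{i\ge0}\mathrm{Sym}^i(\mathfrak g^*[-1])$ and $\mathrm{CE}_{\mathfrak g}^V=\prod_{i\ge0}\big(\mathrm{Sym}^i(\mathfrak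 g^*[-1])\otimes V\big)$ (products of graded vector spaces). A completed semi-free $\mathrm{CE}_{\mathfrak g}$-dg-module is a dg-module whose underlying graded module is isomorphic to $\prod_i(\mathrm{Sym}^i(\mathfrak g^*[-1])\otimes V)$ for some graded vector space $V$. They form a full subcategory ${}_{\mathrm{CE}_{\mathfrak g}}\mathsf{dgMod}^{\rm sf}_\Pi$ of the dg-category of dg-modules, in which a morphism of degree $n$ is a linear map $f$ of degree $n$ with $f(am)=(-1)^{n|a|}af(m)$ and $\partial f=d f-(-1)^{n}f d$. Its tensor product is the (completed) relative tensor product $\otimes_{\mathrm{CE}_{\mathfrak g}}$, i.e. the completed semi-free dg-module that carries the universal $\mathrm{CE}_{\mathfrak g}$-balanced map among completed semi-free modules, with $d(m\otimes m')=dm\otimes m'+(-1)^{|m|}m\otimes dm'$ and $(f\otimes g)(m\otimes m')=(-1)^{|g||m|}f(m)\otimes g(m')$; its unit is $\mathrm{CE}_{\mathfrak g}$, its braiding is $m\otimes m'\mapsto(-1)^{|m||m'|}m'\otimes m$, and the associativity and unit constraints are the canonical ones. **Proposition.** 1. $\mathsf{Rep}(\mathfrak g)$ is a symmetric monoidal dg-category.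 2. There is a unique derivation $\delta$ of degree $1$ of $\mathrm{CE}_{\mathfrak g}$ with $$\delta\theta^\alpha=\sum_{i\ge1}\tfrac1{i!}(-1)^{\sum_{l=1}^i|x_{\alpha_l}|(l+|x_{\alpha_{l+1}}\cdots x_{\alpha_i}|)}\,\ell^\alpha_{\alpha_1,\dots,\alpha_i}\,\theta^{\alpha_1}\cdots\theta^{\alpha_i},$$ and $(\mathrm{CE}_{\mathfrak g},\delta)$ is a CDGA. The relative tensor product above exists and makes ${}_{\mathrm{CE}_{\mathfrak g}}\mathsf{dgMod}^{\rm sf}_\Pi$ a symmetric monoidal dg-category. 3. For every representation $V$ there is a unique linear map $d$ of degree $1$ on $\mathrm{CE}^V_{\mathfrak g}$ with $d(am)=(\delta a)m+(-1)^{|a|}a\,dm$ and $$dv=\sum_{i\ge1}\tfrac1{\tilde i!}(-1)^{|x_{\alpha_1}\cdots x_{\alpha_{\tilde i}}|_{\rm rev}+\sum_{l=1}^{\tilde i}|x_{\alpha_l}|\tilde l}\,\theta^{\alpha_1}\cdots\theta^{\alpha_{\tilde i}}\,\rho^i_{\alpha_1,\dots,\alpha_{\tilde i}}(v)\qquad(v\in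 V);$$ this makes $\mathrm{CE}^V_{\mathfrak g}$ a completed semi-free dg-module. For every intertwiner $f:U\rightsquigarrow V[|f|]$ there is a unique $\mathrm{CE}_{\mathfrak g}$-linear map $\mathrm{CE}^f_{\mathfrak g}:\mathrm{CE}^U_{\mathfrak g}\to\mathrm{CE}^V_{\mathfrak g}[|f|]$ with $$\mathrm{CE}_{\mathfrak g}^f(u)=\sum_{i\ge1}\tfrac1{\tilde i!}(-1)^{|x_{\alpha_1}\cdots x_{\alpha_{\tilde i}}|_{\rm rev}+\sum_{l=1}^{\tilde i}|x_{\alpha_l}|(l+|f|)}\,\theta^{\alpha_1}\cdots\theta^{\alpha_{\tilde i}}\,f^i_{\alpha_1,\dots,\alpha_{\tilde i}}(u)\qquad(u\in U).$$ 4. $V\mapsto\mathrm{CE}_{\mathfrak g}^V$, $f\mapsto\mathrm{CE}_{\mathfrak g}^f$ is a symmetric strict monoidal dg-equivalence $\mathsf{Rep}(\mathfrak g)\simeq{}_{\mathrm{CE}_{\mathfrak g}}\mathsf{dgMod}^{\rm sf}_\Pi$: it is a dg-functor; it is fully faithful (bijective on every degree of the hom-complexes); it is essentially surjective (every completed semi-free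 dg-module is isomorphic, by a closed degree-$0$ isomorphism, to some $\mathrm{CE}_{\mathfrak g}^V$); and, along the isomorphisms $\mathrm{CE}_{\mathfrak g}^U\otimes_{\mathrm{CE}_{\mathfrak g}}\mathrm{CE}_{\mathfrak g}^V\cong\mathrm{CE}_{\mathfrak g}^{U\odot V}$ determined by $u\otimes v\mapsto u\otimes v$ on generators and the equality $\mathrm{CE}_{\mathfrak g}=\mathrm{CE}_{\mathfrak g}^{\mathbb K}$, one has $\mathrm{CE}_{\mathfrak g}^{U\odot V}=\mathrm{CE}_{\mathfrak g}^U\otimes_{\mathrm{CE}_{\mathfrak g}}\mathrm{CE}_{\mathfrak g}^V$, $\mathrm{CE}_{\mathfrak g}^{f\odot g}=\mathrm{CE}_{\mathfrak g}^f\otimes_{\mathrm{CE}_{\mathfrak g}}\mathrm{CE}_{\mathfrak g}^g$ and $\mathrm{CE}_{\mathfrak g}^{s_{U,V}}=s_{\mathrm{CE}_{\mathfrak g}^U,\mathrm{CE}_{\mathfrak g}^V}$, and these identifications are compatible with the associativity and unit constraints. -/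

import Mathlib

open scoped TensorProduct

universe u v w v' w'

noncomputable section

/-! ### Graded vector spaces -/

/-- A `ℤ`-graded vector space: a vector space that is the internal direct sum of subspaces
`gr m`, `m : ℤ`. -/
structure GrSp (K : Type u) [Field K] where
  carrier : Type u
  [acg : AddCommGroup carrier]
  [mod : Module K carrier]
  gr : ℤ → Submodule K carrier
  isInternal : DirectSum.IsInternal gr

attribute [instance] GrSp.acg GrSp.mod

instance GrSp.instCoeSort {K : Type u} [Field K] : CoeSort (GrSp K) (Type u) := ⟨GrSp.carrier⟩

namespace GrSp

variable {K : Type u} [Field K]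

/-- Linear maps of degree `n`, i.e. graded linear maps `V → W[n]`. -/
def mapDeg (V W : GrSp K) (n : ℤ) : Submodule K (V →ₗ[K] W) where
  carrier := {f | ∀ p : ℤ, ∀ x ∈ V.gr p, f x ∈ W.gr (p + n)}
  add_mem' hf hg p x hx := (W.gr (p + n)).add_mem (hf p x hx) (hg p x hx)
  zero_mem' p _ _ := (W.gr (p + n)).zero_mem
  smul_mem' c _ hf p x hx := (W.gr (p + n)).smul_mem c (hf p x hx)

/-- The decomposition `⨁ p, V.gr p ≃ V`. -/
def decomp (V : GrSp K) : (DirectSum ℤ fun p => V.gr p) ≃ₗ[K] V :=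
  LinearEquiv.ofBijective (DirectSum.coeLinearMap V.gr)
    (show Function.Bijective (DirectSum.coeAddMonoidHom V.gr) from V.isInternal)

theorem decomp_symm_apply (V : GrSp K) {p : ℤ} {x : V} (hx : x ∈ V.gr p) :
    V.decomp.symm x = DirectSum.lof K ℤ (fun i => V.gr i) p ⟨x, hx⟩ := by
  rw [LinearEquiv.symm_apply_eq]
  exact (DirectSum.coeLinearMap_lof V.gr p ⟨x, hx⟩).symm

/-- The projection onto the part of parity `e`, i.e. onto the sum of the `V.gr p` with
`p ≡ e` modulo `2`. -/
def par (V : GrSp K) (e : Fin 2) : V →ₗ[K] V :=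
  (DirectSum.toModule K ℤ V fun p => if p % 2 = ((e : ℕ) : ℤ) then (V.gr p).subtype else 0) ∘ₗ
    V.decomp.symm.toLinearMap

theorem par_apply (V : GrSp K) (e : Fin 2) {p : ℤ} {x : V} (hx : x ∈ V.gr p) :
    V.par e x = if p % 2 = ((e : ℕ) : ℤ) then x else 0 := by
  simp only [par, LinearMap.comp_apply, LinearEquiv.coe_coe, decomp_symm_apply V hx, DirectSum.toModule_lof]
  split_ifs <;> simp

/-- The operator `v ↦ (-1) ^ (c * |v|) v`. -/
def sgn (V : GrSp K) (c : ℤ) : V →ₗ[K] V := V.par 0 + c.negOnePow • V.par 1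

/-- The ground field, concentrated in degree `0`. -/
abbrev ground (K : Type u) [Field K] : GrSp K where
  carrier := K
  gr m := if m = 0 then ⊤ else ⊥
  isInternal := by
    refine DirectSum.isInternal_submodule_of_iSupIndep_of_iSup_eq_top ?_ ?_
    · intro i
      by_cases hi : i = 0
      · have : (⨆ j, ⨆ (_ : j ≠ i), (if j = 0 then ⊤ else ⊥ : Submodule K K)) = ⊥ := by
          simp only [iSup_eq_bot]
          intro j hj
          rw [if_neg]
          rintro rfl
          exact hj hi.symm
        rw [this]
        exact disjoint_bot_right
      · simp only [if_neg hi]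
        exact disjoint_bot_left
    · exact top_le_iff.1 (le_iSup_of_le 0 (by simp))

/-- The degree `m` part of `V ⊗ W`. -/
def tensorGr (V W : GrSp K) (m : ℤ) : Submodule K (V ⊗[K] W) :=
  Submodule.span K {t | ∃ p q : ℤ, p + q = m ∧ ∃ v ∈ V.gr p, ∃ w ∈ W.gr q, t = v ⊗ₜ[K] w}

theorem tmul_mem_tensorGr (V W : GrSp K) {p q m : ℤ} (h : p + q = m) {v : V} {w : W}
    (hv : v ∈ V.gr p) (hw : w ∈ W.gr q) : v ⊗ₜ[K] w ∈ tensorGr V W m :=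
  Submodule.subset_span ⟨p, q, h, v, hv, w, hw, rfl⟩

theorem span_homogeneous (V : GrSp K) : Submodule.span K {x : V | ∃ p, x ∈ V.gr p} = ⊤ := by
  rw [← V.isInternal.submodule_iSup_eq_top]
  refine le_antisymm (Submodule.span_le.2 ?_) (iSup_le fun p x hx => Submodule.subset_span ⟨p, hx⟩)
  rintro x ⟨p, hx⟩
  exact Submodule.mem_iSup_of_mem p hx

theorem tensor_isInternal (V W : GrSp K) : DirectSum.IsInternal (tensorGr V W) := by
  let inner : ∀ p q : ℤ, V.gr p →ₗ[K] W.gr q →ₗ[K] DirectSum ℤ fun m => tensorGr V W m :=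
    fun p q => LinearMap.mk₂ K
      (fun x y => DirectSum.lof K ℤ (fun m => tensorGr V W m) (p + q)
        ⟨(x : V) ⊗ₜ[K] (y : W), tmul_mem_tensorGr V W rfl x.2 y.2⟩)
      (fun x x' y => by
        rw [← map_add]; congr 1; ext; simp [TensorProduct.add_tmul])
      (fun c x y => by
        rw [← map_smul]; congr 1)
      (fun x y y' => by
        rw [← map_add]; congr 1; ext; simp [TensorProduct.tmul_add])
      (fun c x y => by
        rw [← map_smul]; congr 1; ext; simp)
  let D : V ⊗[K] W →ₗ[K] DirectSum ℤ fun m => tensorGr V W m :=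
    TensorProduct.lift
      (((DirectSum.toModule K ℤ _ fun p =>
        (LinearMap.flip (DirectSum.toModule K ℤ _ fun q => (inner p q).flip)))
        ∘ₗ V.decomp.symm.toLinearMap).compl₂
          W.decomp.symm.toLinearMap)
  have hD : ∀ (p q : ℤ) (x : V) (hx : x ∈ V.gr p) (y : W) (hy : y ∈ W.gr q),
      D (x ⊗ₜ[K] y) = DirectSum.lof K ℤ (fun m => tensorGr V W m) (p + q)
        ⟨x ⊗ₜ[K] y, tmul_mem_tensorGr V W rfl hx hy⟩ := by
    intro p q x hx y hy
    simp only [D, TensorProduct.lift.tmul, LinearMap.compl₂_apply, LinearMap.comp_apply,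
      LinearEquiv.coe_coe, decomp_symm_apply V hx, decomp_symm_apply W hy, DirectSum.toModule_lof,
      LinearMap.flip_apply]
    rfl
  refine (DirectSum.Decomposition.ofLinearMap (tensorGr V W) D ?_ ?_).isInternal
  · have key : ∀ t ∈ Submodule.span K {t : V ⊗[K] W | ∃ v w, v ⊗ₜ[K] w = t},
        (DirectSum.coeLinearMap (tensorGr V W) ∘ₗ D) t = t := by
      intro t _
      induction t using TensorProduct.induction_on with
      | zero => simp
      | add a b ha hb =>
        rw [map_add, ha, hb] <;> simp [TensorProduct.span_tmul_eq_top]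
      | tmul a b =>
        have ha : a ∈ Submodule.span K {x : V | ∃ p, x ∈ V.gr p} := by
          simp [span_homogeneous]
        have hb : b ∈ Submodule.span K {x : W | ∃ p, x ∈ W.gr p} := by
          simp [span_homogeneous]
        induction ha, hb using Submodule.span_induction₂ with
        | mem_mem x y hx hy =>
          obtain ⟨p, hx⟩ := hx
          obtain ⟨q, hy⟩ := hy
          rw [LinearMap.comp_apply, hD p q x hx y hy]
          simp
        | zero_left => simp
        | zero_right => simp
        | add_left x y z _ _ _ h1 h2 =>
          rw [TensorProduct.add_tmul, map_add, h1, h2] <;> simp [TensorProduct.span_tmul_eq_top]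
        | add_right x y z _ _ _ h1 h2 =>
          rw [TensorProduct.tmul_add, map_add, h1, h2] <;> simp [TensorProduct.span_tmul_eq_top]
        | smul_left r x y _ _ h =>
          rw [← TensorProduct.smul_tmul', map_smul, h]; simp [TensorProduct.span_tmul_eq_top]
        | smul_right r x y _ _ h =>
          rw [TensorProduct.tmul_smul, map_smul, h]; simp [TensorProduct.span_tmul_eq_top]
    ext v w
    exact key _ (Submodule.subset_span ⟨v, w, rfl⟩)
  · refine DirectSum.linearMap_ext K fun m => ?_
    ext1 ⟨t, ht⟩
    simp only [LinearMap.comp_apply, LinearMap.id_apply, DirectSum.coeLinearMap_lof]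
    have ht' := ht
    unfold tensorGr at ht'
    induction ht' using Submodule.span_induction with
    | mem x hx =>
      obtain ⟨p, q, rfl, v, hv, w, hw, rfl⟩ := hx
      exact hD p q v hv w hw
    | zero => rw [map_zero]; exact (map_zero _).symm
    | add x y hx hy h1 h2 =>
      rw [map_add, h1 hx, h2 hy, ← map_add]; rfl
    | smul c x hx h1 =>
      rw [map_smul, h1 hx, ← map_smul]; rfl

/-- The tensor product of graded vector spaces. -/
abbrev tensor (V W : GrSp K) : GrSp K where
  carrier := V ⊗[K] W
  gr := tensorGr V W
  isInternal := tensor_isInternal V W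

/-- The symmetry `v ⊗ w ↦ (-1) ^ (|v| * |w|) w ⊗ v`. -/
def swap (V W : GrSp K) : V ⊗[K] W →ₗ[K] W ⊗[K] V :=
  (TensorProduct.comm K V W).toLinearMap ∘ₗ
    ∑ e : Fin 2, ∑ e' : Fin 2, ((e : ℤ) * (e' : ℤ)).negOnePow • TensorProduct.map (V.par e) (W.par e')

end GrSp

/-! ### Shuffles and multilinear maps -/

section Shuffles

variable {K : Type u} [Field K]

/-- A `(j, k)`-shuffle `σ` of `{1, …, i}`, `i = j + k`, is the same thing as the subset
`S = {σ 1, …, σ j}`. `sub S x` is the tuple `x (σ 1), …, x (σ j)`; thus `sub Sᶜ x` is the tuple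
`x (σ (j+1)), …, x (σ i)`. -/
def sub {X : Type*} {i : ℕ} (S : Finset (Fin i)) (x : Fin i → X) : Fin S.card → X :=
  fun l => x (S.orderEmbOfFin rfl l)

/-- The sign `ε_σ = χ_σ sgn σ` of the shuffle given by `S`, for inputs of degrees `d`: every pair
`a < b` that is interchanged contributes `-(-1) ^ (|x_a| |x_b|)`. -/
def shuffleSign {i : ℕ} (d : Fin i → ℤ) (S : Finset (Fin i)) : ℤˣ :=
  ∏ a ∈ Sᶜ, ∏ b ∈ S, if a < b then -(d a * d b).negOnePow else 1

/-- The multilinear map `x ↦ β (G (x_S)) (F (x_{Sᶜ}))`. -/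
def shufflePair {X A B C : Type*} [AddCommGroup X] [Module K X] [AddCommGroup A] [Module K A]
    [AddCommGroup B] [Module K B] [AddCommGroup C] [Module K C]
    (β : A →ₗ[K] B →ₗ[K] C) {i : ℕ} (S : Finset (Fin i))
    (G : MultilinearMap K (fun _ : Fin S.card => X) A)
    (F : MultilinearMap K (fun _ : Fin Sᶜ.card => X) B) :
    MultilinearMap K (fun _ : Fin i => X) C :=
  (MultilinearMap.curryFinFinset K C X (rfl : S.card = S.card) rfl).symm
    ((⟨⟨fun a => (β a).compMultilinearMap F, fun a a' => by ext; simp⟩,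
      fun c a => by ext; simp⟩ : A →ₗ[K] MultilinearMap K (fun _ : Fin Sᶜ.card => X) C)
      |>.compMultilinearMap G)

theorem shufflePair_apply {X A B C : Type*} [AddCommGroup X] [Module K X] [AddCommGroup A]
    [Module K A] [AddCommGroup B] [Module K B] [AddCommGroup C] [Module K C]
    (β : A →ₗ[K] B →ₗ[K] C) {i : ℕ} (S : Finset (Fin i))
    (G : MultilinearMap K (fun _ : Fin S.card => X) A)
    (F : MultilinearMap K (fun _ : Fin Sᶜ.card => X) B) (x : Fin i → X) :
    shufflePair β S G F x = β (G (sub S x)) (F (sub Sᶜ x)) := by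
  simp only [shufflePair, MultilinearMap.curryFinFinset_symm_apply]
  rfl

/-- If `φ d` depends on the degrees `d` only modulo `2`, then `homExt φ` is the multilinear map
whose value at homogeneous `x` of degrees `d` is `φ d x`. -/
def homExt (g : GrSp K) {C : Type*} [AddCommGroup C] [Module K C] {i : ℕ}
    (φ : (Fin i → ℤ) → MultilinearMap K (fun _ : Fin i => g) C) :
    MultilinearMap K (fun _ : Fin i => g) C :=
  ∑ e : Fin i → Fin 2, (φ fun l => ((e l : ℕ) : ℤ)).compLinearMap fun l => g.par (e l)

theorem homExt_apply (g : GrSp K) {C : Type*} [AddCommGroup C] [Module K C] {i : ℕ}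
    (φ : (Fin i → ℤ) → MultilinearMap K (fun _ : Fin i => g) C)
    (hφ : ∀ d d' : Fin i → ℤ, (∀ l, d l % 2 = d' l % 2) → φ d = φ d')
    (d : Fin i → ℤ) (x : Fin i → g) (hx : ∀ l, x l ∈ g.gr (d l)) :
    homExt g φ x = φ d x := by
  have h01 : ∀ l, ∃ e : Fin 2, d l % 2 = ((e : ℕ) : ℤ) := fun l => by
    rcases Int.emod_two_eq_zero_or_one (d l) with h | h
    · exact ⟨0, by simp [h]⟩
    · exact ⟨1, by simp [h]⟩
  choose e₀ he₀ using h01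
  simp only [homExt, sum_apply, MultilinearMap.compLinearMap_apply]
  rw [Finset.sum_eq_single e₀]
  · rw [hφ (fun l => ((e₀ l : ℕ) : ℤ)) d fun l => by
      rw [← he₀ l]; simp]
    congr 1
    funext l
    rw [GrSp.par_apply g (e₀ l) (hx l), if_pos (he₀ l)]
  · intro e _ he
    obtain ⟨l, hl⟩ : ∃ l, e l ≠ e₀ l := by
      by_contra h
      push Not at h
      exact he (funext h)
    refine MultilinearMap.map_coord_zero _ l ?_
    rw [GrSp.par_apply g (e l) (hx l), if_neg]
    intro h
    rw [he₀ l] at h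
    exact hl (Fin.ext (by exact_mod_cast h.symm))
  · intro h
    exact absurd (Finset.mem_univ _) h

end Shuffles

/-! ### Homotopy Lie algebras and intertwiners -/

/-- A homotopy Lie algebra: graded skew-symmetric brackets `ℓ i : g^{⊗ i} → g[2 - i]`, `i ≥ 1`
(with the convention `ℓ 0 = 0`), satisfying the generalised Jacobi identity. -/
structure HomotopyLie (K : Type u) [Field K] where
  g : GrSp K
  ℓ : ∀ i : ℕ, MultilinearMap K (fun _ : Fin i => g) g
  ℓ_zero : ℓ 0 = 0
  degree : ∀ (i : ℕ) (d : Fin i → ℤ) (x : Fin i → g), (∀ l, x l ∈ g.gr (d l)) →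
    ℓ i x ∈ g.gr ((∑ l, d l) + 2 - i)
  skew : ∀ (i : ℕ) (d : Fin i → ℤ) (x : Fin i → g), (∀ l, x l ∈ g.gr (d l)) →
    ∀ a b : Fin i, (a : ℕ) + 1 = b →
      ℓ i (x ∘ Equiv.swap a b) = -((d a * d b).negOnePow • ℓ i x)
  jacobi : ∀ (i : ℕ) (d : Fin i → ℤ) (x : Fin i → g), (∀ l, x l ∈ g.gr (d l)) →
    ∑ S : Finset (Fin i), (shuffleSign d S * (Sᶜ.card : ℤ).negOnePow) •
      ℓ (Sᶜ.card + 1) (Fin.cons (ℓ S.card (sub S x)) (sub Sᶜ x)) = 0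

namespace HomotopyLie

variable {K : Type u} [Field K] (L : HomotopyLie K)

/-- Families of multilinear maps `f k : g^{⊗ k} ⊗ U → V`, `k ≥ 0`; the component `f k` is the one
that is often indexed by `i = k + 1`. -/
abbrev Raw (U V : Type u) [AddCommGroup U] [Module K U] [AddCommGroup V] [Module K V] : Type u :=
  ∀ k : ℕ, MultilinearMap K (fun _ : Fin k => L.g) (U →ₗ[K] V)

/-- Intertwiners `U ⇝ V[n]`: families of skew-symmetric maps `f k : g^{⊗ k} ⊗ U → V[n - k]`. -/
def intertwiner (U V : GrSp K) (n : ℤ) : Submodule K (L.Raw U V) where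
  carrier := {f | ∀ (k : ℕ) (d : Fin k → ℤ) (x : Fin k → L.g), (∀ l, x l ∈ L.g.gr (d l)) →
    f k x ∈ GrSp.mapDeg U V ((∑ l, d l) + n - k) ∧
    ∀ a b : Fin k, (a : ℕ) + 1 = b → f k (x ∘ Equiv.swap a b) = -((d a * d b).negOnePow • f k x)}
  add_mem' {f f'} hf hf' k d x hx :=
    ⟨Submodule.add_mem _ (hf k d x hx).1 (hf' k d x hx).1, fun a b hab => by
      have h1 := (hf k d x hx).2 a b hab
      have h2 := (hf' k d x hx).2 a b hab
      simp only [Pi.add_apply, add_apply, h1, h2, smul_add, neg_add]⟩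
  zero_mem' k d x hx := ⟨Submodule.zero_mem _, fun a b hab => by simp⟩
  smul_mem' c f hf k d x hx :=
    ⟨Submodule.smul_mem _ c (hf k d x hx).1, fun a b hab => by
      have h1 := (hf k d x hx).2 a b hab
      simp only [Pi.smul_apply, smul_apply, h1, smul_neg]
      rw [smul_comm]⟩

/-- A linear map, viewed as a family concentrated in arity `k = 0`. -/
def ofLin {U V : Type u} [AddCommGroup U] [Module K U] [AddCommGroup V] [Module K V]
    (f : U →ₗ[K] V) : L.Raw U V
  | 0 => MultilinearMap.constOfIsEmpty K _ f
  | _ + 1 => 0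

/-- The juxtaposition `G F` of `F : U ⇝ V[n]` and `G : V ⇝ W[m]`. On homogeneous inputs
it is the sum over all shuffles of
`± G (x_{σ 1}, …, x_{σ j}) (F (x_{σ (j+1)}, …, x_{σ (j+k)}) u)`. -/
def comp {U V W : Type u} [AddCommGroup U] [Module K U] [AddCommGroup V] [Module K V]
    [AddCommGroup W] [Module K W] (m n : ℤ) (G : L.Raw V W) (F : L.Raw U V) : L.Raw U W :=
  fun i => homExt L.g fun d => ∑ S : Finset (Fin i),
    (shuffleSign d S * ((m - S.card) * Sᶜ.card + (n - Sᶜ.card) * ∑ a ∈ S, d a).negOnePow) •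
      shufflePair (LinearMap.llcomp K U V W) S (G S.card) (F Sᶜ.card)

/-- The odot product `F ⊙ G` of `F : U ⇝ U'[m]` and `G : V ⇝ V'[n]`. On homogeneous inputs it is
the sum over all shuffles of
`± F (x_{σ 1}, …, x_{σ j}) u ⊗ G (x_{σ (j+1)}, …, x_{σ (j+k)}) v`, where the part of the sign
that depends on `u` is `(-1) ^ (|u| (|x_{σ (j+1)}| + … + |x_{σ (j+k)}| + n - k))`. -/
def odot {U U' V V' : GrSp K} (m n : ℤ) (F : L.Raw U U') (G : L.Raw V V') :
    L.Raw (U.tensor V) (U'.tensor V') :=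
  fun i => homExt L.g fun d => ∑ S : Finset (Fin i),
    (shuffleSign d S * ((m - S.card) * Sᶜ.card + (n - Sᶜ.card) * ∑ a ∈ S, d a).negOnePow) •
      shufflePair (TensorProduct.mapBilinear (.id K) U V U' V') S
        ((LinearMap.lcomp K U' (U.sgn ((∑ a ∈ Sᶜ, d a) + n - Sᶜ.card))).compMultilinearMap
          (F S.card))
        (G Sᶜ.card)

/-- `ell U : U ⇝ (g ⊗ U)[2]`, `(x₁, …, x_k, u) ↦ ℓ (x₁, …, x_k) ⊗ u`. -/
def ell (U : GrSp K) : L.Raw U (L.g.tensor U) :=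
  fun k => (TensorProduct.mk K L.g U).compMultilinearMap (L.ℓ k)

/-- `varrho f : g ⊗ U ⇝ V[n - 1]`,
`(x₁, …, x_k, x ⊗ u) ↦ (-1) ^ (k + 1) f (x₁, …, x_k, x) u`, for `f : U ⇝ V[n]`. -/
def varrho {U V : GrSp K} (f : L.Raw U V) : L.Raw (L.g.tensor U) V :=
  fun k => (k + 1 : ℤ).negOnePow •
    (TensorProduct.uncurry (.id K) L.g U V).compMultilinearMap (f (k + 1)).curryRight

/-- A graded vector space `V` with a candidate `ρ` for a representation of the homotopy Lie
algebra on `V`. -/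
structure PreRep where
  V : GrSp K
  ρ : L.Raw V V

/-- `V` is a representation: `ρ` is an intertwiner `V ⇝ V[1]` with `ρ ρ = varrho_ρ ell_V`. -/
def IsRep (V : L.PreRep) : Prop :=
  V.ρ ∈ L.intertwiner V.V V.V 1 ∧ L.comp 1 1 V.ρ V.ρ = L.comp 0 2 (L.varrho V.ρ) (L.ell V.V)

end HomotopyLie

/-! ### Symmetric monoidal dg-categories -/

/-- The data of a dg-category: objects, hom-complexes, units and composition. Objects are the
`X : Obj` with `isObj X`; the degree `n` part of the hom-complex is `homDeg X Y n`, with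
differential `d n`; `comp m n g f` is the composite of `g` of degree `m` with `f` of degree `n`.
The values of the operations on other arguments are irrelevant. -/
structure DGData (K : Type u) [Field K] where
  Obj : Type v
  isObj : Obj → Prop
  Hom : Obj → Obj → Type w
  [acg : ∀ X Y, AddCommGroup (Hom X Y)]
  [mod : ∀ X Y, Module K (Hom X Y)]
  homDeg : ∀ X Y, ℤ → Submodule K (Hom X Y)
  id : ∀ X, Hom X X
  comp : ∀ {X Y Z}, ℤ → ℤ → Hom Y Z → Hom X Y → Hom X Z
  d : ∀ {X Y}, ℤ → Hom X Y → Hom X Y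

attribute [instance] DGData.acg DGData.mod

/-- The axioms of a dg-category: a category enriched in cochain complexes. -/
structure DGData.IsDGCategory {K : Type u} [Field K] (C : DGData.{u, v, w} K) : Prop where
  d_mem : ∀ {X Y : C.Obj}, C.isObj X → C.isObj Y → ∀ n, ∀ f ∈ C.homDeg X Y n,
    C.d n f ∈ C.homDeg X Y (n + 1)
  d_add : ∀ {X Y : C.Obj}, C.isObj X → C.isObj Y → ∀ n, ∀ f ∈ C.homDeg X Y n,
    ∀ f' ∈ C.homDeg X Y n, C.d n (f + f') = C.d n f + C.d n f'
  d_smul : ∀ {X Y : C.Obj}, C.isObj X → C.isObj Y → ∀ n (c : K), ∀ f ∈ C.homDeg X Y n,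
    C.d n (c • f) = c • C.d n f
  d_d : ∀ {X Y : C.Obj}, C.isObj X → C.isObj Y → ∀ n, ∀ f ∈ C.homDeg X Y n,
    C.d (n + 1) (C.d n f) = 0
  id_mem : ∀ {X : C.Obj}, C.isObj X → C.id X ∈ C.homDeg X X 0
  d_id : ∀ {X : C.Obj}, C.isObj X → C.d 0 (C.id X) = 0
  comp_mem : ∀ {X Y Z : C.Obj}, C.isObj X → C.isObj Y → C.isObj Z → ∀ m n,
    ∀ g ∈ C.homDeg Y Z m, ∀ f ∈ C.homDeg X Y n, C.comp m n g f ∈ C.homDeg X Z (m + n)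
  comp_add : ∀ {X Y Z : C.Obj}, C.isObj X → C.isObj Y → C.isObj Z → ∀ m n,
    ∀ g ∈ C.homDeg Y Z m, ∀ f ∈ C.homDeg X Y n, ∀ f' ∈ C.homDeg X Y n,
    C.comp m n g (f + f') = C.comp m n g f + C.comp m n g f'
  add_comp : ∀ {X Y Z : C.Obj}, C.isObj X → C.isObj Y → C.isObj Z → ∀ m n,
    ∀ g ∈ C.homDeg Y Z m, ∀ g' ∈ C.homDeg Y Z m, ∀ f ∈ C.homDeg X Y n,
    C.comp m n (g + g') f = C.comp m n g f + C.comp m n g' f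
  comp_smul : ∀ {X Y Z : C.Obj}, C.isObj X → C.isObj Y → C.isObj Z → ∀ m n (c : K),
    ∀ g ∈ C.homDeg Y Z m, ∀ f ∈ C.homDeg X Y n,
    C.comp m n g (c • f) = c • C.comp m n g f ∧ C.comp m n (c • g) f = c • C.comp m n g f
  d_comp : ∀ {X Y Z : C.Obj}, C.isObj X → C.isObj Y → C.isObj Z → ∀ m n,
    ∀ g ∈ C.homDeg Y Z m, ∀ f ∈ C.homDeg X Y n,
    C.d (m + n) (C.comp m n g f) =
      C.comp (m + 1) n (C.d m g) f + m.negOnePow • C.comp m (n + 1) g (C.d n f)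
  id_comp : ∀ {X Y : C.Obj}, C.isObj X → C.isObj Y → ∀ n, ∀ f ∈ C.homDeg X Y n,
    C.comp 0 n (C.id Y) f = f
  comp_id : ∀ {X Y : C.Obj}, C.isObj X → C.isObj Y → ∀ n, ∀ f ∈ C.homDeg X Y n,
    C.comp n 0 f (C.id X) = f
  assoc : ∀ {X Y Z W : C.Obj}, C.isObj X → C.isObj Y → C.isObj Z → C.isObj W → ∀ l m n,
    ∀ h ∈ C.homDeg Z W l, ∀ g ∈ C.homDeg Y Z m, ∀ f ∈ C.homDeg X Y n,
    C.comp (l + m) n (C.comp l m h g) f = C.comp l (m + n) h (C.comp m n g f)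

/-- `f` is a `0`-cocycle of the hom-complex. -/
def DGData.IsClosed {K : Type u} [Field K] (C : DGData.{u, v, w} K) {X Y : C.Obj}
    (f : C.Hom X Y) : Prop :=
  f ∈ C.homDeg X Y 0 ∧ C.d 0 f = 0

/-- `f` and `g` are mutually inverse isomorphisms of dg-categories (`0`-cocycles). -/
def DGData.IsIso {K : Type u} [Field K] (C : DGData.{u, v, w} K) {X Y : C.Obj}
    (f : C.Hom X Y) : Prop :=
  C.IsClosed f ∧ ∃ g : C.Hom Y X, C.IsClosed g ∧ C.comp 0 0 g f = C.id X ∧ C.comp 0 0 f g = C.id Y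

/-- The data of a symmetric monoidal structure on a dg-category; `tensorHom m n f g` is the product
of `f` of degree `m` and `g` of degree `n`. -/
structure MonData {K : Type u} [Field K] (C : DGData.{u, v, w} K) where
  tensorObj : C.Obj → C.Obj → C.Obj
  tensorHom : ∀ {X X' Y Y'}, ℤ → ℤ → C.Hom X X' → C.Hom Y Y' →
    C.Hom (tensorObj X Y) (tensorObj X' Y')
  unit : C.Obj
  assoc : ∀ X Y Z, C.Hom (tensorObj (tensorObj X Y) Z) (tensorObj X (tensorObj Y Z))
  lunit : ∀ X, C.Hom (tensorObj unit X) X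
  runit : ∀ X, C.Hom (tensorObj X unit) X
  braid : ∀ X Y, C.Hom (tensorObj X Y) (tensorObj Y X)

/-- The axioms of a symmetric monoidal dg-category. -/
structure MonData.IsSymmetricMonoidal {K : Type u} [Field K] {C : DGData.{u, v, w} K}
    (T : MonData C) : Prop extends C.IsDGCategory where
  tensorObj_isObj : ∀ {X Y : C.Obj}, C.isObj X → C.isObj Y → C.isObj (T.tensorObj X Y)
  unit_isObj : C.isObj T.unit
  tensorHom_mem : ∀ {X X' Y Y' : C.Obj}, C.isObj X → C.isObj X' → C.isObj Y → C.isObj Y' →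
    ∀ m n, ∀ f ∈ C.homDeg X X' m, ∀ g ∈ C.homDeg Y Y' n,
    T.tensorHom m n f g ∈ C.homDeg (T.tensorObj X Y) (T.tensorObj X' Y') (m + n)
  tensorHom_add : ∀ {X X' Y Y' : C.Obj}, C.isObj X → C.isObj X' → C.isObj Y → C.isObj Y' →
    ∀ m n, ∀ f ∈ C.homDeg X X' m, ∀ g ∈ C.homDeg Y Y' n, ∀ g' ∈ C.homDeg Y Y' n,
    T.tensorHom m n f (g + g') = T.tensorHom m n f g + T.tensorHom m n f g'
  add_tensorHom : ∀ {X X' Y Y' : C.Obj}, C.isObj X → C.isObj X' → C.isObj Y → C.isObj Y' →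
    ∀ m n, ∀ f ∈ C.homDeg X X' m, ∀ f' ∈ C.homDeg X X' m, ∀ g ∈ C.homDeg Y Y' n,
    T.tensorHom m n (f + f') g = T.tensorHom m n f g + T.tensorHom m n f' g
  tensorHom_smul : ∀ {X X' Y Y' : C.Obj}, C.isObj X → C.isObj X' → C.isObj Y → C.isObj Y' →
    ∀ m n (c : K), ∀ f ∈ C.homDeg X X' m, ∀ g ∈ C.homDeg Y Y' n,
    T.tensorHom m n f (c • g) = c • T.tensorHom m n f g ∧
      T.tensorHom m n (c • f) g = c • T.tensorHom m n f g
  d_tensorHom : ∀ {X X' Y Y' : C.Obj}, C.isObj X → C.isObj X' → C.isObj Y → C.isObj Y' →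
    ∀ m n, ∀ f ∈ C.homDeg X X' m, ∀ g ∈ C.homDeg Y Y' n,
    C.d (m + n) (T.tensorHom m n f g) =
      T.tensorHom (m + 1) n (C.d m f) g + m.negOnePow • T.tensorHom m (n + 1) f (C.d n g)
  tensorHom_id : ∀ {X Y : C.Obj}, C.isObj X → C.isObj Y →
    T.tensorHom 0 0 (C.id X) (C.id Y) = C.id (T.tensorObj X Y)
  interchange : ∀ {X X' X'' Y Y' Y'' : C.Obj}, C.isObj X → C.isObj X' → C.isObj X'' →
    C.isObj Y → C.isObj Y' → C.isObj Y'' → ∀ m n m' n', ∀ f ∈ C.homDeg X X' m,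
    ∀ g ∈ C.homDeg Y Y' n, ∀ f' ∈ C.homDeg X' X'' m', ∀ g' ∈ C.homDeg Y' Y'' n',
    C.comp (m' + n') (m + n) (T.tensorHom m' n' f' g') (T.tensorHom m n f g) =
      (n' * m).negOnePow • T.tensorHom (m' + m) (n' + n) (C.comp m' m f' f) (C.comp n' n g' g)
  assoc_isIso : ∀ {X Y Z : C.Obj}, C.isObj X → C.isObj Y → C.isObj Z → C.IsIso (T.assoc X Y Z)
  assoc_natural : ∀ {X X' Y Y' Z Z' : C.Obj}, C.isObj X → C.isObj X' → C.isObj Y → C.isObj Y' →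
    C.isObj Z → C.isObj Z' → ∀ l m n, ∀ f ∈ C.homDeg X X' l, ∀ g ∈ C.homDeg Y Y' m,
    ∀ h ∈ C.homDeg Z Z' n,
    C.comp 0 (l + m + n) (T.assoc X' Y' Z') (T.tensorHom (l + m) n (T.tensorHom l m f g) h) =
      C.comp (l + (m + n)) 0 (T.tensorHom l (m + n) f (T.tensorHom m n g h)) (T.assoc X Y Z)
  lunit_isIso : ∀ {X : C.Obj}, C.isObj X → C.IsIso (T.lunit X)
  lunit_natural : ∀ {X X' : C.Obj}, C.isObj X → C.isObj X' → ∀ n, ∀ f ∈ C.homDeg X X' n,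
    C.comp 0 n (T.lunit X') (T.tensorHom 0 n (C.id T.unit) f) = C.comp n 0 f (T.lunit X)
  runit_isIso : ∀ {X : C.Obj}, C.isObj X → C.IsIso (T.runit X)
  runit_natural : ∀ {X X' : C.Obj}, C.isObj X → C.isObj X' → ∀ n, ∀ f ∈ C.homDeg X X' n,
    C.comp 0 n (T.runit X') (T.tensorHom n 0 f (C.id T.unit)) = C.comp n 0 f (T.runit X)
  pentagon : ∀ {X Y Z W : C.Obj}, C.isObj X → C.isObj Y → C.isObj Z → C.isObj W →
    C.comp 0 0 (T.assoc X Y (T.tensorObj Z W)) (T.assoc (T.tensorObj X Y) Z W) =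
      C.comp 0 0 (T.tensorHom 0 0 (C.id X) (T.assoc Y Z W))
        (C.comp 0 0 (T.assoc X (T.tensorObj Y Z) W)
          (T.tensorHom 0 0 (T.assoc X Y Z) (C.id W)))
  triangle : ∀ {X Y : C.Obj}, C.isObj X → C.isObj Y →
    C.comp 0 0 (T.tensorHom 0 0 (C.id X) (T.lunit Y)) (T.assoc X T.unit Y) =
      T.tensorHom 0 0 (T.runit X) (C.id Y)
  braid_isIso : ∀ {X Y : C.Obj}, C.isObj X → C.isObj Y → C.IsIso (T.braid X Y)
  braid_natural : ∀ {X X' Y Y' : C.Obj}, C.isObj X → C.isObj X' → C.isObj Y → C.isObj Y' →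
    ∀ m n, ∀ f ∈ C.homDeg X X' m, ∀ g ∈ C.homDeg Y Y' n,
    C.comp 0 (m + n) (T.braid X' Y') (T.tensorHom m n f g) =
      (m * n).negOnePow • C.comp (n + m) 0 (T.tensorHom n m g f) (T.braid X Y)
  braid_braid : ∀ {X Y : C.Obj}, C.isObj X → C.isObj Y →
    C.comp 0 0 (T.braid Y X) (T.braid X Y) = C.id (T.tensorObj X Y)
  hexagon : ∀ {X Y Z : C.Obj}, C.isObj X → C.isObj Y → C.isObj Z →
    ∀ a ∈ C.homDeg (T.tensorObj X (T.tensorObj Z Y)) (T.tensorObj (T.tensorObj X Z) Y) 0,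
    C.comp 0 0 (T.assoc X Z Y) a = C.id _ → C.comp 0 0 a (T.assoc X Z Y) = C.id _ →
    T.braid (T.tensorObj X Y) Z =
      C.comp 0 0 (T.assoc Z X Y) (C.comp 0 0 (T.tensorHom 0 0 (T.braid X Z) (C.id Y))
        (C.comp 0 0 a (C.comp 0 0 (T.tensorHom 0 0 (C.id X) (T.braid Y Z)) (T.assoc X Y Z))))

/-- The data of a dg-functor; `map n` is the map on the degree `n` part of the hom-complexes. -/
structure DGFunctorData {K : Type u} [Field K] (C : DGData.{u, v, w} K)
    (D : DGData.{u, v', w'} K) where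
  obj : C.Obj → D.Obj
  map : ∀ {X Y : C.Obj}, ℤ → C.Hom X Y → D.Hom (obj X) (obj Y)

/-- `F` is a dg-functor. -/
structure DGFunctorData.IsDGFunctor {K : Type u} [Field K] {C : DGData.{u, v, w} K}
    {D : DGData.{u, v', w'} K} (F : DGFunctorData C D) : Prop where
  obj_isObj : ∀ {X : C.Obj}, C.isObj X → D.isObj (F.obj X)
  map_mem : ∀ {X Y : C.Obj}, C.isObj X → C.isObj Y → ∀ n, ∀ f ∈ C.homDeg X Y n,
    F.map n f ∈ D.homDeg (F.obj X) (F.obj Y) n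
  map_add : ∀ {X Y : C.Obj}, C.isObj X → C.isObj Y → ∀ n, ∀ f ∈ C.homDeg X Y n,
    ∀ f' ∈ C.homDeg X Y n, F.map n (f + f') = F.map n f + F.map n f'
  map_smul : ∀ {X Y : C.Obj}, C.isObj X → C.isObj Y → ∀ n (c : K), ∀ f ∈ C.homDeg X Y n,
    F.map n (c • f) = c • F.map n f
  map_d : ∀ {X Y : C.Obj}, C.isObj X → C.isObj Y → ∀ n, ∀ f ∈ C.homDeg X Y n,
    F.map (n + 1) (C.d n f) = D.d n (F.map n f)
  map_id : ∀ {X : C.Obj}, C.isObj X → F.map 0 (C.id X) = D.id (F.obj X)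
  map_comp : ∀ {X Y Z : C.Obj}, C.isObj X → C.isObj Y → C.isObj Z → ∀ m n,
    ∀ g ∈ C.homDeg Y Z m, ∀ f ∈ C.homDeg X Y n,
    F.map (m + n) (C.comp m n g f) = D.comp m n (F.map m g) (F.map n f)

/-- `F`, together with the comparison isomorphisms `μ X Y : F X ⊗ F Y ≅ F (X ⊗ Y)` and
`ε : I ≅ F I`, is an equivalence of symmetric monoidal dg-categories: an essentially surjective
and fully faithful dg-functor that preserves tensor products of objects and of morphisms, the
unit and the braiding (and the associativity and unit constraints) along `μ` and `ε`. -/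
structure DGFunctorData.IsSymmetricMonoidalDGEquivalence {K : Type u} [Field K]
    {C : DGData.{u, v, w} K} {D : DGData.{u, v', w'} K} (F : DGFunctorData C D)
    (T : MonData C) (T' : MonData D)
    (μ : ∀ X Y, D.Hom (T'.tensorObj (F.obj X) (F.obj Y)) (F.obj (T.tensorObj X Y)))
    (ε : D.Hom T'.unit (F.obj T.unit)) : Prop extends F.IsDGFunctor where
  fully_faithful : ∀ {X Y : C.Obj}, C.isObj X → C.isObj Y → ∀ n,
    Set.BijOn (F.map n) (C.homDeg X Y n : Set (C.Hom X Y))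
      (D.homDeg (F.obj X) (F.obj Y) n : Set (D.Hom (F.obj X) (F.obj Y)))
  ess_surj : ∀ {M : D.Obj}, D.isObj M → ∃ X : C.Obj, C.isObj X ∧
    ∃ f : D.Hom (F.obj X) M, D.IsIso f
  mul_isIso : ∀ {X Y : C.Obj}, C.isObj X → C.isObj Y → D.IsIso (μ X Y)
  unit_isIso : D.IsIso ε
  map_tensorHom : ∀ {X X' Y Y' : C.Obj}, C.isObj X → C.isObj X' → C.isObj Y → C.isObj Y' →
    ∀ m n, ∀ f ∈ C.homDeg X X' m, ∀ g ∈ C.homDeg Y Y' n,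
    D.comp (m + n) 0 (F.map (m + n) (T.tensorHom m n f g)) (μ X Y) =
      D.comp 0 (m + n) (μ X' Y') (T'.tensorHom m n (F.map m f) (F.map n g))
  map_assoc : ∀ {X Y Z : C.Obj}, C.isObj X → C.isObj Y → C.isObj Z →
    D.comp 0 0 (F.map 0 (T.assoc X Y Z)) (D.comp 0 0 (μ (T.tensorObj X Y) Z)
        (T'.tensorHom 0 0 (μ X Y) (D.id (F.obj Z)))) =
      D.comp 0 0 (μ X (T.tensorObj Y Z)) (D.comp 0 0
        (T'.tensorHom 0 0 (D.id (F.obj X)) (μ Y Z)) (T'.assoc (F.obj X) (F.obj Y) (F.obj Z)))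
  map_lunit : ∀ {X : C.Obj}, C.isObj X →
    D.comp 0 0 (F.map 0 (T.lunit X)) (D.comp 0 0 (μ T.unit X)
      (T'.tensorHom 0 0 ε (D.id (F.obj X)))) = T'.lunit (F.obj X)
  map_runit : ∀ {X : C.Obj}, C.isObj X →
    D.comp 0 0 (F.map 0 (T.runit X)) (D.comp 0 0 (μ X T.unit)
      (T'.tensorHom 0 0 (D.id (F.obj X)) ε)) = T'.runit (F.obj X)
  map_braid : ∀ {X Y : C.Obj}, C.isObj X → C.isObj Y →
    D.comp 0 0 (F.map 0 (T.braid X Y)) (μ X Y) =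
      D.comp 0 0 (μ Y X) (T'.braid (F.obj X) (F.obj Y))

/-! ### The symmetric monoidal dg-category of representations -/

namespace HomotopyLie

variable {K : Type u} [Field K] (L : HomotopyLie K)

/-- The dg-category of representations of a homotopy Lie algebra: morphisms are intertwiners, with
juxtaposition as composition and differential
`f ↦ ρ_V f - (-1) ^ |f| f ρ_U - varrho_f ell_U`. -/
abbrev rep : DGData.{u, u + 1, u} K where
  Obj := L.PreRep
  isObj := L.IsRep
  Hom U V := L.Raw U.V V.V
  homDeg U V n := L.intertwiner U.V V.V n
  id _ := L.ofLin LinearMap.id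
  comp m n g f := L.comp m n g f
  d {U V} n f := L.comp 1 n V.ρ f - n.negOnePow • L.comp n 1 f U.ρ
    - L.comp (n - 1) 2 (L.varrho f) (L.ell U.V)

/-- The symmetric monoidal structure: `U ⊙ V` is `U ⊗ V` with the representation
`ρ_U ⊙ 1 + 1 ⊙ ρ_V`, the unit is the trivial representation on the ground field, and the braiding
is given by the Koszul sign rule. -/
abbrev repMon : MonData L.rep where
  tensorObj U V :=
    ⟨U.V.tensor V.V, L.odot 1 0 U.ρ (L.ofLin LinearMap.id) + L.odot 0 1 (L.ofLin LinearMap.id) V.ρ⟩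
  tensorHom m n f g := L.odot m n f g
  unit := ⟨GrSp.ground K, 0⟩
  assoc U V W := L.ofLin (TensorProduct.assoc K U.V V.V W.V).toLinearMap
  lunit U := L.ofLin (TensorProduct.lid K U.V).toLinearMap
  runit U := L.ofLin (TensorProduct.rid K U.V).toLinearMap
  braid U V := L.ofLin (GrSp.swap U.V V.V)

end HomotopyLie

/-! ### CDGAs and dg-modules -/

/-- The data of a differential graded algebra. -/
structure DGAlg (K : Type u) [Field K] where
  A : GrSp K
  mul : A →ₗ[K] A →ₗ[K] A
  one : A
  δ : A →ₗ[K] A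

/-- The axioms of a commutative differential graded algebra. -/
structure DGAlg.IsCDGA {K : Type u} [Field K] (R : DGAlg K) : Prop where
  mul_mem : ∀ p q, ∀ a ∈ R.A.gr p, ∀ b ∈ R.A.gr q, R.mul a b ∈ R.A.gr (p + q)
  one_mem : R.one ∈ R.A.gr 0
  mul_assoc : ∀ a b c, R.mul (R.mul a b) c = R.mul a (R.mul b c)
  one_mul : ∀ a, R.mul R.one a = a
  mul_one : ∀ a, R.mul a R.one = a
  mul_comm : ∀ p q, ∀ a ∈ R.A.gr p, ∀ b ∈ R.A.gr q,
    R.mul a b = (p * q).negOnePow • R.mul b a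
  δ_mem : R.δ ∈ GrSp.mapDeg R.A R.A 1
  δ_one : R.δ R.one = 0
  leibniz : ∀ p, ∀ a ∈ R.A.gr p, ∀ b,
    R.δ (R.mul a b) = R.mul (R.δ a) b + p.negOnePow • R.mul a (R.δ b)
  δ_δ : ∀ a, R.δ (R.δ a) = 0

/-- The data of a dg-module over a differential graded algebra. -/
structure DGModData {K : Type u} [Field K] (R : DGAlg K) where
  M : GrSp K
  act : R.A →ₗ[K] M →ₗ[K] M
  d : M →ₗ[K] M

namespace DGModData

variable {K : Type u} [Field K] {R : DGAlg K}

/-- The axioms of a dg-module. -/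
structure IsDGModule (M : DGModData R) : Prop where
  act_mem : ∀ p q, ∀ a ∈ R.A.gr p, ∀ x ∈ M.M.gr q, M.act a x ∈ M.M.gr (p + q)
  mul_act : ∀ a b x, M.act (R.mul a b) x = M.act a (M.act b x)
  one_act : ∀ x, M.act R.one x = x
  d_mem : M.d ∈ GrSp.mapDeg M.M M.M 1
  d_act : ∀ p, ∀ a ∈ R.A.gr p, ∀ x,
    M.d (M.act a x) = M.act (R.δ a) x + p.negOnePow • M.act a (M.d x)
  d_d : ∀ x, M.d (M.d x) = 0

/-- The `R`-linear maps of degree `n`: `f (a x) = (-1) ^ (n |a|) a (f x)`. -/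
def hom (M N : DGModData R) (n : ℤ) : Submodule K (M.M →ₗ[K] N.M) where
  carrier := {f | f ∈ GrSp.mapDeg M.M N.M n ∧
    ∀ p, ∀ a ∈ R.A.gr p, ∀ x, f (M.act a x) = (n * p).negOnePow • N.act a (f x)}
  add_mem' {f f'} hf hf' := ⟨Submodule.add_mem _ hf.1 hf'.1, fun p a ha x => by
    simp only [LinearMap.add_apply, hf.2 p a ha x, hf'.2 p a ha x, map_add, smul_add]⟩
  zero_mem' := ⟨Submodule.zero_mem _, fun p a ha x => by simp⟩
  smul_mem' c f hf := ⟨Submodule.smul_mem _ c hf.1, fun p a ha x => by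
    simp only [LinearMap.smul_apply, hf.2 p a ha x, map_smul]
    rw [smul_comm]⟩

/-- `R` as a dg-module over itself. -/
abbrev regular (R : DGAlg K) : DGModData R := ⟨R.A, R.mul, R.δ⟩

/-- The dg-category of those dg-modules over `R` that satisfy `P`, as a full subcategory of the
dg-category of all dg-modules. -/
abbrev dgMod (R : DGAlg K) (P : DGModData R → Prop) : DGData.{u, u + 1, u} K where
  Obj := DGModData R
  isObj M := M.IsDGModule ∧ P M
  Hom M N := M.M →ₗ[K] N.M
  homDeg M N n := hom M N n
  id _ := LinearMap.id
  comp _ _ g f := g ∘ₗ f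
  d {M N} n f := N.d ∘ₗ f - n.negOnePow • (f ∘ₗ M.d)

/-- The `R`-balanced, `R`-linear maps `b : M × N → Q` of degree `n`. -/
structure IsBalanced {M N Q : DGModData R} (n : ℤ) (b : M.M →ₗ[K] N.M →ₗ[K] Q.M) : Prop where
  degree : ∀ p q, ∀ x ∈ M.M.gr p, ∀ y ∈ N.M.gr q, b x y ∈ Q.M.gr (p + q + n)
  act_left : ∀ p, ∀ a ∈ R.A.gr p, ∀ x y,
    b (M.act a x) y = (n * p).negOnePow • Q.act a (b x y)
  balanced : ∀ p q, ∀ a ∈ R.A.gr p, ∀ x ∈ M.M.gr q, ∀ y,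
    b x (N.act a y) = (p * q).negOnePow • b (M.act a x) y

end DGModData

/-- Relative tensor products `M ⊗_R N` in the full subcategory of the dg-modules satisfying `P`,
with the pairings `(x, y) ↦ x ⊗ y`, the products of morphisms, and the constraints. -/
structure RelTensor {K : Type u} [Field K] (R : DGAlg K) where
  obj : DGModData R → DGModData R → DGModData R
  tmul : ∀ M N : DGModData R, M.M →ₗ[K] N.M →ₗ[K] (obj M N).M
  hom : ∀ {M M' N N' : DGModData R}, ℤ → ℤ → (M.M →ₗ[K] M'.M) → (N.M →ₗ[K] N'.M) →
    ((obj M N).M →ₗ[K] (obj M' N').M)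
  assoc : ∀ M N Q : DGModData R, (obj (obj M N) Q).M →ₗ[K] (obj M (obj N Q)).M
  lunit : ∀ M : DGModData R, (obj (.regular R) M).M →ₗ[K] M.M
  runit : ∀ M : DGModData R, (obj M (.regular R)).M →ₗ[K] M.M
  braid : ∀ M N : DGModData R, (obj M N).M →ₗ[K] (obj N M).M

/-- The symmetric monoidal data with `R` as the unit. -/
abbrev RelTensor.mon {K : Type u} [Field K] {R : DGAlg K} (T : RelTensor R)
    (P : DGModData R → Prop) : MonData (DGModData.dgMod R P) where
  tensorObj := T.obj
  tensorHom := T.hom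
  unit := .regular R
  assoc := T.assoc
  lunit := T.lunit
  runit := T.runit
  braid := T.braid

/-- `T` is the relative tensor product of the dg-modules satisfying `P`: `(x, y) ↦ x ⊗ y` is the
universal `R`-balanced map to a dg-module satisfying `P`, with `d (x ⊗ y) = dx ⊗ y ± x ⊗ dy`, and
products of morphisms, constraints and braiding are the `R`-linear maps given on the elements
`x ⊗ y` by the standard formulas (which determines them, by the universal property). -/
structure RelTensor.IsRelativeTensor {K : Type u} [Field K] {R : DGAlg K} (T : RelTensor R)
    (P : DGModData R → Prop) : Prop where
  isObj : ∀ {M N : DGModData R}, M.IsDGModule ∧ P M → N.IsDGModule ∧ P N →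
    (T.obj M N).IsDGModule ∧ P (T.obj M N)
  balanced : ∀ {M N : DGModData R}, M.IsDGModule ∧ P M → N.IsDGModule ∧ P N →
    DGModData.IsBalanced 0 (T.tmul M N)
  d_tmul : ∀ {M N : DGModData R}, M.IsDGModule ∧ P M → N.IsDGModule ∧ P N →
    ∀ p, ∀ x ∈ M.M.gr p, ∀ y, (T.obj M N).d (T.tmul M N x y) =
      T.tmul M N (M.d x) y + p.negOnePow • T.tmul M N x (N.d y)
  universal : ∀ {M N Q : DGModData R}, M.IsDGModule ∧ P M → N.IsDGModule ∧ P N →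
    Q.IsDGModule ∧ P Q → ∀ (n : ℤ) (b : M.M →ₗ[K] N.M →ₗ[K] Q.M), DGModData.IsBalanced n b →
    ∃! h : (T.obj M N).M →ₗ[K] Q.M, h ∈ DGModData.hom (T.obj M N) Q n ∧
      ∀ x y, h (T.tmul M N x y) = b x y
  hom_mem : ∀ {M M' N N' : DGModData R}, M.IsDGModule ∧ P M → M'.IsDGModule ∧ P M' →
    N.IsDGModule ∧ P N → N'.IsDGModule ∧ P N' → ∀ m n, ∀ f ∈ DGModData.hom M M' m,
    ∀ g ∈ DGModData.hom N N' n,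
    T.hom m n f g ∈ DGModData.hom (T.obj M N) (T.obj M' N') (m + n)
  hom_tmul : ∀ {M M' N N' : DGModData R}, M.IsDGModule ∧ P M → M'.IsDGModule ∧ P M' →
    N.IsDGModule ∧ P N → N'.IsDGModule ∧ P N' → ∀ m n, ∀ f ∈ DGModData.hom M M' m,
    ∀ g ∈ DGModData.hom N N' n, ∀ p, ∀ x ∈ M.M.gr p, ∀ y,
    T.hom m n f g (T.tmul M N x y) = (n * p).negOnePow • T.tmul M' N' (f x) (g y)
  assoc_mem : ∀ {M N Q : DGModData R}, M.IsDGModule ∧ P M → N.IsDGModule ∧ P N →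
    Q.IsDGModule ∧ P Q →
    T.assoc M N Q ∈ DGModData.hom (T.obj (T.obj M N) Q) (T.obj M (T.obj N Q)) 0
  assoc_tmul : ∀ {M N Q : DGModData R}, M.IsDGModule ∧ P M → N.IsDGModule ∧ P N →
    Q.IsDGModule ∧ P Q → ∀ x y z, T.assoc M N Q (T.tmul (T.obj M N) Q (T.tmul M N x y) z) =
      T.tmul M (T.obj N Q) x (T.tmul N Q y z)
  lunit_mem : ∀ {M : DGModData R}, M.IsDGModule ∧ P M →
    T.lunit M ∈ DGModData.hom (T.obj (.regular R) M) M 0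
  lunit_tmul : ∀ {M : DGModData R}, M.IsDGModule ∧ P M →
    ∀ a x, T.lunit M (T.tmul (.regular R) M a x) = M.act a x
  runit_mem : ∀ {M : DGModData R}, M.IsDGModule ∧ P M →
    T.runit M ∈ DGModData.hom (T.obj M (.regular R)) M 0
  runit_tmul : ∀ {M : DGModData R}, M.IsDGModule ∧ P M → ∀ p q, ∀ a ∈ R.A.gr p,
    ∀ x ∈ M.M.gr q, T.runit M (T.tmul M (.regular R) x a) = (p * q).negOnePow • M.act a x
  braid_mem : ∀ {M N : DGModData R}, M.IsDGModule ∧ P M → N.IsDGModule ∧ P N →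
    T.braid M N ∈ DGModData.hom (T.obj M N) (T.obj N M) 0
  braid_tmul : ∀ {M N : DGModData R}, M.IsDGModule ∧ P M → N.IsDGModule ∧ P N →
    ∀ p q, ∀ x ∈ M.M.gr p, ∀ y ∈ N.M.gr q,
    T.braid M N (T.tmul M N x y) = (p * q).negOnePow • T.tmul N M y x

/-! ### The Chevalley-Eilenberg algebra and its completed semi-free modules -/

/-- A homogeneous basis `x_1, …, x_N` of a finite-dimensional graded vector space. -/
structure HomogeneousBasis {K : Type u} [Field K] (V : GrSp K) (N : ℕ) where
  basis : Module.Basis (Fin N) K V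
  deg : Fin N → ℤ
  mem : ∀ α, basis α ∈ V.gr (deg α)

namespace CE

variable {K : Type u} [Field K] {N : ℕ} (deg : Fin N → ℤ)

/-- The generators `θ^1, …, θ^N` have degrees `|θ^α| = 1 - deg α`. Exponents `R` index the ordered
monomials `θ^R = (θ^1)^(R 1) ⋯ (θ^N)^(R N)`. Since odd generators square to zero, the nonzero
monomials are those for which `R α ≤ 1` whenever `θ^α` is odd; they form a basis of the free
graded-commutative algebra `Sym U` on the span `U` of the generators, those with `R.degree = i`
being a basis of `Sym^i U`. -/
def Adm (R : Fin N →₀ ℕ) : Prop := ∀ α, Even (deg α) → R α ≤ 1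

/-- The degree of the monomial `θ^R`. -/
def wt (R : Fin N →₀ ℕ) : ℤ := ∑ α, (R α : ℤ) * (1 - deg α)

/-- The sign in `θ^S θ^T = ± θ^(S + T)`: each `θ^α` in `θ^S` is moved past each `θ^β` in `θ^T`
with `β < α`. -/
def mulSign (S T : Fin N →₀ ℕ) : ℤˣ :=
  (∑ α, ∑ β, if β < α then (S α * T β : ℤ) * ((1 - deg α) * (1 - deg β)) else 0).negOnePow

/-- The degree `m` part of `∏_i (Sym^i U ⊗ V)`: the series `∑_R θ^R c_R` with `c_R ∈ V`,
`|c_R| + |θ^R| = m`. -/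
def piece (V : GrSp K) (m : ℤ) : Submodule K ((Fin N →₀ ℕ) → V) where
  carrier := {c | ∀ R, c R ∈ V.gr (m - wt deg R) ∧ (¬ Adm deg R → c R = 0)}
  add_mem' ha hb R := ⟨Submodule.add_mem _ (ha R).1 (hb R).1, fun h => by
    simp [(ha R).2 h, (hb R).2 h]⟩
  zero_mem' R := ⟨Submodule.zero_mem _, fun _ => rfl⟩
  smul_mem' c _ ha R := ⟨Submodule.smul_mem _ c (ha R).1, fun h => by simp [(ha R).2 h]⟩

/-- The finite sums of homogeneous series. -/
abbrev total (V : GrSp K) : Submodule K ((Fin N →₀ ℕ) → V) := ⨆ m, piece deg V m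

theorem piece_iSupIndep (V : GrSp K) : iSupIndep (piece deg V) := by
  rw [iSupIndep_def]
  intro m
  rw [Submodule.disjoint_def]
  intro c hc hc'
  funext R
  have h := V.isInternal.submodule_iSupIndep
  rw [iSupIndep_def] at h
  refine (Submodule.disjoint_def.1 (h (m - wt deg R))) _ (hc R).1 ?_
  have h2 : (⨆ j, ⨆ (_ : j ≠ m), piece deg V j) ≤
      (⨆ j, ⨆ (_ : j ≠ m - wt deg R), V.gr j).comap (LinearMap.proj R) := by
    refine iSup_le fun j => iSup_le fun hj c hc => ?_
    have : j - wt deg R ≠ m - wt deg R := fun h => hj (by linarith)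
    exact Submodule.mem_iSup_of_mem _ (Submodule.mem_iSup_of_mem this (hc R).1)
  exact h2 hc'

/-- The graded vector space `∏_i (Sym^i U ⊗ V)`, the product being taken in graded vector
spaces. -/
abbrev gr (V : GrSp K) : GrSp K where
  carrier := total deg V
  gr m := (piece deg V m).comap (total deg V).subtype
  isInternal := by
    have h := piece_iSupIndep deg V
    refine DirectSum.isInternal_submodule_of_iSupIndep_of_iSup_eq_top ?_ ?_
    · let e : Submodule K (total deg V) ≃o Set.Iic (total deg V) := (total deg V).mapIic
      suffices (e ∘ fun m => (piece deg V m).comap (total deg V).subtype) =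
          fun m => ⟨piece deg V m, le_iSup (piece deg V) m⟩ by
        rw [← iSupIndep_map_orderIso_iff e, this]
        exact .of_coe_Iic_comp h
      ext m c
      change c ∈ ((piece deg V m).comap (total deg V).subtype).map (total deg V).subtype ↔ _
      rw [Submodule.map_comap_subtype, inf_of_le_right (le_iSup (piece deg V) m)]
    · refine Submodule.map_injective_of_injective (total deg V).injective_subtype ?_
      rw [Submodule.map_iSup, Submodule.map_top, Submodule.range_subtype]
      exact iSup_congr fun m => by
        rw [Submodule.map_comap_subtype, inf_of_le_right (le_iSup (piece deg V) m)]

open Classical in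
/-- The product `(∑ θ^S a_S) (∑ θ^T x_T)`. -/
def mulFun {V : Type*} [AddCommGroup V] [Module K V] (a : (Fin N →₀ ℕ) → K)
    (x : (Fin N →₀ ℕ) → V) : (Fin N →₀ ℕ) → V :=
  fun R => if Adm deg R then
    ∑ p ∈ Finset.HasAntidiagonal.antidiagonal R, mulSign deg p.1 p.2 • a p.1 • x p.2 else 0

theorem mulFun_mem_piece (V : GrSp K) {p q : ℤ} {a : (Fin N →₀ ℕ) → K} {x : (Fin N →₀ ℕ) → V}
    (ha : a ∈ piece deg (GrSp.ground K) p) (hx : x ∈ piece deg V q) :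
    mulFun deg a x ∈ piece deg V (p + q) := by
  intro R
  refine ⟨?_, fun h => if_neg h⟩
  unfold mulFun
  split_ifs with hR
  · refine Submodule.sum_mem _ fun s hs => ?_
    have hs' : wt deg R = wt deg s.1 + wt deg s.2 := by
      rw [← Finset.HasAntidiagonal.mem_antidiagonal.1 hs]
      simp only [wt, Finsupp.add_apply, Nat.cast_add, add_mul, Finset.sum_add_distrib]
    have h1 := (ha s.1).1
    have h2 := (hx s.2).1
    by_cases h0 : p - wt deg s.1 = 0
    · have : p + q - wt deg R = q - wt deg s.2 := by linarith
      rw [this]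
      exact Submodule.smul_of_tower_mem _ _ (Submodule.smul_mem _ _ h2)
    · have h3 : a s.1 = 0 := by simpa [h0] using h1
      simp [h3]
  · exact Submodule.zero_mem _

theorem mulFun_add_left {V : Type*} [AddCommGroup V] [Module K V] (a a' : (Fin N →₀ ℕ) → K)
    (x : (Fin N →₀ ℕ) → V) : mulFun deg (a + a') x = mulFun deg a x + mulFun deg a' x := by
  funext R
  by_cases h : Adm deg R
  · simp [mulFun, h, add_smul, smul_add, Finset.sum_add_distrib]
  · simp [mulFun, h]

theorem mulFun_add_right {V : Type*} [AddCommGroup V] [Module K V] (a : (Fin N →₀ ℕ) → K)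
    (x x' : (Fin N →₀ ℕ) → V) : mulFun deg a (x + x') = mulFun deg a x + mulFun deg a x' := by
  funext R
  by_cases h : Adm deg R
  · simp [mulFun, h, smul_add, Finset.sum_add_distrib]
  · simp [mulFun, h]

theorem mulFun_smul_left {V : Type*} [AddCommGroup V] [Module K V] (c : K)
    (a : (Fin N →₀ ℕ) → K) (x : (Fin N →₀ ℕ) → V) :
    mulFun deg (c • a) x = c • mulFun deg a x := by
  funext R
  by_cases h : Adm deg R
  · simp only [mulFun, h, if_true, Pi.smul_apply, Finset.smul_sum]
    exact Finset.sum_congr rfl fun p _ => by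
      rw [smul_assoc, smul_comm (mulSign deg p.1 p.2) c]
  · simp [mulFun, h]

theorem mulFun_smul_right {V : Type*} [AddCommGroup V] [Module K V] (c : K)
    (a : (Fin N →₀ ℕ) → K) (x : (Fin N →₀ ℕ) → V) :
    mulFun deg a (c • x) = c • mulFun deg a x := by
  funext R
  by_cases h : Adm deg R
  · simp only [mulFun, h, if_true, Pi.smul_apply, Finset.smul_sum]
    exact Finset.sum_congr rfl fun p _ => by
      rw [smul_comm (a p.1) c, smul_comm (mulSign deg p.1 p.2) c]
  · simp [mulFun, h]

theorem mulFun_mem_total (V : GrSp K) {a : (Fin N →₀ ℕ) → K} {x : (Fin N →₀ ℕ) → V}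
    (ha : a ∈ total deg (GrSp.ground K)) (hx : x ∈ total deg V) :
    mulFun deg a x ∈ total deg V := by
  induction ha using Submodule.iSup_induction' with
  | mem p a ha =>
    induction hx using Submodule.iSup_induction' with
    | mem q x hx => exact Submodule.mem_iSup_of_mem _ (mulFun_mem_piece deg V ha hx)
    | zero =>
      rw [← zero_smul K (0 : (Fin N →₀ ℕ) → V), mulFun_smul_right, zero_smul]
      exact Submodule.zero_mem _
    | add x y _ _ hx hy =>
      rw [mulFun_add_right]
      exact Submodule.add_mem _ hx hy
  | zero =>
    rw [← zero_smul K (0 : (Fin N →₀ ℕ) → K)]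
    erw [mulFun_smul_left]
    rw [zero_smul]
    exact Submodule.zero_mem _
  | add a b _ _ ha hb =>
    erw [mulFun_add_left]
    exact Submodule.add_mem _ ha hb

/-- The left action of `∏_i Sym^i U` on `∏_i (Sym^i U ⊗ V)`. -/
def act (V : GrSp K) : gr deg (GrSp.ground K) →ₗ[K] gr deg V →ₗ[K] gr deg V :=
  LinearMap.mk₂ K (fun a x => ⟨mulFun deg a.1 x.1, mulFun_mem_total deg V a.2 x.2⟩)
    (fun _ _ _ => Subtype.ext (mulFun_add_left deg _ _ _))
    (fun _ _ _ => Subtype.ext (mulFun_smul_left deg _ _ _))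
    (fun _ _ _ => Subtype.ext (mulFun_add_right deg _ _ _))
    (fun _ _ _ => Subtype.ext (mulFun_smul_right deg _ _ _))

theorem single_mem_piece (V : GrSp K) {R : Fin N →₀ ℕ} (hR : Adm deg R) {p : ℤ} {v : V}
    (hv : v ∈ V.gr p) : (Pi.single R v : (Fin N →₀ ℕ) → V) ∈ piece deg V (p + wt deg R) := by
  intro S
  by_cases h : S = R
  · subst h
    simp [hv, hR]
  · simp [Pi.single_eq_of_ne h]

/-- The generator `v = 1 ⊗ v` of `∏_i (Sym^i U ⊗ V)`. -/
def gen (V : GrSp K) : V →ₗ[K] gr deg V :=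
  LinearMap.codRestrict (total deg V) (LinearMap.single K (fun _ => (V : Type u)) 0) fun v => by
    have hv : v ∈ ⨆ p, V.gr p := by rw [V.isInternal.submodule_iSup_eq_top]; trivial
    induction hv using Submodule.iSup_induction' with
    | mem p v hv =>
      exact Submodule.mem_iSup_of_mem _ (single_mem_piece deg V (fun α _ => by simp) hv)
    | zero => rw [map_zero]; exact Submodule.zero_mem _
    | add v w _ _ h1 h2 => rw [map_add]; exact Submodule.add_mem _ h1 h2

/-- The generator `θ^α`. -/
def theta (α : Fin N) : gr deg (GrSp.ground K) :=
  ⟨Pi.single (Finsupp.single α 1) 1, Submodule.mem_iSup_of_mem _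
    (single_mem_piece deg (GrSp.ground K) (p := 0) (v := (1 : K))
      (fun β _ => by
        rw [Finsupp.single_apply]
        split_ifs <;> simp) (by simp))⟩

/-- The product `θ^(α_1) ⋯ θ^(α_k)`. -/
def thetaWord : List (Fin N) → gr deg (GrSp.ground K)
  | [] => gen deg (GrSp.ground K) (1 : K)
  | α :: w => act deg (GrSp.ground K) (theta deg α) (thetaWord w)

/-- The series `∑_k ∑_{α_1, …, α_k} θ^(α_1) ⋯ θ^(α_k) φ_k(α_1, …, α_k)`: only the words of length
`k = R.degree` contribute to the coefficient at `θ^R`. -/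
def series {V : Type*} [AddCommGroup V] [Module K V] (φ : ∀ k, (Fin k → Fin N) → V) :
    (Fin N →₀ ℕ) → V :=
  fun R => ∑ α : Fin R.degree → Fin N,
    ((thetaWord deg (List.ofFn α) : gr deg (GrSp.ground K)) : (Fin N →₀ ℕ) → K) R • φ R.degree α

/-- The reversal degree `∑_l |x_(α_l)| |x_(α_(l+1)) ⋯ x_(α_k)|`. -/
def revDeg {k : ℕ} (α : Fin k → Fin N) : ℤ :=
  ∑ l, deg (α l) * ∑ m ∈ Finset.Ioi l, deg (α m)

/-- The coefficient
`1 / k! * (-1) ^ (|x_(α_1) ⋯ x_(α_k)|_rev + ∑_{l = 1}^k |x_(α_l)| (l + n))`. -/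
def coeff (K : Type u) [Field K] (n : ℤ) {k : ℕ} (α : Fin k → Fin N) : K :=
  (revDeg deg α + ∑ l : Fin k, deg (α l) * (((l : ℕ) : ℤ) + 1 + n)).negOnePow • (k.factorial : K)⁻¹

/-- The graded algebra `∏_i Sym^i U` with the candidate `δ` for a differential. -/
abbrev alg (δ : gr deg (GrSp.ground K) →ₗ[K] gr deg (GrSp.ground K)) : DGAlg K where
  A := gr deg (GrSp.ground K)
  mul := act deg (GrSp.ground K)
  one := gen deg (GrSp.ground K) (1 : K)
  δ := δ

/-- The graded module `∏_i (Sym^i U ⊗ V)` with the candidate `d` for a differential. -/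
abbrev mod (δ : gr deg (GrSp.ground K) →ₗ[K] gr deg (GrSp.ground K)) (V : GrSp K)
    (d : gr deg V →ₗ[K] gr deg V) : DGModData (alg deg δ) where
  M := gr deg V
  act := act deg V
  d := d

/-- Completed semi-free modules: as a graded module, `M` is isomorphic to `∏_i (Sym^i U ⊗ V)` for
some graded vector space `V`. -/
def IsCompletedSemiFree {δ : gr deg (GrSp.ground K) →ₗ[K] gr deg (GrSp.ground K)}
    (M : DGModData (alg deg δ)) : Prop :=
  ∃ (V : GrSp K) (e : gr deg V ≃ₗ[K] M.M),
    (∀ m, ∀ x ∈ (gr deg V).gr m, e x ∈ M.M.gr m) ∧ ∀ a x, e (act deg V a x) = M.act a (e x)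

end CE

namespace HomotopyLie

variable {K : Type u} [Field K] (L : HomotopyLie K) {N : ℕ} (B : HomogeneousBasis L.g N)

/-- The underlying graded algebra of the Chevalley-Eilenberg algebra. -/
abbrev ceGr : GrSp K := CE.gr B.deg (GrSp.ground K)

/-- `δ` is the Chevalley-Eilenberg differential: the derivation of degree `1` with
`δ θ^α = ∑_i 1 / i! (-1) ^ (⋯) ℓ^α_(α_1, …, α_i) θ^(α_1) ⋯ θ^(α_i)`. -/
def IsCEDifferential (δ : L.ceGr B →ₗ[K] L.ceGr B) : Prop :=
  δ ∈ GrSp.mapDeg (L.ceGr B) (L.ceGr B) 1 ∧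
  (∀ p, ∀ a ∈ (L.ceGr B).gr p, ∀ b, δ (CE.act B.deg (GrSp.ground K) a b) =
    CE.act B.deg (GrSp.ground K) (δ a) b +
      p.negOnePow • CE.act B.deg (GrSp.ground K) a (δ b)) ∧
  ∀ α, (δ (CE.theta B.deg α) : (Fin N →₀ ℕ) → K) = CE.series (K := K) (V := K) B.deg fun k w =>
    CE.coeff B.deg K 0 w * B.basis.repr (L.ℓ k (B.basis ∘ w)) α

/-- The series `∑_k 1 / k! (-1) ^ (⋯) θ^(α_1) ⋯ θ^(α_k) f_(α_1, …, α_k) (u)`, where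
`f_(α_1, …, α_k) (u) = f (x_(α_1), …, x_(α_k), u)` and `f` has degree `n`. -/
def ceSeries {U V : Type u} [AddCommGroup U] [Module K U] [AddCommGroup V] [Module K V]
    (n : ℤ) (f : L.Raw U V) (u : U) : (Fin N →₀ ℕ) → V :=
  CE.series (K := K) (V := V) B.deg fun k w => CE.coeff B.deg K n w • f k (B.basis ∘ w) u

/-- `d` is the differential of the Chevalley-Eilenberg module of `V`: the derivation of degree `1`
over `δ` with the prescribed values on generators. -/
def IsCEModuleDifferential (δ : L.ceGr B →ₗ[K] L.ceGr B) (V : L.PreRep)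
    (d : CE.gr B.deg V.V →ₗ[K] CE.gr B.deg V.V) : Prop :=
  d ∈ GrSp.mapDeg (CE.gr B.deg V.V) (CE.gr B.deg V.V) 1 ∧
  (∀ p, ∀ a ∈ (L.ceGr B).gr p, ∀ x, d (CE.act B.deg V.V a x) =
    CE.act B.deg V.V (δ a) x + p.negOnePow • CE.act B.deg V.V a (d x)) ∧
  ∀ v, (d (CE.gen B.deg V.V v) : (Fin N →₀ ℕ) → V.V) = L.ceSeries B 1 V.ρ v

/-- `φ` is the map of Chevalley-Eilenberg modules induced by the intertwiner `f : U ⇝ V[n]`: the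
linear map of degree `n` over the Chevalley-Eilenberg algebra with the prescribed values on
generators. -/
def IsCEMap (U V : GrSp K) (n : ℤ) (f : L.Raw U V)
    (φ : CE.gr B.deg U →ₗ[K] CE.gr B.deg V) : Prop :=
  φ ∈ GrSp.mapDeg (CE.gr B.deg U) (CE.gr B.deg V) n ∧
  (∀ p, ∀ a ∈ (L.ceGr B).gr p, ∀ x, φ (CE.act B.deg U a x) =
    (n * p).negOnePow • CE.act B.deg V a (φ x)) ∧
  ∀ u, (φ (CE.gen B.deg U u) : (Fin N →₀ ℕ) → V) = L.ceSeries B n f u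

/-- The dg-category of completed semi-free dg-modules over the Chevalley-Eilenberg algebra with
differential `δ`. -/
abbrev ceMod (δ : L.ceGr B →ₗ[K] L.ceGr B) : DGData.{u, u + 1, u} K :=
  DGModData.dgMod (CE.alg B.deg δ) (CE.IsCompletedSemiFree B.deg)

/-- The functor with the module of `V` having the differential `D V` and with `f : U ⇝ V[n]` sent
to `Φ U V n f`. -/
abbrev ceFunctor (δ : L.ceGr B →ₗ[K] L.ceGr B)
    (D : ∀ V : L.PreRep, CE.gr B.deg V.V →ₗ[K] CE.gr B.deg V.V)
    (Φ : ∀ U V : L.PreRep, ℤ → L.Raw U.V V.V → (CE.gr B.deg U.V →ₗ[K] CE.gr B.deg V.V)) :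
    DGFunctorData L.rep (L.ceMod B δ) where
  obj V := CE.mod B.deg δ V.V (D V)
  map {U V} n f := Φ U V n f

end HomotopyLie

end

noncomputable section


/-! ### Signs and homogeneous maps -/

/-! An element of the Chevalley-Eilenberg module of `V` is a formal power series in the graded
variables θ^α with coefficients in `V`. A map of degree `n` that is linear over the power series in
θ is determined by its values on the coefficients `u ∈ U`, that is, by a power series with
coefficients in Hom(U, V). In characteristic 0 such a series amounts to its Taylor coefficients, the
constant terms of its iterated derivatives, and these may be prescribed freely subject to Koszul
symmetry in the letters. Multiplying the components of an intertwiner by the sign `signExp` turns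
graded skew-symmetry in the inputs into exactly this symmetry. So intertwiners of degree `n` are the
same as linear maps of degree `n`; the relation `Represents` records this.

Under this dictionary algebraic operations match. The Leibniz rule for iterated derivatives of `G (F
u)` is a sum over the subsets of derivatives that hit `G`, hence a sum over shuffles, and the sign
identity `shuffle_signExp` identifies it with juxtaposition (`Represents.comp`). The same rule for a
product of series gives the odot product (`Represents.odot`). With `dTriv = ∑ δθ^α ∂_α`, the
composite of `varrho f` and `ell` represents minus the graded commutator of `dTriv` with the map of
`f` (`Represents.varrho_ell`). The Jacobi identity says that `dTriv` squares to zero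
(`dTriv_dtheta`). Consequently `ρ` is a representation exactly when `dTriv + R`, with `R` the map of
`ρ`, squares to zero (`isRep_iff`), and the differential on intertwiners is the commutator with the
module differentials (`represents_d`).

Infinite series are handled without any continuity assumption. A subspace of series that is closed
under derivatives and has vanishing constant terms is zero (`eq_zero_of_pd`); and every series is
its constant term plus a combination `∑ θ^β y_β`, so that linear maps are determined on generators
(`eq_zero_of_gen`).

The monoidal axioms are proved once, in the form `FamTensor.IsTensor`, for any family of dg-modules
with products on which homomorphisms are determined by their values on elements `x ⊗ y`. This is
applied to the Chevalley-Eilenberg modules of representations with the product of series, and the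
axioms for representations follow because represented intertwiners are equal when their linear maps
are. It is applied again to an arbitrary relative tensor product of completed semi-free modules.
Transport of the differential shows that every completed semi-free module is isomorphic to the
module of a representation (`exists_isInverse`), which yields essential surjectivity and also the
existence of relative tensor products. The comparison isomorphisms come from the two universal
properties, and all remaining compatibilities are checked on products. -/

theorem Int.negOnePow_congr {a b : ℤ} (h : (a : ZMod 2) = b) : a.negOnePow = b.negOnePow := by
  rw [Int.negOnePow_eq_iff, ← ZMod.intCast_eq_zero_iff_even, Int.cast_sub, h, sub_self]

theorem Int.negOnePow_smul_smul_congr {M : Type*} [AddCommGroup M] {a b c : ℤ} {x : M}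
    (h : (a : ZMod 2) + b = c) : a.negOnePow • b.negOnePow • x = c.negOnePow • x := by
  rw [smul_smul, ← Int.negOnePow_add, Int.negOnePow_congr]
  push_cast
  exact h

theorem Int.negOnePow_smul_self_smul {M : Type*} [AddCommGroup M] (a : ℤ) (x : M) :
    a.negOnePow • a.negOnePow • x = x := by
  rw [smul_smul, Int.units_mul_self, one_smul]

theorem LinearMap.map_units_int_smul {K V W : Type*} [Field K] [AddCommGroup V] [AddCommGroup W] [Module K V]
    [Module K W] (f : V →ₗ[K] W) (c : ℤˣ) (x : V) : f (c • x) = c • f x := by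
  rw [Units.smul_def, Units.smul_def, map_zsmul]

theorem LinearMap.units_int_smul_apply {K V W : Type*} [Field K] [AddCommGroup V] [AddCommGroup W]
    [Module K V] [Module K W] (f : V →ₗ[K] W) (c : ℤˣ) (x : V) : (c • f) x = c • f x := by
  rfl

theorem Submodule.units_int_smul_mem {K V : Type*} [Field K] [AddCommGroup V] [Module K V]
    (S : Submodule K V) (c : ℤˣ) {x : V} (hx : x ∈ S) : c • x ∈ S :=
  Submodule.smul_of_tower_mem S c hx

namespace GrSp

variable {K : Type u} [Field K]

theorem induction_on (V : GrSp K) {P : V → Prop} (x : V) (hom : ∀ p, ∀ x ∈ V.gr p, P x)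
    (add : ∀ x y, P x → P y → P (x + y)) : P x := by
  have hx : x ∈ ⨆ p, V.gr p := by rw [V.isInternal.submodule_iSup_eq_top]; trivial
  induction hx using Submodule.iSup_induction' with
  | mem p x hx => exact hom p x hx
  | zero => exact hom 0 0 (Submodule.zero_mem _)
  | add x y _ _ hx hy => exact add x y hx hy

theorem hom_ext (V : GrSp K) {W : Type*} [AddCommGroup W] [Module K W] {f g : V →ₗ[K] W}
    (h : ∀ p, ∀ x ∈ V.gr p, f x = g x) : f = g := by
  ext x
  induction x using GrSp.induction_on with
  | hom p x hx => exact h p x hx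
  | add x y hx hy => rw [map_add, map_add, hx, hy]

theorem sgn_apply (V : GrSp K) (c : ℤ) {p : ℤ} {x : V} (hx : x ∈ V.gr p) :
    V.sgn c x = (c * p).negOnePow • x := by
  rw [sgn, LinearMap.add_apply, LinearMap.units_int_smul_apply, par_apply V 0 hx, par_apply V 1 hx]
  rcases Int.emod_two_eq_zero_or_one p with h | h
  · have : (c * p).negOnePow = 1 := Int.negOnePow_even _ ((Int.even_iff.2 h).mul_left c)
    simp [h, this]
  · have : (c * p).negOnePow = c.negOnePow := by
      rw [Int.negOnePow_eq_iff, show c * p - c = c * (p - 1) by ring]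
      exact Even.mul_left (Int.even_iff.2 (by omega)) c
    simp [h, this]

theorem sgn_mem (V : GrSp K) (c : ℤ) {p : ℤ} {x : V} (hx : x ∈ V.gr p) : V.sgn c x ∈ V.gr p := by
  rw [sgn_apply V c hx]
  exact Submodule.units_int_smul_mem _ _ hx

theorem sgn_congr (V : GrSp K) {c c' : ℤ} (h : (c : ZMod 2) = c') : V.sgn c = V.sgn c' := by
  rw [sgn, sgn, Int.negOnePow_congr h]

theorem swap_tmul (V W : GrSp K) {p q : ℤ} {x : V} {y : W} (hx : x ∈ V.gr p) (hy : y ∈ W.gr q) :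
    swap V W (x ⊗ₜ[K] y) = (p * q).negOnePow • y ⊗ₜ[K] x := by
  simp only [swap, LinearMap.comp_apply, LinearMap.sum_apply, LinearMap.units_int_smul_apply,
    TensorProduct.map_tmul, LinearEquiv.coe_coe]
  simp only [Fin.sum_univ_two, par_apply V _ hx, par_apply W _ hy]
  rcases Int.emod_two_eq_zero_or_one p with h | h <;>
  rcases Int.emod_two_eq_zero_or_one q with h' | h'
  · have : (p * q).negOnePow = 1 := Int.negOnePow_even _ ((Int.even_iff.2 h).mul_right q)
    simp [h, h', this]
  · have : (p * q).negOnePow = 1 := Int.negOnePow_even _ ((Int.even_iff.2 h).mul_right q)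
    simp [h, h', this]
  · have : (p * q).negOnePow = 1 := Int.negOnePow_even _ ((Int.even_iff.2 h').mul_left p)
    simp [h, h', this]
  · have : (p * q).negOnePow = -1 :=
      Int.negOnePow_odd _ ((Int.odd_iff.2 h).mul (Int.odd_iff.2 h'))
    simp [h, h', this]

theorem comp_mem_mapDeg {U V W : GrSp K} {m n k : ℤ} {g : V →ₗ[K] W} {f : U →ₗ[K] V}
    (hg : g ∈ mapDeg V W m) (hf : f ∈ mapDeg U V n) (h : m + n = k) : g ∘ₗ f ∈ mapDeg U W k :=
  fun p x hx => by
    have := hg _ _ (hf p x hx)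
    rwa [add_assoc, add_comm n m, h] at this

theorem id_mem_mapDeg (V : GrSp K) : LinearMap.id ∈ mapDeg V V 0 := fun p x hx => by
  simpa using hx

theorem gr_congr (V : GrSp K) {p q : ℤ} (h : p = q) {x : V} (hx : x ∈ V.gr p) : x ∈ V.gr q :=
  h ▸ hx

theorem ground_mem (c : K) : c ∈ (ground K).gr 0 := by simp

theorem ground_gr {p : ℤ} (h : p ≠ 0) {c : K} (hc : c ∈ (ground K).gr p) : c = 0 := by
  simpa [h] using hc

/-- Linear maps out of a tensor product of graded spaces are determined by their values on
products of homogeneous elements. -/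
theorem tensor_hom_ext (V W : GrSp K) {X : Type*} [AddCommGroup X] [Module K X]
    {f g : V ⊗[K] W →ₗ[K] X}
    (h : ∀ p q, ∀ x ∈ V.gr p, ∀ y ∈ W.gr q, f (x ⊗ₜ y) = g (x ⊗ₜ y)) : f = g := by
  refine TensorProduct.ext (V.hom_ext fun p x hx => W.hom_ext fun q y hy => ?_)
  simpa using h p q x hx y hy

theorem mapDeg_tensor {V W X : GrSp K} {f : V ⊗[K] W →ₗ[K] X} {n : ℤ}
    (h : ∀ p q, ∀ x ∈ V.gr p, ∀ y ∈ W.gr q, f (x ⊗ₜ y) ∈ X.gr (p + q + n)) :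
    f ∈ mapDeg (V.tensor W) X n := by
  intro m t ht
  change t ∈ tensorGr V W m at ht
  unfold tensorGr at ht
  induction ht using Submodule.span_induction with
  | mem x hx =>
    obtain ⟨p, q, rfl, v, hv, w, hw, rfl⟩ := hx
    exact h p q v hv w hw
  | zero => rw [map_zero]; exact Submodule.zero_mem _
  | add x y _ _ h1 h2 => rw [map_add]; exact Submodule.add_mem _ h1 h2
  | smul c x _ h1 => rw [map_smul]; exact Submodule.smul_mem _ c h1

end GrSp


/-! ### Dg-modules -/

namespace DGModData

variable {K : Type u} [Field K] {R : DGAlg K}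

theorem id_mem_hom (M : DGModData R) : LinearMap.id ∈ hom M M 0 :=
  ⟨GrSp.id_mem_mapDeg _, fun p a _ x => by simp⟩

theorem comp_mem_hom {M N Q : DGModData R} {m n k : ℤ} {g : N.M →ₗ[K] Q.M} {f : M.M →ₗ[K] N.M}
    (hg : g ∈ hom N Q m) (hf : f ∈ hom M N n) (h : m + n = k) : g ∘ₗ f ∈ hom M Q k :=
  ⟨GrSp.comp_mem_mapDeg hg.1 hf.1 h, fun p a ha x => by
    rw [LinearMap.comp_apply, hf.2 p a ha, LinearMap.map_units_int_smul, hg.2 p a ha, ← h]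
    exact Int.negOnePow_smul_smul_congr (by push_cast; ring)⟩

theorem hom_congr {M N : DGModData R} {m n : ℤ} (h : m = n) {f : M.M →ₗ[K] N.M}
    (hf : f ∈ hom M N m) : f ∈ hom M N n := h ▸ hf

theorem units_smul_act {M : DGModData R} (c : ℤˣ) (a : R.A) (x : M.M) :
    M.act (c • a) x = c • M.act a x := by
  rw [LinearMap.map_units_int_smul]; rfl

/-- In the graded commutator the two terms containing `δ a` carry the signs `n p` and `n + n (p +
1)`, which agree modulo 2, so they cancel; what is left is linear of degree `n + 1`. -/
theorem d_mem_hom {M N : DGModData R} (hR : R.δ ∈ GrSp.mapDeg R.A R.A 1) (hM : M.IsDGModule)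
    (hN : N.IsDGModule) {n : ℤ} {f : M.M →ₗ[K] N.M} (hf : f ∈ hom M N n) :
    N.d ∘ₗ f - n.negOnePow • (f ∘ₗ M.d) ∈ hom M N (n + 1) := by
  refine ⟨Submodule.sub_mem _ (GrSp.comp_mem_mapDeg hN.d_mem hf.1 (add_comm _ _))
    (Submodule.units_int_smul_mem _ _ (GrSp.comp_mem_mapDeg hf.1 hM.d_mem rfl)),
    fun p a ha x => ?_⟩
  simp only [LinearMap.sub_apply, LinearMap.comp_apply, LinearMap.units_int_smul_apply,
    hf.2 p a ha, LinearMap.map_units_int_smul, hN.d_act p a ha, hM.d_act p a ha, map_add,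
    hf.2 _ _ (hR p a ha), smul_add, map_sub, smul_sub]
  rw [show ((n + 1) * p).negOnePow • n.negOnePow • (N.act a) (f (M.d x)) =
    n.negOnePow • p.negOnePow • (n * p).negOnePow • (N.act a) (f (M.d x)) by
      simp only [smul_smul, ← Int.negOnePow_add]
      rw [Int.negOnePow_congr]; push_cast; ring,
    show (n * p).negOnePow • p.negOnePow • (N.act a) (N.d (f x)) =
      ((n + 1) * p).negOnePow • (N.act a) (N.d (f x)) from
      Int.negOnePow_smul_smul_congr (by push_cast; ring),
    show n.negOnePow • (n * (p + 1)).negOnePow • (N.act (R.δ a)) (f x) =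
      (n * p).negOnePow • (N.act (R.δ a)) (f x) from
      Int.negOnePow_smul_smul_congr (by push_cast; grind)]
  abel

/-- The dg-category of a family of dg-modules. -/
abbrev famCat {O : Type v} (M : O → DGModData R) (P : O → Prop) : DGData.{u, v, u} K where
  Obj := O
  isObj := P
  Hom X Y := (M X).M →ₗ[K] (M Y).M
  homDeg X Y n := hom (M X) (M Y) n
  id _ := LinearMap.id
  comp _ _ g f := g ∘ₗ f
  d {X Y} n f := (M Y).d ∘ₗ f - n.negOnePow • (f ∘ₗ (M X).d)

theorem famCat_isDGCategory {O : Type v} (M : O → DGModData R) (P : O → Prop)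
    (hR : R.δ ∈ GrSp.mapDeg R.A R.A 1) (h : ∀ X, P X → (M X).IsDGModule) :
    (famCat M P).IsDGCategory where
  d_mem hX hY _ _ hf := d_mem_hom hR (h _ hX) (h _ hY) hf
  d_add _ _ n f _ f' _ := by
    simp only [LinearMap.comp_add, LinearMap.add_comp, smul_add]; abel
  d_smul _ _ n c f _ := by
    simp only [LinearMap.comp_smul, LinearMap.smul_comp, smul_sub]
    rw [smul_comm]
  d_d {X Y} hX hY n f _ := by
    ext x
    simp only [LinearMap.sub_apply, LinearMap.comp_apply, LinearMap.units_int_smul_apply,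
      map_sub, LinearMap.map_units_int_smul, (h _ hX).d_d, (h _ hY).d_d, map_zero, smul_zero,
      LinearMap.zero_apply, Int.negOnePow_succ]
    simp
  id_mem _ := id_mem_hom _
  d_id _ := by simp
  comp_mem _ _ _ _ _ _ hg _ hf := comp_mem_hom hg hf rfl
  comp_add _ _ _ _ _ _ _ _ _ _ _ := LinearMap.comp_add _ _ _
  add_comp _ _ _ _ _ _ _ _ _ _ _ := LinearMap.add_comp _ _ _
  comp_smul _ _ _ _ _ _ _ _ _ _ := ⟨LinearMap.comp_smul _ _ _, LinearMap.smul_comp _ _ _⟩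
  d_comp _ _ _ m n g _ f _ := by
    ext x
    simp only [LinearMap.sub_apply, LinearMap.comp_apply, LinearMap.units_int_smul_apply,
      map_sub, LinearMap.map_units_int_smul, smul_sub, smul_smul, ← Int.negOnePow_add,
      LinearMap.add_apply]
    abel
  id_comp _ _ _ _ _ := LinearMap.id_comp _
  comp_id _ _ _ _ _ := LinearMap.comp_id _
  assoc _ _ _ _ _ _ _ _ _ _ _ _ _ := rfl

/-- Data of relative tensor products, with constraints, for a family of dg-modules; `ι` is the
identification of the regular module with the module of the unit object. -/
structure FamTensor {O : Type v} (M : O → DGModData R) where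
  obj : O → O → O
  tmul : ∀ X Y, (M X).M →ₗ[K] (M Y).M →ₗ[K] (M (obj X Y)).M
  hom : ∀ {X X' Y Y'}, ℤ → ℤ → ((M X).M →ₗ[K] (M X').M) → ((M Y).M →ₗ[K] (M Y').M) →
    ((M (obj X Y)).M →ₗ[K] (M (obj X' Y')).M)
  unit : O
  ι : R.A →ₗ[K] (M unit).M
  assoc : ∀ X Y Z, (M (obj (obj X Y) Z)).M →ₗ[K] (M (obj X (obj Y Z))).M
  lunit : ∀ X, (M (obj unit X)).M →ₗ[K] (M X).M
  runit : ∀ X, (M (obj X unit)).M →ₗ[K] (M X).M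
  braid : ∀ X Y, (M (obj X Y)).M →ₗ[K] (M (obj Y X)).M

namespace FamTensor

variable {O : Type v} {M : O → DGModData R}

/-- The monoidal data on the dg-category of the family. -/
abbrev mon (T : FamTensor M) (P : O → Prop) : MonData (famCat M P) where
  tensorObj := T.obj
  tensorHom := T.hom
  unit := T.unit
  assoc := T.assoc
  lunit := T.lunit
  runit := T.runit
  braid := T.braid

/-- The products are balanced, compatible with differentials, and homomorphisms out of them are
determined by their values on products; the constraints are given by the standard formulas. -/
structure IsTensor (T : FamTensor M) (P : O → Prop) : Prop where
  isDG : ∀ {X}, P X → (M X).IsDGModule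
  isObj : ∀ {X Y}, P X → P Y → P (T.obj X Y)
  unit_isObj : P T.unit
  balanced : ∀ {X Y}, P X → P Y → IsBalanced 0 (T.tmul X Y)
  d_tmul : ∀ {X Y}, P X → P Y → ∀ {p x}, x ∈ (M X).M.gr p → ∀ y,
    (M (T.obj X Y)).d (T.tmul X Y x y) =
      T.tmul X Y ((M X).d x) y + p.negOnePow • T.tmul X Y x ((M Y).d y)
  ext : ∀ {X Y Z}, P X → P Y → P Z → ∀ n, ∀ h ∈ DGModData.hom (M (T.obj X Y)) (M Z) n,
    ∀ h' ∈ DGModData.hom (M (T.obj X Y)) (M Z) n,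
    (∀ x y, h (T.tmul X Y x y) = h' (T.tmul X Y x y)) → h = h'
  hom_mem : ∀ {X X' Y Y'}, P X → P X' → P Y → P Y' → ∀ {m n f g},
    f ∈ DGModData.hom (M X) (M X') m → g ∈ DGModData.hom (M Y) (M Y') n →
    T.hom m n f g ∈ DGModData.hom (M (T.obj X Y)) (M (T.obj X' Y')) (m + n)
  hom_tmul : ∀ {X X' Y Y'}, P X → P X' → P Y → P Y' → ∀ {m n f g},
    f ∈ DGModData.hom (M X) (M X') m → g ∈ DGModData.hom (M Y) (M Y') n →
    ∀ {p x}, x ∈ (M X).M.gr p → ∀ y,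
    T.hom m n f g (T.tmul X Y x y) = (n * p).negOnePow • T.tmul X' Y' (f x) (g y)
  ι_mem : ∀ {p a}, a ∈ R.A.gr p → T.ι a ∈ (M T.unit).M.gr p
  ι_mul : ∀ a b, T.ι (R.mul a b) = (M T.unit).act a (T.ι b)
  d_ι : ∀ a, (M T.unit).d (T.ι a) = T.ι (R.δ a)
  ι_surjective : Function.Surjective T.ι
  ι_injective : Function.Injective T.ι
  assoc_mem : ∀ {X Y Z}, P X → P Y → P Z →
    T.assoc X Y Z ∈ DGModData.hom (M (T.obj (T.obj X Y) Z)) (M (T.obj X (T.obj Y Z))) 0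
  assoc_tmul : ∀ {X Y Z}, P X → P Y → P Z → ∀ x y z,
    T.assoc X Y Z (T.tmul (T.obj X Y) Z (T.tmul X Y x y) z) =
      T.tmul X (T.obj Y Z) x (T.tmul Y Z y z)
  lunit_mem : ∀ {X}, P X → T.lunit X ∈ DGModData.hom (M (T.obj T.unit X)) (M X) 0
  lunit_tmul : ∀ {X}, P X → ∀ a x, T.lunit X (T.tmul T.unit X (T.ι a) x) = (M X).act a x
  runit_mem : ∀ {X}, P X → T.runit X ∈ DGModData.hom (M (T.obj X T.unit)) (M X) 0
  runit_tmul : ∀ {X}, P X → ∀ {p q a x}, a ∈ R.A.gr p → x ∈ (M X).M.gr q →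
    T.runit X (T.tmul X T.unit x (T.ι a)) = (p * q).negOnePow • (M X).act a x
  braid_mem : ∀ {X Y}, P X → P Y →
    T.braid X Y ∈ DGModData.hom (M (T.obj X Y)) (M (T.obj Y X)) 0
  braid_tmul : ∀ {X Y}, P X → P Y → ∀ {p q x y}, x ∈ (M X).M.gr p → y ∈ (M Y).M.gr q →
    T.braid X Y (T.tmul X Y x y) = (p * q).negOnePow • T.tmul Y X y x

namespace IsTensor

variable {T : FamTensor M} {P : O → Prop} (hT : T.IsTensor P)

include hT

theorem tmul_mem {X Y} (hX : P X) (hY : P Y) {p q : ℤ} {x : (M X).M} {y : (M Y).M}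
    (hx : x ∈ (M X).M.gr p) (hy : y ∈ (M Y).M.gr q) :
    T.tmul X Y x y ∈ (M (T.obj X Y)).M.gr (p + q) := by
  simpa using (hT.balanced hX hY).degree p q x hx y hy

theorem act_tmul {X Y} (hX : P X) (hY : P Y) {p : ℤ} {a : R.A} (ha : a ∈ R.A.gr p)
    (x : (M X).M) (y : (M Y).M) :
    (M (T.obj X Y)).act a (T.tmul X Y x y) = T.tmul X Y ((M X).act a x) y := by
  simpa using ((hT.balanced hX hY).act_left p a ha x y).symm

theorem tmul_act {X Y} (hX : P X) (hY : P Y) {p q : ℤ} {a : R.A} (ha : a ∈ R.A.gr p)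
    {x : (M X).M} (hx : x ∈ (M X).M.gr q) (y : (M Y).M) :
    T.tmul X Y x ((M Y).act a y) = (p * q).negOnePow • T.tmul X Y ((M X).act a x) y :=
  (hT.balanced hX hY).balanced p q a ha x hx y

theorem ext₂ {X Y Z} (hX : P X) (hY : P Y) (hZ : P Z) {n : ℤ}
    {h h' : (M (T.obj X Y)).M →ₗ[K] (M Z).M} (hh : h ∈ DGModData.hom (M (T.obj X Y)) (M Z) n)
    (hh' : h' ∈ DGModData.hom (M (T.obj X Y)) (M Z) n)
    (H : ∀ p q, ∀ x ∈ (M X).M.gr p, ∀ y ∈ (M Y).M.gr q,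
      h (T.tmul X Y x y) = h' (T.tmul X Y x y)) : h = h' := by
  refine hT.ext hX hY hZ n h hh h' hh' fun x y => ?_
  have : (T.tmul X Y).compr₂ h = (T.tmul X Y).compr₂ h' :=
    (M X).M.hom_ext fun p x hx => (M Y).M.hom_ext fun q y hy => H p q x hx y hy
  exact LinearMap.congr_fun (LinearMap.congr_fun this x) y

omit hT in
/-- The restriction of `h` to the elements `t ⊗ z`, with a sign that makes it linear. -/
def lslice {A Z : O} {W : DGModData R} (T : FamTensor M) (q : ℤ) (z : (M Z).M)
    (h : (M (T.obj A Z)).M →ₗ[K] W.M) : (M A).M →ₗ[K] W.M :=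
  h ∘ₗ (T.tmul A Z).flip z ∘ₗ (M A).M.sgn q

omit hT in
theorem lslice_apply {A Z : O} {W : DGModData R} (q : ℤ) (z : (M Z).M)
    (h : (M (T.obj A Z)).M →ₗ[K] W.M) {p : ℤ} {x : (M A).M} (hx : x ∈ (M A).M.gr p) :
    lslice T q z h x = (q * p).negOnePow • h (T.tmul A Z x z) := by
  simp only [lslice, LinearMap.comp_apply, GrSp.sgn_apply _ _ hx, LinearMap.map_units_int_smul,
    LinearMap.flip_apply, LinearMap.units_int_smul_apply]

/-- With `z` held fixed on the right, `x ↦ h (x ⊗ z)` has degree `n + q` but only the linearity sign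
of degree `n`; the factor `(-1)^(q |x|)` in `lslice` supplies the missing `(-1)^(q |a|)`. -/
theorem lslice_mem {A Z : O} {W : DGModData R} (hA : P A) (hZ : P Z) {n q : ℤ}
    {z : (M Z).M} (hz : z ∈ (M Z).M.gr q) {h : (M (T.obj A Z)).M →ₗ[K] W.M}
    (hh : h ∈ DGModData.hom (M (T.obj A Z)) W n) :
    lslice T q z h ∈ DGModData.hom (M A) W (n + q) := by
  refine ⟨fun p x hx => ?_, fun p a ha x => ?_⟩
  · rw [lslice_apply q z h hx]
    refine Submodule.units_int_smul_mem _ _ (GrSp.gr_congr _ ?_ (hh.1 _ _ (hT.tmul_mem hA hZ hx hz)))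
    ring
  · induction x using GrSp.induction_on with
    | hom r x hx =>
      rw [lslice_apply q z h hx, lslice_apply q z h ((hT.isDG hA).act_mem p r a ha x hx),
        ← hT.act_tmul hA hZ ha, hh.2 p a ha, LinearMap.map_units_int_smul]
      simp only [smul_smul, ← Int.negOnePow_add]
      rw [Int.negOnePow_congr]
      push_cast
      ring
    | add x y hx hy => simp only [map_add, hx, hy, smul_add]

/-- Slicing replaces a map out of `A ⊗ Z` by a family of homomorphisms out of `A`, so that
extensionality for iterated products follows by induction on the number of factors. -/
theorem ext_lslice {A Z W} (hA : P A) (hZ : P Z) (hW : P W) {n : ℤ}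
    {h h' : (M (T.obj A Z)).M →ₗ[K] (M W).M} (hh : h ∈ DGModData.hom (M (T.obj A Z)) (M W) n)
    (hh' : h' ∈ DGModData.hom (M (T.obj A Z)) (M W) n)
    (H : ∀ q, ∀ z ∈ (M Z).M.gr q, lslice T q z h = lslice T q z h') : h = h' := by
  refine hT.ext₂ hA hZ hW hh hh' fun p q x hx z hz => ?_
  have := LinearMap.congr_fun (H q z hz) x
  rw [lslice_apply q z h hx, lslice_apply q z h' hx] at this
  exact smul_left_cancel _ this

theorem ext₃ {X Y Z W} (hX : P X) (hY : P Y) (hZ : P Z) (hW : P W) {n : ℤ}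
    {h h' : (M (T.obj (T.obj X Y) Z)).M →ₗ[K] (M W).M}
    (hh : h ∈ DGModData.hom (M (T.obj (T.obj X Y) Z)) (M W) n)
    (hh' : h' ∈ DGModData.hom (M (T.obj (T.obj X Y) Z)) (M W) n)
    (H : ∀ p q r, ∀ x ∈ (M X).M.gr p, ∀ y ∈ (M Y).M.gr q, ∀ z ∈ (M Z).M.gr r,
      h (T.tmul _ Z (T.tmul X Y x y) z) = h' (T.tmul _ Z (T.tmul X Y x y) z)) : h = h' := by
  have hXY := hT.isObj hX hY
  refine hT.ext_lslice hXY hZ hW hh hh' fun r z hz => hT.ext₂ hX hY hW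
    (hT.lslice_mem hXY hZ hz hh) (hT.lslice_mem hXY hZ hz hh') fun p q x hx y hy => ?_
  rw [lslice_apply _ _ _ (hT.tmul_mem hX hY hx hy), lslice_apply _ _ _ (hT.tmul_mem hX hY hx hy),
    H p q r x hx y hy z hz]

theorem ext₄ {X Y Z V W} (hX : P X) (hY : P Y) (hZ : P Z) (hV : P V) (hW : P W) {n : ℤ}
    {h h' : (M (T.obj (T.obj (T.obj X Y) Z) V)).M →ₗ[K] (M W).M}
    (hh : h ∈ DGModData.hom (M (T.obj (T.obj (T.obj X Y) Z) V)) (M W) n)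
    (hh' : h' ∈ DGModData.hom (M (T.obj (T.obj (T.obj X Y) Z) V)) (M W) n)
    (H : ∀ p q r s, ∀ x ∈ (M X).M.gr p, ∀ y ∈ (M Y).M.gr q, ∀ z ∈ (M Z).M.gr r,
      ∀ v ∈ (M V).M.gr s, h (T.tmul _ V (T.tmul _ Z (T.tmul X Y x y) z) v) =
        h' (T.tmul _ V (T.tmul _ Z (T.tmul X Y x y) z) v)) : h = h' := by
  have hXY := hT.isObj hX hY
  have hXYZ := hT.isObj hXY hZ
  refine hT.ext_lslice hXYZ hV hW hh hh' fun s v hv => hT.ext₃ hX hY hZ hW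
    (hT.lslice_mem hXYZ hV hv hh) (hT.lslice_mem hXYZ hV hv hh') fun p q r x hx y hy z hz => ?_
  have ht := hT.tmul_mem hXY hZ (hT.tmul_mem hX hY hx hy) hz
  rw [lslice_apply _ _ _ ht, lslice_apply _ _ _ ht, H p q r s x hx y hy z hz v hv]

/-- Homomorphisms out of `X ⊗ (Y ⊗ Z)` are determined by their values on products. -/
theorem ext₃' {X Y Z W} (hX : P X) (hY : P Y) (hZ : P Z) (hW : P W) {n : ℤ}
    {h h' : (M (T.obj X (T.obj Y Z))).M →ₗ[K] (M W).M}
    (hh : h ∈ DGModData.hom (M (T.obj X (T.obj Y Z))) (M W) n)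
    (hh' : h' ∈ DGModData.hom (M (T.obj X (T.obj Y Z))) (M W) n)
    (H : ∀ p q r, ∀ x ∈ (M X).M.gr p, ∀ y ∈ (M Y).M.gr q, ∀ z ∈ (M Z).M.gr r,
      h (T.tmul X _ x (T.tmul Y Z y z)) = h' (T.tmul X _ x (T.tmul Y Z y z))) : h = h' := by
  have hYZ := hT.isObj hY hZ
  -- Fixing the left factor needs no sign correction: balancedness already gives the linearity sign
  -- of degree `n + p` in the right factor.
  have mem : ∀ k : (M (T.obj X (T.obj Y Z))).M →ₗ[K] (M W).M,
      k ∈ DGModData.hom (M (T.obj X (T.obj Y Z))) (M W) n → ∀ p, ∀ x ∈ (M X).M.gr p,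
      k ∘ₗ T.tmul X _ x ∈ DGModData.hom (M (T.obj Y Z)) (M W) (n + p) := by
    refine fun k hk p x hx => ⟨fun q t ht => GrSp.gr_congr _ (by ring)
      (hk.1 _ _ (hT.tmul_mem hX hYZ hx ht)), fun q a ha t => ?_⟩
    rw [LinearMap.comp_apply, hT.tmul_act hX hYZ ha hx, LinearMap.map_units_int_smul,
      ← hT.act_tmul hX hYZ ha, hk.2 q a ha]
    exact Int.negOnePow_smul_smul_congr (by push_cast; ring)
  refine hT.ext₂ hX hYZ hW hh hh' fun p q x hx t ht => ?_
  have := hT.ext₂ hY hZ hW (mem h hh p x hx) (mem h' hh' p x hx)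
    fun q r y hy z hz => H p q r x hx y hy z hz
  exact LinearMap.congr_fun this t

end IsTensor
end FamTensor
end DGModData


/-! ### Leibniz rule for products of morphisms, closedness of the constraints -/

namespace DGModData
namespace FamTensor
namespace IsTensor

variable {K : Type u} [Field K] {R : DGAlg K} {O : Type v} {M : O → DGModData R}
  {T : FamTensor M} {P : O → Prop} (hT : T.IsTensor P)

include hT

theorem d_tensorHom (hR : R.δ ∈ GrSp.mapDeg R.A R.A 1) {X X' Y Y'} (hX : P X) (hX' : P X')
    (hY : P Y) (hY' : P Y') {m n : ℤ} {f : (M X).M →ₗ[K] (M X').M} {g : (M Y).M →ₗ[K] (M Y').M}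
    (hf : f ∈ DGModData.hom (M X) (M X') m) (hg : g ∈ DGModData.hom (M Y) (M Y') n) :
    (famCat M P).d (m + n) (T.hom m n f g) =
      T.hom (m + 1) n ((famCat M P).d m f) g +
        m.negOnePow • T.hom m (n + 1) f ((famCat M P).d n g) := by
  have hdf := d_mem_hom hR (hT.isDG hX) (hT.isDG hX') hf
  have hdg := d_mem_hom hR (hT.isDG hY) (hT.isDG hY') hg
  have hXY := hT.isObj hX hY
  have hXY' := hT.isObj hX' hY'
  refine hT.ext₂ hX hY hXY' (d_mem_hom hR (hT.isDG hXY) (hT.isDG hXY') (hT.hom_mem hX hX' hY hY'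
    hf hg)) (Submodule.add_mem _ (hom_congr (by ring) (hT.hom_mem hX hX' hY hY' hdf hg))
    (Submodule.units_int_smul_mem _ _ (hom_congr (by ring) (hT.hom_mem hX hX' hY hY' hf hdg))))
    fun p q x hx y hy => ?_
  rw [LinearMap.add_apply, LinearMap.units_int_smul_apply, hT.hom_tmul hX hX' hY hY' hdf hg hx,
    hT.hom_tmul hX hX' hY hY' hf hdg hx]
  simp only [LinearMap.sub_apply, LinearMap.comp_apply, LinearMap.units_int_smul_apply,
    hT.d_tmul hX hY hx, hT.hom_tmul hX hX' hY hY' hf hg hx,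
    hT.hom_tmul hX hX' hY hY' hf hg ((hT.isDG hX).d_mem _ _ hx), map_add, map_sub,
    LinearMap.map_units_int_smul, hT.d_tmul hX' hY' (hf.1 _ _ hx), smul_add, smul_sub, smul_smul,
    ← Int.negOnePow_add]
  rw [show n * p + (p + m) = m + ((n + 1) * p) by ring,
    Int.negOnePow_congr (show ((m + n + n * (p + 1) : ℤ) : ZMod 2) = ((n * p + m : ℤ) : ZMod 2) by
      push_cast; grind),
    Int.negOnePow_congr (show ((m + ((n + 1) * p + n) : ℤ) : ZMod 2) =
      ((m + n + (p + n * p) : ℤ) : ZMod 2) by push_cast; ring)]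
  abel

theorem assoc_closed (hR : R.δ ∈ GrSp.mapDeg R.A R.A 1) {X Y Z} (hX : P X) (hY : P Y)
    (hZ : P Z) : (famCat M P).IsClosed (T.assoc X Y Z) := by
  have hXY := hT.isObj hX hY
  have hYZ := hT.isObj hY hZ
  have hl := hT.isObj hXY hZ
  have hr := hT.isObj hX hYZ
  refine ⟨hT.assoc_mem hX hY hZ, hT.ext₃ hX hY hZ hr (d_mem_hom hR (hT.isDG hl) (hT.isDG hr)
    (hT.assoc_mem hX hY hZ)) (Submodule.zero_mem _) fun p q r x hx y hy z hz => ?_⟩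
  have hxy := hT.tmul_mem hX hY hx hy
  simp only [LinearMap.sub_apply, LinearMap.comp_apply, hT.assoc_tmul hX hY hZ, hT.d_tmul hX hYZ hx,
    hT.d_tmul hXY hZ hxy, hT.d_tmul hX hY hx, hT.d_tmul hY hZ hy, map_add,
    LinearMap.map_units_int_smul, LinearMap.add_apply, LinearMap.units_int_smul_apply,
    smul_add, smul_smul, ← Int.negOnePow_add, LinearMap.zero_apply, Int.negOnePow_zero, one_smul]
  abel

theorem braid_closed (hR : R.δ ∈ GrSp.mapDeg R.A R.A 1) {X Y} (hX : P X) (hY : P Y) :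
    (famCat M P).IsClosed (T.braid X Y) := by
  have hXY := hT.isObj hX hY
  have hYX := hT.isObj hY hX
  refine ⟨hT.braid_mem hX hY, hT.ext₂ hX hY hYX (d_mem_hom hR (hT.isDG hXY) (hT.isDG hYX)
    (hT.braid_mem hX hY)) (Submodule.zero_mem _) fun p q x hx y hy => ?_⟩
  have hdx := (hT.isDG hX).d_mem _ _ hx
  have hdy := (hT.isDG hY).d_mem _ _ hy
  simp only [LinearMap.sub_apply, LinearMap.comp_apply, hT.braid_tmul hX hY hx hy,
    hT.d_tmul hX hY hx, hT.braid_tmul hX hY hdx hy, hT.braid_tmul hX hY hx hdy,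
    hT.d_tmul hY hX hy, map_add, LinearMap.map_units_int_smul,
    smul_add, smul_smul, ← Int.negOnePow_add, LinearMap.zero_apply, Int.negOnePow_zero, one_smul]
  rw [Int.negOnePow_congr (show ((p * q + q : ℤ) : ZMod 2) = (((p + 1) * q : ℤ) : ZMod 2) by
      push_cast; ring),
    Int.negOnePow_congr (show ((p + p * (q + 1) : ℤ) : ZMod 2) = ((p * q : ℤ) : ZMod 2) by
      push_cast; grind)]
  abel

theorem lunit_closed (hR : R.δ ∈ GrSp.mapDeg R.A R.A 1) {X} (hX : P X) :
    (famCat M P).IsClosed (T.lunit X) := by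
  have hUX := hT.isObj hT.unit_isObj hX
  refine ⟨hT.lunit_mem hX, hT.ext₂ hT.unit_isObj hX hX (d_mem_hom hR (hT.isDG hUX) (hT.isDG hX)
    (hT.lunit_mem hX)) (Submodule.zero_mem _) fun p q a' ha' x hx => ?_⟩
  obtain ⟨a, rfl⟩ := hT.ι_surjective a'
  -- Only `ι a` is known to be homogeneous at this point, not `a`. The Leibniz rule for `d (a x)` is
  -- therefore stated as an identity of maps linear in `a`, with `sgn 1` in place of the sign
  -- `(-1)^|a|`.
  suffices (M X).d ∘ₗ (M X).act.flip x = (M X).act.flip x ∘ₗ R.δ +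
      (M X).act.flip ((M X).d x) ∘ₗ R.A.sgn 1 by
    have h := LinearMap.congr_fun this a
    have hsgn : T.ι (R.A.sgn 1 a) = p.negOnePow • T.ι a := by
      have : T.ι ∘ₗ R.A.sgn 1 = (M T.unit).M.sgn 1 ∘ₗ T.ι := R.A.hom_ext fun p a ha => by
        simp only [LinearMap.comp_apply, GrSp.sgn_apply _ _ ha, GrSp.sgn_apply _ _ (hT.ι_mem ha),
          LinearMap.map_units_int_smul]
      have := LinearMap.congr_fun this a
      simpa only [LinearMap.comp_apply, GrSp.sgn_apply _ _ ha', one_mul] using this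
    simp only [LinearMap.comp_apply, LinearMap.flip_apply, LinearMap.add_apply] at h
    simp only [LinearMap.sub_apply, LinearMap.comp_apply, hT.lunit_tmul hX,
      hT.d_tmul hT.unit_isObj hX ha', map_add, LinearMap.map_units_int_smul, hT.d_ι, h,
      LinearMap.zero_apply, Int.negOnePow_zero, one_smul]
    rw [show R.A.sgn 1 a = p.negOnePow • a from hT.ι_injective (by
      rw [hsgn, LinearMap.map_units_int_smul]), units_smul_act]
    abel
  refine R.A.hom_ext fun p a ha => ?_
  simp only [LinearMap.comp_apply, LinearMap.flip_apply, LinearMap.add_apply,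
    GrSp.sgn_apply _ _ ha, (hT.isDG hX).d_act p a ha, one_mul, units_smul_act]

end IsTensor
end FamTensor
end DGModData


/-! ### Invertibility, naturality and coherence of the constraints -/

namespace DGModData
namespace FamTensor
namespace IsTensor

variable {K : Type u} [Field K] {R : DGAlg K} {O : Type v} {M : O → DGModData R}
  {T : FamTensor M} {P : O → Prop} (hT : T.IsTensor P)

include hT

theorem id_hom_tmul {X Y Y'} (hX : P X) (hY : P Y) (hY' : P Y') {n : ℤ}
    {g : (M Y).M →ₗ[K] (M Y').M} (hg : g ∈ DGModData.hom (M Y) (M Y') n) {p : ℤ} {x : (M X).M}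
    (hx : x ∈ (M X).M.gr p) (y : (M Y).M) :
    T.hom 0 n LinearMap.id g (T.tmul X Y x y) = (n * p).negOnePow • T.tmul X Y' x (g y) :=
  hT.hom_tmul hX hX hY hY' (id_mem_hom _) hg hx y

theorem hom_id_tmul {X X' Y} (hX : P X) (hX' : P X') (hY : P Y) {n : ℤ}
    {f : (M X).M →ₗ[K] (M X').M} (hf : f ∈ DGModData.hom (M X) (M X') n) (x : (M X).M)
    (y : (M Y).M) :
    T.hom n 0 f LinearMap.id (T.tmul X Y x y) = T.tmul X' Y (f x) y := by
  induction x using GrSp.induction_on with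
  | hom p x hx => simpa using hT.hom_tmul hX hX' hY hY hf (id_mem_hom _) hx y
  | add x x' h h' => simp only [map_add, LinearMap.add_apply, h, h']

theorem id_hom_tmul_zero {X Y Y'} (hX : P X) (hY : P Y) (hY' : P Y')
    {g : (M Y).M →ₗ[K] (M Y').M} (hg : g ∈ DGModData.hom (M Y) (M Y') 0) (x : (M X).M)
    (y : (M Y).M) :
    T.hom 0 0 LinearMap.id g (T.tmul X Y x y) = T.tmul X Y' x (g y) := by
  induction x using GrSp.induction_on with
  | hom p x hx => simpa using hT.id_hom_tmul hX hY hY' hg hx y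
  | add x x' h h' => simp only [map_add, LinearMap.add_apply, h, h']

theorem braid_braid {X Y} (hX : P X) (hY : P Y) :
    T.braid Y X ∘ₗ T.braid X Y = LinearMap.id :=
  hT.ext₂ hX hY (hT.isObj hX hY) (comp_mem_hom (hT.braid_mem hY hX) (hT.braid_mem hX hY) rfl)
    (id_mem_hom _) fun p q x hx y hy => by
      rw [LinearMap.comp_apply, hT.braid_tmul hX hY hx hy, LinearMap.map_units_int_smul,
        hT.braid_tmul hY hX hy hx, mul_comm q p, Int.negOnePow_smul_self_smul, LinearMap.id_apply]

theorem isClosed_comp (hR : R.δ ∈ GrSp.mapDeg R.A R.A 1) {X Y Z} (hX : P X) (hY : P Y)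
    (hZ : P Z) {g : (M Y).M →ₗ[K] (M Z).M} {f : (M X).M →ₗ[K] (M Y).M}
    (hg : (famCat M P).IsClosed (X := Y) (Y := Z) g)
    (hf : (famCat M P).IsClosed (X := X) (Y := Y) f) :
    (famCat M P).IsClosed (X := X) (Y := Z) (g ∘ₗ f) := by
  refine ⟨comp_mem_hom hg.1 hf.1 rfl, ?_⟩
  have := (famCat_isDGCategory M P hR fun _ hX => hT.isDG hX).d_comp hX hY hZ 0 0 g hg.1 f hf.1
  rw [zero_add] at this
  refine this.trans ?_
  rw [hg.2, hf.2]
  simp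

/-- The inverse of the associator is assembled from closed maps already at hand, by rotating the
factors: `x(yz) → (yz)x → y(zx) → (zx)y → z(xy) → (xy)z`, alternating braidings and associators. -/
theorem assoc_isIso (hR : R.δ ∈ GrSp.mapDeg R.A R.A 1) {X Y Z} (hX : P X) (hY : P Y)
    (hZ : P Z) : (famCat M P).IsIso (T.assoc X Y Z) := by
  have hXY := hT.isObj hX hY
  have hYZ := hT.isObj hY hZ
  have hZX := hT.isObj hZ hX
  have h3 {X Y Z} (hX : P X) (hY : P Y) (hZ : P Z) := hT.isObj (hT.isObj hX hY) hZ
  have h3' {X Y Z} (hX : P X) (hY : P Y) (hZ : P Z) := hT.isObj hX (hT.isObj hY hZ)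
  let a : (M (T.obj X (T.obj Y Z))).M →ₗ[K] (M (T.obj (T.obj X Y) Z)).M :=
    T.braid Z (T.obj X Y) ∘ₗ T.assoc Z X Y ∘ₗ T.braid Y (T.obj Z X) ∘ₗ T.assoc Y Z X ∘ₗ
      T.braid X (T.obj Y Z)
  have ha : (famCat M P).IsClosed (X := T.obj X (T.obj Y Z)) (Y := T.obj (T.obj X Y) Z) a :=
    hT.isClosed_comp hR (h3' hX hY hZ) (h3' hZ hX hY) (h3 hX hY hZ) (hT.braid_closed hR hZ hXY) <|
    hT.isClosed_comp hR (h3' hX hY hZ) (h3 hZ hX hY) (h3' hZ hX hY) (hT.assoc_closed hR hZ hX hY) <|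
    hT.isClosed_comp hR (h3' hX hY hZ) (h3' hY hZ hX) (h3 hZ hX hY) (hT.braid_closed hR hY hZX) <|
    hT.isClosed_comp hR (h3' hX hY hZ) (h3 hY hZ hX) (h3' hY hZ hX) (hT.assoc_closed hR hY hZ hX)
      (hT.braid_closed hR hX hYZ)
  have key : ∀ p q r, ∀ x ∈ (M X).M.gr p, ∀ y ∈ (M Y).M.gr q, ∀ z ∈ (M Z).M.gr r,
      a (T.tmul X _ x (T.tmul Y Z y z)) = T.tmul _ Z (T.tmul X Y x y) z := by
    intro p q r x hx y hy z hz
    simp only [a, LinearMap.comp_apply]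
    rw [hT.braid_tmul hX hYZ hx (hT.tmul_mem hY hZ hy hz), LinearMap.map_units_int_smul,
      hT.assoc_tmul hY hZ hX, LinearMap.map_units_int_smul,
      hT.braid_tmul hY hZX hy (hT.tmul_mem hZ hX hz hx)]
    simp only [LinearMap.map_units_int_smul, hT.assoc_tmul hZ hX hY,
      hT.braid_tmul hZ hXY hz (hT.tmul_mem hX hY hx hy)]
    simp only [smul_smul, ← Int.negOnePow_add]
    -- The three braidings contribute `p(q+r) + q(r+p) + r(p+q)`, in which every product of two
    -- degrees occurs twice.
    rw [Int.negOnePow_even, one_smul]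
    exact ⟨p * q + q * r + p * r, by ring⟩
  refine ⟨hT.assoc_closed hR hX hY hZ, a, ha, ?_, ?_⟩
  · refine hT.ext₃ hX hY hZ (h3 hX hY hZ) (comp_mem_hom ha.1 (hT.assoc_mem hX hY hZ) rfl)
      (id_mem_hom _) fun p q r x hx y hy z hz => ?_
    rw [LinearMap.comp_apply, hT.assoc_tmul hX hY hZ, key p q r x hx y hy z hz, LinearMap.id_apply]
  · refine hT.ext₃' hX hY hZ (h3' hX hY hZ) (comp_mem_hom (hT.assoc_mem hX hY hZ) ha.1 rfl)
      (id_mem_hom _) fun p q r x hx y hy z hz => ?_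
    rw [LinearMap.comp_apply, key p q r x hx y hy z hz, hT.assoc_tmul hX hY hZ, LinearMap.id_apply]

/-- Balancedness lets scalars cross the tensor sign, so every `a ⊗ x` equals `1 ⊗ a x`. This makes
`x ↦ 1 ⊗ x` inverse to the left unit constraint. -/
theorem tmul_one_mul (hR : R.IsCDGA) {X} (hX : P X) (a : R.A) (x : (M X).M) :
    T.tmul T.unit X (T.ι R.one) ((M X).act a x) = T.tmul T.unit X (T.ι a) x := by
  induction a using GrSp.induction_on with
  | hom p a ha =>
    rw [hT.tmul_act hT.unit_isObj hX ha (hT.ι_mem hR.one_mem), ← hT.ι_mul, hR.mul_one]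
    simp
  | add a b h h' => simp only [map_add, LinearMap.add_apply, h, h']

theorem act_one_tmul (hR : R.IsCDGA) {X} (hX : P X) (a : R.A) {q : ℤ} {x : (M X).M}
    (hx : x ∈ (M X).M.gr q) (p : ℤ) (ha : a ∈ R.A.gr p) :
    T.tmul X T.unit ((M X).act a x) (T.ι R.one) =
      (p * q).negOnePow • T.tmul X T.unit x (T.ι a) := by
  have := hT.tmul_act hX hT.unit_isObj ha hx (T.ι R.one)
  rw [← hT.ι_mul, hR.mul_one] at this
  rw [this, Int.negOnePow_smul_self_smul]

theorem tmul_one_closed (hR : R.IsCDGA) {X} (hX : P X) :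
    (famCat M P).IsClosed (X := X) (Y := T.obj T.unit X) (T.tmul T.unit X (T.ι R.one)) := by
  have h1 := hT.ι_mem hR.one_mem
  refine ⟨⟨fun p x hx => GrSp.gr_congr _ (by ring) (hT.tmul_mem hT.unit_isObj hX h1 hx),
    fun p a ha x => ?_⟩, ?_⟩
  · rw [hT.tmul_act hT.unit_isObj hX ha h1, hT.act_tmul hT.unit_isObj hX ha]
    simp
  · ext x
    simp [hT.d_tmul hT.unit_isObj hX h1, hT.d_ι, hR.δ_one]

theorem one_tmul_closed (hR : R.IsCDGA) {X} (hX : P X) :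
    (famCat M P).IsClosed (X := X) (Y := T.obj X T.unit)
      ((T.tmul X T.unit).flip (T.ι R.one)) := by
  have h1 := hT.ι_mem hR.one_mem
  refine ⟨⟨fun p x hx => GrSp.gr_congr _ (by ring) (hT.tmul_mem hX hT.unit_isObj hx h1),
    fun p a ha x => ?_⟩, ?_⟩
  · simp [hT.act_tmul hX hT.unit_isObj ha]
  · refine (M X).M.hom_ext fun p x hx => ?_
    simp [hT.d_tmul hX hT.unit_isObj hx, hT.d_ι, hR.δ_one]

theorem lunit_isIso (hR : R.IsCDGA) {X} (hX : P X) : (famCat M P).IsIso (T.lunit X) := by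
  have hUX := hT.isObj hT.unit_isObj hX
  have hc := hT.tmul_one_closed hR hX
  refine ⟨hT.lunit_closed hR.δ_mem hX, T.tmul T.unit X (T.ι R.one), hc, ?_, ?_⟩
  · refine hT.ext₂ hT.unit_isObj hX hUX (comp_mem_hom hc.1 (hT.lunit_mem hX) rfl)
      (id_mem_hom _) fun p q a' _ x hx => ?_
    obtain ⟨a, rfl⟩ := hT.ι_surjective a'
    rw [LinearMap.comp_apply, hT.lunit_tmul hX, hT.tmul_one_mul hR hX, LinearMap.id_apply]
  · ext x
    change T.lunit X (T.tmul _ _ _ _) = _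
    rw [hT.lunit_tmul hX, (hT.isDG hX).one_act, LinearMap.id_apply]

/-- A degree-preserving map commutes with the projections onto homogeneous components; being
injective as well, `ι` reflects degrees. -/
theorem ι_mem_iff {p : ℤ} {a : R.A} : T.ι a ∈ (M T.unit).M.gr p ↔ a ∈ R.A.gr p := by
  refine ⟨fun ha => ?_, hT.ι_mem⟩
  let c : ∀ (V : GrSp K), ℤ → V →ₗ[K] V := fun V q =>
    (V.gr q).subtype ∘ₗ DirectSum.component K ℤ (fun i => V.gr i) q ∘ₗ V.decomp.symm.toLinearMap
  have hc : ∀ (V : GrSp K) (q r : ℤ) (x : V), x ∈ V.gr r → c V q x = if r = q then x else 0 := by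
    intro V q r x hx
    simp only [c, LinearMap.comp_apply, LinearEquiv.coe_coe, V.decomp_symm_apply hx,
      DirectSum.component.of]
    split_ifs with h
    · subst h; rfl
    · rfl
  have hmem : ∀ (V : GrSp K) (q : ℤ) (x : V), c V q x ∈ V.gr q := fun V q x => Submodule.coe_mem _
  have comm : T.ι ∘ₗ c R.A p = c (M T.unit).M p ∘ₗ T.ι := R.A.hom_ext fun r b hb => by
    simp only [LinearMap.comp_apply, hc _ _ _ _ hb, hc _ _ _ _ (hT.ι_mem hb)]
    split_ifs <;> simp
  have h := LinearMap.congr_fun comm a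
  simp only [LinearMap.comp_apply, hc _ _ _ _ ha, if_true] at h
  rw [← hT.ι_injective h]
  exact hmem _ _ _

theorem runit_closed (hR : R.IsCDGA) {X} (hX : P X) :
    (famCat M P).IsClosed (T.runit X) := by
  have hXU := hT.isObj hX hT.unit_isObj
  refine ⟨hT.runit_mem hX, hT.ext₂ hX hT.unit_isObj hX (d_mem_hom hR.δ_mem (hT.isDG hXU)
    (hT.isDG hX) (hT.runit_mem hX)) (Submodule.zero_mem _) fun p q x hx a' ha' => ?_⟩
  obtain ⟨a, rfl⟩ := hT.ι_surjective a'
  have ha := hT.ι_mem_iff.1 ha'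
  have hdx := (hT.isDG hX).d_mem _ _ hx
  have hda := hR.δ_mem _ _ ha
  simp only [LinearMap.sub_apply, LinearMap.comp_apply, hT.runit_tmul hX ha hx,
    hT.d_tmul hX hT.unit_isObj hx, map_add, LinearMap.map_units_int_smul, hT.d_ι,
    hT.runit_tmul hX ha hdx, hT.runit_tmul hX hda hx, (hT.isDG hX).d_act _ _ ha, smul_add,
    smul_smul, ← Int.negOnePow_add, LinearMap.zero_apply, Int.negOnePow_zero, one_smul]
  rw [Int.negOnePow_congr (show ((q * p + q : ℤ) : ZMod 2) = ((q * (p + 1) : ℤ) : ZMod 2) by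
      push_cast; ring),
    Int.negOnePow_congr (show ((p + (q + 1) * p : ℤ) : ZMod 2) = ((q * p : ℤ) : ZMod 2) by
      push_cast; grind)]
  abel

theorem runit_isIso (hR : R.IsCDGA) {X} (hX : P X) : (famCat M P).IsIso (T.runit X) := by
  have hXU := hT.isObj hX hT.unit_isObj
  have hc := hT.one_tmul_closed hR hX
  refine ⟨hT.runit_closed hR hX, (T.tmul X T.unit).flip (T.ι R.one), hc, ?_, ?_⟩
  · refine hT.ext₂ hX hT.unit_isObj hXU (comp_mem_hom hc.1 (hT.runit_mem hX) rfl)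
      (id_mem_hom _) fun p q x hx a' ha' => ?_
    obtain ⟨a, rfl⟩ := hT.ι_surjective a'
    have ha := hT.ι_mem_iff.1 ha'
    rw [LinearMap.comp_apply, hT.runit_tmul hX ha hx, LinearMap.map_units_int_smul,
      LinearMap.flip_apply, hT.act_one_tmul hR hX a hx q ha, Int.negOnePow_smul_self_smul,
      LinearMap.id_apply]
  · refine (M X).M.hom_ext fun p x hx => ?_
    change T.runit X (T.tmul _ _ _ _) = _
    rw [hT.runit_tmul hX hR.one_mem hx, (hT.isDG hX).one_act, LinearMap.id_apply]
    simp

theorem hexagon {X Y Z} (hX : P X) (hY : P Y) (hZ : P Z)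
    {a : (M (T.obj X (T.obj Z Y))).M →ₗ[K] (M (T.obj (T.obj X Z) Y)).M}
    (ha : a ∈ DGModData.hom (M (T.obj X (T.obj Z Y))) (M (T.obj (T.obj X Z) Y)) 0)
    (h : a ∘ₗ T.assoc X Z Y = LinearMap.id) :
    T.braid (T.obj X Y) Z = T.assoc Z X Y ∘ₗ T.hom 0 0 (T.braid X Z) LinearMap.id ∘ₗ
      a ∘ₗ T.hom 0 0 LinearMap.id (T.braid Y Z) ∘ₗ T.assoc X Y Z := by
  have hXY := hT.isObj hX hY
  have hXZ := hT.isObj hX hZ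
  have hYZ := hT.isObj hY hZ
  have hZY := hT.isObj hZ hY
  have hZX := hT.isObj hZ hX
  refine hT.ext₃ hX hY hZ (hT.isObj hZ hXY) (hT.braid_mem hXY hZ)
    (comp_mem_hom (hT.assoc_mem hZ hX hY) (comp_mem_hom (hT.hom_mem hXZ hZX hY hY
      (hT.braid_mem hX hZ) (id_mem_hom _)) (comp_mem_hom ha (comp_mem_hom (hT.hom_mem hX hX hYZ hZY
      (id_mem_hom _) (hT.braid_mem hY hZ)) (hT.assoc_mem hX hY hZ) rfl) rfl) rfl) rfl)
    fun p q r x hx y hy z hz => ?_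
  -- Nothing is known about `a` except that it inverts the associator, so its values on products are
  -- read off from `h`.
  have key : a (T.tmul X _ x (T.tmul Z Y z y)) = T.tmul _ Y (T.tmul X Z x z) y := by
    have := LinearMap.congr_fun h (T.tmul _ Y (T.tmul X Z x z) y)
    rwa [LinearMap.comp_apply, hT.assoc_tmul hX hZ hY] at this
  simp only [LinearMap.comp_apply, hT.assoc_tmul hX hY hZ,
    hT.id_hom_tmul_zero hX hYZ hZY (hT.braid_mem hY hZ), hT.braid_tmul hY hZ hy hz,
    LinearMap.map_units_int_smul, key, hT.hom_id_tmul hXZ hZX hY (hT.braid_mem hX hZ),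
    hT.braid_tmul hX hZ hx hz, LinearMap.units_int_smul_apply, hT.assoc_tmul hZ hX hY,
    hT.braid_tmul hXY hZ (hT.tmul_mem hX hY hx hy) hz]
  rw [Int.negOnePow_smul_smul_congr (c := (p + q) * r) (by push_cast; ring)]

theorem interchange {X X' X'' Y Y' Y''} (hX : P X) (hX' : P X') (hX'' : P X'') (hY : P Y)
    (hY' : P Y') (hY'' : P Y'') {m n m' n' : ℤ} {f : (M X).M →ₗ[K] (M X').M}
    {g : (M Y).M →ₗ[K] (M Y').M} {f' : (M X').M →ₗ[K] (M X'').M}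
    {g' : (M Y').M →ₗ[K] (M Y'').M}
    (hf : f ∈ DGModData.hom (M X) (M X') m) (hg : g ∈ DGModData.hom (M Y) (M Y') n)
    (hf' : f' ∈ DGModData.hom (M X') (M X'') m') (hg' : g' ∈ DGModData.hom (M Y') (M Y'') n') :
    T.hom m' n' f' g' ∘ₗ T.hom m n f g =
      (n' * m).negOnePow • T.hom (m' + m) (n' + n) (f' ∘ₗ f) (g' ∘ₗ g) := by
  have hff := comp_mem_hom hf' hf rfl
  have hgg := comp_mem_hom hg' hg rfl
  refine hT.ext₂ hX hY (hT.isObj hX'' hY'') (comp_mem_hom (hT.hom_mem hX' hX'' hY' hY'' hf' hg')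
    (hT.hom_mem hX hX' hY hY' hf hg) rfl) (Submodule.units_int_smul_mem _ _ (hom_congr (by ring)
    (hT.hom_mem hX hX'' hY hY'' hff hgg))) fun p q x hx y hy => ?_
  rw [LinearMap.comp_apply, LinearMap.units_int_smul_apply, hT.hom_tmul hX hX' hY hY' hf hg hx,
    hT.hom_tmul hX hX'' hY hY'' hff hgg hx, LinearMap.map_units_int_smul,
    hT.hom_tmul hX' hX'' hY' hY'' hf' hg' (hf.1 _ _ hx)]
  simp only [LinearMap.comp_apply, smul_smul, ← Int.negOnePow_add]
  congr 2
  ring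

theorem tensorHom_add {X X' Y Y'} (hX : P X) (hX' : P X') (hY : P Y) (hY' : P Y') {m n : ℤ}
    {f : (M X).M →ₗ[K] (M X').M} {g g' : (M Y).M →ₗ[K] (M Y').M}
    (hf : f ∈ DGModData.hom (M X) (M X') m) (hg : g ∈ DGModData.hom (M Y) (M Y') n)
    (hg' : g' ∈ DGModData.hom (M Y) (M Y') n) :
    T.hom m n f (g + g') = T.hom m n f g + T.hom m n f g' := by
  refine hT.ext₂ hX hY (hT.isObj hX' hY') (hT.hom_mem hX hX' hY hY' hf (Submodule.add_mem _ hg hg'))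
    (Submodule.add_mem _ (hT.hom_mem hX hX' hY hY' hf hg) (hT.hom_mem hX hX' hY hY' hf hg'))
    fun p q x hx y hy => ?_
  rw [LinearMap.add_apply, hT.hom_tmul hX hX' hY hY' hf hg hx, hT.hom_tmul hX hX' hY hY' hf hg' hx,
    hT.hom_tmul hX hX' hY hY' hf (Submodule.add_mem _ hg hg') hx]
  simp

theorem add_tensorHom {X X' Y Y'} (hX : P X) (hX' : P X') (hY : P Y) (hY' : P Y') {m n : ℤ}
    {f f' : (M X).M →ₗ[K] (M X').M} {g : (M Y).M →ₗ[K] (M Y').M}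
    (hf : f ∈ DGModData.hom (M X) (M X') m) (hf' : f' ∈ DGModData.hom (M X) (M X') m)
    (hg : g ∈ DGModData.hom (M Y) (M Y') n) :
    T.hom m n (f + f') g = T.hom m n f g + T.hom m n f' g := by
  refine hT.ext₂ hX hY (hT.isObj hX' hY') (hT.hom_mem hX hX' hY hY' (Submodule.add_mem _ hf hf') hg)
    (Submodule.add_mem _ (hT.hom_mem hX hX' hY hY' hf hg) (hT.hom_mem hX hX' hY hY' hf' hg))
    fun p q x hx y hy => ?_
  rw [LinearMap.add_apply, hT.hom_tmul hX hX' hY hY' hf hg hx, hT.hom_tmul hX hX' hY hY' hf' hg hx,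
    hT.hom_tmul hX hX' hY hY' (Submodule.add_mem _ hf hf') hg hx]
  simp

theorem tensorHom_smul {X X' Y Y'} (hX : P X) (hX' : P X') (hY : P Y) (hY' : P Y') {m n : ℤ}
    (c : K) {f : (M X).M →ₗ[K] (M X').M} {g : (M Y).M →ₗ[K] (M Y').M}
    (hf : f ∈ DGModData.hom (M X) (M X') m) (hg : g ∈ DGModData.hom (M Y) (M Y') n) :
    T.hom m n f (c • g) = c • T.hom m n f g ∧ T.hom m n (c • f) g = c • T.hom m n f g := by
  constructor
  · refine hT.ext₂ hX hY (hT.isObj hX' hY') (hT.hom_mem hX hX' hY hY' hf (Submodule.smul_mem _ c hg))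
      (Submodule.smul_mem _ c (hT.hom_mem hX hX' hY hY' hf hg)) fun p q x hx y hy => ?_
    rw [LinearMap.smul_apply, hT.hom_tmul hX hX' hY hY' hf hg hx,
      hT.hom_tmul hX hX' hY hY' hf (Submodule.smul_mem _ c hg) hx]
    simp [smul_comm c]
  · refine hT.ext₂ hX hY (hT.isObj hX' hY') (hT.hom_mem hX hX' hY hY' (Submodule.smul_mem _ c hf) hg)
      (Submodule.smul_mem _ c (hT.hom_mem hX hX' hY hY' hf hg)) fun p q x hx y hy => ?_
    rw [LinearMap.smul_apply, hT.hom_tmul hX hX' hY hY' hf hg hx,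
      hT.hom_tmul hX hX' hY hY' (Submodule.smul_mem _ c hf) hg hx]
    simp [smul_comm c]

theorem tensorHom_id {X Y} (hX : P X) (hY : P Y) :
    T.hom 0 0 (LinearMap.id : (M X).M →ₗ[K] _) (LinearMap.id : (M Y).M →ₗ[K] _) =
      LinearMap.id := by
  refine hT.ext₂ (n := 0) hX hY (hT.isObj hX hY) (hom_congr (add_zero 0)
    (hT.hom_mem hX hX hY hY (id_mem_hom _) (id_mem_hom _))) (id_mem_hom _) fun p q x hx y hy => ?_
  exact hT.hom_id_tmul hX hX hY (id_mem_hom _) x y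

theorem assoc_natural {X X' Y Y' Z Z'} (hX : P X) (hX' : P X') (hY : P Y) (hY' : P Y') (hZ : P Z)
    (hZ' : P Z') {l m n : ℤ} {f : (M X).M →ₗ[K] (M X').M} {g : (M Y).M →ₗ[K] (M Y').M}
    {h : (M Z).M →ₗ[K] (M Z').M} (hf : f ∈ DGModData.hom (M X) (M X') l)
    (hg : g ∈ DGModData.hom (M Y) (M Y') m) (hh : h ∈ DGModData.hom (M Z) (M Z') n) :
    T.assoc X' Y' Z' ∘ₗ T.hom (l + m) n (T.hom l m f g) h =
      T.hom l (m + n) f (T.hom m n g h) ∘ₗ T.assoc X Y Z := by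
  have hXY := hT.isObj hX hY
  have hXY' := hT.isObj hX' hY'
  have hYZ := hT.isObj hY hZ
  have hYZ' := hT.isObj hY' hZ'
  have hfg := hT.hom_mem hX hX' hY hY' hf hg
  have hgh := hT.hom_mem hY hY' hZ hZ' hg hh
  refine hT.ext₃ hX hY hZ (hT.isObj hX' hYZ')
    (comp_mem_hom (hT.assoc_mem hX' hY' hZ') (hT.hom_mem hXY hXY' hZ hZ' hfg hh) rfl)
    (comp_mem_hom (hT.hom_mem hX hX' hYZ hYZ' hf hgh) (hT.assoc_mem hX hY hZ) (by ring))
    fun p q r x hx y hy z hz => ?_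
  rw [LinearMap.comp_apply, LinearMap.comp_apply, hT.assoc_tmul hX hY hZ,
    hT.hom_tmul hXY hXY' hZ hZ' hfg hh (hT.tmul_mem hX hY hx hy), hT.hom_tmul hX hX' hY hY' hf hg hx,
    hT.hom_tmul hX hX' hYZ hYZ' hf hgh hx, hT.hom_tmul hY hY' hZ hZ' hg hh hy]
  simp only [LinearMap.map_units_int_smul, LinearMap.units_int_smul_apply,
    hT.assoc_tmul hX' hY' hZ', smul_smul, ← Int.negOnePow_add]
  congr 2
  ring

theorem lunit_natural {X X'} (hX : P X) (hX' : P X') {n : ℤ} {f : (M X).M →ₗ[K] (M X').M}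
    (hf : f ∈ DGModData.hom (M X) (M X') n) :
    T.lunit X' ∘ₗ T.hom 0 n LinearMap.id f = f ∘ₗ T.lunit X := by
  have hU := hT.unit_isObj
  refine hT.ext₂ hU hX hX' (comp_mem_hom (hT.lunit_mem hX') (hT.hom_mem hU hU hX hX'
    (id_mem_hom _) hf) (by ring)) (comp_mem_hom hf (hT.lunit_mem hX) (by ring))
    fun p q a' ha' x hx => ?_
  obtain ⟨a, rfl⟩ := hT.ι_surjective a'
  rw [LinearMap.comp_apply, LinearMap.comp_apply, hT.lunit_tmul hX,
    hT.id_hom_tmul hU hX hX' hf ha', LinearMap.map_units_int_smul, hT.lunit_tmul hX',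
    hf.2 _ _ (hT.ι_mem_iff.1 ha')]

theorem runit_natural {X X'} (hX : P X) (hX' : P X') {n : ℤ} {f : (M X).M →ₗ[K] (M X').M}
    (hf : f ∈ DGModData.hom (M X) (M X') n) :
    T.runit X' ∘ₗ T.hom n 0 f LinearMap.id = f ∘ₗ T.runit X := by
  have hU := hT.unit_isObj
  refine hT.ext₂ hX hU hX' (comp_mem_hom (hT.runit_mem hX') (hT.hom_mem hX hX' hU hU hf
    (id_mem_hom _)) (by ring)) (comp_mem_hom hf (hT.runit_mem hX) (by ring))
    fun p q x hx a' ha' => ?_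
  obtain ⟨a, rfl⟩ := hT.ι_surjective a'
  have ha := hT.ι_mem_iff.1 ha'
  rw [LinearMap.comp_apply, LinearMap.comp_apply, hT.runit_tmul hX ha hx,
    hT.hom_id_tmul hX hX' hU hf, LinearMap.map_units_int_smul, hT.runit_tmul hX' ha (hf.1 _ _ hx),
    hf.2 _ _ ha]
  exact (Int.negOnePow_smul_smul_congr (by push_cast; ring)).symm

theorem pentagon {X Y Z W} (hX : P X) (hY : P Y) (hZ : P Z) (hW : P W) :
    T.assoc X Y (T.obj Z W) ∘ₗ T.assoc (T.obj X Y) Z W =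
      T.hom 0 0 LinearMap.id (T.assoc Y Z W) ∘ₗ T.assoc X (T.obj Y Z) W ∘ₗ
        T.hom 0 0 (T.assoc X Y Z) LinearMap.id := by
  have hXY := hT.isObj hX hY
  have hYZ := hT.isObj hY hZ
  have hZW := hT.isObj hZ hW
  have hXYZ := hT.isObj hXY hZ
  have hXYZ' := hT.isObj hX hYZ
  have hYZW := hT.isObj hYZ hW
  have hYZW' := hT.isObj hY hZW
  have hf := hT.hom_mem hXYZ hXYZ' hW hW (hT.assoc_mem hX hY hZ) (id_mem_hom _)
  have hg := hT.hom_mem hX hX hYZW hYZW' (id_mem_hom _) (hT.assoc_mem hY hZ hW)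
  refine hT.ext₄ (n := 0) hX hY hZ hW (hT.isObj hX hYZW')
    (comp_mem_hom (hT.assoc_mem hX hY hZW) (hT.assoc_mem hXY hZ hW) rfl)
    (comp_mem_hom hg (comp_mem_hom (hT.assoc_mem hX hYZ hW) hf rfl) rfl)
    fun p q r s x hx y hy z hz v hv => ?_
  simp only [LinearMap.comp_apply]
  rw [hT.assoc_tmul hXY hZ hW, hT.assoc_tmul hX hY hZW,
    hT.hom_id_tmul hXYZ hXYZ' hW (hT.assoc_mem hX hY hZ), hT.assoc_tmul hX hY hZ,
    hT.assoc_tmul hX hYZ hW, hT.id_hom_tmul_zero hX hYZW hYZW' (hT.assoc_mem hY hZ hW),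
    hT.assoc_tmul hY hZ hW]

theorem triangle {X Y} (hX : P X) (hY : P Y) :
    T.hom 0 0 LinearMap.id (T.lunit Y) ∘ₗ T.assoc X T.unit Y =
      T.hom 0 0 (T.runit X) LinearMap.id := by
  have hU := hT.unit_isObj
  have hXU := hT.isObj hX hU
  have hUY := hT.isObj hU hY
  refine hT.ext₃ (n := 0) hX hU hY (hT.isObj hX hY) (comp_mem_hom (hT.hom_mem hX hX hUY hY
    (id_mem_hom _) (hT.lunit_mem hY)) (hT.assoc_mem hX hU hY) rfl)
    (hom_congr (add_zero 0) (hT.hom_mem hXU hX hY hY (hT.runit_mem hX) (id_mem_hom _)))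
    fun p q r x hx a' ha' y hy => ?_
  obtain ⟨a, rfl⟩ := hT.ι_surjective a'
  have ha := hT.ι_mem_iff.1 ha'
  rw [LinearMap.comp_apply, hT.assoc_tmul hX hU hY,
    hT.id_hom_tmul_zero hX hUY hY (hT.lunit_mem hY), hT.lunit_tmul hY,
    hT.hom_id_tmul hXU hX hY (hT.runit_mem hX), hT.runit_tmul hX ha hx, hT.tmul_act hX hY ha hx,
    LinearMap.map_units_int_smul, LinearMap.units_int_smul_apply]

theorem braid_natural {X X' Y Y'} (hX : P X) (hX' : P X') (hY : P Y) (hY' : P Y') {m n : ℤ}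
    {f : (M X).M →ₗ[K] (M X').M} {g : (M Y).M →ₗ[K] (M Y').M}
    (hf : f ∈ DGModData.hom (M X) (M X') m) (hg : g ∈ DGModData.hom (M Y) (M Y') n) :
    T.braid X' Y' ∘ₗ T.hom m n f g = (m * n).negOnePow • (T.hom n m g f ∘ₗ T.braid X Y) := by
  refine hT.ext₂ hX hY (hT.isObj hY' hX')
    (comp_mem_hom (hT.braid_mem hX' hY') (hT.hom_mem hX hX' hY hY' hf hg) rfl)
    (Submodule.units_int_smul_mem _ _ (comp_mem_hom (hT.hom_mem hY hY' hX hX' hg hf)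
      (hT.braid_mem hX hY) (by ring))) fun p q x hx y hy => ?_
  rw [LinearMap.comp_apply, LinearMap.units_int_smul_apply, LinearMap.comp_apply,
    hT.hom_tmul hX hX' hY hY' hf hg hx, hT.braid_tmul hX hY hx hy, LinearMap.map_units_int_smul,
    LinearMap.map_units_int_smul, hT.hom_tmul hY hY' hX hX' hg hf hy,
    hT.braid_tmul hX' hY' (hf.1 _ _ hx) (hg.1 _ _ hy)]
  simp only [smul_smul, ← Int.negOnePow_add]
  rw [Int.negOnePow_congr]
  push_cast
  grind

/-- Dg-modules with relative tensor products form a symmetric monoidal dg-category. -/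
theorem isSymmetricMonoidal (hR : R.IsCDGA) : (T.mon P).IsSymmetricMonoidal where
  toIsDGCategory := famCat_isDGCategory M P hR.δ_mem fun _ hX => hT.isDG hX
  tensorObj_isObj := hT.isObj
  unit_isObj := hT.unit_isObj
  tensorHom_mem hX hX' hY hY' _ _ _ hf _ hg := hT.hom_mem hX hX' hY hY' hf hg
  tensorHom_add hX hX' hY hY' _ _ _ hf _ hg _ hg' := hT.tensorHom_add hX hX' hY hY' hf hg hg'
  add_tensorHom hX hX' hY hY' _ _ _ hf _ hf' _ hg := hT.add_tensorHom hX hX' hY hY' hf hf' hg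
  tensorHom_smul hX hX' hY hY' _ _ c _ hf _ hg := hT.tensorHom_smul hX hX' hY hY' c hf hg
  d_tensorHom hX hX' hY hY' _ _ _ hf _ hg := hT.d_tensorHom hR.δ_mem hX hX' hY hY' hf hg
  tensorHom_id hX hY := hT.tensorHom_id hX hY
  interchange hX hX' hX'' hY hY' hY'' _ _ _ _ _ hf _ hg _ hf' _ hg' :=
    hT.interchange hX hX' hX'' hY hY' hY'' hf hg hf' hg'
  assoc_isIso hX hY hZ := hT.assoc_isIso hR.δ_mem hX hY hZ
  assoc_natural hX hX' hY hY' hZ hZ' _ _ _ _ hf _ hg _ hh :=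
    hT.assoc_natural hX hX' hY hY' hZ hZ' hf hg hh
  lunit_isIso hX := hT.lunit_isIso hR hX
  lunit_natural hX hX' _ _ hf := hT.lunit_natural hX hX' hf
  runit_isIso hX := hT.runit_isIso hR hX
  runit_natural hX hX' _ _ hf := hT.runit_natural hX hX' hf
  pentagon hX hY hZ hW := hT.pentagon hX hY hZ hW
  triangle hX hY := hT.triangle hX hY
  braid_isIso {X Y} hX hY := ⟨hT.braid_closed hR.δ_mem hX hY, T.braid Y X,
    hT.braid_closed hR.δ_mem hY hX, hT.braid_braid hX hY, hT.braid_braid hY hX⟩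
  braid_natural hX hX' hY hY' _ _ _ hf _ hg := hT.braid_natural hX hX' hY hY' hf hg
  braid_braid hX hY := hT.braid_braid hX hY
  hexagon hX hY hZ _ ha _ h := hT.hexagon hX hY hZ ha h

end IsTensor
end FamTensor
end DGModData


/-! ### Calculus with the generators -/

namespace CE

variable {K : Type u} [Field K] {N : ℕ} (deg : Fin N → ℤ)

theorem mulSign_add_left (S S' T : Fin N →₀ ℕ) :
    mulSign deg (S + S') T = mulSign deg S T * mulSign deg S' T := by
  simp only [mulSign, ← Int.negOnePow_add, ← Finset.sum_add_distrib]
  congr 1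
  refine Finset.sum_congr rfl fun α _ => Finset.sum_congr rfl fun β _ => ?_
  split_ifs
  · push_cast [Finsupp.add_apply]; ring
  · simp

theorem mulSign_add_right (S T T' : Fin N →₀ ℕ) :
    mulSign deg S (T + T') = mulSign deg S T * mulSign deg S T' := by
  simp only [mulSign, ← Int.negOnePow_add, ← Finset.sum_add_distrib]
  congr 1
  refine Finset.sum_congr rfl fun α _ => Finset.sum_congr rfl fun β _ => ?_
  split_ifs
  · push_cast [Finsupp.add_apply]; ring
  · simp

@[simp] theorem mulSign_zero_left (T : Fin N →₀ ℕ) : mulSign deg 0 T = 1 := by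
  simp [mulSign]

@[simp] theorem mulSign_zero_right (S : Fin N →₀ ℕ) : mulSign deg S 0 = 1 := by
  simp [mulSign]

@[simp] theorem wt_zero : wt deg (0 : Fin N →₀ ℕ) = 0 := by simp [wt]

theorem wt_add (S T : Fin N →₀ ℕ) : wt deg (S + T) = wt deg S + wt deg T := by
  simp only [wt, Finsupp.add_apply, Nat.cast_add, add_mul, Finset.sum_add_distrib]

@[simp] theorem wt_single (α : Fin N) : wt deg (Finsupp.single α 1) = 1 - deg α := by
  rw [wt, Finset.sum_eq_single α] <;> simp +contextual [eq_comm]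

/-- `mulSign S T` counts the pairs of letters with `β < α` and `mulSign T S` those with `β > α`.
Together they give the full Koszul sign except for the pairs `α = β`, which need no reordering;
these are the correction term. -/
theorem mulSign_mul_swap (S T : Fin N →₀ ℕ) : mulSign deg S T * mulSign deg T S =
    (wt deg S * wt deg T + ∑ α, (S α : ℤ) * T α * (1 - deg α)).negOnePow := by
  have h : wt deg S * wt deg T = (∑ α, ∑ β, if β < α then (S α * T β : ℤ) * ((1 - deg α) * (1 - deg β))
      else 0) + (∑ α, ∑ β, if β < α then (T α * S β : ℤ) * ((1 - deg α) * (1 - deg β)) else 0) +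
      ∑ α, (S α : ℤ) * T α * ((1 - deg α) * (1 - deg α)) := by
    rw [Finset.sum_comm (f := fun α β => if β < α then (T α * S β : ℤ) * ((1 - deg α) * (1 - deg β))
      else 0), wt, wt, Finset.sum_mul_sum, ← Finset.sum_add_distrib, ← Finset.sum_add_distrib]
    refine Finset.sum_congr rfl fun α _ => ?_
    have hd : (S α : ℤ) * T α * ((1 - deg α) * (1 - deg α)) =
        ∑ β, if α = β then (S α : ℤ) * T β * ((1 - deg α) * (1 - deg β)) else 0 := by simp
    rw [← Finset.sum_add_distrib, hd, ← Finset.sum_add_distrib]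
    refine Finset.sum_congr rfl fun β _ => ?_
    rcases lt_trichotomy β α with h | h | h
    · simp only [h, if_true, not_lt.2 h.le, if_false, h.ne']; ring
    · subst h; simp only [lt_irrefl, if_false, if_true]; ring
    · simp only [h, if_true, not_lt.2 h.le, if_false, h.ne]; ring
  rw [h, mulSign, mulSign, ← Int.negOnePow_add]
  refine Int.negOnePow_congr ?_
  -- The diagonal part of `wt S * wt T` has factors `(1 - deg α)²`, of the same parity as `1 - deg
  -- α`, so it cancels the correction term modulo 2.
  have hz : (∑ α, (S α : ZMod 2) * T α * ((1 - deg α) * (1 - deg α))) +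
      ∑ α, (S α : ZMod 2) * T α * (1 - deg α) = 0 := by
    have sq : ∀ a : ZMod 2, a * a = a := by decide
    rw [← Finset.sum_add_distrib]
    refine Finset.sum_eq_zero fun α _ => ?_
    rw [sq]
    grind
  push_cast
  rw [add_assoc (_ + _), hz, add_zero]

theorem Adm.of_le {R S : Fin N →₀ ℕ} (h : Adm deg R) (hS : S ≤ R) : Adm deg S :=
  fun α hα => (hS α).trans (h α hα)

theorem adm_zero : Adm deg (0 : Fin N →₀ ℕ) := fun α _ => by simp

open Classical in
/-- The series with coefficients `∑_{P + Q = R} ± B P Q`, the signs being those of `θ^P θ^Q`. -/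
def conv {V : Type*} [AddCommGroup V] (B : (Fin N →₀ ℕ) → (Fin N →₀ ℕ) → V) :
    (Fin N →₀ ℕ) → V :=
  fun R => if Adm deg R then
    ∑ p ∈ Finset.HasAntidiagonal.antidiagonal R, mulSign deg p.1 p.2 • B p.1 p.2 else 0

theorem conv_zero_apply {V : Type*} [AddCommGroup V] (B : (Fin N →₀ ℕ) → (Fin N →₀ ℕ) → V) :
    conv deg B 0 = B 0 0 := by
  simp [conv, adm_zero]

/-- The partial derivative with respect to `θ^α` (from the left). -/
def pdFun {V : Type*} [AddCommGroup V] (α : Fin N) (x : (Fin N →₀ ℕ) → V) : (Fin N →₀ ℕ) → V :=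
  fun R => mulSign deg (Finsupp.single α 1) R • (R α + 1) • x (R + Finsupp.single α 1)

/-- The weight `p.1 α` kills the splittings whose first part lacks `θ^α`; all the others arise
uniquely from a splitting of `R` by adding that letter to the first part. This reindexing underlies
the Leibniz rule. -/
theorem sum_antidiagonal_add_single {A : Type*} [AddCommMonoid A] (α : Fin N) (R : Fin N →₀ ℕ)
    (f : (Fin N →₀ ℕ) → (Fin N →₀ ℕ) → A) :
    ∑ p ∈ Finset.HasAntidiagonal.antidiagonal (R + Finsupp.single α 1), (p.1 : Fin N →₀ ℕ) α • f p.1 p.2 =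
      ∑ p ∈ Finset.HasAntidiagonal.antidiagonal R,
        (p.1 α + 1) • f (p.1 + Finsupp.single α 1) p.2 := by
  symm
  refine Finset.sum_bij_ne_zero (fun p _ _ => (p.1 + Finsupp.single α 1, p.2)) ?_ ?_ ?_ ?_
  · intro p hp _
    rw [Finset.HasAntidiagonal.mem_antidiagonal] at hp ⊢
    rw [← hp]
    exact add_right_comm _ _ _
  · rintro ⟨p, q⟩ _ _ ⟨p', q'⟩ _ _ h
    simpa using h
  · rintro ⟨p, q⟩ hp h
    have hp0 : p α ≠ 0 := fun h0 => h (by simp [h0])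
    have hle : Finsupp.single α 1 ≤ p := by
      rw [Finsupp.single_le_iff]; omega
    refine ⟨(p - Finsupp.single α 1, q), ?_, ?_, ?_⟩
    · rw [Finset.HasAntidiagonal.mem_antidiagonal] at hp ⊢
      have : p - Finsupp.single α 1 + q + Finsupp.single α 1 = R + Finsupp.single α 1 := by
        rw [← hp, add_right_comm, tsub_add_cancel_of_le hle]
      exact add_right_cancel this
    · simp only [tsub_add_cancel_of_le hle]
      have : (p - Finsupp.single α 1 : Fin N →₀ ℕ) α + 1 = p α := by simp; omega
      rw [this]
      exact h
    · simp [tsub_add_cancel_of_le hle]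
  · intro p _ _
    simp

theorem sum_antidiagonal_add_single' {A : Type*} [AddCommMonoid A] (α : Fin N) (R : Fin N →₀ ℕ)
    (f : (Fin N →₀ ℕ) → (Fin N →₀ ℕ) → A) :
    ∑ p ∈ Finset.HasAntidiagonal.antidiagonal (R + Finsupp.single α 1), (p.2 : Fin N →₀ ℕ) α • f p.1 p.2 =
      ∑ p ∈ Finset.HasAntidiagonal.antidiagonal R,
        (p.2 α + 1) • f p.1 (p.2 + Finsupp.single α 1) := by
  rw [← Finset.HasAntidiagonal.map_swap_antidiagonal, Finset.sum_map, ← Finset.HasAntidiagonal.map_swap_antidiagonal (n := R),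
    Finset.sum_map]
  exact sum_antidiagonal_add_single α R fun Q P => f P Q

/-- The Leibniz rule for `∂_α` on products. The derivative multiplies the coefficient at `R + e` by
`R α + 1`, the total exponent of `θ^α`, and this exponent is distributed over the two factors as `P
α + Q α`. -/
theorem pdFun_conv {V : Type*} [AddCommGroup V] (α : Fin N)
    (B : (Fin N →₀ ℕ) → (Fin N →₀ ℕ) → V)
    (hB : ∀ P Q, ¬ (Adm deg P ∧ Adm deg Q) → B P Q = 0) :
    pdFun deg α (conv deg B) = conv deg (fun P Q => pdFun deg α (fun P => B P Q) P) +
      conv deg (fun P Q => ((1 - deg α) * wt deg P).negOnePow • pdFun deg α (B P) Q) := by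
  set e : Fin N →₀ ℕ := Finsupp.single α 1 with he
  funext R
  by_cases hR : Adm deg R
  swap
  · have : ¬ Adm deg (R + e) := fun h => hR (h.of_le deg (by simp))
    simp [pdFun, conv, hR, this, ← he]
  have h1 : conv deg (fun P Q => pdFun deg α (fun P => B P Q) P) R =
      ∑ p ∈ Finset.HasAntidiagonal.antidiagonal (R + e),
        p.1 α • (mulSign deg e R • mulSign deg p.1 p.2 • B p.1 p.2) := by
    rw [sum_antidiagonal_add_single α R
      (fun P Q => mulSign deg e R • mulSign deg P Q • B P Q)]
    simp only [conv, hR, if_true, pdFun]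
    refine Finset.sum_congr rfl fun p hp => ?_
    rw [← Finset.HasAntidiagonal.mem_antidiagonal.1 hp, smul_comm (p.1 α + 1),
      smul_comm (p.1 α + 1), smul_smul, smul_smul, mulSign_add_left, mulSign_add_right]
    congr 1
    rw [mul_comm (mulSign deg p.1 p.2) (mulSign deg _ p.2), mul_assoc, ← mul_assoc _ _ (mulSign deg p.1 p.2),
      Int.units_mul_self, one_mul, mul_comm]
  have h2 : conv deg (fun P Q => ((1 - deg α) * wt deg P).negOnePow • pdFun deg α (B P) Q) R =
      ∑ p ∈ Finset.HasAntidiagonal.antidiagonal (R + e), p.2 α • (((1 - deg α) * p.1 α).negOnePow •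
        mulSign deg e R • mulSign deg p.1 p.2 • B p.1 p.2) := by
    rw [sum_antidiagonal_add_single' α R (fun P Q => ((1 - deg α) * P α).negOnePow •
      mulSign deg e R • mulSign deg P Q • B P Q)]
    simp only [conv, hR, if_true, pdFun]
    refine Finset.sum_congr rfl fun p hp => ?_
    rw [← Finset.HasAntidiagonal.mem_antidiagonal.1 hp]
    simp only [smul_comm (p.2 α + 1)]
    simp only [smul_smul]
    congr 1
    have hsw := mulSign_mul_swap deg p.1 e
    rw [Finset.sum_eq_single α (by simp +contextual [he, eq_comm]) (by simp),
      he, wt_single, Finsupp.single_eq_same, ← he] at hsw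
    -- The Koszul sign for moving `∂_α` past `θ^P` differs from the ratio of the two ordering signs
    -- only by the diagonal term `(1 - deg α) P α`.
    have hsw' : ((1 - deg α) * wt deg p.1).negOnePow = ((1 - deg α) * p.1 α).negOnePow *
        (mulSign deg p.1 e * mulSign deg e p.1) := by
      rw [hsw, ← Int.negOnePow_add, Int.negOnePow_congr]
      push_cast
      grind
    rw [hsw', mulSign_add_right, mulSign_add_right, ← he]
    ac_rfl
  rw [Pi.add_apply, h1, h2, ← Finset.sum_add_distrib]
  -- For even `θ^α` the weights `P α` and `Q α` simply add up to `R α + 1`. For odd `θ^α` (that is,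
  -- `deg α` even) the exponents are at most 1 and the cases are examined one by one.
  have key : ∀ p ∈ Finset.HasAntidiagonal.antidiagonal (R + e),
      p.1 α • (mulSign deg e R • mulSign deg p.1 p.2 • B p.1 p.2) +
      p.2 α • (((1 - deg α) * p.1 α).negOnePow • mulSign deg e R • mulSign deg p.1 p.2 • B p.1 p.2) =
      mulSign deg e R • (R α + 1) • (open Classical in if Adm deg (R + e) then
        mulSign deg p.1 p.2 • B p.1 p.2 else 0) := by
    intro p hp
    have hs : p.1 α + p.2 α = R α + 1 := by
      have := DFunLike.congr_fun (Finset.HasAntidiagonal.mem_antidiagonal.1 hp) α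
      simpa [he] using this
    by_cases hPQ : Adm deg p.1 ∧ Adm deg p.2
    swap
    · simp [hB _ _ hPQ]
    by_cases hα : Even (deg α)
    · have hP := hPQ.1 α hα
      have hQ := hPQ.2 α hα
      have hRα := hR α hα
      by_cases hR0 : R α = 0
      · have : Adm deg (R + e) := fun β hβ => by
          by_cases hβα : β = α
          · subst hβα; simp [he, hR0]
          · simpa [he, Finsupp.single_apply, Ne.symm hβα] using hR β hβ
        rw [if_pos this, hR0]
        rcases Nat.le_one_iff_eq_zero_or_eq_one.1 hP with h0 | h0
        · have hQ1 : p.2 α = 1 := by omega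
          simp [h0, hQ1]
        · have hQ1 : p.2 α = 0 := by omega
          simp [h0, hQ1]
      -- Both factors contain the odd letter: the two Leibniz terms have opposite signs and cancel,
      -- in accordance with `θ^α θ^α = 0`.
      · have hP1 : p.1 α = 1 := by omega
        have hQ1 : p.2 α = 1 := by omega
        have : ¬ Adm deg (R + e) := fun h => by
          have := h α hα
          simp [he] at this
          omega
        have hodd : ((1 - deg α) * ((1 : ℕ) : ℤ)).negOnePow = -1 :=
          Int.negOnePow_odd _ (by simpa using Int.odd_sub.2 (by simp [hα]))
        rw [if_neg this, hP1, hQ1, hodd]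
        simp
    · have : Adm deg (R + e) := fun β hβ => by
          have hβα : β ≠ α := by rintro rfl; exact hα hβ
          simpa [he, Finsupp.single_apply, Ne.symm hβα] using hR β hβ
      have hev : ((1 - deg α) * (p.1 α : ℤ)).negOnePow = 1 :=
        Int.negOnePow_even _ (Even.mul_right (by
          rw [Int.even_sub]; simpa using hα) _)
      rw [if_pos this, hev, one_smul, ← add_smul, hs, smul_comm]
  rw [Finset.sum_congr rfl key, ← Finset.smul_sum, ← Finset.smul_sum]
  simp only [pdFun, conv]
  split_ifs <;> simp [he]

/-- For `α ≠ β` the sign is that of exchanging the two letters. For `α = β` odd both sides vanish,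
since no admissible monomial contains the square of an odd letter; this is where the support
condition enters. -/
theorem pdFun_pdFun {V : Type*} [AddCommGroup V] (α β : Fin N) (x : (Fin N →₀ ℕ) → V)
    (hx : ∀ R, ¬ Adm deg R → x R = 0) :
    pdFun deg α (pdFun deg β x) =
      ((1 - deg α) * (1 - deg β)).negOnePow • pdFun deg β (pdFun deg α x) := by
  funext R
  simp only [pdFun, Pi.smul_apply, mulSign_add_right]
  have hcomm : R + Finsupp.single α 1 + Finsupp.single β 1 =
    R + Finsupp.single β 1 + Finsupp.single α 1 := add_right_comm _ _ _
  by_cases h : α = β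
  · subst h
    by_cases hα : Even (deg α)
    · have : ¬ Adm deg (R + Finsupp.single α 1 + Finsupp.single α 1) := fun h => by
        have := h α hα
        simp at this
      simp [hx _ this]
    · have : ((1 - deg α) * (1 - deg α)).negOnePow = 1 :=
        Int.negOnePow_even _ (Even.mul_right (by rw [Int.even_sub]; simpa using hα) _)
      rw [this, one_smul]
  · have h1 := mulSign_mul_swap deg (Finsupp.single α 1) (Finsupp.single β 1)
    rw [Finset.sum_eq_zero (fun γ _ => by
      by_cases hγ : γ = α
      · subst hγ; simp [Ne.symm h]
      · simp [Ne.symm hγ]), add_zero, wt_single, wt_single] at h1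
    rw [hcomm, ← h1]
    simp only [Finsupp.add_apply, Finsupp.single_apply, h, Ne.symm h, if_false, add_zero]
    set X := x (R + Finsupp.single β 1 + Finsupp.single α 1)
    set u := mulSign deg (Finsupp.single α 1) (Finsupp.single β 1)
    set u' := mulSign deg (Finsupp.single β 1) (Finsupp.single α 1)
    set a := mulSign deg (Finsupp.single α 1) R
    set b := mulSign deg (Finsupp.single β 1) R
    rw [smul_comm (R α + 1) (b * u'), smul_comm (R β + 1) (a * u), smul_comm (R β + 1) (R α + 1),
      smul_smul a, smul_smul b, smul_smul (u * u')]
    congr 1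
    calc a * (b * u') = (u * u) * (a * (b * u')) := by rw [Int.units_mul_self, one_mul]
      _ = _ := by ac_rfl

end CE


/-! ### Series as graded modules: derivatives, constant terms, the action -/

namespace CE

variable {K : Type u} [Field K] {N : ℕ} (deg : Fin N → ℤ)

section Basic

variable {deg} {U V W : GrSp K}

@[ext] theorem gr_ext {x y : gr deg V} (h : ∀ R, x.1 R = y.1 R) : x = y :=
  Subtype.ext (funext h)

theorem coeff_eq_zero (x : gr deg V) {R : Fin N →₀ ℕ} (h : ¬ Adm deg R) : x.1 R = 0 := by
  induction x using GrSp.induction_on with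
  | hom p x hx => exact (hx R).2 h
  | add x y hx hy => exact (congrArg₂ (· + ·) hx hy).trans (add_zero _)

theorem coe_add (x y : gr deg V) (R : Fin N →₀ ℕ) : (x + y).1 R = x.1 R + y.1 R := rfl

theorem coe_smul (c : K) (x : gr deg V) (R : Fin N →₀ ℕ) : (c • x).1 R = c • x.1 R := rfl

theorem coe_zero (R : Fin N →₀ ℕ) : (0 : gr deg V).1 R = 0 := rfl

theorem coe_units_smul (c : ℤˣ) (x : gr deg V) (R : Fin N →₀ ℕ) : (c • x).1 R = c • x.1 R := rfl

/-- The linear map on series that is given by a homogeneous linear map on families of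
coefficients. -/
def mkHom (n : ℤ) (Φ : ((Fin N →₀ ℕ) → U) →ₗ[K] ((Fin N →₀ ℕ) → V))
    (h : ∀ m, ∀ x ∈ piece deg U m, Φ x ∈ piece deg V (m + n)) : gr deg U →ₗ[K] gr deg V :=
  LinearMap.codRestrict (total deg V) (Φ ∘ₗ (total deg U).subtype) fun x => by
    induction x using GrSp.induction_on (gr deg U) with
    | hom p x hx => exact Submodule.mem_iSup_of_mem _ (h p _ hx)
    | add x y hx hy => rw [map_add]; exact Submodule.add_mem _ hx hy

theorem mkHom_mem {n : ℤ} {Φ : ((Fin N →₀ ℕ) → U) →ₗ[K] ((Fin N →₀ ℕ) → V)}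
    (h : ∀ m, ∀ x ∈ piece deg U m, Φ x ∈ piece deg V (m + n)) :
    mkHom n Φ h ∈ GrSp.mapDeg (gr deg U) (gr deg V) n := fun m _ hx => h m _ hx

end Basic

/-- The partial derivative with respect to `θ^α` on series with coefficients in `V`. -/
def pd (V : GrSp K) (α : Fin N) : gr deg V →ₗ[K] gr deg V :=
  mkHom (deg := deg) (-(1 - deg α))
    { toFun := pdFun deg α
      map_add' := fun x y => by funext R; simp [pdFun]
      map_smul' := fun c x => by
        funext R
        simp only [pdFun, Pi.smul_apply, RingHom.id_apply]
        rw [smul_comm (R α + 1) c, smul_comm _ c] }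
    fun m _ hx R => by
      refine ⟨Submodule.units_int_smul_mem _ _ ((V.gr _).nsmul_mem (GrSp.gr_congr V ?_ (hx _).1) _),
        fun hR => ?_⟩
      · rw [wt_add, wt_single]; ring
      · have : ¬ Adm deg (R + Finsupp.single α 1) := fun h => hR (h.of_le deg (by simp))
        simp [pdFun, (hx _).2 this]

theorem pd_coe (V : GrSp K) (α : Fin N) (x : gr deg V) : (pd deg V α x).1 = pdFun deg α x.1 := rfl

theorem pd_mem (V : GrSp K) (α : Fin N) :
    pd deg V α ∈ GrSp.mapDeg (gr deg V) (gr deg V) (-(1 - deg α)) := mkHom_mem _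

theorem pd_mem_gr (V : GrSp K) (α : Fin N) {m : ℤ} {x : gr deg V} (hx : x ∈ (gr deg V).gr m) :
    pd deg V α x ∈ (gr deg V).gr (m - (1 - deg α)) :=
  GrSp.gr_congr _ (by ring) (pd_mem deg V α m x hx)

theorem pd_pd (V : GrSp K) (α β : Fin N) (x : gr deg V) : pd deg V α (pd deg V β x) =
    ((1 - deg α) * (1 - deg β)).negOnePow • pd deg V β (pd deg V α x) :=
  Subtype.ext (pdFun_pdFun deg α β x.1 fun _ h => coeff_eq_zero x h)

/-- The constant coefficient. -/
def const (V : GrSp K) : gr deg V →ₗ[K] V := LinearMap.proj 0 ∘ₗ (total deg V).subtype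

theorem const_apply (V : GrSp K) (x : gr deg V) : const deg V x = x.1 0 := rfl

theorem const_mem (V : GrSp K) {m : ℤ} {x : gr deg V} (hx : x ∈ (gr deg V).gr m) :
    const deg V x ∈ V.gr m := by
  have := (hx 0).1
  rw [wt_zero, sub_zero] at this
  exact this

theorem gen_coe (V : GrSp K) (v : V) : (gen deg V v).1 = Pi.single 0 v := rfl

theorem const_gen (V : GrSp K) (v : V) : const deg V (gen deg V v) = v := by
  rw [const_apply, gen_coe, Pi.single_eq_same]

theorem gen_mem (V : GrSp K) {p : ℤ} {v : V} (hv : v ∈ V.gr p) :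
    gen deg V v ∈ (gr deg V).gr p := by
  have := single_mem_piece deg V (adm_zero deg) hv
  rwa [wt_zero, add_zero] at this

theorem pd_gen (V : GrSp K) (α : Fin N) (v : V) : pd deg V α (gen deg V v) = 0 := by
  ext R
  have : R + Finsupp.single α 1 ≠ 0 := fun h => by
    have := DFunLike.congr_fun h α
    simp at this
  rw [pd_coe, pdFun, gen_coe, coe_zero, Pi.single_eq_of_ne this, smul_zero, smul_zero]

theorem act_coe (V : GrSp K) (a : gr deg (GrSp.ground K)) (x : gr deg V) :
    (act deg V a x).1 = conv deg fun P Q => (a.1 P : K) • x.1 Q := rfl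

theorem act_mem (V : GrSp K) {p q : ℤ} {a : gr deg (GrSp.ground K)} {x : gr deg V}
    (ha : a ∈ (gr deg (GrSp.ground K)).gr p) (hx : x ∈ (gr deg V).gr q) :
    act deg V a x ∈ (gr deg V).gr (p + q) :=
  mulFun_mem_piece deg V ha hx

theorem units_smul_act (V : GrSp K) (c : ℤˣ) (a : gr deg (GrSp.ground K)) (x : gr deg V) :
    act deg V (c • a) x = c • act deg V a x := by
  exact LinearMap.congr_fun (LinearMap.map_units_int_smul (K := K) (V := gr deg (GrSp.ground K))
    (W := gr deg V →ₗ[K] gr deg V) (act deg V) c a) x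

theorem act_units_smul (V : GrSp K) (c : ℤˣ) (a : gr deg (GrSp.ground K)) (x : gr deg V) :
    act deg V a (c • x) = c • act deg V a x := LinearMap.map_units_int_smul _ _ _

theorem const_act (V : GrSp K) (a : gr deg (GrSp.ground K)) (x : gr deg V) :
    const deg V (act deg V a x) = (const deg (GrSp.ground K) a : K) • const deg V x := by
  rw [const_apply, act_coe, conv_zero_apply]; rfl

/-- In `pdFun_conv` the sign of the second term depends on `wt P`. The coefficient `a_P` is a scalar
of degree 0, so it vanishes unless `wt P = p`, and the sign may be taken out as that of `a`. -/
theorem pd_act (V : GrSp K) (α : Fin N) {p : ℤ} {a : gr deg (GrSp.ground K)}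
    (ha : a ∈ (gr deg (GrSp.ground K)).gr p) (x : gr deg V) :
    pd deg V α (act deg V a x) = act deg V (pd deg _ α a) x +
      ((1 - deg α) * p).negOnePow • act deg V a (pd deg V α x) := by
  ext R
  rw [pd_coe, act_coe, pdFun_conv, coe_add, coe_units_smul, act_coe, act_coe, Pi.add_apply]
  · refine congrArg₂ (· + ·) ?_ ?_
    · refine congrFun (congrArg (conv deg) (funext fun P => funext fun Q => ?_)) R
      rw [pd_coe]
      simp only [pdFun]
      rw [smul_assoc, smul_assoc]
    · rw [conv, conv]
      split_ifs with hR
      · rw [Finset.smul_sum]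
        refine Finset.sum_congr rfl fun s _ => ?_
        by_cases h0 : p - wt deg s.1 = 0
        · rw [smul_comm _ (mulSign deg s.1 s.2), show wt deg s.1 = p by omega, pd_coe]
          simp only [pdFun]
          rw [smul_comm (a.1 s.1 : K) (mulSign _ _ _), smul_comm (a.1 s.1 : K) (s.2 α + 1)]
        · have h3 : (a.1 s.1 : K) = 0 := by simpa [h0] using (ha s.1).1
          simp [h3, pdFun]
      · simp
  · intro P Q h
    rw [not_and_or] at h
    rcases h with h | h
    · rw [coeff_eq_zero a h]; exact zero_smul K _
    · rw [coeff_eq_zero x h, smul_zero]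

theorem act_gen_coe (V : GrSp K) (a : gr deg (GrSp.ground K)) (v : V) (R : Fin N →₀ ℕ) :
    (act deg V a (gen deg V v)).1 R = (a.1 R : K) • v := by
  by_cases h : Adm deg R
  · rw [act_coe, conv, if_pos h, Finset.sum_eq_single (R, 0)]
    · rw [mulSign_zero_right, one_smul, gen_coe, Pi.single_eq_same]
    · intro p hp hne
      have : p.2 ≠ 0 := fun h0 => hne (by
        have := Finset.HasAntidiagonal.mem_antidiagonal.1 hp
        rw [h0, add_zero] at this
        exact Prod.ext this h0)
      rw [gen_coe, Pi.single_eq_of_ne this, smul_zero, smul_zero]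
    · simp
  · rw [coeff_eq_zero _ h, coeff_eq_zero a h]
    exact (zero_smul K v).symm

theorem act_one_right (a : gr deg (GrSp.ground K)) :
    act deg (GrSp.ground K) a (gen deg (GrSp.ground K) (1 : K)) = a := by
  ext R
  rw [act_gen_coe]
  exact mul_one (a.1 R : K)

theorem one_mem : gen deg (GrSp.ground K) (1 : K) ∈ (gr deg (GrSp.ground K)).gr 0 :=
  gen_mem deg _ (GrSp.ground_mem 1)

section CharZero

variable [CharZero K]

/-- The coefficient at `θ^R` is obtained from the constant term of an iterated derivative by
dividing by a sign and a product of positive integers; the latter is possible in characteristic 0.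
-/
theorem eq_zero_of_pd {V : GrSp K} (W : Submodule K (gr deg V)) (h0 : ∀ x ∈ W, const deg V x = 0)
    (h1 : ∀ α, ∀ x ∈ W, pd deg V α x ∈ W) : ∀ x ∈ W, x = 0 := by
  have key : ∀ n (R : Fin N →₀ ℕ), R.degree = n → ∀ x ∈ W, x.1 R = 0 := by
    intro n
    induction n with
    | zero =>
      intro R hR x hx
      rw [(Finsupp.degree_eq_zero_iff R).1 hR]
      exact h0 x hx
    | succ n ih =>
      intro R hR x hx
      obtain ⟨α, hα⟩ : ∃ α, R α ≠ 0 := by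
        by_contra h
        push Not at h
        rw [show R = 0 from Finsupp.ext h] at hR
        simp at hR
      have hle : Finsupp.single α 1 ≤ R := by rw [Finsupp.single_le_iff]; omega
      obtain ⟨S, rfl⟩ := exists_add_of_le hle
      rw [add_comm] at hR ⊢
      have hS : S.degree = n := by simpa using hR
      have := ih S hS _ (h1 α x hx)
      rw [pd_coe, pdFun, smul_eq_zero_iff_eq, ← Nat.cast_smul_eq_nsmul K, smul_eq_zero] at this
      exact this.resolve_left (by exact_mod_cast Nat.succ_ne_zero (S α))
  intro x hx
  ext R
  exact key _ R rfl x hx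

/-- Two families of series, closed under derivatives up to linear combinations, agree. -/
theorem eq_zero_of_pd_span {V : GrSp K} (S : Set (gr deg V)) (h0 : ∀ x ∈ S, const deg V x = 0)
    (h1 : ∀ α, ∀ x ∈ S, pd deg V α x ∈ Submodule.span K S) : ∀ x ∈ S, x = 0 := by
  refine fun x hx => eq_zero_of_pd deg (Submodule.span K S) ?_ ?_ x (Submodule.subset_span hx)
  · intro x hx
    exact (Submodule.span_le (p := LinearMap.ker (const deg V))).2 (fun y hy => h0 y hy) hx
  · intro α x hx
    exact (Submodule.span_le (p := (Submodule.span K S).comap (pd deg V α))).2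
      (fun y hy => h1 α y hy) hx

/-- Consider the defects of the identity for all homogeneous pairs at once. By the Leibniz rule a
derivative of a defect is a combination of defects of differentiated pairs, and all constant terms
vanish, so `eq_zero_of_pd_span` applies. The same pattern proves associativity, the unit law, the
linearity of extensions and the linearity of products. -/
theorem act_comm (p q : ℤ) {a b : gr deg (GrSp.ground K)}
    (ha : a ∈ (gr deg (GrSp.ground K)).gr p) (hb : b ∈ (gr deg (GrSp.ground K)).gr q) :
    act deg (GrSp.ground K) a b = (p * q).negOnePow • act deg (GrSp.ground K) b a := by
  rw [← sub_eq_zero]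
  let S : Set (gr deg (GrSp.ground K)) := {x | ∃ p q : ℤ, ∃ a ∈ (gr deg (GrSp.ground K)).gr p,
    ∃ b ∈ (gr deg (GrSp.ground K)).gr q, act deg (GrSp.ground K) a b -
      (p * q).negOnePow • act deg (GrSp.ground K) b a = x}
  refine eq_zero_of_pd_span deg S ?_ ?_ _ ⟨p, q, a, ha, b, hb, rfl⟩
  · rintro _ ⟨p, q, a, ha, b, hb, rfl⟩
    rw [map_sub, LinearMap.map_units_int_smul, const_act, const_act]
    -- The constant term of `a` lies in `K`, which is concentrated in degree 0: either it vanishes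
    -- or the sign is trivial.
    by_cases hp : p = 0
    · subst hp
      rw [zero_mul, Int.negOnePow_zero, one_smul, sub_eq_zero]
      exact mul_comm (const deg _ a : K) (const deg _ b)
    · have : const deg _ a = 0 := GrSp.ground_gr hp (const_mem deg _ ha)
      rw [this, smul_zero, smul_zero, sub_zero]
      exact zero_smul K _
  · rintro α _ ⟨p, q, a, ha, b, hb, rfl⟩
    rw [map_sub, LinearMap.map_units_int_smul, pd_act deg _ α ha, pd_act deg _ α hb]
    have h1 := Submodule.subset_span (R := K) (s := S)
      ⟨p - (1 - deg α), q, pd deg _ α a, pd_mem_gr deg _ α ha, b, hb, rfl⟩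
    have h2 := Submodule.subset_span (R := K) (s := S)
      ⟨p, q - (1 - deg α), a, ha, pd deg _ α b, pd_mem_gr deg _ α hb, rfl⟩
    convert Submodule.add_mem _ h1
      (Submodule.units_int_smul_mem _ (((1 - deg α) * p).negOnePow) h2) using 1
    simp only [smul_add, smul_sub, smul_smul, ← Int.negOnePow_add]
    rw [Int.negOnePow_congr (show ((p * q + (1 - deg α) * q : ℤ) : ZMod 2) =
      (((p - (1 - deg α)) * q : ℤ) : ZMod 2) by push_cast; grind),
      Int.negOnePow_congr (show (((1 - deg α) * p + p * (q - (1 - deg α)) : ℤ) : ZMod 2) =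
      ((p * q : ℤ) : ZMod 2) by push_cast; ring)]
    abel

theorem act_act (V : GrSp K) (a b : gr deg (GrSp.ground K)) (x : gr deg V) :
    act deg V (act deg (GrSp.ground K) a b) x = act deg V a (act deg V b x) := by
  induction a using GrSp.induction_on with
  | add a a' h h' => simp only [map_add, LinearMap.add_apply, h, h']
  | hom p a ha =>
  induction b using GrSp.induction_on with
  | add a a' h h' => simp only [map_add, LinearMap.add_apply, h, h']
  | hom q b hb =>
  rw [← sub_eq_zero]
  let S : Set (gr deg V) := {y | ∃ p q : ℤ, ∃ a ∈ (gr deg (GrSp.ground K)).gr p,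
    ∃ b ∈ (gr deg (GrSp.ground K)).gr q, ∃ x, act deg V (act deg (GrSp.ground K) a b) x -
      act deg V a (act deg V b x) = y}
  refine eq_zero_of_pd_span deg S ?_ ?_ _ ⟨p, q, a, ha, b, hb, x, rfl⟩
  · rintro _ ⟨p, q, a, ha, b, hb, x, rfl⟩
    rw [map_sub, const_act, const_act, const_act, const_act, sub_eq_zero]
    exact mul_smul (const deg _ a : K) (const deg _ b) _
  · rintro α _ ⟨p, q, a, ha, b, hb, x, rfl⟩
    rw [map_sub, pd_act deg _ α (act_mem deg _ ha hb), pd_act deg _ α ha, pd_act deg _ α ha,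
      pd_act deg _ α hb]
    have h1 := Submodule.subset_span (R := K) (s := S)
      ⟨p - (1 - deg α), q, pd deg _ α a, pd_mem_gr deg _ α ha, b, hb, x, rfl⟩
    have h2 := Submodule.subset_span (R := K) (s := S)
      ⟨p, q - (1 - deg α), a, ha, pd deg _ α b, pd_mem_gr deg _ α hb, x, rfl⟩
    have h3 := Submodule.subset_span (R := K) (s := S)
      ⟨p, q, a, ha, b, hb, pd deg _ α x, rfl⟩
    convert Submodule.add_mem _ (Submodule.add_mem _ h1
      (Submodule.units_int_smul_mem _ (((1 - deg α) * p).negOnePow) h2))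
      (Submodule.units_int_smul_mem _ (((1 - deg α) * (p + q)).negOnePow) h3) using 1
    simp only [map_add, LinearMap.add_apply, LinearMap.map_units_int_smul, smul_add, smul_sub, smul_smul, ← Int.negOnePow_add, ← mul_add]
    rw [units_smul_act]
    abel

theorem one_act (V : GrSp K) (x : gr deg V) :
    act deg V (gen deg (GrSp.ground K) (1 : K)) x = x := by
  rw [← sub_eq_zero]
  refine eq_zero_of_pd_span deg {y | ∃ x, act deg V (gen deg (GrSp.ground K) (1 : K)) x - x = y}
    ?_ ?_ _ ⟨x, rfl⟩
  · rintro _ ⟨x, rfl⟩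
    rw [map_sub, const_act, const_gen, sub_eq_zero]
    exact one_smul K _
  · rintro α _ ⟨x, rfl⟩
    rw [map_sub, pd_act deg _ α (one_mem deg), pd_gen, map_zero, LinearMap.zero_apply, zero_add,
      mul_zero, Int.negOnePow_zero, one_smul]
    exact Submodule.subset_span ⟨_, rfl⟩

end CharZero
end CE


/-! ### Generators, Euler's identity and linear extension -/

namespace CE

variable {K : Type u} [Field K] {N : ℕ} (deg : Fin N → ℤ)

theorem theta_mem (α : Fin N) : theta (K := K) deg α ∈ (gr deg (GrSp.ground K)).gr (1 - deg α) := by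
  have : Adm deg (Finsupp.single α 1) := fun β _ => by
    rw [Finsupp.single_apply]; split_ifs <;> simp
  have := single_mem_piece deg (GrSp.ground K) this (GrSp.ground_mem (1 : K))
  rw [wt_single, zero_add] at this
  exact this

theorem theta_coe (α : Fin N) : (theta (K := K) deg α).1 = Pi.single (Finsupp.single α 1) (1 : K) :=
  rfl

theorem act_theta_coe (V : GrSp K) (α : Fin N) (x : gr deg V) {R : Fin N →₀ ℕ}
    (hR : Adm deg (R + Finsupp.single α 1)) :
    (act deg V (theta deg α) x).1 (R + Finsupp.single α 1) =
      mulSign deg (Finsupp.single α 1) R • x.1 R := by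
  rw [act_coe, conv, if_pos hR, Finset.sum_eq_single (Finsupp.single α 1, R)]
  · rw [theta_coe, Pi.single_eq_same]
    exact congrArg _ (one_smul K _)
  · intro p hp hne
    have : p.1 ≠ Finsupp.single α 1 := fun h0 => hne (by
      have := Finset.HasAntidiagonal.mem_antidiagonal.1 hp
      rw [h0, add_comm] at this
      exact Prod.ext h0 (add_right_cancel this))
    rw [theta_coe, Pi.single_eq_of_ne this]
    exact (congrArg _ (zero_smul K _)).trans (smul_zero _)
  · intro h
    exact absurd (Finset.HasAntidiagonal.mem_antidiagonal.2 (add_comm _ _)) h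

theorem act_theta_coe_of_eq_zero (V : GrSp K) (α : Fin N) (x : gr deg V) {R : Fin N →₀ ℕ}
    (hR : R α = 0) : (act deg V (theta deg α) x).1 R = 0 := by
  rw [act_coe, conv]
  split_ifs
  · refine Finset.sum_eq_zero fun p hp => ?_
    have : p.1 ≠ Finsupp.single α 1 := fun h0 => by
      have := DFunLike.congr_fun (Finset.HasAntidiagonal.mem_antidiagonal.1 hp) α
      rw [h0, Finsupp.add_apply, Finsupp.single_eq_same, hR] at this
      omega
    rw [theta_coe, Pi.single_eq_of_ne this]
    exact (congrArg _ (zero_smul K _)).trans (smul_zero _)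
  · rfl

theorem const_act_theta (V : GrSp K) (α : Fin N) (x : gr deg V) :
    const deg V (act deg V (theta deg α) x) = 0 :=
  act_theta_coe_of_eq_zero deg V α x rfl

/-- The summand for `β` multiplies the coefficient at `θ^R` by `R β`, because the sign from
differentiating is undone by multiplying back. -/
theorem euler (V : GrSp K) (x : gr deg V) (R : Fin N →₀ ℕ) :
    (∑ β, act deg V (theta deg β) (pd deg V β x)).1 R = (R.degree : K) • x.1 R := by
  have hs : ∀ f : Fin N → gr deg V, (∑ β, f β).1 R = ∑ β, (f β).1 R := fun f => by
    rw [← Finset.sum_apply]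
    exact congrFun (map_sum (total deg V).subtype f Finset.univ) R
  rw [hs, Finsupp.degree_eq_sum, Nat.cast_sum, Finset.sum_smul]
  refine Finset.sum_congr rfl fun β _ => ?_
  by_cases hR : R β = 0
  · rw [act_theta_coe_of_eq_zero deg V β _ hR, hR, Nat.cast_zero, zero_smul]
  · have hle : Finsupp.single β 1 ≤ R := by rw [Finsupp.single_le_iff]; omega
    obtain ⟨S, rfl⟩ := exists_add_of_le hle
    rw [add_comm]
    by_cases hA : Adm deg (S + Finsupp.single β 1)
    · rw [act_theta_coe deg V β _ hA, pd_coe, pdFun, smul_smul, Int.units_mul_self, one_smul,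
        Nat.cast_smul_eq_nsmul, Finsupp.add_apply, Finsupp.single_eq_same]
    · rw [coeff_eq_zero _ hA, coeff_eq_zero _ hA, smul_zero]

/-- Divide the coefficient at each `θ^R` by `R.degree` and apply Euler's identity: this reproduces
every coefficient but the constant one. -/
theorem exists_eq_gen_add [CharZero K] (V : GrSp K) (x : gr deg V) :
    ∃ y : Fin N → gr deg V, x = gen deg V (const deg V x) + ∑ β, act deg V (theta deg β) (y β) := by
  -- At `R = 0` the inverse of `0` is `0` by convention, so the constant coefficient is dropped.
  let D : gr deg V →ₗ[K] gr deg V := mkHom (deg := deg) 0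
    { toFun := fun x R => (R.degree : K)⁻¹ • x R
      map_add' := fun x y => by funext R; simp
      map_smul' := fun c x => by funext R; simp [smul_comm c] }
    fun m x hx R => ⟨(V.gr _).smul_mem _ (by rw [add_zero]; exact (hx R).1),
      fun hR => by simp [(hx R).2 hR]⟩
  have hD : ∀ x R, (D x).1 R = (R.degree : K)⁻¹ • x.1 R := fun x R => rfl
  refine ⟨fun β => pd deg V β (D x), ?_⟩
  ext R
  rw [coe_add, euler, hD, gen_coe]
  by_cases hR : R = 0
  · subst hR
    rw [Pi.single_eq_same, map_zero, Nat.cast_zero, zero_smul, add_zero, const_apply]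
  · rw [Pi.single_eq_of_ne hR, zero_add, smul_smul, mul_inv_cancel₀, one_smul]
    exact_mod_cast fun h => hR ((Finsupp.degree_eq_zero_iff R).1 h)

/-- No continuity of `F` is needed. Writing `x` as a generator plus a finite sum `∑ θ^β y_β`, the
coefficient of `F x` at `θ^R` involves only coefficients of the `F y_β` at monomials of smaller
degree, and induction on the degree applies. -/
theorem eq_zero_of_gen [CharZero K] {U V : GrSp K} {F : gr deg U →ₗ[K] gr deg V}
    (h0 : ∀ u, F (gen deg U u) = 0) (c : Fin N → ℤˣ)
    (h1 : ∀ β y, F (act deg U (theta deg β) y) = c β • act deg V (theta deg β) (F y)) : F = 0 := by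
  have key : ∀ n (R : Fin N →₀ ℕ), R.degree = n → ∀ x, (F x).1 R = 0 := by
    intro n
    induction n using Nat.strong_induction_on with
    | _ n ih =>
      intro R hR x
      obtain ⟨y, hy⟩ := exists_eq_gen_add deg U x
      rw [hy, map_add, h0, zero_add, map_sum]
      have hs : ∀ f : Fin N → gr deg V, (∑ β, f β).1 R = ∑ β, (f β).1 R := fun f => by
        rw [← Finset.sum_apply]
        exact congrFun (map_sum (total deg V).subtype f Finset.univ) R
      rw [hs]
      refine Finset.sum_eq_zero fun β _ => ?_
      rw [h1, coe_units_smul]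
      by_cases hβ : R β = 0
      · rw [act_theta_coe_of_eq_zero deg V β _ hβ, smul_zero]
      · have hle : Finsupp.single β 1 ≤ R := by rw [Finsupp.single_le_iff]; omega
        obtain ⟨S, rfl⟩ := exists_add_of_le hle
        rw [add_comm]
        by_cases hA : Adm deg (S + Finsupp.single β 1)
        · have hS : S.degree < n := by rw [← hR, map_add]; simp
          rw [act_theta_coe deg V β _ hA, ih _ hS S rfl, smul_zero, smul_zero]
        · rw [coeff_eq_zero _ hA, smul_zero]
  ext x R
  exact key _ R rfl x

/-- Linear maps of degree `n` over the graded algebra. -/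
def IsLin (U V : GrSp K) (n : ℤ) (F : gr deg U →ₗ[K] gr deg V) : Prop :=
  F ∈ GrSp.mapDeg (gr deg U) (gr deg V) n ∧ ∀ p, ∀ a ∈ (gr deg (GrSp.ground K)).gr p, ∀ x,
    F (act deg U a x) = (n * p).negOnePow • act deg V a (F x)

theorem IsLin.ext_gen [CharZero K] {U V : GrSp K} {n : ℤ} {F G : gr deg U →ₗ[K] gr deg V}
    (hF : IsLin deg U V n F) (hG : IsLin deg U V n G)
    (h : ∀ u, F (gen deg U u) = G (gen deg U u)) : F = G := by
  rw [← sub_eq_zero]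
  refine eq_zero_of_gen deg (fun u => by rw [LinearMap.sub_apply, h, sub_self])
    (fun β => (n * (1 - deg β)).negOnePow) fun β y => ?_
  rw [LinearMap.sub_apply, hF.2 _ _ (theta_mem deg β), hG.2 _ _ (theta_mem deg β),
    LinearMap.sub_apply, map_sub, smul_sub]

/-- The linear extension of `F₀ : U → ∏_i (Sym^i ⊗ V)`, of degree `n`. -/
def ext {U V : GrSp K} (n : ℤ) (F₀ : U →ₗ[K] gr deg V) (h : F₀ ∈ GrSp.mapDeg U (gr deg V) n) :
    gr deg U →ₗ[K] gr deg V :=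
  mkHom (deg := deg) n
    { toFun := fun x => conv deg fun P Q => (n * wt deg P).negOnePow • (F₀ (x P)).1 Q
      map_add' := fun x y => by
        funext R
        simp only [conv, Pi.add_apply]
        split_ifs
        · rw [← Finset.sum_add_distrib]
          refine Finset.sum_congr rfl fun p _ => ?_
          rw [map_add, coe_add, smul_add, smul_add]
        · simp
      map_smul' := fun c x => by
        funext R
        simp only [conv, Pi.smul_apply, RingHom.id_apply]
        split_ifs
        · rw [Finset.smul_sum]
          refine Finset.sum_congr rfl fun p _ => ?_
          rw [map_smul, coe_smul, smul_comm c, smul_comm c]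
        · simp }
    fun m x hx R => by
      refine ⟨?_, fun hR => if_neg hR⟩
      change conv deg (fun P Q => (n * wt deg P).negOnePow • (F₀ (x P)).1 Q) R ∈
        V.gr (m + n - wt deg R)
      rw [conv]
      split_ifs with hR
      · refine Submodule.sum_mem _ fun p hp => Submodule.units_int_smul_mem _ _
          (Submodule.units_int_smul_mem _ _ (GrSp.gr_congr V ?_ (h _ _ (hx p.1).1 p.2).1))
        rw [← Finset.HasAntidiagonal.mem_antidiagonal.1 hp, wt_add]
        ring
      · exact Submodule.zero_mem _

theorem ext_coe {U V : GrSp K} {n : ℤ} {F₀ : U →ₗ[K] gr deg V}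
    (h : F₀ ∈ GrSp.mapDeg U (gr deg V) n) (x : gr deg U) :
    (ext deg n F₀ h x).1 = conv deg fun P Q => (n * wt deg P).negOnePow • (F₀ (x.1 P)).1 Q := rfl

theorem ext_gen {U V : GrSp K} {n : ℤ} {F₀ : U →ₗ[K] gr deg V}
    (h : F₀ ∈ GrSp.mapDeg U (gr deg V) n) (u : U) : ext deg n F₀ h (gen deg U u) = F₀ u := by
  ext R
  rw [ext_coe]
  by_cases hR : Adm deg R
  · rw [conv, if_pos hR, Finset.sum_eq_single (0, R)]
    · rw [mulSign_zero_left, wt_zero, mul_zero, Int.negOnePow_zero, one_smul, one_smul, gen_coe,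
        Pi.single_eq_same]
    · intro p hp hne
      have : p.1 ≠ 0 := fun h0 => hne (by
        have := Finset.HasAntidiagonal.mem_antidiagonal.1 hp
        rw [h0, zero_add] at this
        exact Prod.ext h0 this)
      rw [gen_coe, Pi.single_eq_of_ne this, map_zero, coe_zero, smul_zero, smul_zero]
    · intro h
      exact absurd (Finset.HasAntidiagonal.mem_antidiagonal.2 (zero_add _)) h
  · rw [conv, if_neg hR, coeff_eq_zero _ hR]

theorem const_ext {U V : GrSp K} {n : ℤ} {F₀ : U →ₗ[K] gr deg V}
    (h : F₀ ∈ GrSp.mapDeg U (gr deg V) n) (x : gr deg U) :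
    const deg V (ext deg n F₀ h x) = const deg V (F₀ (const deg U x)) := by
  rw [const_apply, ext_coe, conv_zero_apply, wt_zero, mul_zero, Int.negOnePow_zero, one_smul]
  rfl

theorem pd_comp_mem {U V : GrSp K} {n : ℤ} {F₀ : U →ₗ[K] gr deg V} (α : Fin N)
    (h : F₀ ∈ GrSp.mapDeg U (gr deg V) n) :
    pd deg V α ∘ₗ F₀ ∈ GrSp.mapDeg U (gr deg V) (n - (1 - deg α)) :=
  fun p x hx => GrSp.gr_congr _ (by ring) (pd_mem_gr deg V α (h p x hx))

/-- The Leibniz rule for `∑ θ^P F₀ (x_P)`: either `F₀` is differentiated, which lowers its degree by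
`1 - deg α`, or the series `x` is, which costs the Koszul sign for passing `F₀`. -/
theorem pd_ext {U V : GrSp K} {n : ℤ} {F₀ : U →ₗ[K] gr deg V}
    (h : F₀ ∈ GrSp.mapDeg U (gr deg V) n) (α : Fin N) (x : gr deg U) :
    pd deg V α (ext deg n F₀ h x) = ext deg (n - (1 - deg α)) (pd deg V α ∘ₗ F₀)
      (pd_comp_mem deg α h) x + (n * (1 - deg α)).negOnePow • ext deg n F₀ h (pd deg U α x) := by
  ext R
  rw [pd_coe, ext_coe, pdFun_conv, coe_add, coe_units_smul, ext_coe, ext_coe, Pi.add_apply, add_comm]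
  · refine congrArg₂ (· + ·) ?_ ?_
    · refine congrFun (congrArg (conv deg) (funext fun P => funext fun Q => ?_)) R
      rw [LinearMap.comp_apply, pd_coe]
      simp only [pdFun]
      rw [smul_comm _ (n * wt deg P).negOnePow, smul_comm _ (n * wt deg P).negOnePow, smul_smul,
        ← Int.negOnePow_add, Int.negOnePow_congr]
      push_cast
      grind
    · rw [conv, conv]
      split_ifs with hR
      · rw [Finset.smul_sum]
        refine Finset.sum_congr rfl fun s _ => ?_
        rw [pd_coe, smul_comm _ (mulSign deg s.1 s.2)]
        simp only [pdFun]
        rw [wt_add, wt_single, LinearMap.map_units_int_smul, map_nsmul, coe_units_smul]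
        rw [smul_comm (s.1 α + 1), smul_comm (mulSign deg (Finsupp.single α 1) s.1),
          smul_smul (n * (1 - deg α)).negOnePow, ← Int.negOnePow_add]
        congr 2
        congr 1
        ring
      · simp
  · intro P Q h
    rw [not_and_or] at h
    rcases h with h | h
    · rw [coeff_eq_zero x h, map_zero, coe_zero, smul_zero]
    · rw [coeff_eq_zero _ h, smul_zero]

end CE


/-! ### Linear maps, commutators with derivatives, Taylor coefficients -/

namespace CE

variable {K : Type u} [Field K] {N : ℕ} (deg : Fin N → ℤ)

theorem ext_isLin [CharZero K] {U V : GrSp K} {n : ℤ} {F₀ : U →ₗ[K] gr deg V}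
    (h : F₀ ∈ GrSp.mapDeg U (gr deg V) n) : IsLin deg U V n (ext deg n F₀ h) := by
  refine ⟨mkHom_mem _, fun p a ha x => ?_⟩
  rw [← sub_eq_zero]
  -- The defects have to range over all `n` and `F₀`, since differentiating replaces `F₀` by `∂_α ∘
  -- F₀`.
  let S : Set (gr deg V) := {y | ∃ (n : ℤ) (F₀ : U →ₗ[K] gr deg V)
    (h : F₀ ∈ GrSp.mapDeg U (gr deg V) n) (p : ℤ), ∃ a ∈ (gr deg (GrSp.ground K)).gr p, ∃ x,
    ext deg n F₀ h (act deg U a x) - (n * p).negOnePow • act deg V a (ext deg n F₀ h x) = y}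
  refine eq_zero_of_pd_span deg S ?_ ?_ _ ⟨n, F₀, h, p, a, ha, x, rfl⟩
  · rintro _ ⟨n, F₀, h, p, a, ha, x, rfl⟩
    rw [map_sub, LinearMap.map_units_int_smul, const_ext, const_act, const_act, const_ext,
      map_smul, map_smul]
    by_cases hp : p = 0
    · rw [hp, mul_zero, Int.negOnePow_zero, one_smul, sub_self]
    · rw [GrSp.ground_gr hp (const_mem deg _ ha), zero_smul, smul_zero, sub_zero]
  · rintro α _ ⟨n, F₀, h, p, a, ha, x, rfl⟩
    rw [map_sub, LinearMap.map_units_int_smul, pd_ext, pd_act deg _ α ha, pd_act deg _ α ha, pd_ext]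
    have h1 := Submodule.subset_span (R := K) (s := S)
      ⟨n - (1 - deg α), _, pd_comp_mem deg α h, p, a, ha, x, rfl⟩
    have h2 := Submodule.subset_span (R := K) (s := S)
      ⟨n, _, h, p - (1 - deg α), pd deg _ α a, pd_mem_gr deg _ α ha, x, rfl⟩
    have h3 := Submodule.subset_span (R := K) (s := S)
      ⟨n, _, h, p, a, ha, pd deg _ α x, rfl⟩
    convert Submodule.add_mem _ (Submodule.add_mem _ h1
      (Submodule.units_int_smul_mem _ ((n * (1 - deg α)).negOnePow) h2))
      (Submodule.units_int_smul_mem _ ((n * (1 - deg α) + (1 - deg α) * p).negOnePow) h3) using 1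
    simp only [map_add, LinearMap.map_units_int_smul, smul_add, smul_sub, smul_smul,
      ← Int.negOnePow_add]
    rw [Int.negOnePow_congr (show ((n * (1 - deg α) + n * (p - (1 - deg α)) : ℤ) : ZMod 2) =
        ((n * p : ℤ) : ZMod 2) by push_cast; ring),
      Int.negOnePow_congr (show ((n * (1 - deg α) + (1 - deg α) * p + n * p : ℤ) : ZMod 2) =
        ((n * p + ((1 - deg α) * p + n * (1 - deg α)) : ℤ) : ZMod 2) by push_cast; ring),
      Int.negOnePow_congr (show (((n - (1 - deg α)) * p : ℤ) : ZMod 2) =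
        ((n * p + (1 - deg α) * p : ℤ) : ZMod 2) by push_cast; grind)]
    abel

/-- Graded commutativity makes multiplication by `a` a linear map of degree `|a|`, so the Leibniz
rule for Taylor coefficients of linear maps applies to it too. -/
theorem act_isLin [CharZero K] (V : GrSp K) {p : ℤ} {a : gr deg (GrSp.ground K)}
    (ha : a ∈ (gr deg (GrSp.ground K)).gr p) : IsLin deg V V p (act deg V a) := by
  refine ⟨fun q x hx => GrSp.gr_congr _ (add_comm _ _) (act_mem deg V ha hx), fun q b hb x => ?_⟩
  rw [← act_act, act_comm deg p q ha hb, units_smul_act, act_act]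

variable {deg} in
theorem IsLin.comp {U V W : GrSp K} {m n : ℤ} {G : gr deg V →ₗ[K] gr deg W}
    {F : gr deg U →ₗ[K] gr deg V} (hG : IsLin deg V W m G) (hF : IsLin deg U V n F) :
    IsLin deg U W (m + n) (G ∘ₗ F) := by
  refine ⟨GrSp.comp_mem_mapDeg hG.1 hF.1 rfl, fun p a ha x => ?_⟩
  rw [LinearMap.comp_apply, hF.2 p a ha, LinearMap.map_units_int_smul, hG.2 p a ha]
  exact Int.negOnePow_smul_smul_congr (by push_cast; ring)

/-- The graded commutator of the derivative `∂_α` with a map of degree `n`. -/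
def bracket {U V : GrSp K} (α : Fin N) (n : ℤ) (F : gr deg U →ₗ[K] gr deg V) :
    gr deg U →ₗ[K] gr deg V :=
  pd deg V α ∘ₗ F - (n * (1 - deg α)).negOnePow • (F ∘ₗ pd deg U α)

theorem pd_apply_eq {U V : GrSp K} (α : Fin N) (n : ℤ) (F : gr deg U →ₗ[K] gr deg V)
    (x : gr deg U) : pd deg V α (F x) =
      bracket deg α n F x + (n * (1 - deg α)).negOnePow • F (pd deg U α x) := by
  rw [bracket, LinearMap.sub_apply, LinearMap.units_int_smul_apply, LinearMap.comp_apply,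
    LinearMap.comp_apply, sub_add_cancel]

theorem bracket_gen {U V : GrSp K} (α : Fin N) (n : ℤ) (F : gr deg U →ₗ[K] gr deg V) (u : U) :
    bracket deg α n F (gen deg U u) = pd deg V α (F (gen deg U u)) := by
  rw [pd_apply_eq deg α n, pd_gen, map_zero, smul_zero, add_zero]

variable {deg} in
-- The terms containing `∂_α a` cancel in the graded commutator. On generators the commutator is
-- just the derivative of the value, so it plays the part of differentiating the coefficients of
-- `F`.
theorem IsLin.bracket {U V : GrSp K} {n : ℤ} {F : gr deg U →ₗ[K] gr deg V}
    (hF : IsLin deg U V n F) (α : Fin N) :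
    IsLin deg U V (n - (1 - deg α)) (bracket deg α n F) := by
  refine ⟨Submodule.sub_mem _ (GrSp.comp_mem_mapDeg (pd_mem deg V α) hF.1 (by ring))
    (Submodule.units_int_smul_mem _ _ (GrSp.comp_mem_mapDeg hF.1 (pd_mem deg U α) (by ring))),
    fun p a ha x => ?_⟩
  have hpa := pd_mem_gr deg _ α ha
  rw [CE.bracket, LinearMap.sub_apply, LinearMap.units_int_smul_apply, LinearMap.comp_apply,
    LinearMap.comp_apply, hF.2 p a ha, LinearMap.map_units_int_smul, pd_act deg _ α ha,
    pd_act deg _ α ha, map_add, LinearMap.map_units_int_smul, hF.2 _ _ hpa, hF.2 p a ha,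
    LinearMap.sub_apply, LinearMap.units_int_smul_apply, LinearMap.comp_apply,
    LinearMap.comp_apply, map_sub, act_units_smul]
  simp only [smul_add, smul_sub, smul_smul, ← Int.negOnePow_add]
  rw [Int.negOnePow_congr (show ((n * (1 - deg α) + n * (p - (1 - deg α)) : ℤ) : ZMod 2) =
      ((n * p : ℤ) : ZMod 2) by push_cast; ring),
    Int.negOnePow_congr (show ((n * p + (1 - deg α) * p : ℤ) : ZMod 2) =
      (((n - (1 - deg α)) * p : ℤ) : ZMod 2) by push_cast; grind),
    Int.negOnePow_congr (show ((n * (1 - deg α) + ((1 - deg α) * p + n * p) : ℤ) : ZMod 2) =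
      (((n - (1 - deg α)) * p + n * (1 - deg α) : ℤ) : ZMod 2) by push_cast; grind)]
  abel

/-- The coefficient of the Taylor expansion of a series at a word. -/
def tay (V : GrSp K) : List (Fin N) → gr deg V →ₗ[K] V
  | [] => const deg V
  | α :: w => tay V w ∘ₗ pd deg V α

theorem tay_nil (V : GrSp K) (x : gr deg V) : tay deg V [] x = const deg V x := rfl

theorem tay_cons (V : GrSp K) (α : Fin N) (w : List (Fin N)) (x : gr deg V) :
    tay deg V (α :: w) x = tay deg V w (pd deg V α x) := rfl

theorem tay_mem (V : GrSp K) (w : List (Fin N)) {m : ℤ} {x : gr deg V}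
    (hx : x ∈ (gr deg V).gr m) : tay deg V w x ∈ V.gr (m - (w.map fun α => 1 - deg α).sum) := by
  induction w generalizing m x with
  | nil => exact GrSp.gr_congr _ (by simp) (const_mem deg V hx)
  | cons α w ih =>
    exact GrSp.gr_congr _ (by rw [List.map_cons, List.sum_cons]; ring) (ih (pd_mem_gr deg V α hx))

theorem tay_swap (V : GrSp K) (w₁ w₂ : List (Fin N)) (α β : Fin N) (x : gr deg V) :
    tay deg V (w₁ ++ α :: β :: w₂) x =
      ((1 - deg α) * (1 - deg β)).negOnePow • tay deg V (w₁ ++ β :: α :: w₂) x := by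
  induction w₁ generalizing x with
  | nil =>
    change tay deg V w₂ (pd deg V β (pd deg V α x)) =
      _ • tay deg V w₂ (pd deg V α (pd deg V β x))
    rw [pd_pd deg V β α, LinearMap.map_units_int_smul, mul_comm]
  | cons γ w ih => exact ih _

/-- The intersection of the kernels of all Taylor coefficients is closed under derivatives and
consists of series with vanishing constant term. -/
theorem eq_zero_of_tay [CharZero K] (V : GrSp K) {x : gr deg V} (h : ∀ w, tay deg V w x = 0) :
    x = 0 := by
  refine eq_zero_of_pd deg (⨅ w, LinearMap.ker (tay deg V w)) ?_ ?_ x ?_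
  · intro y hy
    exact (Submodule.mem_iInf _).1 hy []
  · intro α y hy
    exact (Submodule.mem_iInf _).2 fun w => (Submodule.mem_iInf _).1 hy (α :: w)
  · exact (Submodule.mem_iInf _).2 h

theorem eq_of_tay [CharZero K] (V : GrSp K) {x y : gr deg V}
    (h : ∀ w, tay deg V w x = tay deg V w y) : x = y := by
  rw [← sub_eq_zero]
  exact eq_zero_of_tay deg V fun w => by rw [map_sub, h, sub_self]

end CE

/-! ### Sums over shuffles -/

section Split

/-- Splitting subsets by whether they contain `0` is the recursion behind the inductions over
shuffles: the first letter goes to one factor or to the other. -/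
theorem Fin.sum_finset_succ {A : Type*} [AddCommMonoid A] {k : ℕ} (f : Finset (Fin (k + 1)) → A) :
    ∑ S, f S = ∑ T : Finset (Fin k), (f (T.map (Fin.succEmb k)) +
      f (insert 0 (T.map (Fin.succEmb k)))) := by
  have h0 : (0 : Fin (k + 1)) ∉ Finset.univ.map (Fin.succEmb k) := by
    simp [Fin.succ_ne_zero]
  have hu : (Finset.univ : Finset (Fin (k + 1))) =
      insert 0 (Finset.univ.map (Fin.succEmb k)) := by
    ext i
    refine Fin.cases ?_ (fun i => ?_) i <;> simp
  rw [← Finset.powerset_univ, hu, Finset.sum_powerset_insert h0, Finset.sum_add_distrib]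
  have : ∀ g : Finset (Fin (k + 1)) → A, ∑ S ∈ (Finset.univ.map (Fin.succEmb k)).powerset, g S =
      ∑ T : Finset (Fin k), g (T.map (Fin.succEmb k)) := fun g => by
    symm
    refine Finset.sum_bij (fun T _ => T.map (Fin.succEmb k)) ?_ ?_ ?_ (fun _ _ => rfl)
    · intro T _
      exact Finset.mem_powerset.2 (Finset.map_subset_map.2 (Finset.subset_univ T))
    · intro T _ T' _ h
      exact Finset.map_injective _ h
    · intro S hS
      obtain ⟨T, _, rfl⟩ := Finset.subset_map_iff.1 (Finset.mem_powerset.1 hS)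
      exact ⟨T, Finset.mem_univ _, rfl⟩
  rw [this, this]

theorem Fin.compl_map_succ {k : ℕ} (T : Finset (Fin k)) :
    (T.map (Fin.succEmb k))ᶜ = insert 0 (Tᶜ.map (Fin.succEmb k)) := by
  ext i
  refine Fin.cases ?_ (fun i => ?_) i <;> simp [Fin.succ_ne_zero]

theorem Fin.compl_insert_zero {k : ℕ} (T : Finset (Fin k)) :
    (insert 0 (T.map (Fin.succEmb k)))ᶜ = Tᶜ.map (Fin.succEmb k) := by
  ext i
  refine Fin.cases ?_ (fun i => ?_) i <;> simp [Fin.succ_ne_zero]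

theorem ofFn_sub {X : Type*} {k : ℕ} (S : Finset (Fin k)) (x : Fin k → X) :
    List.ofFn (sub S x) = (S.sort).map x := by
  rw [List.ext_get_iff]
  refine ⟨by simp, fun n h1 h2 => ?_⟩
  simp [sub, Finset.orderEmbOfFin_apply]

theorem ofFn_sub_map_succ {X : Type*} {k : ℕ} (T : Finset (Fin k)) (x : Fin (k + 1) → X) :
    List.ofFn (sub (T.map (Fin.succEmb k)) x) = List.ofFn (sub T fun l => x l.succ) := by
  rw [ofFn_sub, ofFn_sub]
  have : (T.map (Fin.succEmb k)).sort = T.sort.map Fin.succ := by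
    refine List.Perm.eq_of_pairwise (le := (· ≤ ·)) (fun a b _ _ => le_antisymm)
      (Finset.pairwise_sort _ _) ?_ ?_
    · rw [List.pairwise_map]
      exact (Finset.pairwise_sort T (· ≤ ·)).imp Fin.succ_le_succ_iff.2
    · rw [List.perm_ext_iff_of_nodup (Finset.sort_nodup _ _)
        ((Finset.sort_nodup _ _).map (Fin.succ_injective k))]
      intro a
      simp
  rw [this, List.map_map]
  rfl

theorem ofFn_sub_insert_zero {X : Type*} {k : ℕ} (T : Finset (Fin k)) (x : Fin (k + 1) → X) :
    List.ofFn (sub (insert 0 (T.map (Fin.succEmb k))) x) =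
      x 0 :: List.ofFn (sub T fun l => x l.succ) := by
  rw [← ofFn_sub_map_succ, ofFn_sub, ofFn_sub, Finset.sort_insert, List.map_cons]
  · intro b _; exact Fin.zero_le b
  · simp [Fin.succ_ne_zero]

/-- The sign in the Leibniz rule for iterated derivatives of degrees `-e 0, -e 1, …` applied to
`G x`, `G` of degree `n`, for the term where the derivatives in `S` act on `G`. -/
def leibnizSign (n : ℤ) {k : ℕ} (e : Fin k → ℤ) (S : Finset (Fin k)) : ℤˣ :=
  (n * ∑ b ∈ Sᶜ, e b + ∑ a ∈ S, ∑ b ∈ Sᶜ, if a < b then e a * e b else 0).negOnePow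

theorem leibnizSign_map_succ (n : ℤ) {k : ℕ} (e : Fin (k + 1) → ℤ) (T : Finset (Fin k)) :
    leibnizSign n e (T.map (Fin.succEmb k)) =
      (n * e 0).negOnePow * leibnizSign n (fun l => e l.succ) T := by
  have h0 : (0 : Fin (k + 1)) ∉ Tᶜ.map (Fin.succEmb k) := by simp [Fin.succ_ne_zero]
  simp only [leibnizSign, Fin.compl_map_succ, Finset.sum_insert h0, Finset.sum_map, Fin.coe_succEmb,
    Fin.not_lt_zero, if_false, zero_add, Fin.succ_lt_succ_iff, ← Int.negOnePow_add]
  congr 1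
  ring

/-- When the first derivative acts on `G`, the degree of `G` drops by `e 0`; this change of `n`
accounts for all pairs `a < b` with `a = 0`. -/
theorem leibnizSign_insert_zero (n : ℤ) {k : ℕ} (e : Fin (k + 1) → ℤ) (T : Finset (Fin k)) :
    leibnizSign n e (insert 0 (T.map (Fin.succEmb k))) =
      leibnizSign (n - e 0) (fun l => e l.succ) T := by
  have h0 : (0 : Fin (k + 1)) ∉ T.map (Fin.succEmb k) := by simp [Fin.succ_ne_zero]
  simp only [leibnizSign, Fin.compl_insert_zero, Finset.sum_insert h0, Finset.sum_map,
    Fin.coe_succEmb, Fin.succ_pos, if_true, Fin.succ_lt_succ_iff, ← Finset.mul_sum]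
  refine Int.negOnePow_congr ?_
  push_cast
  grind

end Split

namespace CE

variable {K : Type u} [Field K] {N : ℕ} (deg : Fin N → ℤ)

/-- A linear map preserves the series of the form `∑ θ^β y_β`, which have no constant term, so the
constant term of `G x` depends on that of `x` alone. -/
theorem IsLin.const_apply [CharZero K] {V W : GrSp K} {n : ℤ} {G : gr deg V →ₗ[K] gr deg W}
    (hG : IsLin deg V W n G) (x : gr deg V) :
    const deg W (G x) = const deg W (G (gen deg V (const deg V x))) := by
  obtain ⟨y, hy⟩ := exists_eq_gen_add deg V x
  conv_lhs => rw [hy]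
  rw [map_add, map_add, add_eq_left, map_sum, map_sum]
  refine Finset.sum_eq_zero fun β _ => ?_
  rw [hG.2 _ _ (theta_mem deg β), LinearMap.map_units_int_smul, const_act_theta, smul_zero]

/-- The Leibniz rule for Taylor coefficients. -/
theorem IsLin.tay_apply [CharZero K] {V W : GrSp K} {n : ℤ} {G : gr deg V →ₗ[K] gr deg W}
    (hG : IsLin deg V W n G) {k : ℕ} (w : Fin k → Fin N) (x : gr deg V) :
    tay deg W (List.ofFn w) (G x) = ∑ S : Finset (Fin k),
      leibnizSign n (fun l => 1 - deg (w l)) S • tay deg W (List.ofFn (sub S w))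
        (G (gen deg V (tay deg V (List.ofFn (sub Sᶜ w)) x))) := by
  induction k generalizing n G x with
  | zero =>
    rw [Fintype.sum_eq_single ∅ fun S hS => absurd (Finset.eq_empty_of_isEmpty S) hS]
    have h : ∀ (j : ℕ) (hj : j = 0) (w : Fin j → Fin N), List.ofFn w = [] := by
      rintro j rfl w; rfl
    have hs : leibnizSign n (fun l => 1 - deg (w l)) ∅ = 1 := by simp [leibnizSign]
    rw [hs, one_smul, h _ rfl w, h _ (by simp) (sub ∅ w), h _ (by simp) (sub ∅ᶜ w), tay_nil,
      tay_nil, tay_nil, hG.const_apply]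
  | succ k ih =>
    -- The first derivative either acts on `G`, giving the commutator and the subsets containing
    -- `0`, or passes `G` and acts on `x`, giving the subsets without `0`.
    rw [Fin.sum_finset_succ, List.ofFn_succ, tay_cons, pd_apply_eq deg (w 0) n G, map_add,
      LinearMap.map_units_int_smul, ih hG, ih (hG.bracket (w 0)), add_comm, Finset.smul_sum,
      ← Finset.sum_add_distrib]
    refine Finset.sum_congr rfl fun T _ => ?_
    rw [leibnizSign_map_succ, leibnizSign_insert_zero, Fin.compl_map_succ, Fin.compl_insert_zero,
      ofFn_sub_map_succ, ofFn_sub_map_succ, ofFn_sub_insert_zero, ofFn_sub_insert_zero, tay_cons,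
      tay_cons, bracket_gen, smul_smul]

end CE


/-! ### Series with prescribed Taylor coefficients -/

namespace CE

variable {K : Type u} [Field K] {N : ℕ} (deg : Fin N → ℤ)

theorem pd_theta_self (α : Fin N) :
    pd deg (GrSp.ground K) α (theta deg α) = gen deg (GrSp.ground K) (1 : K) := by
  ext R
  rw [pd_coe, pdFun, theta_coe, gen_coe]
  by_cases hR : R = 0
  · subst hR
    rw [zero_add, Pi.single_eq_same, Pi.single_eq_same, mulSign_zero_right, one_smul,
      Finsupp.coe_zero, Pi.zero_apply, zero_add, one_smul]
  · rw [Pi.single_eq_of_ne hR, Pi.single_eq_of_ne (by simpa using hR), smul_zero, smul_zero]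

theorem pd_theta_of_ne {α β : Fin N} (h : α ≠ β) :
    pd deg (GrSp.ground K) α (theta deg β) = 0 := by
  ext R
  rw [pd_coe, pdFun, theta_coe, Pi.single_eq_of_ne, smul_zero, smul_zero, coe_zero]
  intro h0
  have := DFunLike.congr_fun h0 α
  rw [Finsupp.add_apply, Finsupp.single_eq_same, Finsupp.single_eq_of_ne h] at this
  omega

/-- The total degree of a word in the generators. -/
def wordDeg (L : List (Fin N)) : ℤ := (L.map fun α => 1 - deg α).sum

@[simp] theorem wordDeg_nil : wordDeg deg [] = 0 := rfl

@[simp] theorem wordDeg_cons (α : Fin N) (L : List (Fin N)) :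
    wordDeg deg (α :: L) = 1 - deg α + wordDeg deg L := rfl

/-- Families indexed by words in the generators that have the symmetry of the Taylor coefficients
of a series. -/
def KoszulSymm {A : Type*} [AddCommGroup A] (φ : List (Fin N) → A) : Prop :=
  ∀ L L' α β, φ (L ++ α :: β :: L') =
    ((1 - deg α) * (1 - deg β)).negOnePow • φ (L ++ β :: α :: L')

variable {deg} in
theorem KoszulSymm.cons {A : Type*} [AddCommGroup A] {φ : List (Fin N) → A}
    (h : KoszulSymm deg φ) (α : Fin N) : KoszulSymm deg fun L => φ (α :: L) :=
  fun L L' β γ => h (α :: L) L' β γ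

/-- `∑ θ^(α_1) ⋯ θ^(α_k) φ (α_1, …, α_k)`. -/
def wordSum (V : GrSp K) (k : ℕ) (φ : List (Fin N) → V) : gr deg V :=
  ∑ w : Fin k → Fin N, act deg V (thetaWord deg (List.ofFn w)) (gen deg V (φ (List.ofFn w)))

theorem wordSum_zero [CharZero K] (V : GrSp K) (φ : List (Fin N) → V) :
    wordSum deg V 0 φ = gen deg V (φ []) := by
  rw [wordSum, Fintype.sum_unique]
  exact one_act deg V _

theorem wordSum_succ [CharZero K] (V : GrSp K) (k : ℕ) (φ : List (Fin N) → V) :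
    wordSum deg V (k + 1) φ =
      ∑ β, act deg V (theta deg β) (wordSum deg V k fun L => φ (β :: L)) := by
  rw [wordSum, ← (Fin.consEquiv fun _ : Fin (k + 1) => Fin N).sum_comp, Fintype.sum_prod_type]
  refine Finset.sum_congr rfl fun β _ => ?_
  rw [wordSum, map_sum]
  refine Finset.sum_congr rfl fun w _ => ?_
  have : List.ofFn ((Fin.consEquiv fun _ : Fin (k + 1) => Fin N) (β, w)) = β :: List.ofFn w := by
    simp [Fin.consEquiv, List.ofFn_succ]
  rw [this, ← act_act]
  rfl

theorem pd_sum_act_theta [CharZero K] (V : GrSp K) (α : Fin N) (y : Fin N → gr deg V) :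
    pd deg V α (∑ β, act deg V (theta deg β) (y β)) =
      y α + ∑ β, ((1 - deg α) * (1 - deg β)).negOnePow • act deg V (theta deg β)
        (pd deg V α (y β)) := by
  rw [map_sum, Finset.sum_congr rfl fun β _ => pd_act deg V α (theta_mem deg β) (y β),
    Finset.sum_add_distrib, Finset.sum_eq_single α]
  · rw [pd_theta_self, one_act]
  · intro β _ hβ
    rw [pd_theta_of_ne deg hβ.symm]
    exact LinearMap.map_zero₂ _ _
  · intro h
    exact absurd (Finset.mem_univ _) h

/-- As for a symmetric form, each of the `k + 1` positions contributes equally. The first letter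
contributes once; the other `k` positions come from the induction hypothesis, and the symmetry of
`φ` absorbs the sign of moving `∂_α` past the first letter. -/
theorem pd_wordSum [CharZero K] (V : GrSp K) (α : Fin N) (k : ℕ) (φ : List (Fin N) → V)
    (hφ : KoszulSymm deg φ) : pd deg V α (wordSum deg V (k + 1) φ) =
      (k + 1) • wordSum deg V k fun L => φ (α :: L) := by
  induction k generalizing φ with
  | zero =>
    rw [wordSum_succ, pd_sum_act_theta, zero_add, one_smul, add_eq_left]
    refine Finset.sum_eq_zero fun β _ => ?_
    rw [wordSum_zero, pd_gen, map_zero, smul_zero]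
  | succ k ih =>
    rw [wordSum_succ, pd_sum_act_theta, add_comm (k + 1), add_smul, one_smul]
    congr 1
    rw [wordSum_succ, Finset.smul_sum]
    refine Finset.sum_congr rfl fun β _ => ?_
    rw [ih _ (hφ.cons β), ← map_nsmul, ← act_units_smul]
    congr 1
    rw [smul_comm]
    congr 1
    rw [wordSum, wordSum, Finset.smul_sum]
    refine Finset.sum_congr rfl fun w _ => ?_
    have := hφ [] (List.ofFn w) α β
    rw [List.nil_append, List.nil_append] at this
    rw [this, LinearMap.map_units_int_smul, act_units_smul]

theorem tay_wordSum [CharZero K] (V : GrSp K) (L : List (Fin N)) (φ : List (Fin N) → V)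
    (hφ : KoszulSymm deg φ) :
    tay deg V L (wordSum deg V L.length φ) = L.length.factorial • φ L := by
  induction L generalizing φ with
  | nil => rw [List.length_nil, wordSum_zero, tay_nil, const_gen, Nat.factorial_zero, one_smul]
  | cons α L ih =>
    rw [List.length_cons, tay_cons, pd_wordSum deg V α _ φ hφ, map_nsmul, ih _ (hφ.cons α),
      smul_smul, Nat.factorial_succ]

/-- A Taylor coefficient at a word sees only the coefficients at monomials of that length. An
infinite series can therefore be replaced by a finite word sum when it is evaluated. -/
theorem tay_congr (V : GrSp K) (L : List (Fin N)) {x y : gr deg V}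
    (h : ∀ R, R.degree = L.length → x.1 R = y.1 R) : tay deg V L x = tay deg V L y := by
  induction L generalizing x y with
  | nil => exact h 0 (by simp)
  | cons α L ih =>
    refine ih fun R hR => ?_
    rw [pd_coe, pd_coe, pdFun, pdFun, h]
    rw [map_add, hR]
    simp

theorem thetaWord_mem (L : List (Fin N)) :
    thetaWord (K := K) deg L ∈ (gr deg (GrSp.ground K)).gr (wordDeg deg L) := by
  induction L with
  | nil => exact one_mem deg
  | cons α L ih => exact act_mem deg _ (theta_mem deg α) ih

theorem wordSum_mem (V : GrSp K) (k : ℕ) {m : ℤ} {φ : List (Fin N) → V}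
    (hφ : ∀ L, φ L ∈ V.gr (m - wordDeg deg L)) : wordSum deg V k φ ∈ (gr deg V).gr m :=
  Submodule.sum_mem _ fun _ _ => GrSp.gr_congr _ (by ring)
    (act_mem deg V (thetaWord_mem deg _) (gen_mem deg V (hφ _)))

/-- The series with Taylor coefficients `φ`. -/
def wordSeries (V : GrSp K) (φ : List (Fin N) → V) : (Fin N →₀ ℕ) → V :=
  fun R => (R.degree.factorial : K)⁻¹ • (wordSum deg V R.degree φ).1 R

theorem wordSum_coe (V : GrSp K) (k : ℕ) (φ : List (Fin N) → V) (R : Fin N →₀ ℕ) :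
    (wordSum deg V k φ).1 R = ∑ w : Fin k → Fin N,
      ((thetaWord deg (List.ofFn w) : gr deg (GrSp.ground K)).1 R : K) • φ (List.ofFn w) := by
  rw [wordSum]
  refine (congrFun (map_sum (total deg V).subtype _ Finset.univ) R).trans ?_
  rw [Finset.sum_apply]
  exact Finset.sum_congr rfl fun w _ => act_gen_coe deg V _ _ R

theorem wordSeries_eq_series (V : GrSp K) (φ : List (Fin N) → V) :
    wordSeries deg V φ = series (K := K) deg
      fun k w => (k.factorial : K)⁻¹ • φ (List.ofFn w) := by
  funext R
  rw [wordSeries, series, wordSum_coe, Finset.smul_sum]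
  refine Finset.sum_congr rfl fun w _ => ?_
  exact smul_comm (M := K) (N := K) _ _ _

theorem wordSeries_mem_piece (V : GrSp K) {m : ℤ} {φ : List (Fin N) → V}
    (hφ : ∀ L, φ L ∈ V.gr (m - wordDeg deg L)) : wordSeries deg V φ ∈ piece deg V m := fun R =>
  ⟨Submodule.smul_mem _ _ (wordSum_mem deg V _ hφ R).1, fun hR => by
    rw [wordSeries, coeff_eq_zero _ hR, smul_zero]⟩

theorem wordSeries_add (V : GrSp K) (φ ψ : List (Fin N) → V) :
    wordSeries deg V (φ + ψ) = wordSeries deg V φ + wordSeries deg V ψ := by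
  funext R
  simp only [wordSeries, wordSum_coe, Pi.add_apply, smul_add, Finset.sum_add_distrib]

theorem wordSeries_smul (V : GrSp K) (c : K) (φ : List (Fin N) → V) :
    wordSeries deg V (c • φ) = c • wordSeries deg V φ := by
  funext R
  simp only [wordSeries, wordSum_coe, Pi.smul_apply, Finset.smul_sum]
  refine Finset.sum_congr rfl fun w _ => ?_
  rw [smul_comm _ c, smul_comm _ c]

/-- In the degree of the word the series coincides with a word sum divided by the factorial of the
length, and that factorial is exactly what the iterated derivative produces. -/
theorem tay_eq_of_coe [CharZero K] (V : GrSp K) {φ : List (Fin N) → V} (hφ : KoszulSymm deg φ)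
    {x : gr deg V} (hx : x.1 = wordSeries deg V φ) (L : List (Fin N)) : tay deg V L x = φ L := by
  rw [tay_congr deg V L (y := (L.length.factorial : K)⁻¹ • wordSum deg V L.length φ), map_smul,
    tay_wordSum deg V L φ hφ, ← Nat.cast_smul_eq_nsmul K, smul_smul, inv_mul_cancel₀, one_smul]
  · exact_mod_cast L.length.factorial_ne_zero
  · intro R hR
    rw [hx, coe_smul, wordSeries, hR]

/-- Families of maps indexed by words that are the Taylor coefficients of a linear map of
degree `n`. -/
def IsWordMap (U V : GrSp K) (n : ℤ) (h : List (Fin N) → (U →ₗ[K] V)) : Prop :=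
  (∀ L, h L ∈ GrSp.mapDeg U V (n - wordDeg deg L)) ∧ KoszulSymm deg h

section WordMap

variable {deg} {U V : GrSp K} {n : ℤ} {h : List (Fin N) → (U →ₗ[K] V)}

theorem IsWordMap.symm_apply (hh : IsWordMap deg U V n h) (u : U) :
    KoszulSymm deg fun L => h L u := fun L L' α β => LinearMap.congr_fun (hh.2 L L' α β) u

theorem IsWordMap.apply_mem (hh : IsWordMap deg U V n h) {p : ℤ} {u : U} (hu : u ∈ U.gr p)
    (L : List (Fin N)) : h L u ∈ V.gr (p + n - wordDeg deg L) :=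
  GrSp.gr_congr _ (by ring) (hh.1 L p u hu)

/-- The map `u ↦ ∑ θ^w h_w u`. -/
def IsWordMap.toLin (hh : IsWordMap deg U V n h) : U →ₗ[K] gr deg V :=
  LinearMap.codRestrict (total deg V)
    { toFun := fun u => wordSeries deg V fun L => h L u
      map_add' := fun u u' => by
        rw [← wordSeries_add]; congr 1; funext L; exact map_add _ _ _
      map_smul' := fun c u => by
        rw [RingHom.id_apply, ← wordSeries_smul]; congr 1; funext L; exact map_smul _ _ _ }
    fun u => by
      induction u using GrSp.induction_on with
      | hom p u hu =>
        exact Submodule.mem_iSup_of_mem _ (wordSeries_mem_piece deg V (hh.apply_mem hu))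
      | add x y hx hy => rw [map_add]; exact Submodule.add_mem _ hx hy

theorem IsWordMap.toLin_coe (hh : IsWordMap deg U V n h) (u : U) :
    (hh.toLin u).1 = wordSeries deg V fun L => h L u := rfl

theorem IsWordMap.toLin_mem (hh : IsWordMap deg U V n h) :
    hh.toLin ∈ GrSp.mapDeg U (gr deg V) n := fun _ _ hu =>
  wordSeries_mem_piece deg V (hh.apply_mem hu)

variable (deg) in
theorem IsLin.isWordMap {F : gr deg U →ₗ[K] gr deg V} (hF : IsLin deg U V n F) :
    IsWordMap deg U V n fun L => tay deg V L ∘ₗ F ∘ₗ gen deg U :=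
  ⟨fun L p u hu => GrSp.gr_congr _ (by rw [wordDeg]; ring)
      (tay_mem deg V L (hF.1 _ _ (gen_mem deg U hu))),
    fun L L' α β => LinearMap.ext fun u => tay_swap deg V L L' α β _⟩

variable [CharZero K]

theorem IsWordMap.exists_isLin (hh : IsWordMap deg U V n h) : ∃ F, IsLin deg U V n F ∧
    ∀ u, (F (gen deg U u)).1 = wordSeries deg V fun L => h L u :=
  ⟨ext deg n hh.toLin hh.toLin_mem, ext_isLin deg _, fun u => by rw [ext_gen]; rfl⟩

/-- Equality with a prescribed series is traded for equality of all Taylor coefficients; this is how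
the explicit formulas on generators become usable. -/
theorem IsWordMap.coe_eq_iff (hh : IsWordMap deg U V n h) (x : gr deg V) (u : U) :
    x.1 = wordSeries deg V (fun L => h L u) ↔ ∀ L, tay deg V L x = h L u := by
  refine ⟨fun hx => tay_eq_of_coe deg V (hh.symm_apply u) hx, fun hx => ?_⟩
  rw [← hh.toLin_coe]
  congr 1
  refine eq_of_tay deg V fun L => ?_
  rw [hx, tay_eq_of_coe deg V (hh.symm_apply u) (hh.toLin_coe u)]

end WordMap

end CE


/-! ### The signs of the Chevalley-Eilenberg maps -/

namespace CE

/-- The exponent of the sign in the coefficients of the Chevalley-Eilenberg maps of degree `n`, at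
basis elements of degrees `d_1, …, d_k`. -/
def signExp (n : ℤ) : List ℤ → ℤ
  | [] => 0
  | d :: l => (1 + d) * l.sum + d * (1 + n) + signExp n l

@[simp] theorem signExp_nil (n : ℤ) : signExp n [] = 0 := rfl

@[simp] theorem signExp_cons (n d : ℤ) (l : List ℤ) :
    signExp n (d :: l) = (1 + d) * l.sum + d * (1 + n) + signExp n l := rfl

/-- Skew-symmetry contributes `1 + a b` for an adjacent interchange. Together with the `a + b` found
here this is `(1 - a)(1 - b)` modulo 2, the Koszul sign of the corresponding letters θ. -/
theorem signExp_swap (n : ℤ) (l l' : List ℤ) (a b : ℤ) :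
    (signExp n (l ++ a :: b :: l') : ZMod 2) = a + b + signExp n (l ++ b :: a :: l') := by
  induction l with
  | nil => simp only [List.nil_append, signExp_cons, List.sum_cons]; push_cast; grind
  | cons c l ih =>
    simp only [List.cons_append, signExp_cons, List.sum_append, List.sum_cons, Int.cast_add, ih]
    push_cast
    ring

/-- Removing the first letter takes `d_1` times the sum of the others out of the reversal degree,
and lowers the position of each remaining letter by one, which accounts for one more copy of that
sum. -/
theorem revDeg_add_eq (n : ℤ) {k : ℕ} (d : Fin k → ℤ) :
    ∑ l, d l * ∑ m ∈ Finset.Ioi l, d m + ∑ l : Fin k, d l * (((l : ℕ) : ℤ) + 1 + n) =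
      signExp n (List.ofFn d) := by
  induction k with
  | zero => simp
  | succ k ih =>
    rw [List.ofFn_succ, signExp_cons, ← ih, Fin.sum_univ_succ, Fin.sum_univ_succ, Fin.sum_Ioi_zero,
      List.sum_ofFn]
    simp only [Fin.sum_Ioi_succ, Fin.val_zero, Fin.val_succ, Nat.cast_add, Nat.cast_zero,
      Nat.cast_one, mul_add, Finset.sum_add_distrib, mul_one, add_mul, one_mul]
    ring

theorem coeff_eq (K : Type u) [Field K] {N : ℕ} (deg : Fin N → ℤ) (n : ℤ) {k : ℕ}
    (w : Fin k → Fin N) : coeff deg K n w =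
      (signExp n ((List.ofFn w).map deg)).negOnePow • (k.factorial : K)⁻¹ := by
  rw [coeff, List.map_ofFn, ← revDeg_add_eq]
  rfl

end CE

theorem Finset.prod_negOnePow {ι : Type*} (s : Finset ι) (f : ι → ℤ) :
    ∏ i ∈ s, (f i).negOnePow = (∑ i ∈ s, f i).negOnePow := by
  classical
  induction s using Finset.induction_on with
  | empty => simp
  | insert a s ha ih => rw [Finset.prod_insert ha, Finset.sum_insert ha, ih, Int.negOnePow_add]

theorem shuffleSign_eq {k : ℕ} (d : Fin k → ℤ) (S : Finset (Fin k)) : shuffleSign d S =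
    (∑ a ∈ Sᶜ, ∑ b ∈ S, if a < b then 1 + d a * d b else 0).negOnePow := by
  simp only [shuffleSign, ← Finset.prod_negOnePow]
  refine Finset.prod_congr rfl fun a _ => Finset.prod_congr rfl fun b _ => ?_
  split_ifs
  · rw [Int.negOnePow_add, Int.negOnePow_one, neg_one_mul]
  · rfl

theorem shuffleSign_congr {k : ℕ} {d d' : Fin k → ℤ} (h : ∀ l, d l % 2 = d' l % 2)
    (S : Finset (Fin k)) : shuffleSign d S = shuffleSign d' S := by
  have h2 : ∀ l, (d l : ZMod 2) = d' l := fun l => (ZMod.intCast_eq_intCast_iff' _ _ 2).2 (h l)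
  simp only [shuffleSign]
  refine Finset.prod_congr rfl fun a _ => Finset.prod_congr rfl fun b _ => ?_
  rw [Int.negOnePow_congr (show ((d a * d b : ℤ) : ZMod 2) = (d' a * d' b : ℤ) by
    push_cast; rw [h2, h2])]

theorem sum_ofFn_sub {k : ℕ} (S : Finset (Fin k)) (d : Fin k → ℤ) :
    (List.ofFn (sub S d)).sum = ∑ a ∈ S, d a := by
  rw [ofFn_sub, ← Multiset.sum_coe, ← Multiset.map_coe, Finset.sort_eq]
  rfl

theorem Fin.finset_cases {k : ℕ} {P : Finset (Fin (k + 1)) → Prop}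
    (h0 : ∀ T : Finset (Fin k), P (T.map (Fin.succEmb k)))
    (h1 : ∀ T : Finset (Fin k), P (insert 0 (T.map (Fin.succEmb k)))) (S) : P S := by
  let T : Finset (Fin k) := Finset.univ.filter fun i => i.succ ∈ S
  by_cases h : 0 ∈ S
  · convert h1 T using 1
    ext i
    refine Fin.cases (by simp [h]) (fun i => ?_) i
    simp [T, Fin.succ_ne_zero]
  · convert h0 T using 1
    ext i
    refine Fin.cases (by simp [h, Fin.succ_ne_zero]) (fun i => ?_) i
    simp [T]

/-- The sign identity on which the dictionary rests. One side collects the Chevalley-Eilenberg sign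
of the whole word, the shuffle sign and the sign in juxtaposition; the other the Leibniz sign and
the Chevalley-Eilenberg signs of the two subwords. Removing the first letter changes both sides by
the same amount modulo 2, whichever subword it belongs to. -/
theorem shuffle_signExp (m n : ℤ) {k : ℕ} (d : Fin k → ℤ) (S : Finset (Fin k)) :
    ((CE.signExp (m + n) (List.ofFn d) + (∑ a ∈ Sᶜ, ∑ b ∈ S, if a < b then 1 + d a * d b else 0) +
      ((m - S.card) * Sᶜ.card + (n - Sᶜ.card) * ∑ a ∈ S, d a) : ℤ) : ZMod 2) =
    ((m * ∑ b ∈ Sᶜ, (1 - d b) + ∑ a ∈ S, ∑ b ∈ Sᶜ, (if a < b then (1 - d a) * (1 - d b) else 0) +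
      (CE.signExp m (List.ofFn (sub S d)) + CE.signExp n (List.ofFn (sub Sᶜ d))) : ℤ) : ZMod 2) := by
  induction k with
  | zero =>
    have h : ∀ (j : ℕ) (hj : j = 0) (w : Fin j → ℤ), List.ofFn w = [] := by
      rintro j rfl w; rfl
    rw [Finset.eq_empty_of_isEmpty S, h _ rfl d, h _ (by simp) (sub ∅ d), h _ (by simp) (sub ∅ᶜ d)]
    simp
  | succ k ih =>
    have hD : ∀ T : Finset (Fin k), ∑ i : Fin k, d i.succ =
        ∑ i ∈ T, d i.succ + ∑ i ∈ Tᶜ, d i.succ := fun T => (Finset.sum_add_sum_compl T _).symm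
    induction S using Fin.finset_cases with
    | h0 T =>
      have ih := ih (fun l => d l.succ) T
      have h0 : (0 : Fin (k + 1)) ∉ Tᶜ.map (Fin.succEmb k) := by simp [Fin.succ_ne_zero]
      rw [Fin.compl_map_succ, ofFn_sub_map_succ, ofFn_sub_insert_zero, List.ofFn_succ,
        CE.signExp_cons, CE.signExp_cons, sum_ofFn_sub, List.sum_ofFn, hD T, Finset.card_map,
        Finset.card_insert_of_notMem h0, Finset.card_map]
      simp only [Finset.sum_insert h0, Finset.sum_map, Fin.coe_succEmb,
        Fin.not_lt_zero, if_false, zero_add, Fin.succ_lt_succ_iff, Fin.succ_pos, if_true,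
        Finset.sum_add_distrib, ← Finset.mul_sum, Finset.sum_const, nsmul_eq_mul, mul_one]
      push_cast at ih ⊢
      grind
    | h1 T =>
      have ih := ih (fun l => d l.succ) T
      have h0 : (0 : Fin (k + 1)) ∉ T.map (Fin.succEmb k) := by simp [Fin.succ_ne_zero]
      rw [Fin.compl_insert_zero, ofFn_sub_map_succ, ofFn_sub_insert_zero, List.ofFn_succ,
        CE.signExp_cons, CE.signExp_cons, sum_ofFn_sub, List.sum_ofFn, hD T, Finset.card_map,
        Finset.card_insert_of_notMem h0, Finset.card_map]
      simp only [Finset.sum_insert h0, Finset.sum_map, Fin.coe_succEmb,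
        Fin.not_lt_zero, if_false, zero_add, Fin.succ_lt_succ_iff, Fin.succ_pos, if_true,
        ← Finset.mul_sum, Finset.sum_sub_distrib, Finset.sum_const, nsmul_eq_mul, mul_one]
      simp only [Finset.sum_sub_distrib, Finset.sum_const, nsmul_eq_mul, mul_one] at ih
      push_cast at ih ⊢
      grind

theorem shuffleSign_mul (m n : ℤ) {k : ℕ} (d : Fin k → ℤ) (S : Finset (Fin k)) :
    (CE.signExp (m + n) (List.ofFn d)).negOnePow * (shuffleSign d S *
      ((m - S.card) * Sᶜ.card + (n - Sᶜ.card) * ∑ a ∈ S, d a).negOnePow) =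
    leibnizSign m (fun l => 1 - d l) S * ((CE.signExp m (List.ofFn (sub S d))).negOnePow *
      (CE.signExp n (List.ofFn (sub Sᶜ d))).negOnePow) := by
  rw [shuffleSign_eq, leibnizSign]
  simp only [← Int.negOnePow_add]
  refine Int.negOnePow_congr ?_
  rw [← add_assoc, shuffle_signExp]

/-! ### Multilinear maps and words in a homogeneous basis -/

theorem List.apply_ofFn_get {X Y : Type*} (f : ∀ k, (Fin k → X) → Y) {k : ℕ} (x : Fin k → X) :
    f (List.ofFn x).length (List.ofFn x).get = f k x := by
  have : ∀ (j : ℕ) (hj : j = k) (y : Fin j → X), (∀ i, y i = x (i.cast hj)) → f j y = f k x := by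
    rintro j rfl y h
    exact congrArg _ (funext h)
  exact this _ (by simp) _ fun i => by simp; rfl

namespace HomogeneousBasis

variable {K : Type u} [Field K] {V : GrSp K} {N : ℕ} (B : HomogeneousBasis V N)
variable {C : Type*} [AddCommGroup C] [Module K C]

/-- The part of the expansion of `x` along basis vectors of other degrees is both of degree `p` and
a sum of components of degrees different from `p`, hence zero. -/
theorem repr_eq_zero {p : ℤ} {x : V} (hx : x ∈ V.gr p) {α : Fin N} (h : B.deg α ≠ p) :
    B.basis.repr x α = 0 := by
  classical
  have key : ∑ β with B.deg β ≠ p, B.basis.repr x β • B.basis β = 0 := by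
    have h1 : ∑ β with B.deg β ≠ p, B.basis.repr x β • B.basis β =
        x - ∑ β with B.deg β = p, B.basis.repr x β • B.basis β := by
      rw [eq_sub_iff_add_eq, add_comm]
      exact (Finset.sum_filter_add_sum_filter_not _ _ _).trans (B.basis.sum_repr x)
    have h2 := V.isInternal.submodule_iSupIndep
    rw [iSupIndep_def] at h2
    refine Submodule.disjoint_def.1 (h2 p) _ ?_ ?_
    · rw [h1]
      refine Submodule.sub_mem _ hx (Submodule.sum_mem _ fun β hβ => Submodule.smul_mem _ _ ?_)
      rw [← (Finset.mem_filter.1 hβ).2]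
      exact B.mem β
    · refine Submodule.sum_mem _ fun β hβ => Submodule.smul_mem _ _ ?_
      exact Submodule.mem_iSup_of_mem (B.deg β)
        (Submodule.mem_iSup_of_mem (Finset.mem_filter.1 hβ).2 (B.mem β))
  have := congrArg (fun y => B.basis.repr y α) key
  simpa [Finsupp.single_apply, Finset.sum_ite_eq', h] using this

/-- Expanding homogeneous arguments in the basis leaves only basis words of the same degrees. With
`W` a degree component this checks degrees; with `W = ⊥` it checks identities. -/
theorem multilinear_mem {k : ℕ} (f : MultilinearMap K (fun _ : Fin k => V) C) (W : Submodule K C)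
    (d : Fin k → ℤ) (h : ∀ w : Fin k → Fin N, (∀ l, B.deg (w l) = d l) → f (B.basis ∘ w) ∈ W)
    (x : Fin k → V) (hx : ∀ l, x l ∈ V.gr (d l)) : f x ∈ W := by
  classical
  have : x = fun l => ∑ α, B.basis.repr (x l) α • B.basis α :=
    funext fun l => (B.basis.sum_repr (x l)).symm
  rw [this, MultilinearMap.map_sum]
  refine Submodule.sum_mem _ fun w _ => ?_
  rw [MultilinearMap.map_smul_univ f (fun l => B.basis.repr (x l) (w l)) fun l => B.basis (w l)]
  by_cases hw : ∀ l, B.deg (w l) = d l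
  · exact Submodule.smul_mem _ _ (h w hw)
  · obtain ⟨l, hl⟩ := not_forall.1 hw
    rw [Finset.prod_eq_zero (Finset.mem_univ l) (B.repr_eq_zero (hx l) hl), zero_smul]
    exact Submodule.zero_mem _

/-- The value of a family of multilinear maps at a word in the basis. -/
def ev (f : ∀ k : ℕ, MultilinearMap K (fun _ : Fin k => V) C) (w : List (Fin N)) : C :=
  f w.length (B.basis ∘ w.get)

theorem ev_ofFn (f : ∀ k : ℕ, MultilinearMap K (fun _ : Fin k => V) C) {k : ℕ}
    (w : Fin k → Fin N) : B.ev f (List.ofFn w) = f k (B.basis ∘ w) :=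
  List.apply_ofFn_get (fun k w => f k (B.basis ∘ w)) w

theorem ev_injective {f f' : ∀ k : ℕ, MultilinearMap K (fun _ : Fin k => V) C}
    (h : ∀ w, B.ev f w = B.ev f' w) : f = f' := by
  funext k
  refine Module.Basis.ext_multilinear (fun _ => B.basis) fun w => ?_
  have := h (List.ofFn w)
  rwa [ev_ofFn, ev_ofFn] at this

theorem exists_ev (h : List (Fin N) → C) :
    ∃ f : ∀ k : ℕ, MultilinearMap K (fun _ : Fin k => V) C, ∀ w, B.ev f w = h w := by
  classical
  refine ⟨fun k => ∑ w : Fin k → Fin N, ((MultilinearMap.mkPiAlgebra K (Fin k) K).compLinearMap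
    fun l => B.basis.coord (w l)).smulRight (h (List.ofFn w)), fun w => ?_⟩
  obtain ⟨k, w, rfl⟩ : ∃ k, ∃ w' : Fin k → Fin N, w = List.ofFn w' :=
    ⟨w.length, w.get, (List.ofFn_get w).symm⟩
  rw [ev_ofFn, sum_apply, Finset.sum_eq_single w]
  · simp
  · intro v _ hv
    obtain ⟨l, hl⟩ := Function.ne_iff.1 hv
    rw [MultilinearMap.smulRight_apply, MultilinearMap.compLinearMap_apply,
      MultilinearMap.mkPiAlgebra_apply, Finset.prod_eq_zero (Finset.mem_univ l), zero_smul]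
    simp [hl.symm]
  · intro h
    exact absurd (Finset.mem_univ _) h

end HomogeneousBasis


theorem Int.neg_negOnePow_smul {M : Type*} [AddCommGroup M] (a : ℤ) (x : M) :
    -(a.negOnePow • x) = (1 + a).negOnePow • x := by
  rw [Int.negOnePow_add, Int.negOnePow_one, neg_one_mul, Units.smul_def, Units.smul_def,
    Units.val_neg, neg_smul]

theorem List.ofFn_comp_swap {X : Type*} {k : ℕ} (w : Fin k → X) (a b : Fin k)
    (hab : (a : ℕ) + 1 = b) : ∃ l l' : List X, l.length = a ∧
      List.ofFn w = l ++ w a :: w b :: l' ∧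
      List.ofFn (w ∘ Equiv.swap a b) = l ++ w b :: w a :: l' := by
  induction k with
  | zero => exact a.elim0
  | succ k ih =>
    obtain ⟨b, rfl⟩ := Fin.exists_succ_eq.2 (show b ≠ 0 by rintro rfl; simp at hab)
    induction a using Fin.cases with
    | zero =>
      cases k with
      | zero => exact b.elim0
      | succ k =>
        obtain rfl : b = 0 := Fin.ext (by simpa using hab.symm)
        refine ⟨[], List.ofFn fun i : Fin k => w i.succ.succ, rfl, ?_, ?_⟩
        · rw [List.ofFn_succ, List.ofFn_succ, List.nil_append]
        · rw [List.ofFn_succ, List.ofFn_succ]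
          simp only [Function.comp_apply, Equiv.swap_apply_left, Equiv.swap_apply_right,
            List.nil_append]
          congr 3
    | succ a =>
      obtain ⟨l, l', h, h1, h2⟩ := ih (fun i => w i.succ) a b (by simpa using hab)
      refine ⟨w 0 :: l, l', by simp [h], by rw [List.ofFn_succ, h1]; rfl, ?_⟩
      rw [List.ofFn_succ, Function.comp_apply,
        Equiv.swap_apply_of_ne_of_ne (Fin.succ_ne_zero a).symm (Fin.succ_ne_zero b).symm,
        List.cons_append, ← h2]
      congr 2
      funext i
      simp only [Function.comp_apply]
      rw [← (Fin.succ_injective k).map_swap]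

namespace CE

theorem wordDeg_ofFn {N : ℕ} (deg : Fin N → ℤ) {k : ℕ} (w : Fin k → Fin N) :
    wordDeg deg (List.ofFn w) = k - ∑ l, deg (w l) := by
  simp [wordDeg, List.map_ofFn, List.sum_ofFn]

end CE

/-! ### The dictionary between intertwiners and Taylor coefficients -/

namespace HomotopyLie

variable {K : Type u} [Field K] (L : HomotopyLie K) {N : ℕ} (B : HomogeneousBasis L.g N)

/-- The components of an intertwiner of degree `n`, with the signs of the Chevalley-Eilenberg
maps. -/
def hat {U V : Type u} [AddCommGroup U] [Module K U] [AddCommGroup V] [Module K V] (n : ℤ)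
    (f : L.Raw U V) (w : List (Fin N)) : U →ₗ[K] V :=
  (CE.signExp n (w.map B.deg)).negOnePow • B.ev f w

theorem hat_ofFn {U V : Type u} [AddCommGroup U] [Module K U] [AddCommGroup V] [Module K V] (n : ℤ)
    (f : L.Raw U V) {k : ℕ} (w : Fin k → Fin N) : L.hat B n f (List.ofFn w) =
      (CE.signExp n (List.ofFn fun l => B.deg (w l))).negOnePow • f k (B.basis ∘ w) := by
  rw [hat, B.ev_ofFn, List.map_ofFn]
  rfl

theorem ev_eq_hat {U V : Type u} [AddCommGroup U] [Module K U] [AddCommGroup V] [Module K V]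
    (n : ℤ) (f : L.Raw U V) (w : List (Fin N)) :
    B.ev f w = (CE.signExp n (w.map B.deg)).negOnePow • L.hat B n f w := by
  rw [hat, Int.negOnePow_smul_self_smul]

theorem hat_injective {U V : Type u} [AddCommGroup U] [Module K U] [AddCommGroup V] [Module K V]
    {n : ℤ} {f f' : L.Raw U V} (h : ∀ w, L.hat B n f w = L.hat B n f' w) : f = f' :=
  B.ev_injective fun w => by rw [L.ev_eq_hat B n, h, ← L.ev_eq_hat B n]

theorem exists_hat {U V : Type u} [AddCommGroup U] [Module K U] [AddCommGroup V] [Module K V]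
    (n : ℤ) (h : List (Fin N) → (U →ₗ[K] V)) : ∃ f : L.Raw U V, ∀ w, L.hat B n f w = h w := by
  obtain ⟨f, hf⟩ := B.exists_ev fun w => (CE.signExp n (w.map B.deg)).negOnePow • h w
  exact ⟨f, fun w => by rw [hat, hf, Int.negOnePow_smul_self_smul]⟩

/-- The sign in `hat` is the one in `coeff`, and the remaining factor `1 / k!` is the normalisation
of Taylor series, so the prescribed series has `hat` as its Taylor coefficients. -/
theorem ceSeries_eq {U V : GrSp K} (n : ℤ) (f : L.Raw U V) (u : U) :
    L.ceSeries B n f u = CE.wordSeries B.deg V fun w => L.hat B n f w u := by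
  rw [CE.wordSeries_eq_series, ceSeries]
  congr 1
  funext k w
  rw [CE.coeff_eq, hat, B.ev_ofFn, LinearMap.units_int_smul_apply]
  rw [smul_comm, smul_assoc]

section Dictionary

variable {U V : GrSp K} {n : ℤ} {f : L.Raw U V}

/-- Degrees match because the letter of `x_α` has degree `1 - deg α`. By `signExp_swap`,
skew-symmetry of `f` becomes Koszul symmetry after the sign twist. -/
theorem isWordMap_hat (hf : f ∈ L.intertwiner U V n) :
    CE.IsWordMap B.deg U V n (L.hat B n f) := by
  refine ⟨fun w => ?_, fun l l' α β => ?_⟩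
  · obtain ⟨k, w, rfl⟩ : ∃ k, ∃ w' : Fin k → Fin N, w = List.ofFn w' :=
      ⟨w.length, w.get, (List.ofFn_get w).symm⟩
    rw [hat_ofFn, CE.wordDeg_ofFn]
    refine Submodule.units_int_smul_mem _ _ ?_
    convert (hf k (fun l => B.deg (w l)) (B.basis ∘ w) fun l => B.mem _).1 using 2
    ring
  · obtain ⟨k, w, hw⟩ : ∃ k, ∃ w' : Fin k → Fin N, l ++ α :: β :: l' = List.ofFn w' :=
      ⟨_, _, (List.ofFn_get _).symm⟩
    have hk : l.length + 1 < k := by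
      have := congrArg List.length hw
      simp at this
      omega
    obtain ⟨l₁, l₂, h1, h2, h3⟩ := List.ofFn_comp_swap w ⟨l.length, by omega⟩ ⟨_, hk⟩ rfl
    rw [← hw] at h2
    obtain ⟨rfl, h4⟩ := List.append_inj h2 h1.symm
    rw [List.cons.injEq, List.cons.injEq] at h4
    obtain ⟨h4, h5, rfl⟩ := h4
    have h6 := (hf k (fun l => B.deg (w l)) (B.basis ∘ w) fun l => B.mem _).2 _ _
      (show ((⟨l.length, by omega⟩ : Fin k) : ℕ) + 1 = (⟨_, hk⟩ : Fin k) from rfl)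
    rw [Function.comp_assoc, ← B.ev_ofFn, ← B.ev_ofFn, h3, ← hw, ← h4, ← h5] at h6
    rw [hat, hat, h6, Int.neg_negOnePow_smul]
    simp only [smul_smul]
    simp only [← Int.negOnePow_add]
    congr 1
    refine Int.negOnePow_congr ?_
    push_cast
    simp only [List.map_append, List.map_cons]
    rw [CE.signExp_swap]
    grind

theorem mem_intertwiner_of_isWordMap (hf : CE.IsWordMap B.deg U V n (L.hat B n f)) :
    f ∈ L.intertwiner U V n := by
  intro k d x hx
  refine ⟨?_, fun a b hab => ?_⟩
  · refine B.multilinear_mem (f k) _ d (fun w hw => ?_) x hx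
    have := hf.1 (List.ofFn w)
    rw [hat_ofFn, CE.wordDeg_ofFn] at this
    have := Submodule.units_int_smul_mem _ (CE.signExp n (List.ofFn fun l => B.deg (w l))).negOnePow
      this
    rw [Int.negOnePow_smul_self_smul] at this
    convert this using 2
    simp only [hw]
    ring
  -- The defect of skew-symmetry is multilinear once the degrees are fixed, so its vanishing need
  -- only be tested on basis words of those degrees.
  · have := B.multilinear_mem ((f k).domDomCongr (Equiv.swap a b) +
      (d a * d b).negOnePow • f k) ⊥ d (fun w hw => ?_) x hx
    · rw [Submodule.mem_bot, add_apply, MultilinearMap.domDomCongr_apply] at this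
      exact eq_neg_of_add_eq_zero_left this
    · rw [Submodule.mem_bot, add_apply, MultilinearMap.domDomCongr_apply]
      obtain ⟨l, l', h1, h2, h3⟩ := List.ofFn_comp_swap w a b hab
      change f k (B.basis ∘ (w ∘ Equiv.swap a b)) + (d a * d b).negOnePow • f k (B.basis ∘ w) = 0
      rw [← B.ev_ofFn, ← B.ev_ofFn, h2, h3, L.ev_eq_hat B n, L.ev_eq_hat B n, hf.2,
        ← neg_eq_iff_add_eq_zero]
      simp only [smul_smul, ← Int.negOnePow_add, List.map_append, List.map_cons, hw]
      rw [Int.neg_negOnePow_smul]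
      congr 1
      refine Int.negOnePow_congr ?_
      push_cast
      rw [CE.signExp_swap]
      grind

end Dictionary

end HomotopyLie


/-! ### Linear maps represented by intertwiners; composition -/

namespace HomotopyLie

variable {K : Type u} [Field K] (L : HomotopyLie K) {N : ℕ} (B : HomogeneousBasis L.g N)

/-- `F` is the linear map of degree `n` whose Taylor coefficients are the components of `f`. -/
def Represents {U V : GrSp K} (n : ℤ) (f : L.Raw U V) (F : CE.gr B.deg U →ₗ[K] CE.gr B.deg V) :
    Prop :=
  CE.IsLin B.deg U V n F ∧ ∀ w u, CE.tay B.deg V w (F (CE.gen B.deg U u)) = L.hat B n f w u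

section Represents

variable {L B} {U V : GrSp K} {n : ℤ} {f f' : L.Raw U V} {F F' : CE.gr B.deg U →ₗ[K] CE.gr B.deg V}

theorem Represents.mem (h : L.Represents B n f F) : f ∈ L.intertwiner U V n := by
  refine L.mem_intertwiner_of_isWordMap B ?_
  have := CE.IsLin.isWordMap B.deg h.1
  convert this using 1
  funext w
  ext u
  exact (h.2 w u).symm

theorem Represents.congr {U V : GrSp K} {m n : ℤ} {f : L.Raw U V}
    {F : CE.gr B.deg U →ₗ[K] CE.gr B.deg V} (hF : L.Represents B m f F) (h : m = n) :
    L.Represents B n f F := h ▸ hF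

theorem Represents.eq (h : L.Represents B n f F) (h' : L.Represents B n f' F) : f = f' :=
  L.hat_injective B fun w => LinearMap.ext fun u => (h.2 w u).symm.trans (h'.2 w u)

theorem Represents.add (h : L.Represents B n f F) (h' : L.Represents B n f' F') :
    L.Represents B n (f + f') (F + F') :=
  -- Linearity over the graded algebra does not involve the differentials, so the homomorphisms
  -- between modules with zero differentials may be used.
  ⟨Submodule.add_mem (DGModData.hom (CE.mod B.deg 0 U 0) (CE.mod B.deg 0 V 0) n) h.1 h'.1,
    fun w u => by
      rw [LinearMap.add_apply, map_add, h.2, h'.2, hat, hat, hat, ← LinearMap.add_apply, ← smul_add]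
      rfl⟩

theorem Represents.smul (c : K) (h : L.Represents B n f F) : L.Represents B n (c • f) (c • F) :=
  ⟨Submodule.smul_mem (DGModData.hom (CE.mod B.deg 0 U 0) (CE.mod B.deg 0 V 0) n) c h.1,
    fun w u => by
      rw [LinearMap.smul_apply, map_smul, h.2, hat, hat, ← LinearMap.smul_apply, smul_comm]
      rfl⟩

theorem Represents.units_smul (c : ℤˣ) (h : L.Represents B n f F) :
    L.Represents B n (c • f) (c • F) := by
  rcases Int.units_eq_one_or c with rfl | rfl
  · simpa using h
  · have := h.smul (-1 : K)
    rw [neg_one_smul K f, neg_one_smul K F] at this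
    rwa [Units.neg_smul, one_smul, Units.neg_smul, one_smul]

theorem Represents.sub (h : L.Represents B n f F) (h' : L.Represents B n f' F') :
    L.Represents B n (f - f') (F - F') := by
  have := h.add (h'.smul (-1 : K))
  rwa [neg_one_smul K f', neg_one_smul K F', ← sub_eq_add_neg, ← sub_eq_add_neg] at this

variable (L B) in
theorem represents_zero : L.Represents B n (0 : L.Raw U V) 0 :=
  ⟨Submodule.zero_mem (DGModData.hom (CE.mod B.deg 0 U 0) (CE.mod B.deg 0 V 0) n), fun w u => by
    rw [hat, LinearMap.zero_apply, map_zero]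
    change 0 = ((CE.signExp n (w.map B.deg)).negOnePow • (0 : U →ₗ[K] V)) u
    rw [smul_zero, LinearMap.zero_apply]⟩

variable (L) in
-- Components of a family may be prescribed arbitrarily on basis words. Together with
-- `Represents.mem` this is the fullness of the functor.
theorem exists_represented (hF : CE.IsLin B.deg U V n F) : ∃ f, L.Represents B n f F := by
  obtain ⟨f, hf⟩ := L.exists_hat B n fun w => CE.tay B.deg V w ∘ₗ F ∘ₗ CE.gen B.deg U
  exact ⟨f, hF, fun w u => by rw [hf]; rfl⟩

variable [CharZero K]

/-- A linear map is determined on generators, and a value there by its Taylor coefficients. All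
uniqueness statements about the functor reduce to this one. -/
theorem Represents.unique (h : L.Represents B n f F) (h' : L.Represents B n f F') : F = F' :=
  h.1.ext_gen B.deg h'.1 fun u => CE.eq_of_tay B.deg V fun w => by rw [h.2, h'.2]

variable (B) in
theorem exists_represents (hf : f ∈ L.intertwiner U V n) : ∃ F, L.Represents B n f F := by
  obtain ⟨F, hF, h⟩ := (L.isWordMap_hat B hf).exists_isLin
  exact ⟨F, hF, fun w u => ((L.isWordMap_hat B hf).coe_eq_iff _ u).1 (h u) w⟩

theorem isCEMap_iff (hf : f ∈ L.intertwiner U V n) :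
    L.IsCEMap B U V n f F ↔ L.Represents B n f F := by
  have key : (∀ u, (F (CE.gen B.deg U u) : (Fin N →₀ ℕ) → V) = L.ceSeries B n f u) ↔
      ∀ w u, CE.tay B.deg V w (F (CE.gen B.deg U u)) = L.hat B n f w u := by
    rw [forall_comm]
    refine forall_congr' fun u => ?_
    rw [L.ceSeries_eq, (L.isWordMap_hat B hf).coe_eq_iff]
  rw [IsCEMap, key, ← and_assoc]
  rfl

end Represents

/-! ### Composition -/

theorem comp_apply_basis {U V W : Type u} [AddCommGroup U] [Module K U] [AddCommGroup V]
    [Module K V] [AddCommGroup W] [Module K W] (m n : ℤ) (G : L.Raw V W) (F : L.Raw U V) {k : ℕ}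
    (w : Fin k → Fin N) : L.comp m n G F k (B.basis ∘ w) = ∑ S : Finset (Fin k),
      (shuffleSign (fun l => B.deg (w l)) S * ((m - S.card) * Sᶜ.card +
        (n - Sᶜ.card) * ∑ a ∈ S, B.deg (w a)).negOnePow) •
      (B.ev G (List.ofFn (sub S w)) ∘ₗ B.ev F (List.ofFn (sub Sᶜ w))) := by
  refine (homExt_apply L.g _ ?_ (fun l => B.deg (w l)) _ fun l => B.mem _).trans ?_
  rotate_left
  · rw [sum_apply]
    refine Finset.sum_congr rfl fun S _ => ?_
    rw [B.ev_ofFn, B.ev_ofFn]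
    change (_ : ℤˣ) • (shufflePair (LinearMap.llcomp K U V W) S (G S.card) (F Sᶜ.card)
      fun l => B.basis (w l)) = _
    rw [shufflePair_apply]
    rfl
  · intro d d' h
    refine Finset.sum_congr rfl fun S _ => ?_
    rw [shuffleSign_congr h]
    congr 2
    refine Int.negOnePow_congr ?_
    have h2 : ∀ l, (d l : ZMod 2) = d' l := fun l => (ZMod.intCast_eq_intCast_iff' _ _ 2).2 (h l)
    push_cast
    simp only [h2]

/-- After the twist by `signExp`, the signs of juxtaposition become those of the Leibniz rule, by
`shuffleSign_mul` applied to each shuffle. -/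
theorem hat_comp {U V W : Type u} [AddCommGroup U] [Module K U] [AddCommGroup V]
    [Module K V] [AddCommGroup W] [Module K W] (m n : ℤ) (G : L.Raw V W) (F : L.Raw U V) {k : ℕ}
    (w : Fin k → Fin N) : L.hat B (m + n) (L.comp m n G F) (List.ofFn w) = ∑ S : Finset (Fin k),
      leibnizSign m (fun l => 1 - B.deg (w l)) S •
        (L.hat B m G (List.ofFn (sub S w)) ∘ₗ L.hat B n F (List.ofFn (sub Sᶜ w))) := by
  rw [hat_ofFn, comp_apply_basis, Finset.smul_sum]
  refine Finset.sum_congr rfl fun S _ => ?_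
  rw [smul_smul, shuffleSign_mul m n (fun l => B.deg (w l)) S, hat, hat, List.map_ofFn,
    List.map_ofFn, mul_smul, mul_smul]
  congr 1
  ext u
  simp only [LinearMap.comp_apply, LinearMap.units_int_smul_apply, LinearMap.map_units_int_smul]
  rw [smul_comm]
  rfl

variable {L B} in
theorem Represents.comp [CharZero K] {U V W : GrSp K} {m n : ℤ} {g : L.Raw V W} {f : L.Raw U V}
    {G : CE.gr B.deg V →ₗ[K] CE.gr B.deg W} {F : CE.gr B.deg U →ₗ[K] CE.gr B.deg V}
    (hG : L.Represents B m g G) (hF : L.Represents B n f F) :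
    L.Represents B (m + n) (L.comp m n g f) (G ∘ₗ F) := by
  refine ⟨hG.1.comp hF.1, fun w u => ?_⟩
  obtain ⟨k, w, rfl⟩ : ∃ k, ∃ w' : Fin k → Fin N, w = List.ofFn w' :=
    ⟨w.length, w.get, (List.ofFn_get w).symm⟩
  rw [LinearMap.comp_apply, hG.1.tay_apply, hat_comp, LinearMap.sum_apply]
  refine Finset.sum_congr rfl fun S _ => ?_
  rw [LinearMap.units_int_smul_apply, LinearMap.comp_apply, hF.2, hG.2]

theorem hat_ofLin_nil {U V : Type u} [AddCommGroup U] [Module K U] [AddCommGroup V] [Module K V]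
    (n : ℤ) (φ : U →ₗ[K] V) : L.hat B n (L.ofLin φ) [] = φ := by
  rw [hat, List.map_nil, CE.signExp_nil, Int.negOnePow_zero, one_smul]
  rfl

theorem hat_ofLin_cons {U V : Type u} [AddCommGroup U] [Module K U] [AddCommGroup V] [Module K V]
    (n : ℤ) (φ : U →ₗ[K] V) (α : Fin N) (w : List (Fin N)) :
    L.hat B n (L.ofLin φ) (α :: w) = 0 := by
  rw [hat]
  exact smul_zero _

theorem represents_ofLin {U V : GrSp K} {n : ℤ} {φ : U →ₗ[K] V}
    {F : CE.gr B.deg U →ₗ[K] CE.gr B.deg V} (hF : CE.IsLin B.deg U V n F)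
    (h : ∀ u, F (CE.gen B.deg U u) = CE.gen B.deg V (φ u)) :
    L.Represents B n (L.ofLin φ) F := by
  refine ⟨hF, fun w u => ?_⟩
  rw [h]
  cases w with
  | nil => rw [hat_ofLin_nil, CE.tay_nil, CE.const_gen]
  | cons α w => rw [hat_ofLin_cons, CE.tay_cons, CE.pd_gen, map_zero, LinearMap.zero_apply]

theorem represents_id (U : GrSp K) : L.Represents B 0 (L.ofLin LinearMap.id)
    (LinearMap.id : CE.gr B.deg U →ₗ[K] CE.gr B.deg U) :=
  L.represents_ofLin B ⟨GrSp.id_mem_mapDeg _, fun p a ha x => by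
    rw [zero_mul, Int.negOnePow_zero, one_smul]; rfl⟩ fun u => rfl

end HomotopyLie


/-! ### Products of series -/

namespace CE

variable {K : Type u} [Field K] {N : ℕ} (deg : Fin N → ℤ)

/-- The coefficients of the product of two series. -/
def tmulFun (U V : GrSp K) (x : (Fin N →₀ ℕ) → U) (y : (Fin N →₀ ℕ) → V) :
    (Fin N →₀ ℕ) → U.tensor V :=
  conv deg fun P Q => U.sgn (wt deg Q) (x P) ⊗ₜ[K] y Q

theorem tmulFun_mem_piece {U V : GrSp K} {p q : ℤ} {x : (Fin N →₀ ℕ) → U} {y : (Fin N →₀ ℕ) → V}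
    (hx : x ∈ piece deg U p) (hy : y ∈ piece deg V q) :
    tmulFun deg U V x y ∈ piece deg (U.tensor V) (p + q) := by
  intro R
  refine ⟨?_, fun h => if_neg h⟩
  rw [tmulFun, conv]
  split_ifs with hR
  · refine Submodule.sum_mem _ fun s hs => Submodule.units_int_smul_mem _ _ ?_
    refine GrSp.tmul_mem_tensorGr U V ?_ (U.sgn_mem _ (hx s.1).1) (hy s.2).1
    rw [← Finset.HasAntidiagonal.mem_antidiagonal.1 hs, wt_add]
    ring
  · exact Submodule.zero_mem _

theorem tmulFun_add_left (U V : GrSp K) (x x' : (Fin N →₀ ℕ) → U) (y : (Fin N →₀ ℕ) → V) :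
    tmulFun deg U V (x + x') y = tmulFun deg U V x y + tmulFun deg U V x' y := by
  funext R
  by_cases h : Adm deg R
  · simp [tmulFun, conv, h, TensorProduct.add_tmul, Finset.sum_add_distrib]
  · simp [tmulFun, conv, h]

theorem tmulFun_add_right (U V : GrSp K) (x : (Fin N →₀ ℕ) → U) (y y' : (Fin N →₀ ℕ) → V) :
    tmulFun deg U V x (y + y') = tmulFun deg U V x y + tmulFun deg U V x y' := by
  funext R
  by_cases h : Adm deg R
  · simp [tmulFun, conv, h, TensorProduct.tmul_add, Finset.sum_add_distrib]
  · simp [tmulFun, conv, h]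

theorem tmulFun_smul_left (U V : GrSp K) (c : K) (x : (Fin N →₀ ℕ) → U) (y : (Fin N →₀ ℕ) → V) :
    tmulFun deg U V (c • x) y = c • tmulFun deg U V x y := by
  funext R
  by_cases h : Adm deg R
  · simp only [tmulFun, conv, h, if_true, Pi.smul_apply, Finset.smul_sum, map_smul]
    exact Finset.sum_congr rfl fun p _ => by
      rw [← TensorProduct.smul_tmul', smul_comm c]
  · simp [tmulFun, conv, h]

theorem tmulFun_smul_right (U V : GrSp K) (c : K) (x : (Fin N →₀ ℕ) → U) (y : (Fin N →₀ ℕ) → V) :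
    tmulFun deg U V x (c • y) = c • tmulFun deg U V x y := by
  funext R
  by_cases h : Adm deg R
  · simp only [tmulFun, conv, h, if_true, Pi.smul_apply, Finset.smul_sum]
    exact Finset.sum_congr rfl fun p _ => by
      rw [TensorProduct.tmul_smul, smul_comm c]
  · simp [tmulFun, conv, h]

theorem tmulFun_mem_total (U V : GrSp K) (x : gr deg U) (y : gr deg V) :
    tmulFun deg U V x.1 y.1 ∈ total deg (U.tensor V) := by
  induction x using GrSp.induction_on with
  | hom p x hx =>
    induction y using GrSp.induction_on with
    | hom q y hy => exact Submodule.mem_iSup_of_mem _ (tmulFun_mem_piece deg hx hy)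
    | add y y' h h' =>
      have := Submodule.add_mem _ h h'
      rwa [← tmulFun_add_right] at this
  | add x x' h h' =>
    have := Submodule.add_mem _ h h'
    rwa [← tmulFun_add_left] at this

/-- The product of series. -/
def tmul (U V : GrSp K) : gr deg U →ₗ[K] gr deg V →ₗ[K] gr deg (U.tensor V) :=
  LinearMap.mk₂ K (fun x y => ⟨tmulFun deg U V x.1 y.1, tmulFun_mem_total deg U V x y⟩)
    (fun _ _ _ => Subtype.ext (tmulFun_add_left deg _ _ _ _ _))
    (fun _ _ _ => Subtype.ext (tmulFun_smul_left deg _ _ _ _ _))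
    (fun _ _ _ => Subtype.ext (tmulFun_add_right deg _ _ _ _ _))
    (fun _ _ _ => Subtype.ext (tmulFun_smul_right deg _ _ _ _ _))

theorem tmul_coe (U V : GrSp K) (x : gr deg U) (y : gr deg V) :
    (tmul deg U V x y).1 = conv deg fun P Q => U.sgn (wt deg Q) (x.1 P) ⊗ₜ[K] y.1 Q := rfl

theorem tmul_mem {U V : GrSp K} {p q : ℤ} {x : gr deg U} {y : gr deg V}
    (hx : x ∈ (gr deg U).gr p) (hy : y ∈ (gr deg V).gr q) :
    tmul deg U V x y ∈ (gr deg (U.tensor V)).gr (p + q) :=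
  tmulFun_mem_piece deg hx hy

theorem _root_.GrSp.sgn_even (V : GrSp K) {c : ℤ} (hc : (c : ZMod 2) = 0) : V.sgn c = .id := by
  refine V.hom_ext fun p x hx => ?_
  rw [V.sgn_apply c hx, Int.negOnePow_congr (b := 0) (by push_cast; rw [hc, zero_mul]),
    Int.negOnePow_zero, one_smul]
  rfl

theorem const_tmul (U V : GrSp K) (x : gr deg U) (y : gr deg V) :
    const deg (U.tensor V) (tmul deg U V x y) = const deg U x ⊗ₜ[K] const deg V y := by
  rw [const_apply, tmul_coe, conv_zero_apply, wt_zero, GrSp.sgn_even _ (by simp)]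
  rfl

theorem tmul_units_smul (U V : GrSp K) (c : ℤˣ) (x : gr deg U) (y : gr deg V) :
    tmul deg U V x (c • y) = c • tmul deg U V x y := LinearMap.map_units_int_smul _ _ _

theorem units_smul_tmul (U V : GrSp K) (c : ℤˣ) (x : gr deg U) (y : gr deg V) :
    tmul deg U V (c • x) y = c • tmul deg U V x y :=
  LinearMap.map_units_int_smul ((tmul deg U V).flip y) _ _

theorem units_smul_tmul' {U V : GrSp K} (c : ℤˣ) (x : U) (y : V) :
    (c • x) ⊗ₜ[K] y = c • x ⊗ₜ[K] y :=
  LinearMap.map_units_int_smul ((TensorProduct.mk K U V).flip y) _ _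

theorem tmul_units_smul' {U V : GrSp K} (c : ℤˣ) (x : U) (y : V) :
    x ⊗ₜ[K] (c • y) = c • x ⊗ₜ[K] y :=
  LinearMap.map_units_int_smul (TensorProduct.mk K U V x) _ _

/-- The coefficient `x_P` has degree `p - wt P`. Removing a letter from the right factor changes the
sign operator on `x_P`, and this combines with the sign for passing `θ^P` to the sign for passing
all of `x`. -/
theorem pd_tmul (U V : GrSp K) (α : Fin N) {p : ℤ} {x : gr deg U}
    (hx : x ∈ (gr deg U).gr p) (y : gr deg V) :
    pd deg (U.tensor V) α (tmul deg U V x y) = tmul deg U V (pd deg U α x) y +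
      ((1 - deg α) * p).negOnePow • tmul deg U V x (pd deg V α y) := by
  ext R
  rw [pd_coe, tmul_coe, pdFun_conv, coe_add, coe_units_smul, tmul_coe, tmul_coe, Pi.add_apply]
  · refine congrArg₂ (· + ·) ?_ ?_
    · refine congrFun (congrArg (conv deg) (funext fun P => funext fun Q => ?_)) R
      rw [pd_coe]
      simp only [pdFun]
      rw [LinearMap.map_units_int_smul, map_nsmul, units_smul_tmul', TensorProduct.smul_tmul']
    · rw [conv, conv]
      split_ifs with hR
      · rw [Finset.smul_sum]
        refine Finset.sum_congr rfl fun s _ => ?_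
        rw [pd_coe, smul_comm _ (mulSign deg s.1 s.2)]
        simp only [pdFun]
        have hx' : x.1 s.1 ∈ U.gr (p - wt deg s.1) := (hx s.1).1
        rw [tmul_units_smul', TensorProduct.tmul_smul, wt_add, wt_single,
          U.sgn_apply _ hx', U.sgn_apply _ hx', units_smul_tmul', units_smul_tmul']
        congr 1
        have h : ∀ (a b c : ℤˣ) (k : ℕ) (t : U.tensor V),
            a • c • k • b • t = (a * b) • c • k • t := fun a b c k t => by
          rw [smul_comm k b, smul_comm c b, smul_smul]
        rw [h, h, ← Int.negOnePow_add, ← Int.negOnePow_add, Int.negOnePow_congr]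
        push_cast
        grind
      · simp
  · intro P Q h
    rw [not_and_or] at h
    rcases h with h | h
    · rw [coeff_eq_zero x h, map_zero, TensorProduct.zero_tmul]
    · rw [coeff_eq_zero y h, TensorProduct.tmul_zero]

theorem tmul_act_left [CharZero K] (U V : GrSp K) (a : gr deg (GrSp.ground K)) (x : gr deg U)
    (y : gr deg V) :
    tmul deg U V (act deg U a x) y = act deg (U.tensor V) a (tmul deg U V x y) := by
  induction a using GrSp.induction_on with
  | add a a' h h' => simp only [map_add, LinearMap.add_apply, h, h']
  | hom p a ha =>
  induction x using GrSp.induction_on with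
  | add a a' h h' => simp only [map_add, LinearMap.add_apply, h, h']
  | hom q x hx =>
  rw [← sub_eq_zero]
  let S : Set (gr deg (U.tensor V)) := {z | ∃ p q : ℤ, ∃ a ∈ (gr deg (GrSp.ground K)).gr p,
    ∃ x ∈ (gr deg U).gr q, ∃ y, tmul deg U V (act deg U a x) y -
      act deg (U.tensor V) a (tmul deg U V x y) = z}
  refine eq_zero_of_pd_span deg S ?_ ?_ _ ⟨p, q, a, ha, x, hx, y, rfl⟩
  · rintro _ ⟨p, q, a, ha, x, hx, y, rfl⟩
    rw [map_sub, const_act, const_tmul, const_tmul, const_act, ← TensorProduct.smul_tmul', sub_self]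
  · rintro α _ ⟨p, q, a, ha, x, hx, y, rfl⟩
    rw [map_sub, pd_tmul deg U V α (act_mem deg U ha hx), pd_act deg _ α ha, pd_act deg _ α ha,
      pd_tmul deg U V α hx]
    have h1 := Submodule.subset_span (R := K) (s := S)
      ⟨_, _, _, pd_mem_gr deg _ α ha, x, hx, y, rfl⟩
    have h2 := Submodule.subset_span (R := K) (s := S)
      ⟨_, _, a, ha, _, pd_mem_gr deg _ α hx, y, rfl⟩
    have h3 := Submodule.subset_span (R := K) (s := S)
      ⟨_, _, a, ha, x, hx, pd deg V α y, rfl⟩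
    convert Submodule.add_mem _ (Submodule.add_mem _ h1
      (Submodule.units_int_smul_mem _ (((1 - deg α) * p).negOnePow) h2))
      (Submodule.units_int_smul_mem _ (((1 - deg α) * (p + q)).negOnePow) h3) using 1
    rw [map_add, map_add, LinearMap.add_apply, units_smul_tmul, act_units_smul]
    simp only [smul_add, smul_sub, smul_smul, ← Int.negOnePow_add, ← mul_add]
    abel

theorem tmul_act_right [CharZero K] (U V : GrSp K) {p q : ℤ} {a : gr deg (GrSp.ground K)}
    (ha : a ∈ (gr deg (GrSp.ground K)).gr p) {x : gr deg U} (hx : x ∈ (gr deg U).gr q)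
    (y : gr deg V) : tmul deg U V x (act deg V a y) =
      (p * q).negOnePow • act deg (U.tensor V) a (tmul deg U V x y) := by
  rw [← sub_eq_zero]
  let S : Set (gr deg (U.tensor V)) := {z | ∃ p q : ℤ, ∃ a ∈ (gr deg (GrSp.ground K)).gr p,
    ∃ x ∈ (gr deg U).gr q, ∃ y, tmul deg U V x (act deg V a y) -
      (p * q).negOnePow • act deg (U.tensor V) a (tmul deg U V x y) = z}
  refine eq_zero_of_pd_span deg S ?_ ?_ _ ⟨p, q, a, ha, x, hx, y, rfl⟩
  · rintro _ ⟨p, q, a, ha, x, hx, y, rfl⟩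
    rw [map_sub, LinearMap.map_units_int_smul, const_act, const_tmul, const_tmul, const_act,
      TensorProduct.tmul_smul]
    by_cases hp : p = 0
    · rw [hp, zero_mul, Int.negOnePow_zero, one_smul, sub_self]
    · rw [GrSp.ground_gr hp (const_mem deg _ ha), zero_smul, smul_zero, sub_zero]
  · rintro α _ ⟨p, q, a, ha, x, hx, y, rfl⟩
    rw [map_sub, LinearMap.map_units_int_smul, pd_tmul deg U V α hx, pd_act deg _ α ha,
      pd_act deg _ α ha, pd_tmul deg U V α hx]
    have h1 := Submodule.subset_span (R := K) (s := S)
      ⟨_, _, _, pd_mem_gr deg _ α ha, x, hx, y, rfl⟩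
    have h2 := Submodule.subset_span (R := K) (s := S)
      ⟨_, _, a, ha, _, pd_mem_gr deg _ α hx, y, rfl⟩
    have h3 := Submodule.subset_span (R := K) (s := S)
      ⟨_, _, a, ha, x, hx, pd deg V α y, rfl⟩
    convert Submodule.add_mem _ (Submodule.add_mem _ h2
      (Submodule.units_int_smul_mem _ (((1 - deg α) * q).negOnePow) h1))
      (Submodule.units_int_smul_mem _ (((1 - deg α) * (p + q)).negOnePow) h3) using 1
    rw [map_add, map_add, tmul_units_smul, act_units_smul]
    simp only [smul_add, smul_sub, smul_smul, ← Int.negOnePow_add]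
    rw [Int.negOnePow_congr (show ((p * (q - (1 - deg α)) : ℤ) : ZMod 2) =
        ((p * q + (1 - deg α) * p : ℤ) : ZMod 2) by push_cast; grind),
      Int.negOnePow_congr (show (((1 - deg α) * q + (p - (1 - deg α)) * q : ℤ) : ZMod 2) =
        ((p * q : ℤ) : ZMod 2) by push_cast; ring),
      Int.negOnePow_congr (show (((1 - deg α) * q + (1 - deg α) * p : ℤ) : ZMod 2) =
        (((1 - deg α) * (p + q) : ℤ) : ZMod 2) by push_cast; ring),
      Int.negOnePow_congr (show (((1 - deg α) * (p + q) + p * q : ℤ) : ZMod 2) =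
        ((p * q + ((1 - deg α) * p + (1 - deg α) * q) : ℤ) : ZMod 2) by push_cast; ring)]
    abel

theorem tmul_isLin [CharZero K] (U V : GrSp K) {q : ℤ} {x : gr deg U} (hx : x ∈ (gr deg U).gr q) :
    IsLin deg V (U.tensor V) q (tmul deg U V x) :=
  ⟨fun _ _ hy => GrSp.gr_congr _ (add_comm _ _) (tmul_mem deg hx hy), fun p a ha y => by
    rw [tmul_act_right deg U V ha hx, mul_comm]⟩

theorem tmul_gen_gen (U V : GrSp K) (u : U) (v : V) :
    tmul deg U V (gen deg U u) (gen deg V v) = gen deg (U.tensor V) (u ⊗ₜ[K] v) := by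
  ext R
  rw [tmul_coe, gen_coe, gen_coe, gen_coe]
  by_cases hR : R = 0
  · subst hR
    rw [conv_zero_apply, Pi.single_eq_same, Pi.single_eq_same, Pi.single_eq_same, wt_zero,
      GrSp.sgn_even _ (by simp)]
    rfl
  · rw [Pi.single_eq_of_ne hR, conv]
    split_ifs
    · refine Finset.sum_eq_zero fun p hp => ?_
      by_cases h1 : p.1 = 0
      · have h2 : p.2 ≠ 0 := fun h2 => hR (by
          rw [← Finset.HasAntidiagonal.mem_antidiagonal.1 hp, h1, h2, add_zero])
        rw [Pi.single_eq_of_ne h2, TensorProduct.tmul_zero, smul_zero]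
      · rw [Pi.single_eq_of_ne h1, map_zero, TensorProduct.zero_tmul, smul_zero]
    · rfl

theorem tay_tmul_gen (U V : GrSp K) (w : List (Fin N)) (x : gr deg U) (v : V) :
    tay deg (U.tensor V) w (tmul deg U V x (gen deg V v)) = tay deg U w x ⊗ₜ[K] v := by
  induction x using GrSp.induction_on with
  | add x y h h' => simp only [map_add, LinearMap.add_apply, h, h', TensorProduct.add_tmul]
  | hom p x hx =>
    induction w generalizing p x with
    | nil => rw [tay_nil, const_tmul, const_gen, tay_nil]
    | cons α w ih =>
      rw [tay_cons, pd_tmul deg U V α hx, pd_gen, map_zero, smul_zero, add_zero, tay_cons,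
        ih _ _ (pd_mem_gr deg U α hx)]

/-- For homogeneous `x`, multiplication by `x` from the left is linear of degree `p`, so this is an
instance of the Leibniz rule for linear maps. -/
theorem tay_tmul [CharZero K] (U V : GrSp K) {p : ℤ} {x : gr deg U} (hx : x ∈ (gr deg U).gr p)
    (y : gr deg V) {k : ℕ} (w : Fin k → Fin N) :
    tay deg (U.tensor V) (List.ofFn w) (tmul deg U V x y) = ∑ S : Finset (Fin k),
      leibnizSign p (fun l => 1 - deg (w l)) S •
        tay deg U (List.ofFn (sub S w)) x ⊗ₜ[K] tay deg V (List.ofFn (sub Sᶜ w)) y := by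
  rw [(tmul_isLin deg U V hx).tay_apply]
  exact Finset.sum_congr rfl fun S _ => congrArg _ (tay_tmul_gen deg U V _ _ _)

/-- Balanced bilinear maps of degree `n`. -/
structure IsBal (U V W : GrSp K) (n : ℤ) (b : gr deg U →ₗ[K] gr deg V →ₗ[K] gr deg W) : Prop where
  degree : ∀ p q, ∀ x ∈ (gr deg U).gr p, ∀ y ∈ (gr deg V).gr q, b x y ∈ (gr deg W).gr (p + q + n)
  act_left : ∀ p, ∀ a ∈ (gr deg (GrSp.ground K)).gr p, ∀ x y,
    b (act deg U a x) y = (n * p).negOnePow • act deg W a (b x y)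
  balanced : ∀ p q, ∀ a ∈ (gr deg (GrSp.ground K)).gr p, ∀ x ∈ (gr deg U).gr q, ∀ y,
    b x (act deg V a y) = (p * q).negOnePow • b (act deg U a x) y

theorem tmul_isBal [CharZero K] (U V : GrSp K) :
    IsBal deg U V (U.tensor V) 0 (tmul deg U V) where
  degree p q x hx y hy := GrSp.gr_congr _ (by ring) (tmul_mem deg hx hy)
  act_left p a ha x y := by rw [tmul_act_left, zero_mul, Int.negOnePow_zero, one_smul]
  balanced p q a ha x hx y := by rw [tmul_act_right deg U V ha hx, tmul_act_left]

/-- `eq_zero_of_gen` is used in one variable at a time: first in `x`, against generators on the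
right, then in `y`, against homogeneous `x`. -/
theorem IsBal.ext_gen [CharZero K] {U V W : GrSp K} {n : ℤ}
    {b b' : gr deg U →ₗ[K] gr deg V →ₗ[K] gr deg W} (hb : IsBal deg U V W n b)
    (hb' : IsBal deg U V W n b')
    (h : ∀ u v, b (gen deg U u) (gen deg V v) = b' (gen deg U u) (gen deg V v)) : b = b' := by
  have h1 : ∀ x v, b x (gen deg V v) = b' x (gen deg V v) := fun x v => by
    have : b.flip (gen deg V v) - b'.flip (gen deg V v) = 0 := by
      refine eq_zero_of_gen deg (fun u => ?_) (fun β => (n * (1 - deg β)).negOnePow) fun β x => ?_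
      · rw [LinearMap.sub_apply, LinearMap.flip_apply, LinearMap.flip_apply, h, sub_self]
      · rw [LinearMap.sub_apply, LinearMap.sub_apply, LinearMap.flip_apply, LinearMap.flip_apply,
          LinearMap.flip_apply, LinearMap.flip_apply, hb.act_left _ _ (theta_mem deg β),
          hb'.act_left _ _ (theta_mem deg β), map_sub, smul_sub]
    exact sub_eq_zero.1 (LinearMap.congr_fun this x)
  refine GrSp.hom_ext (gr deg U) (W := gr deg V →ₗ[K] gr deg W) fun q x hx => ?_
  rw [← sub_eq_zero]
  refine eq_zero_of_gen deg (fun v => ?_)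
    (fun β => ((1 - deg β) * q).negOnePow * (n * (1 - deg β)).negOnePow) fun β y => ?_
  · rw [LinearMap.sub_apply, h1, sub_self]
  · rw [LinearMap.sub_apply, LinearMap.sub_apply, hb.balanced _ _ _ (theta_mem deg β) x hx,
      hb'.balanced _ _ _ (theta_mem deg β) x hx, hb.act_left _ _ (theta_mem deg β),
      hb'.act_left _ _ (theta_mem deg β), map_sub, mul_smul, smul_sub, smul_sub]

/-- The lift is the linear extension of `u ⊗ v ↦ b u v`. It agrees with `b` on products of arbitrary
series because both are balanced and agree on generators, so no convergence argument is required. -/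
theorem IsBal.exists_lift [CharZero K] {U V W : GrSp K} {n : ℤ}
    {b : gr deg U →ₗ[K] gr deg V →ₗ[K] gr deg W} (hb : IsBal deg U V W n b) :
    ∃ H, IsLin deg (U.tensor V) W n H ∧ ∀ x y, H (tmul deg U V x y) = b x y := by
  have h0 : TensorProduct.lift ((b ∘ₗ gen deg U).compl₂ (gen deg V)) ∈
      GrSp.mapDeg (U.tensor V) (gr deg W) n := by
    refine GrSp.mapDeg_tensor fun p q u hu v hv => ?_
    exact hb.degree p q _ (gen_mem deg U hu) _ (gen_mem deg V hv)
  have hH := ext_isLin deg h0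
  refine ⟨_, hH, fun x y => ?_⟩
  have hb' : IsBal deg U V W n ((tmul deg U V).compr₂ (ext deg n _ h0)) := by
    refine ⟨fun p q x hx y hy => hH.1 _ _ (tmul_mem deg hx hy), fun p a ha x y => ?_,
      fun p q a ha x hx y => ?_⟩
    · rw [LinearMap.compr₂_apply, LinearMap.compr₂_apply, tmul_act_left, hH.2 p a ha]
    · rw [LinearMap.compr₂_apply, LinearMap.compr₂_apply, tmul_act_left,
        tmul_act_right deg U V ha hx, LinearMap.map_units_int_smul]
  have := hb'.ext_gen deg hb fun u v => by
    rw [LinearMap.compr₂_apply, tmul_gen_gen, CE.ext_gen]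
    rfl
  exact LinearMap.congr_fun (LinearMap.congr_fun this x) y

theorem IsLin.ext_tmul [CharZero K] {U V W : GrSp K} {n : ℤ}
    {H H' : gr deg (U.tensor V) →ₗ[K] gr deg W} (hH : IsLin deg (U.tensor V) W n H)
    (hH' : IsLin deg (U.tensor V) W n H')
    (h : ∀ u v, H (tmul deg U V (gen deg U u) (gen deg V v)) =
      H' (tmul deg U V (gen deg U u) (gen deg V v))) : H = H' := by
  refine hH.ext_gen deg hH' fun t => ?_
  have : H ∘ₗ gen deg (U.tensor V) = H' ∘ₗ gen deg (U.tensor V) := TensorProduct.ext' fun u v => by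
    rw [LinearMap.comp_apply, LinearMap.comp_apply, ← tmul_gen_gen, h]
  exact LinearMap.congr_fun this t

end CE


/-! ### Tensor products of linear maps and the odot product -/

namespace CE

variable {K : Type u} [Field K] {N : ℕ} (deg : Fin N → ℤ)

theorem IsLin.exists_tensor [CharZero K] {U U' V V' : GrSp K} {m n : ℤ}
    {F : gr deg U →ₗ[K] gr deg U'} {G : gr deg V →ₗ[K] gr deg V'} (hF : IsLin deg U U' m F)
    (hG : IsLin deg V V' n G) : ∃ H, IsLin deg (U.tensor V) (U'.tensor V') (m + n) H ∧
      ∀ p, ∀ x ∈ (gr deg U).gr p, ∀ y,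
        H (tmul deg U V x y) = (n * p).negOnePow • tmul deg U' V' (F x) (G y) := by
  -- The operator `sgn n` makes the Koszul sign `(-1)^(n |x|)` linear in `x`, so that the pairing is
  -- defined on inhomogeneous series as well.
  let b : gr deg U →ₗ[K] gr deg V →ₗ[K] gr deg (U'.tensor V') :=
    (tmul deg U' V').compl₁₂ (F ∘ₗ (gr deg U).sgn n) G
  have hb : ∀ p, ∀ x ∈ (gr deg U).gr p, ∀ y,
      b x y = (n * p).negOnePow • tmul deg U' V' (F x) (G y) := fun p x hx y => by
    simp only [b, LinearMap.compl₁₂_apply, LinearMap.comp_apply]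
    rw [GrSp.sgn_apply _ n hx, LinearMap.map_units_int_smul, units_smul_tmul]
  have h : IsBal deg U V (U'.tensor V') (m + n) b := by
    refine ⟨fun p q x hx y hy => ?_, fun p a ha x y => ?_, fun p q a ha x hx y => ?_⟩
    · rw [hb p x hx]
      exact Submodule.units_int_smul_mem _ _
        (GrSp.gr_congr _ (by ring) (tmul_mem deg (hF.1 _ _ hx) (hG.1 _ _ hy)))
    · induction x using GrSp.induction_on with
      | add x x' h h' => simp only [map_add, LinearMap.add_apply, h, h', smul_add]
      | hom q x hx =>
        rw [hb q x hx, hb _ _ (act_mem deg U ha hx), hF.2 p a ha, units_smul_tmul, tmul_act_left,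
          act_units_smul, smul_smul, smul_smul, ← Int.negOnePow_add, ← Int.negOnePow_add,
          Int.negOnePow_congr]
        push_cast
        grind
    · rw [hb q x hx, hb _ _ (act_mem deg U ha hx), hF.2 p a ha, hG.2 p a ha, units_smul_tmul,
        tmul_act_left, tmul_units_smul, tmul_act_right deg U' V' ha (hF.1 _ _ hx)]
      simp only [smul_smul, ← Int.negOnePow_add]
      rw [Int.negOnePow_congr]
      push_cast
      grind
  obtain ⟨H, hH, h⟩ := h.exists_lift
  exact ⟨H, hH, fun p x hx y => by rw [h, hb p x hx]⟩

end CE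

namespace HomotopyLie

variable {K : Type u} [Field K] (L : HomotopyLie K) {N : ℕ} (B : HomogeneousBasis L.g N)

theorem odot_apply_basis {U U' V V' : GrSp K} (m n : ℤ) (F : L.Raw U U') (G : L.Raw V V') {k : ℕ}
    (w : Fin k → Fin N) : L.odot m n F G k (B.basis ∘ w) = ∑ S : Finset (Fin k),
      (shuffleSign (fun l => B.deg (w l)) S * ((m - S.card) * Sᶜ.card +
        (n - Sᶜ.card) * ∑ a ∈ S, B.deg (w a)).negOnePow) •
      TensorProduct.map (B.ev F (List.ofFn (sub S w)) ∘ₗ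
        U.sgn ((∑ a ∈ Sᶜ, B.deg (w a)) + n - Sᶜ.card)) (B.ev G (List.ofFn (sub Sᶜ w))) := by
  refine (homExt_apply L.g _ ?_ (fun l => B.deg (w l)) _ fun l => B.mem _).trans ?_
  rotate_left
  · rw [sum_apply]
    refine Finset.sum_congr rfl fun S _ => ?_
    rw [B.ev_ofFn, B.ev_ofFn]
    change (_ : ℤˣ) • (shufflePair (TensorProduct.mapBilinear (.id K) U V U' V') S
        ((LinearMap.lcomp K U' (U.sgn ((∑ a ∈ Sᶜ, B.deg (w a)) + n - Sᶜ.card))).compMultilinearMap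
          (F S.card))
        (G Sᶜ.card) fun l => B.basis (w l)) = _
    rw [shufflePair_apply]
    rfl
  · intro d d' h
    have h2 : ∀ l, (d l : ZMod 2) = d' l := fun l => (ZMod.intCast_eq_intCast_iff' _ _ 2).2 (h l)
    refine Finset.sum_congr rfl fun S _ => ?_
    rw [shuffleSign_congr h, GrSp.sgn_congr U (c' := (∑ a ∈ Sᶜ, d' a) + n - Sᶜ.card) (by
      push_cast; simp only [h2])]
    congr 2
    refine Int.negOnePow_congr ?_
    push_cast
    simp only [h2]

/-- The factor `(-1)^(n p)` comes from moving `G` past `u`; what remains is the Leibniz rule for the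
product of `F u`, of degree `p + m`, with `G v`. -/
theorem hat_odot {U U' V V' : GrSp K} (m n : ℤ) (F : L.Raw U U') (G : L.Raw V V') {k : ℕ}
    (w : Fin k → Fin N) {p : ℤ} {u : U} (hu : u ∈ U.gr p) (v : V) :
    L.hat B (m + n) (L.odot m n F G) (List.ofFn w) (u ⊗ₜ v) = (n * p).negOnePow •
      ∑ S : Finset (Fin k), leibnizSign (p + m) (fun l => 1 - B.deg (w l)) S •
        (L.hat B m F (List.ofFn (sub S w)) u ⊗ₜ[K] L.hat B n G (List.ofFn (sub Sᶜ w)) v) := by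
  rw [hat_ofFn, odot_apply_basis, Finset.smul_sum, LinearMap.sum_apply, Finset.smul_sum]
  refine Finset.sum_congr rfl fun S _ => ?_
  -- The exponent of the sign operator on `u` splits into `n p` and `p` times the degree of the
  -- letters in the complement of `S`; the latter is the difference of the Leibniz exponents for `p
  -- + m` and `m`.
  have hl : (n * p).negOnePow * leibnizSign (p + m) (fun l => 1 - B.deg (w l)) S =
      ((∑ a ∈ Sᶜ, B.deg (w a) + n - Sᶜ.card) * p).negOnePow *
        leibnizSign m (fun l => 1 - B.deg (w l)) S := by
    simp only [leibnizSign, ← Int.negOnePow_add]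
    refine Int.negOnePow_congr ?_
    rw [Finset.sum_sub_distrib, Finset.sum_const, nsmul_eq_mul, mul_one]
    push_cast
    grind
  rw [smul_smul, shuffleSign_mul m n (fun l => B.deg (w l)) S, smul_smul, hl,
    LinearMap.units_int_smul_apply, TensorProduct.map_tmul, LinearMap.comp_apply,
    U.sgn_apply _ hu, LinearMap.map_units_int_smul, CE.units_smul_tmul', hat, hat,
    LinearMap.units_int_smul_apply, LinearMap.units_int_smul_apply, CE.units_smul_tmul',
    CE.tmul_units_smul', List.map_ofFn, List.map_ofFn]
  simp only [smul_smul]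
  congr 1
  rw [mul_comm _ (leibnizSign _ _ _), mul_comm _ (Int.negOnePow (_ * p)), mul_assoc]
  rw [mul_left_comm]
  rfl

variable {L B} in
theorem Represents.odot [CharZero K] {U U' V V' : GrSp K} {m n : ℤ} {f : L.Raw U U'}
    {g : L.Raw V V'} {F : CE.gr B.deg U →ₗ[K] CE.gr B.deg U'}
    {G : CE.gr B.deg V →ₗ[K] CE.gr B.deg V'}
    {H : CE.gr B.deg (U.tensor V) →ₗ[K] CE.gr B.deg (U'.tensor V')}
    (hF : L.Represents B m f F) (hG : L.Represents B n g G)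
    (hH : CE.IsLin B.deg (U.tensor V) (U'.tensor V') (m + n) H)
    (h : ∀ p, ∀ x ∈ (CE.gr B.deg U).gr p, ∀ y, H (CE.tmul B.deg U V x y) =
      (n * p).negOnePow • CE.tmul B.deg U' V' (F x) (G y)) :
    L.Represents B (m + n) (L.odot m n f g) H := by
  refine ⟨hH, fun w => ?_⟩
  obtain ⟨k, w, rfl⟩ : ∃ k, ∃ w' : Fin k → Fin N, w = List.ofFn w' :=
    ⟨w.length, w.get, (List.ofFn_get w).symm⟩
  refine LinearMap.congr_fun (f := CE.tay B.deg (U'.tensor V') (List.ofFn w) ∘ₗ H ∘ₗ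
    CE.gen B.deg (U.tensor V)) (GrSp.tensor_hom_ext U V fun p q u hu v hv => ?_)
  rw [L.hat_odot B m n f g w hu v, LinearMap.comp_apply, LinearMap.comp_apply, ← CE.tmul_gen_gen,
    h p _ (CE.gen_mem B.deg U hu), LinearMap.map_units_int_smul,
    CE.tay_tmul B.deg U' V' (hF.1.1 _ _ (CE.gen_mem B.deg U hu))]
  congr 1
  refine Finset.sum_congr rfl fun S _ => ?_
  rw [hF.2, hG.2]

end HomotopyLie


/-! ### The Chevalley-Eilenberg differential -/

theorem CE.tay_act_gen {K : Type u} [Field K] {N : ℕ} {deg : Fin N → ℤ} (V : GrSp K) (w : List (Fin N))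
    (a : CE.gr deg (GrSp.ground K)) (v : V) : CE.tay deg V w (CE.act deg V a (CE.gen deg V v)) =
      (CE.tay deg (GrSp.ground K) w a : K) • v := by
  induction a using GrSp.induction_on with
  | add x y h h' => rw [map_add, LinearMap.add_apply, map_add, h, h', map_add]; exact (add_smul _ _ _).symm
  | hom p a ha =>
    induction w generalizing p a with
    | nil => rw [CE.tay_nil, CE.const_act, CE.const_gen, CE.tay_nil]
    | cons α w ih =>
      rw [CE.tay_cons, CE.pd_act deg V α ha, CE.pd_gen, map_zero, smul_zero, add_zero, CE.tay_cons,
        ih _ _ (CE.pd_mem_gr deg _ α ha)]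

namespace HomotopyLie

variable {K : Type u} [Field K] (L : HomotopyLie K) {N : ℕ} (B : HomogeneousBasis L.g N)

/-- The coefficient of `x_α` in the bracket of a word, with the sign of the Chevalley-Eilenberg
differential. -/
def brCoeff (α : Fin N) (w : List (Fin N)) : K :=
  (CE.signExp 0 (w.map B.deg)).negOnePow • B.basis.repr (B.ev L.ℓ w) α

theorem ell_mem (U : GrSp K) : L.ell U ∈ L.intertwiner U (L.g.tensor U) 2 := by
  intro k d x hx
  refine ⟨fun p u hu => GrSp.tmul_mem_tensorGr L.g U ?_ (L.degree k d x hx) hu, fun a b hab => ?_⟩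
  · ring
  · change TensorProduct.mk K L.g U (L.ℓ k (x ∘ Equiv.swap a b)) =
      -((d a * d b).negOnePow • TensorProduct.mk K L.g U (L.ℓ k x))
    rw [L.skew k d x hx a b hab, map_neg, LinearMap.map_units_int_smul]

theorem ev_varrho {U V : GrSp K} (f : L.Raw U V) (w : List (Fin N)) (β : Fin N) (u : U) :
    B.ev (L.varrho f) w (B.basis β ⊗ₜ u) =
      (w.length + 1 : ℤ).negOnePow • B.ev f (w ++ [β]) u := by
  obtain ⟨k, w, rfl⟩ : ∃ k, ∃ w' : Fin k → Fin N, w = List.ofFn w' :=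
    ⟨w.length, w.get, (List.ofFn_get w).symm⟩
  have h : List.ofFn w ++ [β] = List.ofFn (Fin.snoc w β : Fin (k + 1) → Fin N) := by
    rw [List.ofFn_succ']
    simp
  rw [B.ev_ofFn, h, B.ev_ofFn, Fin.comp_snoc, List.length_ofFn]
  rfl

theorem signExp_append (n : ℤ) (l : List ℤ) (b : ℤ) : CE.signExp n (l ++ [b]) =
    CE.signExp n l + b * (l.sum + l.length) + b * (1 + n) := by
  induction l with
  | nil => simp
  | cons d l ih =>
    rw [List.cons_append, CE.signExp_cons, CE.signExp_cons, ih]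
    simp only [List.sum_append, List.sum_cons, List.length_cons, List.sum_nil]
    push_cast
    ring

theorem signExp_sub_one (n : ℤ) (l : List ℤ) :
    CE.signExp (n - 1) l = CE.signExp n l - l.sum := by
  induction l with
  | nil => simp
  | cons d l ih =>
    rw [CE.signExp_cons, CE.signExp_cons, ih, List.sum_cons]
    ring

theorem _root_.CE.KoszulSymm.append_singleton {A : Type*} [AddCommGroup A] {deg : Fin N → ℤ}
    {φ : List (Fin N) → A} (h : CE.KoszulSymm deg φ) (w : List (Fin N)) (β : Fin N) :
    φ (w ++ [β]) = ((1 - deg β) * CE.wordDeg deg w).negOnePow • φ (β :: w) := by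
  have key : ∀ w₁ w₂ : List (Fin N), φ (w₁ ++ w₂ ++ [β]) =
      ((1 - deg β) * CE.wordDeg deg w₂).negOnePow • φ (w₁ ++ β :: w₂) := by
    intro w₁ w₂
    induction w₂ generalizing w₁ with
    | nil => simp
    | cons α w₂ ih =>
      have h1 := ih (w₁ ++ [α])
      simp only [List.append_assoc, List.cons_append, List.nil_append] at h1 ⊢
      rw [h1, h]
      exact Int.negOnePow_smul_smul_congr (by rw [CE.wordDeg_cons]; push_cast; ring)
  exact key [] w

/-- In `varrho f` the new input occupies the last slot before `u`. Koszul symmetry moves it to the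
front, where it acts as a derivative `∂_β`, and the signs depending on the word cancel. -/
theorem hat_varrho {U V : GrSp K} {n : ℤ} {f : L.Raw U V} (hf : f ∈ L.intertwiner U V n)
    (w : List (Fin N)) (β : Fin N) (u : U) : L.hat B (n - 1) (L.varrho f) w (B.basis β ⊗ₜ u) =
      (1 + B.deg β * (1 + n)).negOnePow • L.hat B n f (β :: w) u := by
  rw [hat, LinearMap.units_int_smul_apply, ev_varrho, L.ev_eq_hat B n,
    (L.isWordMap_hat B hf).2.append_singleton]
  simp only [LinearMap.units_int_smul_apply, smul_smul, ← Int.negOnePow_add]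
  rw [Int.negOnePow_congr]
  rw [List.map_append, List.map_singleton, signExp_append, signExp_sub_one, List.length_map]
  have hD : CE.wordDeg B.deg w = w.length - (w.map B.deg).sum := by
    induction w with
    | nil => rfl
    | cons α w ih =>
      rw [CE.wordDeg_cons, ih, List.map_cons, List.sum_cons, List.length_cons]
      push_cast
      ring
  rw [hD]
  have sq : ∀ a : ZMod 2, a * a = a := by decide
  push_cast
  grind

/-- The degree enters the exponent only modulo 2, so `ell`, of degree 2, and `δ θ^α`, with exponent
0, have the same coefficients. -/
theorem signExp_two (l : List ℤ) : (CE.signExp 2 l : ZMod 2) = CE.signExp 0 l := by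
  induction l with
  | nil => rfl
  | cons d l ih =>
    rw [CE.signExp_cons, CE.signExp_cons]
    push_cast
    rw [ih]
    grind

theorem hat_ell (U : GrSp K) (w : List (Fin N)) (u : U) :
    L.hat B 2 (L.ell U) w u = ∑ α, L.brCoeff B α w • B.basis α ⊗ₜ[K] u := by
  rw [hat, LinearMap.units_int_smul_apply, Int.negOnePow_congr (signExp_two _)]
  change _ • (B.ev L.ℓ w ⊗ₜ[K] u) = _
  conv_lhs => rw [← B.basis.sum_repr (B.ev L.ℓ w)]
  rw [TensorProduct.sum_tmul, Finset.smul_sum]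
  refine Finset.sum_congr rfl fun α _ => ?_
  rw [brCoeff, smul_assoc, TensorProduct.smul_tmul']

theorem ev_bracket_mem (w : List (Fin N)) :
    B.ev L.ℓ w ∈ L.g.gr (2 - CE.wordDeg B.deg w) := by
  obtain ⟨k, w, rfl⟩ : ∃ k, ∃ w' : Fin k → Fin N, w = List.ofFn w' :=
    ⟨w.length, w.get, (List.ofFn_get w).symm⟩
  rw [B.ev_ofFn, CE.wordDeg_ofFn]
  exact GrSp.gr_congr _ (by ring) (L.degree k (fun l => B.deg (w l)) _ fun l => B.mem _)

theorem brCoeff_eq_zero {α : Fin N} {w : List (Fin N)} (h : B.deg α ≠ 2 - CE.wordDeg B.deg w) :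
    L.brCoeff B α w = 0 := by
  rw [brCoeff, B.repr_eq_zero (L.ev_bracket_mem B w) h, smul_zero]

/-- The bracket coefficients are those of the intertwiner `ell` on the ground field, whose symmetry
is already known. -/
theorem brCoeff_symm (α : Fin N) : CE.KoszulSymm B.deg (L.brCoeff B α) := by
  intro l l' β γ
  have h := (L.isWordMap_hat B (L.ell_mem (GrSp.ground K))).2 l l' β γ
  have h1 : ∀ w, L.brCoeff B α w = B.basis.repr (TensorProduct.rid K L.g
      (L.hat B 2 (L.ell (GrSp.ground K)) w (1 : K))) α := fun w => by
    rw [hat_ell, map_sum, map_sum, Finsupp.finsetSum_apply, Finset.sum_eq_single α]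
    · simp
    · intro β _ hβ
      simp [hβ]
    · intro h
      exact absurd (Finset.mem_univ _) h
  rw [h1, h1, h, LinearMap.units_int_smul_apply]
  have : ∀ (c : ℤˣ) (t : L.g ⊗[K] K), B.basis.repr (TensorProduct.rid K L.g (c • t)) α =
      c • B.basis.repr (TensorProduct.rid K L.g t) α := fun c t =>
    LinearMap.map_units_int_smul (B.basis.coord α ∘ₗ (TensorProduct.rid K L.g).toLinearMap) c t
  exact this _ _

theorem exists_dtheta [CharZero K] (α : Fin N) : ∃ t : L.ceGr B, t ∈ (L.ceGr B).gr (2 - B.deg α) ∧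
    t.1 = CE.wordSeries B.deg (GrSp.ground K) (L.brCoeff B α) := by
  have h : ∀ w, L.brCoeff B α w ∈ (GrSp.ground K).gr (2 - B.deg α - CE.wordDeg B.deg w) := by
    intro w
    by_cases h : B.deg α = 2 - CE.wordDeg B.deg w
    · exact GrSp.gr_congr _ (by rw [h]; ring) (GrSp.ground_mem _)
    · rw [L.brCoeff_eq_zero B h]
      exact Submodule.zero_mem _
  have := CE.wordSeries_mem_piece B.deg (GrSp.ground K) h
  exact ⟨⟨_, Submodule.mem_iSup_of_mem _ this⟩, this, rfl⟩

/-- The series `δ θ^α`. -/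
def dtheta [CharZero K] (α : Fin N) : L.ceGr B := (L.exists_dtheta B α).choose

section

variable [CharZero K]

theorem dtheta_mem (α : Fin N) : L.dtheta B α ∈ (L.ceGr B).gr (2 - B.deg α) :=
  (L.exists_dtheta B α).choose_spec.1

theorem dtheta_coe (α : Fin N) : (L.dtheta B α).1 =
    CE.series (K := K) (V := K) B.deg fun k w =>
      CE.coeff B.deg K 0 w * B.basis.repr (L.ℓ k (B.basis ∘ w)) α := by
  rw [dtheta, (L.exists_dtheta B α).choose_spec.2, CE.wordSeries_eq_series]
  congr 1
  funext k w
  rw [CE.coeff_eq, brCoeff, B.ev_ofFn]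
  rw [smul_comm, smul_mul_assoc, smul_eq_mul]

theorem tay_dtheta (α : Fin N) (w : List (Fin N)) :
    CE.tay B.deg (GrSp.ground K) w (L.dtheta B α) = L.brCoeff B α w :=
  CE.tay_eq_of_coe B.deg (GrSp.ground K) (L.brCoeff_symm B α)
    (L.exists_dtheta B α).choose_spec.2 w

/-- The Chevalley-Eilenberg differential with values in a graded vector space with the zero
representation. -/
def dTriv (V : GrSp K) : CE.gr B.deg V →ₗ[K] CE.gr B.deg V :=
  ∑ α, CE.act B.deg V (L.dtheta B α) ∘ₗ CE.pd B.deg V α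

theorem dTriv_apply (V : GrSp K) (x : CE.gr B.deg V) : L.dTriv B V x =
    ∑ α, CE.act B.deg V (L.dtheta B α) (CE.pd B.deg V α x) := by
  rw [dTriv, LinearMap.sum_apply]
  rfl

theorem dTriv_mem (V : GrSp K) : L.dTriv B V ∈ GrSp.mapDeg (CE.gr B.deg V) (CE.gr B.deg V) 1 := by
  intro p x hx
  rw [dTriv_apply]
  exact Submodule.sum_mem _ fun α _ => GrSp.gr_congr _ (by ring)
    (CE.act_mem B.deg V (L.dtheta_mem B α) (CE.pd_mem_gr B.deg V α hx))

theorem dTriv_gen (V : GrSp K) (v : V) : L.dTriv B V (CE.gen B.deg V v) = 0 := by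
  rw [dTriv_apply]
  exact Finset.sum_eq_zero fun α _ => by rw [CE.pd_gen, map_zero]

/-- Each summand is a derivation of degree 1: the sign for passing `∂_α` and the sign for passing `δ
θ^α`, which has degree `2 - deg α`, combine to `(-1)^p`. -/
theorem dTriv_act (V : GrSp K) {p : ℤ} {a : L.ceGr B} (ha : a ∈ (L.ceGr B).gr p)
    (x : CE.gr B.deg V) : L.dTriv B V (CE.act B.deg V a x) =
      CE.act B.deg V (L.dTriv B (GrSp.ground K) a) x +
        p.negOnePow • CE.act B.deg V a (L.dTriv B V x) := by
  rw [dTriv_apply, dTriv_apply, dTriv_apply, map_sum, LinearMap.sum_apply, map_sum, Finset.smul_sum,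
    ← Finset.sum_add_distrib]
  refine Finset.sum_congr rfl fun α _ => ?_
  rw [CE.pd_act B.deg V α ha, map_add, CE.act_act, CE.act_units_smul]
  congr 1
  rw [← CE.act_act,
    CE.act_comm B.deg _ _ (L.dtheta_mem B α) ha, CE.units_smul_act, CE.act_act, smul_smul,
    ← Int.negOnePow_add, Int.negOnePow_congr]
  push_cast
  grind

theorem dTriv_theta (α : Fin N) : L.dTriv B (GrSp.ground K) (CE.theta B.deg α) = L.dtheta B α := by
  rw [dTriv_apply, Finset.sum_eq_single α]
  · rw [CE.pd_theta_self, CE.act_one_right]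
  · intro β _ hβ
    rw [CE.pd_theta_of_ne B.deg hβ, map_zero]
  · intro h
    exact absurd (Finset.mem_univ _) h

theorem isCEDifferential_dTriv : L.IsCEDifferential B (L.dTriv B (GrSp.ground K)) :=
  ⟨L.dTriv_mem B _, fun _ _ ha b => L.dTriv_act B _ ha b, fun α => by
    rw [dTriv_theta]; exact L.dtheta_coe B α⟩

/-- A derivation kills 1. The difference of two candidates vanishes on scalars and on each `θ^β`,
hence commutes with multiplication by `θ^β` up to sign, and `eq_zero_of_gen` applies. -/
theorem eq_dTriv {δ : L.ceGr B →ₗ[K] L.ceGr B} (h : L.IsCEDifferential B δ) :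
    δ = L.dTriv B (GrSp.ground K) := by
  rw [← sub_eq_zero]
  have h' := L.isCEDifferential_dTriv B
  refine CE.eq_zero_of_gen B.deg (fun c => ?_) (fun β => (1 - B.deg β).negOnePow) fun β x => ?_
  · have key : ∀ δ', L.IsCEDifferential B δ' → δ' (CE.gen B.deg (GrSp.ground K) (1 : K)) = 0 := by
      intro δ' h
      have h1 := h.2.1 0 _ (CE.one_mem B.deg) (CE.gen B.deg (GrSp.ground K) (1 : K))
      rwa [CE.act_one_right, CE.act_one_right, CE.one_act, Int.negOnePow_zero, one_smul,
        left_eq_add] at h1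
    have h2 : CE.gen B.deg (GrSp.ground K) c = c • CE.gen B.deg (GrSp.ground K) (1 : K) := by
      rw [← map_smul]
      exact congrArg _ (mul_one c).symm
    rw [h2, map_smul, LinearMap.sub_apply, key _ h, key _ h', sub_zero, smul_zero]
  · have h3 : δ (CE.theta B.deg β) = L.dTriv B (GrSp.ground K) (CE.theta B.deg β) :=
      Subtype.ext ((h.2.2 β).trans (h'.2.2 β).symm)
    rw [LinearMap.sub_apply, h.2.1 _ _ (CE.theta_mem B.deg β), h'.2.1 _ _ (CE.theta_mem B.deg β), h3,
      LinearMap.sub_apply, map_sub, smul_sub]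
    abel

end

end HomotopyLie


/-- The value `b` is the degree of the inner bracket of the letters in `S`, which becomes the first
letter of the outer bracket. The Leibniz sign and the two Chevalley-Eilenberg signs then differ from
the sign in the Jacobi identity by a factor that does not depend on `S`. -/
theorem jacobi_sign {k : ℕ} (d : Fin k → ℤ) (S : Finset (Fin k)) (b : ℤ)
    (hb : b = 2 - (S.card - ∑ a ∈ S, d a)) :
    leibnizSign (2 - b) (fun l => 1 - d l) S * ((CE.signExp 0 (List.ofFn (sub S d))).negOnePow *
      (CE.signExp 0 (b :: List.ofFn (sub Sᶜ d))).negOnePow) =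
    (CE.signExp 0 (List.ofFn d) + ∑ a, d a + k).negOnePow *
      (shuffleSign d S * (Sᶜ.card : ℤ).negOnePow) := by
  have h := shuffle_signExp 0 0 d S
  have hk : (k : ℤ) = S.card + Sᶜ.card := by
    rw [← Nat.cast_add, Finset.card_add_card_compl, Fintype.card_fin]
  rw [shuffleSign_eq, leibnizSign, hk, ← Finset.sum_add_sum_compl S d, CE.signExp_cons,
    sum_ofFn_sub]
  simp only [← Int.negOnePow_add]
  refine Int.negOnePow_congr ?_
  simp only [Finset.sum_sub_distrib, Finset.sum_const, nsmul_eq_mul, mul_one, zero_mul,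
    zero_add, zero_sub] at h ⊢
  have hb' : (b : ZMod 2) = S.card + ∑ a ∈ S, (d a : ZMod 2) := by
    rw [hb]
    push_cast
    grind
  push_cast at h ⊢
  grind

/-! ### The Jacobi identity and the square of the differential -/

namespace HomotopyLie

variable {K : Type u} [Field K] [CharZero K] (L : HomotopyLie K) {N : ℕ}
  (B : HomogeneousBasis L.g N)

/-- Up to one common sign, the Taylor coefficient of `δ² θ^α` at a word is the `x_α`-coordinate of
the Jacobi identity for the basis elements of that word. -/
theorem dTriv_dtheta (α : Fin N) : L.dTriv B (GrSp.ground K) (L.dtheta B α) = 0 := by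
  refine CE.eq_zero_of_tay B.deg _ fun w => ?_
  obtain ⟨k, w, rfl⟩ : ∃ k, ∃ w' : Fin k → Fin N, w = List.ofFn w' :=
    ⟨w.length, w.get, (List.ofFn_get w).symm⟩
  set d : Fin k → ℤ := fun l => B.deg (w l) with hd
  set G : ℤˣ := (CE.signExp 0 (List.ofFn d) + ∑ a, d a + k).negOnePow with hG
  have key : ∀ (S : Finset (Fin k)) (β : Fin N),
      leibnizSign (2 - B.deg β) (fun l => 1 - d l) S •
        (L.brCoeff B β (List.ofFn (sub S w)) * L.brCoeff B α (β :: List.ofFn (sub Sᶜ w))) =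
      G • (shuffleSign d S * (Sᶜ.card : ℤ).negOnePow) •
        (B.basis.repr (L.ℓ S.card (sub S (B.basis ∘ w))) β *
          B.basis.repr (L.ℓ (Sᶜ.card + 1) (Fin.cons (B.basis β) (sub Sᶜ (B.basis ∘ w)))) α) := by
    intro S β
    -- The sign identity holds only when `x_β` has the degree of the inner bracket; otherwise its
    -- coordinate in that bracket vanishes and both sides are zero.
    by_cases hβ : B.deg β = 2 - CE.wordDeg B.deg (List.ofFn (sub S w))
    · rw [CE.wordDeg_ofFn, ← List.sum_ofFn] at hβ
      have h := jacobi_sign d S (B.deg β) (by rw [hβ, ← sum_ofFn_sub S d]; rfl)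
      rw [smul_smul, ← h, brCoeff, brCoeff, ← List.ofFn_cons, B.ev_ofFn, B.ev_ofFn,
        Fin.comp_cons, List.ofFn_cons, List.map_cons, List.map_ofFn, List.map_ofFn]
      rw [smul_mul_assoc, mul_smul_comm, smul_smul, smul_smul, ← mul_assoc]
      rfl
    · have h := B.repr_eq_zero (L.ev_bracket_mem B (List.ofFn (sub S w))) hβ
      rw [B.ev_ofFn] at h
      change B.basis.repr (L.ℓ S.card (sub S (B.basis ∘ w))) β = 0 at h
      rw [L.brCoeff_eq_zero B hβ, h, zero_mul, zero_mul, smul_zero, smul_zero, smul_zero]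
  rw [dTriv_apply, map_sum]
  have h1 : ∀ β, CE.tay B.deg (GrSp.ground K) (List.ofFn w) (CE.act B.deg (GrSp.ground K)
      (L.dtheta B β) (CE.pd B.deg (GrSp.ground K) β (L.dtheta B α))) =
      ∑ S : Finset (Fin k), G • (shuffleSign d S * (Sᶜ.card : ℤ).negOnePow) •
        (B.basis.repr (L.ℓ S.card (sub S (B.basis ∘ w))) β *
          B.basis.repr (L.ℓ (Sᶜ.card + 1) (Fin.cons (B.basis β) (sub Sᶜ (B.basis ∘ w)))) α) := by
    intro β
    rw [(CE.act_isLin B.deg (GrSp.ground K) (L.dtheta_mem B β)).tay_apply]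
    refine Finset.sum_congr rfl fun S _ => ?_
    rw [CE.tay_act_gen, ← CE.tay_cons, tay_dtheta, tay_dtheta, ← key]
    rfl
  rw [Finset.sum_congr rfl fun β _ => h1 β, Finset.sum_comm]
  have h2 : ∀ S : Finset (Fin k), ∑ β, G • (shuffleSign d S * (Sᶜ.card : ℤ).negOnePow) •
        (B.basis.repr (L.ℓ S.card (sub S (B.basis ∘ w))) β *
          B.basis.repr (L.ℓ (Sᶜ.card + 1) (Fin.cons (B.basis β) (sub Sᶜ (B.basis ∘ w)))) α) =
      B.basis.coord α (G • (shuffleSign d S * (Sᶜ.card : ℤ).negOnePow) • L.ℓ (Sᶜ.card + 1)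
        (Fin.cons (L.ℓ S.card (sub S (B.basis ∘ w))) (sub Sᶜ (B.basis ∘ w)))) := by
    intro S
    rw [← Finset.smul_sum, ← Finset.smul_sum, LinearMap.map_units_int_smul,
      LinearMap.map_units_int_smul]
    congr 2
    -- Expanding the inner bracket in the basis, by linearity of the outer bracket in its first
    -- slot, recovers the sum over `β` that defines `dTriv`.
    conv_rhs => rw [← B.basis.sum_repr (L.ℓ S.card (sub S (B.basis ∘ w))),
      ← MultilinearMap.curryLeft_apply, map_sum, sum_apply, map_sum]
    refine Finset.sum_congr rfl fun β _ => ?_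
    rw [map_smul, smul_apply, map_smul]
    rfl
  rw [Finset.sum_congr rfl fun S _ => h2 S, ← map_sum, ← Finset.smul_sum,
    L.jacobi k d (B.basis ∘ w) fun l => B.mem _, smul_zero, map_zero]

/-- The cross terms in the square of an odd derivation cancel, so the square commutes with
multiplication by `θ^β` once `δ² θ^β = 0`; it also vanishes on the generators. -/
theorem dTriv_dTriv (V : GrSp K) (x : CE.gr B.deg V) : L.dTriv B V (L.dTriv B V x) = 0 := by
  have : L.dTriv B V ∘ₗ L.dTriv B V = 0 := by
    refine CE.eq_zero_of_gen B.deg (fun v => ?_) (fun _ => 1) fun β y => ?_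
    · rw [LinearMap.comp_apply, dTriv_gen, map_zero]
    · rw [LinearMap.comp_apply, dTriv_act L B V (CE.theta_mem B.deg β), dTriv_theta, map_add,
        LinearMap.map_units_int_smul, dTriv_act L B V (L.dtheta_mem B β), dTriv_dtheta,
        dTriv_act L B V (CE.theta_mem B.deg β), dTriv_theta, LinearMap.map_zero₂, zero_add,
        smul_add, smul_smul, ← Int.negOnePow_add, one_smul,
        LinearMap.comp_apply, Int.negOnePow_even (1 - B.deg β + (1 - B.deg β)) ⟨_, rfl⟩, one_smul,
        Int.negOnePow_congr (a := 2 - B.deg β) (b := 1 + (1 - B.deg β)) (by push_cast; grind),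
        ← Int.neg_negOnePow_smul, neg_add_cancel_left]
  exact LinearMap.congr_fun this x

/-- The Chevalley-Eilenberg algebra. -/
abbrev ceAlg : DGAlg K := CE.alg B.deg (L.dTriv B (GrSp.ground K))

theorem ceAlg_isCDGA : (L.ceAlg B).IsCDGA where
  mul_mem _ _ _ ha _ hb := CE.act_mem B.deg _ ha hb
  one_mem := CE.one_mem B.deg
  mul_assoc a b c := CE.act_act B.deg _ a b c
  one_mul a := CE.one_act B.deg _ a
  mul_one a := CE.act_one_right B.deg a
  mul_comm p q _ ha _ hb := CE.act_comm B.deg p q ha hb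
  δ_mem := L.dTriv_mem B _
  δ_one := L.dTriv_gen B _ _
  leibniz _ _ ha b := L.dTriv_act B _ ha b
  δ_δ a := L.dTriv_dTriv B _ a

/-- The module of series with coefficients in `V` and differential `d`. -/
abbrev ceModule (V : GrSp K) (d : CE.gr B.deg V →ₗ[K] CE.gr B.deg V) : DGModData (L.ceAlg B) :=
  CE.mod B.deg (L.dTriv B (GrSp.ground K)) V d

theorem ceModule_isDGModule {V : GrSp K} {R : CE.gr B.deg V →ₗ[K] CE.gr B.deg V}
    (hR : CE.IsLin B.deg V V 1 R) (h : (L.dTriv B V + R) ∘ₗ (L.dTriv B V + R) = 0) :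
    (L.ceModule B V (L.dTriv B V + R)).IsDGModule where
  act_mem _ _ _ ha _ hx := CE.act_mem B.deg V ha hx
  mul_act a b x := CE.act_act B.deg V a b x
  one_act x := CE.one_act B.deg V x
  d_mem := Submodule.add_mem _ (L.dTriv_mem B V) hR.1
  d_act p a ha x := by
    rw [LinearMap.add_apply, LinearMap.add_apply, dTriv_act L B V ha, hR.2 p a ha, one_mul, map_add,
      smul_add, add_assoc]
  d_d x := LinearMap.congr_fun h x

theorem ceModule_dTriv_isDGModule (V : GrSp K) :
    (L.ceModule B V (L.dTriv B V)).IsDGModule := by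
  have := L.ceModule_isDGModule B (V := V) (R := 0)
    (Submodule.zero_mem (DGModData.hom (L.ceModule B V 0) (L.ceModule B V 0) 1)) (by
      rw [add_zero]
      exact LinearMap.ext fun x => L.dTriv_dTriv B V x)
  rwa [add_zero] at this

variable {L B} in
theorem _root_.CE.IsLin.commutator {U V : GrSp K} {n : ℤ}
    {F : CE.gr B.deg U →ₗ[K] CE.gr B.deg V} (hF : CE.IsLin B.deg U V n F) :
    CE.IsLin B.deg U V (n + 1) (L.dTriv B V ∘ₗ F - n.negOnePow • (F ∘ₗ L.dTriv B U)) :=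
  DGModData.d_mem_hom (L.dTriv_mem B _) (L.ceModule_dTriv_isDGModule B U)
    (L.ceModule_dTriv_isDGModule B V) hF

variable {L B} in
theorem represents_ell_gen {U : GrSp K} {E : CE.gr B.deg U →ₗ[K] CE.gr B.deg (L.g.tensor U)}
    (hE : L.Represents B 2 (L.ell U) E) (u : U) : E (CE.gen B.deg U u) =
      ∑ β, CE.act B.deg _ (L.dtheta B β) (CE.gen B.deg (L.g.tensor U) (B.basis β ⊗ₜ[K] u)) := by
  refine CE.eq_of_tay B.deg _ fun w => ?_
  rw [hE.2, hat_ell, map_sum]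
  refine Finset.sum_congr rfl fun β _ => ?_
  rw [CE.tay_act_gen, tay_dtheta]

end HomotopyLie


/-! ### Representations as square-zero perturbations of `dTriv` -/

namespace HomotopyLie

variable {K : Type u} [Field K] [CharZero K] {L : HomotopyLie K} {N : ℕ}
  {B : HomogeneousBasis L.g N}

/-- The linear map belonging to `varrho f` is prescribed on `x_β ⊗ u` by `± ∂_β (F u)`; its Taylor
coefficients are then given by `hat_varrho`. -/
theorem Represents.exists_varrho {U V : GrSp K} {n : ℤ} {f : L.Raw U V}
    {F : CE.gr B.deg U →ₗ[K] CE.gr B.deg V} (hF : L.Represents B n f F) :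
    ∃ G, L.Represents B (n - 1) (L.varrho f) G ∧
      ∀ β u, G (CE.gen B.deg (L.g.tensor U) (B.basis β ⊗ₜ[K] u)) =
        (1 + B.deg β * (1 + n)).negOnePow • CE.pd B.deg V β (F (CE.gen B.deg U u)) := by
  let φ : Fin N → U →ₗ[K] CE.gr B.deg V := fun β =>
    (1 + B.deg β * (1 + n)).negOnePow • (CE.pd B.deg V β ∘ₗ F ∘ₗ CE.gen B.deg U)
  let G₀ : L.g.tensor U →ₗ[K] CE.gr B.deg V := TensorProduct.lift (B.basis.constr K φ)
  have h0 : G₀ ∈ GrSp.mapDeg (L.g.tensor U) (CE.gr B.deg V) (n - 1) := by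
    refine GrSp.mapDeg_tensor fun p q x hx u hu => ?_
    change B.basis.constr K φ x u ∈ _
    rw [B.basis.constr_apply_fintype (S := K), LinearMap.sum_apply]
    refine Submodule.sum_mem _ fun β _ => ?_
    rw [Module.Basis.equivFun_apply, LinearMap.smul_apply]
    by_cases hβ : B.deg β = p
    · refine Submodule.smul_mem _ _ (Submodule.units_int_smul_mem _ _ (GrSp.gr_congr _ ?_
        (CE.pd_mem_gr B.deg V β (hF.1.1 _ _ (CE.gen_mem B.deg U hu)))))
      rw [hβ]
      ring
    · rw [B.repr_eq_zero hx hβ, zero_smul]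
      exact Submodule.zero_mem _
  have hG : ∀ β u, CE.ext B.deg (n - 1) G₀ h0 (CE.gen B.deg (L.g.tensor U) (B.basis β ⊗ₜ[K] u)) =
      (1 + B.deg β * (1 + n)).negOnePow • CE.pd B.deg V β (F (CE.gen B.deg U u)) := by
    intro β u
    rw [CE.ext_gen]
    change B.basis.constr K φ (B.basis β) u = _
    rw [B.basis.constr_basis]
    rfl
  refine ⟨CE.ext B.deg (n - 1) G₀ h0, ⟨CE.ext_isLin B.deg h0, fun w => ?_⟩, hG⟩
  refine LinearMap.congr_fun (f := CE.tay B.deg V w ∘ₗ CE.ext B.deg (n - 1) G₀ h0 ∘ₗ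
    CE.gen B.deg (L.g.tensor U)) (TensorProduct.ext (B.basis.ext fun β => LinearMap.ext fun u => ?_))
  change CE.tay B.deg V w (CE.ext B.deg (n - 1) G₀ h0 (CE.gen B.deg (L.g.tensor U)
    (B.basis β ⊗ₜ[K] u))) = L.hat B (n - 1) (L.varrho f) w (B.basis β ⊗ₜ u)
  rw [hG, LinearMap.map_units_int_smul, L.hat_varrho B hF.mem, ← hF.2, CE.tay_cons]

/-- On a generator the composite is `∑ ± δθ^β ∂_β (F u)`, and the signs collapse to `-1`, leaving
`-dTriv (F u)`. Since `dTriv` kills generators, this is minus the graded commutator there, and both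
maps are linear. -/
theorem Represents.varrho_ell {U V : GrSp K} {n : ℤ} {f : L.Raw U V}
    {F : CE.gr B.deg U →ₗ[K] CE.gr B.deg V} (hF : L.Represents B n f F) :
    L.Represents B (n + 1) (L.comp (n - 1) 2 (L.varrho f) (L.ell U))
      (-(L.dTriv B V ∘ₗ F - n.negOnePow • (F ∘ₗ L.dTriv B U))) := by
  obtain ⟨G, hG, hG'⟩ := hF.exists_varrho
  obtain ⟨E, hE⟩ := exists_represents B (L.ell_mem U)
  have h := (hG.comp hE).congr (show n - 1 + 2 = n + 1 by ring)
  convert h using 1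
  refine CE.IsLin.ext_gen (n := n + 1) B.deg ?_ h.1 fun u => ?_
  · exact Submodule.neg_mem (DGModData.hom (L.ceModule B U 0) (L.ceModule B V 0) (n + 1))
      hF.1.commutator
  · rw [LinearMap.neg_apply, LinearMap.sub_apply, LinearMap.units_int_smul_apply,
      LinearMap.comp_apply, LinearMap.comp_apply, dTriv_gen, map_zero, smul_zero, sub_zero,
      LinearMap.comp_apply, represents_ell_gen hE, map_sum, dTriv_apply, ← Finset.sum_neg_distrib]
    refine Finset.sum_congr rfl fun β _ => ?_
    rw [hG.1.2 _ _ (L.dtheta_mem B β), hG', CE.act_units_smul, smul_smul, ← Int.negOnePow_add,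
      Int.negOnePow_congr (b := 1) (by push_cast; grind), Int.negOnePow_one]
    simp

theorem Represents.eq_iff_of_sub {U V : GrSp K} {n : ℤ} {f f' : L.Raw U V}
    {F F' G : CE.gr B.deg U →ₗ[K] CE.gr B.deg V} (hF : L.Represents B n f F)
    (hF' : L.Represents B n f' F') (h : G = F - F') : f = f' ↔ G = 0 := by
  have h0 : G = 0 ↔ F = F' := by
    subst h
    refine ⟨fun h => LinearMap.ext fun x => sub_eq_zero.1 (LinearMap.congr_fun h x), ?_⟩
    rintro rfl
    exact LinearMap.ext fun x => sub_self _
  rw [h0]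
  constructor
  · rintro rfl
    exact hF.unique hF'
  · rintro rfl
    exact hF.eq hF'

/-- As `dTriv` squares to zero, `(dTriv + R)²` is `R²` plus the graded commutator of `dTriv` and
`R`. The first represents `ρ ρ`, and the second represents minus the composite of `varrho ρ` and
`ell`. -/
theorem isRep_iff (V : L.PreRep) : L.IsRep V ↔ ∃ R, L.Represents B 1 V.ρ R ∧
    (L.dTriv B V.V + R) ∘ₗ (L.dTriv B V.V + R) = 0 := by
  have key : ∀ R, L.Represents B 1 V.ρ R →
      (L.comp 1 1 V.ρ V.ρ = L.comp 0 2 (L.varrho V.ρ) (L.ell V.V) ↔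
        (L.dTriv B V.V + R) ∘ₗ (L.dTriv B V.V + R) = 0) := by
    intro R hR
    have h1 := hR.comp hR
    have h2 : L.Represents B (1 + 1) (L.comp 0 2 (L.varrho V.ρ) (L.ell V.V)) _ := hR.varrho_ell
    have h3 : (L.dTriv B V.V + R) ∘ₗ (L.dTriv B V.V + R) =
        R ∘ₗ R - -(L.dTriv B V.V ∘ₗ R - (1 : ℤ).negOnePow • (R ∘ₗ L.dTriv B V.V)) := by
      ext1 x
      simp only [LinearMap.comp_apply, LinearMap.add_apply, map_add, LinearMap.sub_apply,
        LinearMap.neg_apply, Int.negOnePow_one, LinearMap.units_int_smul_apply, Units.neg_smul,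
        one_smul]
      rw [L.dTriv_dTriv B V.V x]
      abel
    rw [← h1.eq_iff_of_sub h2 h3]
  constructor
  · rintro ⟨h1, h2⟩
    obtain ⟨R, hR⟩ := exists_represents B h1
    exact ⟨R, hR, (key R hR).1 h2⟩
  · rintro ⟨R, hR, h⟩
    exact ⟨hR.mem, (key R hR).2 h⟩

end HomotopyLie


/-! ### Chevalley-Eilenberg modules of representations -/

namespace CE

variable {K : Type u} [Field K] {N : ℕ} {deg : Fin N → ℤ} {U V : GrSp K}
  (F G : gr deg U →ₗ[K] gr deg V)

theorem hom_sub_add_cancel : F - G + G = F := LinearMap.ext fun x => sub_add_cancel (F x) (G x)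

theorem hom_add_sub_cancel : G + (F - G) = F := LinearMap.ext fun x => add_sub_cancel (G x) (F x)

theorem hom_add_sub_cancel_left : F + G - F = G :=
  LinearMap.ext fun x => add_sub_cancel_left (F x) (G x)

variable {F G}

theorem IsLin.congr {m n : ℤ} (hF : IsLin deg U V m F) (h : m = n) : IsLin deg U V n F := h ▸ hF

theorem IsLin.add {n : ℤ} (hF : IsLin deg U V n F) (hG : IsLin deg U V n G) :
    IsLin deg U V n (F + G) :=
  Submodule.add_mem (DGModData.hom (mod deg 0 U 0) (mod deg 0 V 0) n) hF hG

end CE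

namespace HomotopyLie

variable {K : Type u} [Field K] [CharZero K] {L : HomotopyLie K} {N : ℕ}
  {B : HomogeneousBasis L.g N}

/-- Two derivations over the same `δ` differ by a linear map, and `dTriv` vanishes on generators, so
the prescribed values are those of the difference. -/
theorem isCEModuleDifferential_iff {V : L.PreRep} (hV : V.ρ ∈ L.intertwiner V.V V.V 1)
    (d : CE.gr B.deg V.V →ₗ[K] CE.gr B.deg V.V) :
    L.IsCEModuleDifferential B (L.dTriv B (GrSp.ground K)) V d ↔
      L.Represents B 1 V.ρ (d - L.dTriv B V.V) := by
  rw [← isCEMap_iff hV]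
  refine and_congr ⟨fun h => Submodule.sub_mem _ h (L.dTriv_mem B V.V), fun h => ?_⟩
    (and_congr ?_ ?_)
  · have := Submodule.add_mem _ h (L.dTriv_mem B V.V)
    rwa [CE.hom_sub_add_cancel] at this
  · refine forall_congr' fun p => forall₂_congr fun a ha => forall_congr' fun x => ?_
    rw [LinearMap.sub_apply, LinearMap.sub_apply, L.dTriv_act B V.V ha, map_sub, smul_sub, one_mul,
      sub_eq_iff_eq_add]
    rw [sub_add_add_cancel, add_comm]
  · refine forall_congr' fun v => ?_
    rw [LinearMap.sub_apply, dTriv_gen, sub_zero]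

theorem existsUnique_isCEModuleDifferential {V : L.PreRep}
    (hV : V.ρ ∈ L.intertwiner V.V V.V 1) :
    ∃! d, L.IsCEModuleDifferential B (L.dTriv B (GrSp.ground K)) V d := by
  obtain ⟨R, hR⟩ := exists_represents B hV
  refine ⟨L.dTriv B V.V + R, ?_, fun d hd => ?_⟩
  · change L.IsCEModuleDifferential B (L.dTriv B (GrSp.ground K)) V _
    rwa [isCEModuleDifferential_iff hV, CE.hom_add_sub_cancel_left]
  · have hd' := (isCEModuleDifferential_iff hV d).1 hd
    rw [hR.unique hd', CE.hom_add_sub_cancel]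

theorem existsUnique_isCEMap {U V : GrSp K} {n : ℤ} {f : L.Raw U V}
    (hf : f ∈ L.intertwiner U V n) : ∃! φ, L.IsCEMap B U V n f φ := by
  obtain ⟨F, hF⟩ := exists_represents B hf
  exact ⟨F, (isCEMap_iff hf).2 hF, fun G hG => ((isCEMap_iff hf).1 hG).unique hF⟩

theorem existsUnique_isCEDifferential : ∃! δ, L.IsCEDifferential B δ :=
  ⟨_, L.isCEDifferential_dTriv B, fun _ h => L.eq_dTriv B h⟩

variable (L B) in
theorem dTriv_tmul (U V : GrSp K) {p : ℤ} {x : CE.gr B.deg U} (hx : x ∈ (CE.gr B.deg U).gr p)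
    (y : CE.gr B.deg V) : L.dTriv B (U.tensor V) (CE.tmul B.deg U V x y) =
      CE.tmul B.deg U V (L.dTriv B U x) y +
        p.negOnePow • CE.tmul B.deg U V x (L.dTriv B V y) := by
  rw [dTriv_apply, dTriv_apply, dTriv_apply, map_sum, map_sum, LinearMap.sum_apply,
    Finset.smul_sum, ← Finset.sum_add_distrib]
  refine Finset.sum_congr rfl fun β _ => ?_
  rw [CE.pd_tmul B.deg U V β hx, map_add, ← CE.tmul_act_left, CE.act_units_smul,
    CE.tmul_act_right B.deg U V (L.dtheta_mem B β) hx, CE.tmul_act_left, smul_smul,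
    ← Int.negOnePow_add]
  congr 2
  refine Int.negOnePow_congr ?_
  push_cast
  grind

variable (L) in
/-- The square of a derivation over the Chevalley-Eilenberg differential is linear. -/
theorem _root_.CE.IsLin.square {V : GrSp K} {R : CE.gr B.deg V →ₗ[K] CE.gr B.deg V}
    (hR : CE.IsLin B.deg V V 1 R) :
    CE.IsLin B.deg V V 2 ((L.dTriv B V + R) ∘ₗ (L.dTriv B V + R)) := by
  have h : (L.dTriv B V + R) ∘ₗ (L.dTriv B V + R) =
      R ∘ₗ R + (L.dTriv B V ∘ₗ R - (1 : ℤ).negOnePow • (R ∘ₗ L.dTriv B V)) := by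
    ext1 x
    simp only [LinearMap.comp_apply, LinearMap.add_apply, map_add, LinearMap.sub_apply,
      Int.negOnePow_one, LinearMap.units_int_smul_apply, Units.neg_smul, one_smul]
    rw [L.dTriv_dTriv B V x]
    abel
  rw [h]
  exact ((hR.comp hR).congr one_add_one_eq_two).add (hR.commutator.congr one_add_one_eq_two)

/-- `D` assigns to every representation the differential of its Chevalley-Eilenberg module. -/
def IsDifferentials (B : HomogeneousBasis L.g N)
    (D : ∀ V : L.PreRep, CE.gr B.deg V.V →ₗ[K] CE.gr B.deg V.V) : Prop :=
  ∀ V, L.IsRep V → L.Represents B 1 V.ρ (D V - L.dTriv B V.V)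

variable (L B) in
theorem exists_isDifferentials : ∃ D, IsDifferentials (L := L) B D := by
  have h : ∀ V : L.PreRep, ∃ d, L.IsRep V → L.Represents B 1 V.ρ (d - L.dTriv B V.V) := by
    intro V
    by_cases hV : L.IsRep V
    · obtain ⟨d, hd, -⟩ := existsUnique_isCEModuleDifferential (B := B) hV.1
      exact ⟨d, fun _ => (isCEModuleDifferential_iff hV.1 d).1 hd⟩
    -- Values on families that are not representations are irrelevant.
    · exact ⟨0, fun h => absurd h hV⟩
  choose D hD using h
  exact ⟨D, hD⟩

variable {D : ∀ V : L.PreRep, CE.gr B.deg V.V →ₗ[K] CE.gr B.deg V.V}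

theorem isRep_of_sq {V : L.PreRep} {d : CE.gr B.deg V.V →ₗ[K] CE.gr B.deg V.V}
    (h : L.Represents B 1 V.ρ (d - L.dTriv B V.V)) (hd : d ∘ₗ d = 0) : L.IsRep V :=
  isRep_iff (B := B) V |>.2 ⟨_, h, by rwa [CE.hom_add_sub_cancel]⟩

theorem IsDifferentials.isDGModule (hD : IsDifferentials B D) {V : L.PreRep} (hV : L.IsRep V) :
    (L.ceModule B V.V (D V)).IsDGModule := by
  obtain ⟨R, hR, h⟩ := (isRep_iff (B := B) V).1 hV
  have := (hD V hV).unique hR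
  rw [← this] at h
  have := L.ceModule_isDGModule B (hD V hV).1 h
  rwa [CE.hom_add_sub_cancel] at this

theorem IsDifferentials.eq (hD : IsDifferentials B D) {V : L.PreRep} (hV : L.IsRep V)
    {d : CE.gr B.deg V.V →ₗ[K] CE.gr B.deg V.V} (h : L.Represents B 1 V.ρ (d - L.dTriv B V.V)) :
    D V = d := by
  have := (hD V hV).unique h
  rw [← CE.hom_sub_add_cancel (D V) (L.dTriv B V.V), this, CE.hom_sub_add_cancel]

end HomotopyLie


/-! ### Degrees of the structure maps and differentials on tensor products -/

namespace GrSp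

variable {K : Type u} [Field K] (U V W : GrSp K)

theorem assoc_mem : (TensorProduct.assoc K U V W).toLinearMap ∈
    mapDeg ((U.tensor V).tensor W) (U.tensor (V.tensor W)) 0 := by
  refine mapDeg_tensor fun p q t ht w hw => ?_
  refine Submodule.span_induction (p := fun t _ => TensorProduct.assoc K U V W (t ⊗ₜ w) ∈
    (U.tensor (V.tensor W)).gr (p + q + 0)) ?_ ?_ ?_ ?_ ht
  · rintro _ ⟨a, b, rfl, u, hu, v, hv, rfl⟩
    exact tmul_mem_tensorGr U (V.tensor W) (by ring) hu (tmul_mem_tensorGr V W rfl hv hw)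
  · rw [TensorProduct.zero_tmul, map_zero]
    exact Submodule.zero_mem _
  · intro s t _ _ hs ht
    rw [TensorProduct.add_tmul, map_add]
    exact Submodule.add_mem _ hs ht
  · intro c t _ ht
    rw [← TensorProduct.smul_tmul', map_smul]
    exact Submodule.smul_mem _ c ht

theorem lid_mem : (TensorProduct.lid K U).toLinearMap ∈ mapDeg ((ground K).tensor U) U 0 := by
  refine mapDeg_tensor fun p q c hc u hu => ?_
  change c • u ∈ _
  by_cases hp : p = 0
  · exact Submodule.smul_mem _ c (gr_congr _ (by rw [hp]; ring) hu)
  · rw [ground_gr hp hc, zero_smul]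
    exact Submodule.zero_mem _

theorem rid_mem : (TensorProduct.rid K U).toLinearMap ∈ mapDeg (U.tensor (ground K)) U 0 := by
  refine mapDeg_tensor fun p q u hu c hc => ?_
  change TensorProduct.rid K U (u ⊗ₜ c) ∈ _
  rw [TensorProduct.rid_tmul]
  by_cases hq : q = 0
  · exact Submodule.smul_mem _ c (gr_congr _ (by rw [hq]; ring) hu)
  · rw [ground_gr hq hc, zero_smul]
    exact Submodule.zero_mem _

theorem swap_mem : swap U V ∈ mapDeg (U.tensor V) (V.tensor U) 0 := by
  refine mapDeg_tensor fun p q u hu v hv => ?_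
  rw [swap_tmul U V hu hv]
  exact Submodule.units_int_smul_mem _ _ (tmul_mem_tensorGr V U (by ring) hv hu)

end GrSp

namespace CE

variable {K : Type u} [Field K] {N : ℕ} (deg : Fin N → ℤ) {U V : GrSp K} {φ : U →ₗ[K] V}

theorem gen_comp_mem (h : φ ∈ GrSp.mapDeg U V 0) :
    gen deg V ∘ₗ φ ∈ GrSp.mapDeg U (gr deg V) 0 :=
  fun _ _ hx => gen_mem deg V (h _ _ hx)

/-- The extension of a linear map of degree `0` of coefficients to series. -/
def coeffMap (h : φ ∈ GrSp.mapDeg U V 0) : gr deg U →ₗ[K] gr deg V :=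
  ext deg 0 (gen deg V ∘ₗ φ) (gen_comp_mem deg h)

theorem coeffMap_isLin [CharZero K] (h : φ ∈ GrSp.mapDeg U V 0) :
    IsLin deg U V 0 (coeffMap deg h) :=
  ext_isLin deg _

theorem coeffMap_gen (h : φ ∈ GrSp.mapDeg U V 0) (u : U) :
    coeffMap deg h (gen deg U u) = gen deg V (φ u) :=
  ext_gen deg _ u

/-- The two mixed terms `d x ⊗ e y` cancel because `d x` has degree one more than `x`. -/
theorem sq_tmul {d : CE.gr deg U →ₗ[K] CE.gr deg U}
    {e : CE.gr deg V →ₗ[K] CE.gr deg V}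
    {D : CE.gr deg (U.tensor V) →ₗ[K] CE.gr deg (U.tensor V)}
    (hd : d ∈ GrSp.mapDeg (CE.gr deg U) (CE.gr deg U) 1) (hd0 : d ∘ₗ d = 0) (he0 : e ∘ₗ e = 0)
    (hD : ∀ p, ∀ x ∈ (CE.gr deg U).gr p, ∀ y, D (CE.tmul deg U V x y) =
      CE.tmul deg U V (d x) y + p.negOnePow • CE.tmul deg U V x (e y))
    (x : CE.gr deg U) (y : CE.gr deg V) : D (D (CE.tmul deg U V x y)) = 0 := by
  induction x using GrSp.induction_on with
  | add x x' h h' => simp only [map_add, LinearMap.add_apply, h, h', add_zero]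
  | hom p x hx =>
    have h1 : d (d x) = 0 := LinearMap.congr_fun hd0 x
    have h2 : e (e y) = 0 := LinearMap.congr_fun he0 y
    rw [hD p x hx, map_add, LinearMap.map_units_int_smul, hD p x hx, hD _ _ (hd _ _ hx), h1, h2,
      LinearMap.map_zero₂, map_zero, smul_zero, zero_add, add_zero, Int.negOnePow_succ,
      Units.neg_smul, neg_add_cancel]

end CE

namespace HomotopyLie

variable {K : Type u} [Field K] [CharZero K] {L : HomotopyLie K} {N : ℕ}
  {B : HomogeneousBasis L.g N}

theorem represents_coeffMap {U V : GrSp K} {φ : U →ₗ[K] V} (h : φ ∈ GrSp.mapDeg U V 0) :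
    L.Represents B 0 (L.ofLin φ) (CE.coeffMap B.deg h) :=
  L.represents_ofLin B (CE.coeffMap_isLin B.deg h) (CE.coeffMap_gen B.deg h)

theorem exists_represents_tensorObj {U V : L.PreRep} {R : CE.gr B.deg U.V →ₗ[K] CE.gr B.deg U.V}
    {S : CE.gr B.deg V.V →ₗ[K] CE.gr B.deg V.V} (hR : L.Represents B 1 U.ρ R)
    (hS : L.Represents B 1 V.ρ S) : ∃ H, L.Represents B 1 (L.repMon.tensorObj U V).ρ H ∧
      ∀ p, ∀ x ∈ (CE.gr B.deg U.V).gr p, ∀ y,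
        (L.dTriv B (U.V.tensor V.V) + H) (CE.tmul B.deg U.V V.V x y) =
          CE.tmul B.deg U.V V.V ((L.dTriv B U.V + R) x) y +
            p.negOnePow • CE.tmul B.deg U.V V.V x ((L.dTriv B V.V + S) y) := by
  obtain ⟨H₁, h₁, h₁'⟩ := CE.IsLin.exists_tensor B.deg hR.1 (L.represents_id B V.V).1
  obtain ⟨H₂, h₂, h₂'⟩ := CE.IsLin.exists_tensor B.deg (L.represents_id B U.V).1 hS.1
  refine ⟨H₁ + H₂, ((hR.odot (L.represents_id B V.V) h₁ h₁').congr (add_zero 1)).add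
    (((L.represents_id B U.V).odot hS h₂ h₂').congr (zero_add 1)), fun p x hx y => ?_⟩
  rw [LinearMap.add_apply, LinearMap.add_apply, LinearMap.add_apply, LinearMap.add_apply,
    h₁' p x hx, h₂' p x hx, L.dTriv_tmul B U.V V.V hx, map_add, map_add, LinearMap.add_apply,
    zero_mul, one_mul, Int.negOnePow_zero, one_smul, smul_add, LinearMap.id_apply,
    LinearMap.id_apply]
  abel

/-- The square of the differential on the tensor product is linear, so it suffices that it vanish on
products of generators. -/
theorem isRep_tensorObj {U V : L.PreRep} (hU : L.IsRep U) (hV : L.IsRep V) (B : HomogeneousBasis L.g N) :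
    L.IsRep (L.repMon.tensorObj U V) := by
  obtain ⟨R, hR, hR0⟩ := (isRep_iff (B := B) U).1 hU
  obtain ⟨S, hS, hS0⟩ := (isRep_iff (B := B) V).1 hV
  obtain ⟨H, hH, h⟩ := exists_represents_tensorObj hR hS
  refine (isRep_iff (B := B) _).2 ⟨H, hH, ?_⟩
  refine CE.IsLin.ext_tmul B.deg (CE.IsLin.square L hH.1)
    (Submodule.zero_mem (DGModData.hom (L.ceModule B _ 0) (L.ceModule B _ 0) 2)) fun u v => ?_
  exact CE.sq_tmul B.deg (Submodule.add_mem _ (L.dTriv_mem B U.V) hR.1.1) hR0 hS0 h _ _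

theorem isRep_unit (B : HomogeneousBasis L.g N) : L.IsRep L.repMon.unit := by
  refine (isRep_iff (B := B) _).2 ⟨0, L.represents_zero B, ?_⟩
  rw [add_zero]
  exact LinearMap.ext fun x => L.dTriv_dTriv B _ x

variable {D : ∀ V : L.PreRep, CE.gr B.deg V.V →ₗ[K] CE.gr B.deg V.V}

theorem IsDifferentials.unit (hD : IsDifferentials B D) :
    D L.repMon.unit = L.dTriv B (GrSp.ground K) :=
  hD.eq (isRep_unit B) (by
    have := L.represents_zero B (U := GrSp.ground K) (V := GrSp.ground K) (n := 1)
    convert this using 1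
    exact LinearMap.ext fun x => sub_self _)

theorem IsDifferentials.tmul (hD : IsDifferentials B D) {U V : L.PreRep} (hU : L.IsRep U)
    (hV : L.IsRep V) {p : ℤ} {x : CE.gr B.deg U.V} (hx : x ∈ (CE.gr B.deg U.V).gr p)
    (y : CE.gr B.deg V.V) :
    D (L.repMon.tensorObj U V) (CE.tmul B.deg U.V V.V x y) =
      CE.tmul B.deg U.V V.V (D U x) y + p.negOnePow • CE.tmul B.deg U.V V.V x (D V y) := by
  obtain ⟨H, hH, h⟩ := exists_represents_tensorObj (hD U hU) (hD V hV)
  have := hD.eq (isRep_tensorObj hU hV B) (d := L.dTriv B _ + H) (by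
    rwa [CE.hom_add_sub_cancel_left])
  rw [this, h p x hx, CE.hom_add_sub_cancel, CE.hom_add_sub_cancel]

end HomotopyLie


/-! ### Associativity, unit and symmetry of the products of series -/

namespace CE

variable {K : Type u} [Field K] {N : ℕ} (deg : Fin N → ℤ) {U V W : GrSp K}

theorem gen_hom_ext {F G : gr deg U →ₗ[K] gr deg V}
    (h : ∀ p, ∀ u ∈ U.gr p, F (gen deg U u) = G (gen deg U u)) (u : U) :
    F (gen deg U u) = G (gen deg U u) :=
  LinearMap.congr_fun (f := F ∘ₗ gen deg U) (g := G ∘ₗ gen deg U)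
    (U.hom_ext fun p u hu => h p u hu) u

theorem IsLin.act_zero {F : gr deg U →ₗ[K] gr deg V} (hF : IsLin deg U V 0 F)
    (a : gr deg (GrSp.ground K)) (x : gr deg U) : F (act deg U a x) = act deg V a (F x) := by
  induction a using GrSp.induction_on with
  | add a b ha hb => simp only [map_add, LinearMap.add_apply, ha, hb]
  | hom p a ha => rw [hF.2 p a ha, zero_mul, Int.negOnePow_zero, one_smul]

theorem sgn_act (c : ℤ) {p : ℤ} {a : gr deg (GrSp.ground K)}
    (ha : a ∈ (gr deg (GrSp.ground K)).gr p) (x : gr deg U) :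
    (gr deg U).sgn c (act deg U a x) = (c * p).negOnePow • act deg U a ((gr deg U).sgn c x) := by
  induction x using GrSp.induction_on with
  | add x y hx hy => simp only [map_add, hx, hy, smul_add]
  | hom q x hx =>
    rw [GrSp.sgn_apply _ c hx, GrSp.sgn_apply _ c (act_mem deg U ha hx), act_units_smul, smul_smul,
      ← Int.negOnePow_add, mul_add]

variable [CharZero K]

theorem eq_of_gen (c : Fin N → ℤˣ) {F G : gr deg U →ₗ[K] gr deg V}
    (h : ∀ u, F (gen deg U u) = G (gen deg U u))
    (hF : ∀ β y, F (act deg U (theta deg β) y) = c β • act deg V (theta deg β) (F y))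
    (hG : ∀ β y, G (act deg U (theta deg β) y) = c β • act deg V (theta deg β) (G y)) : F = G := by
  have := eq_zero_of_gen deg (F := F - G) (fun u => by rw [LinearMap.sub_apply, h, sub_self]) c
    fun β y => by
      rw [LinearMap.sub_apply, LinearMap.sub_apply, hF, hG, map_sub, smul_sub]
  exact LinearMap.ext fun x => sub_eq_zero.1 (LinearMap.congr_fun this x)

/-- The variables are reduced to generators one after another, from left to right; at each stage
both sides are linear in the current variable with the same sign. On generators only the
reassociation of `u ⊗ v ⊗ w` remains. -/
theorem assoc_tmul (x : gr deg U) (y : gr deg V) (z : gr deg W) :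
    coeffMap deg (GrSp.assoc_mem U V W)
      (tmul deg (U.tensor V) W (tmul deg U V x y) z) =
    tmul deg U (V.tensor W) x (tmul deg V W y z) := by
  have hA := (coeffMap_isLin deg (GrSp.assoc_mem U V W))
  refine LinearMap.congr_fun (f := coeffMap deg (GrSp.assoc_mem U V W) ∘ₗ
    (tmul deg (U.tensor V) W).flip z ∘ₗ (tmul deg U V).flip y)
    (g := (tmul deg U (V.tensor W)).flip (tmul deg V W y z)) ?_ x
  refine eq_of_gen deg (fun _ => 1) (gen_hom_ext deg fun p u hu => ?_) (fun β x => ?_)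
    fun β x => ?_
  · have hu' := gen_mem deg U hu
    refine LinearMap.congr_fun (f := coeffMap deg (GrSp.assoc_mem U V W) ∘ₗ
      (tmul deg (U.tensor V) W).flip z ∘ₗ tmul deg U V (gen deg U u))
      (g := tmul deg U (V.tensor W) (gen deg U u) ∘ₗ (tmul deg V W).flip z) ?_ y
    refine eq_of_gen deg (fun β => ((1 - deg β) * p).negOnePow)
      (gen_hom_ext deg fun q v hv => ?_) (fun β y => ?_) fun β y => ?_
    · have huv := GrSp.tmul_mem_tensorGr U V rfl hu hv
      refine LinearMap.congr_fun (f := coeffMap deg (GrSp.assoc_mem U V W) ∘ₗ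
        tmul deg (U.tensor V) W (tmul deg U V (gen deg U u) (gen deg V v)))
        (g := tmul deg U (V.tensor W) (gen deg U u) ∘ₗ tmul deg V W (gen deg V v)) ?_ z
      refine eq_of_gen deg (fun β => ((1 - deg β) * (p + q)).negOnePow) (fun w => ?_)
        (fun β y => ?_) fun β y => ?_
      · simp only [LinearMap.comp_apply]
        rw [tmul_gen_gen, tmul_gen_gen, tmul_gen_gen, tmul_gen_gen, coeffMap_gen]
        rfl
      · simp only [LinearMap.comp_apply]
        rw [tmul_act_right deg _ _ (theta_mem deg β) (tmul_mem deg hu' (gen_mem deg V hv)),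
          LinearMap.map_units_int_smul, hA.act_zero]
      · simp only [LinearMap.comp_apply]
        rw [tmul_act_right deg _ _ (theta_mem deg β) (gen_mem deg V hv), tmul_units_smul,
          tmul_act_right deg _ _ (theta_mem deg β) hu', smul_smul, ← Int.negOnePow_add, mul_add,
          add_comm]
    · simp only [LinearMap.comp_apply, LinearMap.flip_apply]
      rw [tmul_act_right deg _ _ (theta_mem deg β) hu', units_smul_tmul, tmul_act_left,
        LinearMap.map_units_int_smul, hA.act_zero]
    · simp only [LinearMap.comp_apply, LinearMap.flip_apply]
      rw [tmul_act_left, tmul_act_right deg _ _ (theta_mem deg β) hu']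
  · simp only [LinearMap.comp_apply, LinearMap.flip_apply, one_smul]
    rw [tmul_act_left, tmul_act_left, hA.act_zero]
  · simp only [LinearMap.flip_apply, one_smul]
    rw [tmul_act_left]

theorem lid_tmul (a : gr deg (GrSp.ground K)) (x : gr deg U) :
    coeffMap deg (GrSp.lid_mem U) (tmul deg (GrSp.ground K) U a x) = act deg U a x := by
  have hA := coeffMap_isLin deg (GrSp.lid_mem U)
  refine LinearMap.congr_fun (f := coeffMap deg (GrSp.lid_mem U) ∘ₗ
    (tmul deg (GrSp.ground K) U).flip x) (g := (act deg U).flip x) ?_ a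
  -- The case `a = 1` is settled first, by linearity in `x`; the general case is then linearity in
  -- `a`.
  have h1 : coeffMap deg (GrSp.lid_mem U) ∘ₗ tmul deg (GrSp.ground K) U
      (gen deg (GrSp.ground K) (1 : K)) = LinearMap.id := by
    refine eq_of_gen deg (fun _ => 1) (fun u => ?_) (fun β y => ?_) fun β y => ?_
    · rw [LinearMap.comp_apply, tmul_gen_gen, coeffMap_gen]
      exact congrArg (gen deg U) (one_smul K u)
    · rw [LinearMap.comp_apply, tmul_act_right deg _ _ (theta_mem deg β) (one_mem deg), mul_zero,
        Int.negOnePow_zero, one_smul, one_smul, hA.act_zero]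
      rfl
    · rw [one_smul]
      rfl
  refine eq_of_gen deg (fun _ => 1) (fun c => ?_) (fun β y => ?_) fun β y => ?_
  · have hc : gen deg (GrSp.ground K) c = (c : K) • gen deg (GrSp.ground K) (1 : K) := by
      rw [← map_smul]
      exact congrArg (gen deg (GrSp.ground K)) (mul_one (c : K)).symm
    rw [hc, map_smul, map_smul]
    congr 1
    exact (LinearMap.congr_fun h1 x).trans (one_act deg U x).symm
  · simp only [LinearMap.comp_apply, LinearMap.flip_apply, one_smul]
    rw [tmul_act_left, hA.act_zero]
  · simp only [LinearMap.flip_apply, one_smul]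
    rw [act_act]

theorem swap_tmul {p q : ℤ} {x : gr deg U} {y : gr deg V} (hx : x ∈ (gr deg U).gr p)
    (hy : y ∈ (gr deg V).gr q) : coeffMap deg (GrSp.swap_mem U V) (tmul deg U V x y) =
      (p * q).negOnePow • tmul deg V U y x := by
  have hA := coeffMap_isLin deg (GrSp.swap_mem U V)
  have h1 : ∀ r, ∀ u ∈ U.gr r, coeffMap deg (GrSp.swap_mem U V) ∘ₗ tmul deg U V (gen deg U u) =
      (tmul deg V U).flip (gen deg U u) ∘ₗ (gr deg V).sgn r := by
    intro r u hu
    have hu' := gen_mem deg U hu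
    refine eq_of_gen deg (fun β => ((1 - deg β) * r).negOnePow)
      (gen_hom_ext deg fun q v hv => ?_) (fun β y => ?_) fun β y => ?_
    · simp only [LinearMap.comp_apply, LinearMap.flip_apply]
      rw [GrSp.sgn_apply _ r (gen_mem deg V hv), tmul_gen_gen, coeffMap_gen,
        GrSp.swap_tmul U V hu hv, units_smul_tmul, tmul_gen_gen, LinearMap.map_units_int_smul]
    · simp only [LinearMap.comp_apply]
      rw [tmul_act_right deg _ _ (theta_mem deg β) hu', LinearMap.map_units_int_smul, hA.act_zero]
    · simp only [LinearMap.comp_apply, LinearMap.flip_apply]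
      rw [sgn_act deg r (theta_mem deg β), units_smul_tmul, tmul_act_left, mul_comm]
  have h2 : coeffMap deg (GrSp.swap_mem U V) ∘ₗ (tmul deg U V).flip y =
      tmul deg V U y ∘ₗ (gr deg U).sgn q := by
    refine eq_of_gen deg (fun β => 1) (gen_hom_ext deg fun r u hu => ?_) (fun β x => ?_)
      fun β x => ?_
    · have h := LinearMap.congr_fun (h1 r u hu) y
      simp only [LinearMap.comp_apply, LinearMap.flip_apply] at h ⊢
      rw [h, GrSp.sgn_apply _ _ hy, GrSp.sgn_apply _ _ (gen_mem deg U hu), units_smul_tmul,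
        tmul_units_smul, mul_comm]
    · simp only [LinearMap.comp_apply, LinearMap.flip_apply, one_smul]
      rw [tmul_act_left, hA.act_zero]
    · simp only [LinearMap.comp_apply]
      rw [sgn_act deg q (theta_mem deg β), tmul_units_smul, tmul_act_right deg _ _ (theta_mem deg β) hy,
        smul_smul, ← Int.negOnePow_add, mul_comm q, Int.negOnePow_even _ ⟨_, rfl⟩]
  have h := LinearMap.congr_fun h2 x
  simp only [LinearMap.comp_apply, LinearMap.flip_apply] at h
  rw [h, GrSp.sgn_apply _ _ hx, tmul_units_smul, mul_comm]

/-- The right unit is the left unit after the braiding. On coefficients no sign arises, since the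
ground field sits in degree 0. -/
theorem rid_tmul {p q : ℤ} {a : gr deg (GrSp.ground K)} {x : gr deg U}
    (ha : a ∈ (gr deg (GrSp.ground K)).gr p) (hx : x ∈ (gr deg U).gr q) :
    coeffMap deg (GrSp.rid_mem U) (tmul deg U (GrSp.ground K) x a) =
      (p * q).negOnePow • act deg U a x := by
  have h : coeffMap deg (GrSp.rid_mem U) = coeffMap deg (GrSp.lid_mem U) ∘ₗ
      coeffMap deg (GrSp.swap_mem U (GrSp.ground K)) := by
    refine (coeffMap_isLin deg _).ext_gen deg (((coeffMap_isLin deg _).comp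
      (coeffMap_isLin deg _)).congr (add_zero 0)) fun t => ?_
    rw [LinearMap.comp_apply, coeffMap_gen, coeffMap_gen, coeffMap_gen]
    congr 1
    refine LinearMap.congr_fun (g := (TensorProduct.lid K U).toLinearMap ∘ₗ
      GrSp.swap U (GrSp.ground K)) (GrSp.tensor_hom_ext U (GrSp.ground K) fun r s u hu c hc => ?_) t
    rw [LinearMap.comp_apply, GrSp.swap_tmul U _ hu hc]
    change TensorProduct.rid K U (u ⊗ₜ[K] (c : K)) = TensorProduct.lid K U _
    rw [TensorProduct.rid_tmul]
    by_cases hs : s = 0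
    · rw [hs, mul_zero, Int.negOnePow_zero, one_smul]
      rfl
    · rw [GrSp.ground_gr hs hc, TensorProduct.zero_tmul, smul_zero, map_zero]
      exact zero_smul K u
  rw [h, LinearMap.comp_apply, swap_tmul deg hx ha, LinearMap.map_units_int_smul, lid_tmul, mul_comm]

end CE


/-! ### The tensor structure on the modules of representations -/

namespace CE

variable {K : Type u} [Field K] [CharZero K] {N : ℕ} (deg : Fin N → ℤ) {U U' V V' : GrSp K}

open Classical in
/-- The tensor product of linear maps of degrees `m` and `n`. -/
def tensorMap (m n : ℤ) (F : gr deg U →ₗ[K] gr deg U') (G : gr deg V →ₗ[K] gr deg V') :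
    gr deg (U.tensor V) →ₗ[K] gr deg (U'.tensor V') :=
  if h : IsLin deg U U' m F ∧ IsLin deg V V' n G then (h.1.exists_tensor deg h.2).choose else 0

variable {m n : ℤ} {F : gr deg U →ₗ[K] gr deg U'} {G : gr deg V →ₗ[K] gr deg V'}

theorem tensorMap_isLin (hF : IsLin deg U U' m F) (hG : IsLin deg V V' n G) :
    IsLin deg (U.tensor V) (U'.tensor V') (m + n) (tensorMap deg m n F G) := by
  rw [tensorMap, dif_pos ⟨hF, hG⟩]
  exact (hF.exists_tensor deg hG).choose_spec.1

theorem tensorMap_tmul (hF : IsLin deg U U' m F) (hG : IsLin deg V V' n G) {p : ℤ}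
    {x : gr deg U} (hx : x ∈ (gr deg U).gr p) (y : gr deg V) :
    tensorMap deg m n F G (tmul deg U V x y) =
      (n * p).negOnePow • tmul deg U' V' (F x) (G y) := by
  rw [tensorMap, dif_pos ⟨hF, hG⟩]
  exact (hF.exists_tensor deg hG).choose_spec.2 p x hx y

end CE

namespace HomotopyLie

variable {K : Type u} [Field K] [CharZero K] {L : HomotopyLie K} {N : ℕ}
  {B : HomogeneousBasis L.g N}

theorem Represents.tensorMap {U U' V V' : GrSp K} {m n : ℤ} {f : L.Raw U U'} {g : L.Raw V V'}
    {F : CE.gr B.deg U →ₗ[K] CE.gr B.deg U'} {G : CE.gr B.deg V →ₗ[K] CE.gr B.deg V'}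
    (hF : L.Represents B m f F) (hG : L.Represents B n g G) :
    L.Represents B (m + n) (L.odot m n f g) (CE.tensorMap B.deg m n F G) :=
  hF.odot hG (CE.tensorMap_isLin B.deg hF.1 hG.1) fun _ _ hx y =>
    CE.tensorMap_tmul B.deg hF.1 hG.1 hx y

/-- The tensor product of the Chevalley-Eilenberg modules of representations. -/
abbrev repTensor (D : ∀ V : L.PreRep, CE.gr B.deg V.V →ₗ[K] CE.gr B.deg V.V) :
    DGModData.FamTensor fun V : L.PreRep => L.ceModule B V.V (D V) where
  obj := L.repMon.tensorObj
  tmul U V := CE.tmul B.deg U.V V.V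
  hom m n F G := CE.tensorMap B.deg m n F G
  unit := L.repMon.unit
  ι := LinearMap.id
  assoc U V W := CE.coeffMap B.deg (GrSp.assoc_mem U.V V.V W.V)
  lunit U := CE.coeffMap B.deg (GrSp.lid_mem U.V)
  runit U := CE.coeffMap B.deg (GrSp.rid_mem U.V)
  braid U V := CE.coeffMap B.deg (GrSp.swap_mem U.V V.V)

variable {D : ∀ V : L.PreRep, CE.gr B.deg V.V →ₗ[K] CE.gr B.deg V.V}

theorem IsDifferentials.isTensor (hD : IsDifferentials B D) :
    (repTensor D).IsTensor L.IsRep where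
  isDG hX := hD.isDGModule hX
  isObj hX hY := isRep_tensorObj hX hY B
  unit_isObj := isRep_unit B
  balanced {X Y} _ _ :=
    have h := CE.tmul_isBal B.deg X.V Y.V
    ⟨h.degree, h.act_left, h.balanced⟩
  d_tmul hX hY _ _ hx y := hD.tmul hX hY hx y
  ext _ _ _ n _ hh _ hh' H := CE.IsLin.ext_tmul B.deg (n := n) hh hh' fun _ _ => H _ _
  hom_mem _ _ _ _ _ _ _ _ hf hg := CE.tensorMap_isLin B.deg hf hg
  hom_tmul _ _ _ _ _ _ _ _ hf hg _ _ hx y := CE.tensorMap_tmul B.deg hf hg hx y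
  ι_mem ha := ha
  ι_mul _ _ := rfl
  d_ι a := LinearMap.congr_fun hD.unit a
  ι_surjective a := ⟨a, rfl⟩
  ι_injective _ _ h := h
  assoc_mem _ _ _ := CE.coeffMap_isLin B.deg (GrSp.assoc_mem _ _ _)
  assoc_tmul _ _ _ x y z := CE.assoc_tmul B.deg x y z
  lunit_mem _ := CE.coeffMap_isLin B.deg (GrSp.lid_mem _)
  lunit_tmul _ a x := CE.lid_tmul B.deg a x
  runit_mem _ := CE.coeffMap_isLin B.deg (GrSp.rid_mem _)
  runit_tmul _ _ _ _ _ ha hx := CE.rid_tmul B.deg ha hx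
  braid_mem _ _ := CE.coeffMap_isLin B.deg (GrSp.swap_mem _ _)
  braid_tmul _ _ _ _ _ _ hx hy := CE.swap_tmul B.deg hx hy

theorem IsDifferentials.isSymmetricMonoidal (hD : IsDifferentials B D) :
    ((repTensor D).mon L.IsRep).IsSymmetricMonoidal :=
  hD.isTensor.isSymmetricMonoidal (L.ceAlg_isCDGA B)

/-- Write each module differential as `dTriv` plus the map of `ρ`. The `ρ`-parts of the commutator
represent `ρ f ∓ f ρ`, and the commutator with `dTriv` represents minus the `varrho`-`ell` term. -/
theorem IsDifferentials.represents_d (hD : IsDifferentials B D) {U V : L.PreRep}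
    (hU : L.IsRep U) (hV : L.IsRep V) {n : ℤ} {f : L.Raw U.V V.V}
    {F : CE.gr B.deg U.V →ₗ[K] CE.gr B.deg V.V} (hF : L.Represents B n f F) :
    L.Represents B (n + 1) (L.rep.d (X := U) (Y := V) n f)
      (D V ∘ₗ F - n.negOnePow • (F ∘ₗ D U)) := by
  have h := ((((hD V hV).comp hF).congr (add_comm 1 n)).sub
    ((hF.comp (hD U hU)).units_smul n.negOnePow)).sub hF.varrho_ell
  convert h using 1
  ext1 x
  simp only [LinearMap.sub_apply, LinearMap.comp_apply, LinearMap.units_int_smul_apply, map_sub,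
    LinearMap.neg_apply, smul_sub]
  abel

end HomotopyLie


/-! ### The symmetric monoidal dg-category of representations -/

namespace HomotopyLie

variable {K : Type u} [Field K] [CharZero K] {L : HomotopyLie K} {N : ℕ}
  {B : HomogeneousBasis L.g N}

omit [CharZero K] in
theorem Represents.eq_of_eq {U V : GrSp K} {m n : ℤ} {f g : L.Raw U V}
    {F G : CE.gr B.deg U →ₗ[K] CE.gr B.deg V} (hf : L.Represents B m f F)
    (hg : L.Represents B n g G) (hmn : m = n) (h : F = G) : f = g := by
  subst hmn h
  exact hf.eq hg

theorem Represents.comp_zero {U V W : GrSp K} {g : L.Raw V W} {f : L.Raw U V}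
    {G : CE.gr B.deg V →ₗ[K] CE.gr B.deg W} {F : CE.gr B.deg U →ₗ[K] CE.gr B.deg V}
    (hG : L.Represents B 0 g G) (hF : L.Represents B 0 f F) :
    L.Represents B 0 (L.comp 0 0 g f) (G ∘ₗ F) :=
  (hG.comp hF).congr (add_zero 0)

theorem Represents.tensorMap_zero {U U' V V' : GrSp K} {f : L.Raw U U'} {g : L.Raw V V'}
    {F : CE.gr B.deg U →ₗ[K] CE.gr B.deg U'} {G : CE.gr B.deg V →ₗ[K] CE.gr B.deg V'}
    (hF : L.Represents B 0 f F) (hG : L.Represents B 0 g G) :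
    L.Represents B 0 (L.odot 0 0 f g) (CE.tensorMap B.deg 0 0 F G) :=
  (hF.tensorMap hG).congr (add_zero 0)

variable {D : ∀ V : L.PreRep, CE.gr B.deg V.V →ₗ[K] CE.gr B.deg V.V}

theorem IsDifferentials.isClosed (hD : IsDifferentials B D) {U V : L.PreRep}
    (hU : L.IsRep U) (hV : L.IsRep V) {f : L.Raw U.V V.V}
    {F : CE.gr B.deg U.V →ₗ[K] CE.gr B.deg V.V} (hf : L.Represents B 0 f F)
    (h : ((DGModData.famCat (fun V : L.PreRep => L.ceModule B V.V (D V)) L.IsRep).IsClosed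
      (X := U) (Y := V) F)) : L.rep.IsClosed (X := U) (Y := V) f :=
  ⟨hf.mem, (hD.represents_d hU hV hf).eq_of_eq (L.represents_zero B) rfl h.2⟩

theorem IsDifferentials.isIso (hD : IsDifferentials B D) {U V : L.PreRep}
    (hU : L.IsRep U) (hV : L.IsRep V) {f : L.Raw U.V V.V}
    {F : CE.gr B.deg U.V →ₗ[K] CE.gr B.deg V.V} (hf : L.Represents B 0 f F)
    (h : ((DGModData.famCat (fun V : L.PreRep => L.ceModule B V.V (D V)) L.IsRep).IsIso
      (X := U) (Y := V) F)) : L.rep.IsIso (X := U) (Y := V) f := by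
  obtain ⟨hF, G, hG, h1, h2⟩ := h
  obtain ⟨g, hg⟩ := L.exists_represented (B := B) hG.1
  exact ⟨hD.isClosed hU hV hf hF, g, hD.isClosed hV hU hg hG,
    (hg.comp hf).eq_of_eq (L.represents_id B U.V) (add_zero 0) h1,
    (hf.comp hg).eq_of_eq (L.represents_id B V.V) (add_zero 0) h2⟩

/-- Each axiom stated as an equation is an equality of intertwiners whose two sides are represented
by linear maps; these agree by the same axiom for modules, and `Represents.eq_of_eq` transfers the
equality back. The remaining axioms, on membership and invertibility, are transferred likewise. -/
theorem repMon_isSymmetricMonoidal (B : HomogeneousBasis L.g N) :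
    L.repMon.IsSymmetricMonoidal := by
  obtain ⟨D, hD⟩ := L.exists_isDifferentials B
  have S := hD.isSymmetricMonoidal
  have ex : ∀ {U V : GrSp K} {n : ℤ} {f : L.Raw U V}, f ∈ L.intertwiner U V n →
    ∃ F, L.Represents B n f F := fun hf => exists_represents B hf
  have ob : ∀ {U V : L.PreRep}, L.IsRep U → L.IsRep V → L.IsRep (L.repMon.tensorObj U V) :=
    fun hU hV => isRep_tensorObj hU hV B
  have rid : ∀ U : L.PreRep, L.Represents B 0 (L.rep.id U) LinearMap.id :=
    fun U => L.represents_id B U.V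
  have ras : ∀ U V W : L.PreRep, L.Represents B 0 (L.repMon.assoc U V W)
    ((repTensor D).assoc U V W) := fun U V W =>
    represents_coeffMap (GrSp.assoc_mem U.V V.V W.V)
  have rlu : ∀ U : L.PreRep, L.Represents B 0 (L.repMon.lunit U) ((repTensor D).lunit U) :=
    fun U => represents_coeffMap (GrSp.lid_mem U.V)
  have rru : ∀ U : L.PreRep, L.Represents B 0 (L.repMon.runit U) ((repTensor D).runit U) :=
    fun U => represents_coeffMap (GrSp.rid_mem U.V)
  have rbr : ∀ U V : L.PreRep, L.Represents B 0 (L.repMon.braid U V) ((repTensor D).braid U V) :=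
    fun U V => represents_coeffMap (GrSp.swap_mem U.V V.V)
  have run := isRep_unit (L := L) B
  constructor
  case toIsDGCategory =>
    constructor
    case d_mem =>
      intro X Y hX hY n f hf
      obtain ⟨F, hF⟩ := ex hf
      exact (hD.represents_d hX hY hF).mem
    case d_add =>
      intro X Y hX hY n f hf f' hf'
      obtain ⟨F, hF⟩ := ex hf
      obtain ⟨F', hF'⟩ := ex hf'
      exact (hD.represents_d hX hY (hF.add hF')).eq_of_eq
        ((hD.represents_d hX hY hF).add (hD.represents_d hX hY hF')) rfl
        (S.d_add hX hY n F hF.1 F' hF'.1)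
    case d_smul =>
      intro X Y hX hY n c f hf
      obtain ⟨F, hF⟩ := ex hf
      exact (hD.represents_d hX hY (hF.smul c)).eq_of_eq ((hD.represents_d hX hY hF).smul c) rfl
        (S.d_smul hX hY n c F hF.1)
    case d_d =>
      intro X Y hX hY n f hf
      obtain ⟨F, hF⟩ := ex hf
      exact (hD.represents_d hX hY (hD.represents_d hX hY hF)).eq_of_eq (L.represents_zero B) rfl
        (S.d_d hX hY n F hF.1)
    case id_mem => exact fun {X} _ => (rid X).mem
    case d_id =>
      exact fun {X} hX => (hD.represents_d hX hX (rid X)).eq_of_eq (L.represents_zero B) rfl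
        (S.d_id hX)
    case comp_mem =>
      intro X Y Z hX hY hZ m n g hg f hf
      obtain ⟨F, hF⟩ := ex hf
      obtain ⟨G, hG⟩ := ex hg
      exact (hG.comp hF).mem
    case comp_add =>
      intro X Y Z hX hY hZ m n g hg f hf f' hf'
      obtain ⟨F, hF⟩ := ex hf
      obtain ⟨F', hF'⟩ := ex hf'
      obtain ⟨G, hG⟩ := ex hg
      exact (hG.comp (hF.add hF')).eq_of_eq ((hG.comp hF).add (hG.comp hF')) rfl
        (S.comp_add hX hY hZ m n G hG.1 F hF.1 F' hF'.1)
    case add_comp =>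
      intro X Y Z hX hY hZ m n g hg g' hg' f hf
      obtain ⟨F, hF⟩ := ex hf
      obtain ⟨G', hG'⟩ := ex hg'
      obtain ⟨G, hG⟩ := ex hg
      exact ((hG.add hG').comp hF).eq_of_eq ((hG.comp hF).add (hG'.comp hF)) rfl
        (S.add_comp hX hY hZ m n G hG.1 G' hG'.1 F hF.1)
    case comp_smul =>
      intro X Y Z hX hY hZ m n c g hg f hf
      obtain ⟨F, hF⟩ := ex hf
      obtain ⟨G, hG⟩ := ex hg
      have h := S.comp_smul hX hY hZ m n c G hG.1 F hF.1
      exact ⟨(hG.comp (hF.smul c)).eq_of_eq ((hG.comp hF).smul c) rfl h.1,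
        ((hG.smul c).comp hF).eq_of_eq ((hG.comp hF).smul c) rfl h.2⟩
    case d_comp =>
      intro X Y Z hX hY hZ m n g hg f hf
      obtain ⟨F, hF⟩ := ex hf
      obtain ⟨G, hG⟩ := ex hg
      exact (hD.represents_d hX hZ (hG.comp hF)).eq_of_eq
        ((((hD.represents_d hY hZ hG).comp hF).congr (by ring)).add
          (((hG.comp (hD.represents_d hX hY hF)).congr (by ring)).units_smul m.negOnePow)) rfl
        (S.d_comp hX hY hZ m n G hG.1 F hF.1)
    case id_comp =>
      intro X Y hX hY n f hf
      obtain ⟨F, hF⟩ := ex hf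
      exact ((rid Y).comp hF).eq_of_eq hF (zero_add n) (S.id_comp hX hY n F hF.1)
    case comp_id =>
      intro X Y hX hY n f hf
      obtain ⟨F, hF⟩ := ex hf
      exact (hF.comp (rid X)).eq_of_eq hF (add_zero n) (S.comp_id hX hY n F hF.1)
    case assoc =>
      intro X Y Z W hX hY hZ hW l m n h hh g hg f hf
      obtain ⟨F, hF⟩ := ex hf
      obtain ⟨G, hG⟩ := ex hg
      obtain ⟨H, hH⟩ := ex hh
      exact ((hH.comp hG).comp hF).eq_of_eq (hH.comp (hG.comp hF)) (add_assoc l m n)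
        (S.assoc hX hY hZ hW l m n H hH.1 G hG.1 F hF.1)
  case tensorObj_isObj => exact fun hX hY => ob hX hY
  case unit_isObj => exact run
  case tensorHom_mem =>
    intro X X' Y Y' hX hX' hY hY' m n f hf g hg
    obtain ⟨F, hF⟩ := ex hf
    obtain ⟨G, hG⟩ := ex hg
    exact (hF.tensorMap hG).mem
  case tensorHom_add =>
    intro X X' Y Y' hX hX' hY hY' m n f hf g hg g' hg'
    obtain ⟨F, hF⟩ := ex hf
    obtain ⟨G, hG⟩ := ex hg
    obtain ⟨G', hG'⟩ := ex hg'
    exact (hF.tensorMap (hG.add hG')).eq_of_eq ((hF.tensorMap hG).add (hF.tensorMap hG')) rfl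
      (S.tensorHom_add hX hX' hY hY' m n F hF.1 G hG.1 G' hG'.1)
  case add_tensorHom =>
    intro X X' Y Y' hX hX' hY hY' m n f hf f' hf' g hg
    obtain ⟨F, hF⟩ := ex hf
    obtain ⟨G, hG⟩ := ex hg
    obtain ⟨F', hF'⟩ := ex hf'
    exact ((hF.add hF').tensorMap hG).eq_of_eq ((hF.tensorMap hG).add (hF'.tensorMap hG)) rfl
      (S.add_tensorHom hX hX' hY hY' m n F hF.1 F' hF'.1 G hG.1)
  case tensorHom_smul =>
    intro X X' Y Y' hX hX' hY hY' m n c f hf g hg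
    obtain ⟨F, hF⟩ := ex hf
    obtain ⟨G, hG⟩ := ex hg
    have h := S.tensorHom_smul hX hX' hY hY' m n c F hF.1 G hG.1
    exact ⟨(hF.tensorMap (hG.smul c)).eq_of_eq ((hF.tensorMap hG).smul c) rfl h.1,
      ((hF.smul c).tensorMap hG).eq_of_eq ((hF.tensorMap hG).smul c) rfl h.2⟩
  case d_tensorHom =>
    intro X X' Y Y' hX hX' hY hY' m n f hf g hg
    obtain ⟨F, hF⟩ := ex hf
    obtain ⟨G, hG⟩ := ex hg
    exact (hD.represents_d (ob hX hY) (ob hX' hY') (hF.tensorMap hG)).eq_of_eq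
      ((((hD.represents_d hX hX' hF).tensorMap hG).congr (by ring)).add
        (((hF.tensorMap (hD.represents_d hY hY' hG)).congr (by ring)).units_smul m.negOnePow)) rfl
      (S.d_tensorHom hX hX' hY hY' m n F hF.1 G hG.1)
  case tensorHom_id =>
    exact fun {X Y} hX hY => ((rid X).tensorMap_zero (rid Y)).eq_of_eq (rid _) rfl
      (S.tensorHom_id hX hY)
  case interchange =>
    intro X X' X'' Y Y' Y'' hX hX' hX'' hY hY' hY'' m n m' n' f hf g hg f' hf' g' hg'
    obtain ⟨F, hF⟩ := ex hf
    obtain ⟨G, hG⟩ := ex hg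
    obtain ⟨F', hF'⟩ := ex hf'
    obtain ⟨G', hG'⟩ := ex hg'
    exact ((hF'.tensorMap hG').comp (hF.tensorMap hG)).eq_of_eq
      (((hF'.comp hF).tensorMap (hG'.comp hG)).units_smul _) (by ring)
      (S.interchange hX hX' hX'' hY hY' hY'' m n m' n' F hF.1 G hG.1 F' hF'.1 G' hG'.1)
  case assoc_isIso =>
    exact fun hX hY hZ => hD.isIso (ob (ob hX hY) hZ) (ob hX (ob hY hZ)) (ras _ _ _)
      (S.assoc_isIso hX hY hZ)
  case assoc_natural =>
    intro X X' Y Y' Z Z' hX hX' hY hY' hZ hZ' l m n f hf g hg h hh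
    obtain ⟨F, hF⟩ := ex hf
    obtain ⟨G, hG⟩ := ex hg
    obtain ⟨H, hH⟩ := ex hh
    exact ((ras X' Y' Z').comp ((hF.tensorMap hG).tensorMap hH)).eq_of_eq
      ((hF.tensorMap (hG.tensorMap hH)).comp (ras X Y Z)) (by ring)
      (S.assoc_natural hX hX' hY hY' hZ hZ' l m n F hF.1 G hG.1 H hH.1)
  case lunit_isIso =>
    exact fun hX => hD.isIso (ob run hX) hX (rlu _) (S.lunit_isIso hX)
  case lunit_natural =>
    intro X X' hX hX' n f hf
    obtain ⟨F, hF⟩ := ex hf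
    exact ((rlu X').comp (((rid _).tensorMap hF).congr (zero_add n))).eq_of_eq (hF.comp (rlu X)) (by ring)
      (S.lunit_natural hX hX' n F hF.1)
  case runit_isIso =>
    exact fun hX => hD.isIso (ob hX run) hX (rru _) (S.runit_isIso hX)
  case runit_natural =>
    intro X X' hX hX' n f hf
    obtain ⟨F, hF⟩ := ex hf
    exact ((rru X').comp ((hF.tensorMap (rid _)).congr (add_zero n))).eq_of_eq (hF.comp (rru X)) (by ring)
      (S.runit_natural hX hX' n F hF.1)
  case pentagon =>
    intro X Y Z W hX hY hZ hW
    exact ((ras X Y (L.repMon.tensorObj Z W)).comp_zero (ras (L.repMon.tensorObj X Y) Z W)).eq_of_eq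
      (((rid X).tensorMap_zero (ras Y Z W)).comp_zero
        ((ras X (L.repMon.tensorObj Y Z) W).comp_zero ((ras X Y Z).tensorMap_zero (rid W)))) rfl
      (S.pentagon hX hY hZ hW)
  case triangle =>
    intro X Y hX hY
    exact (((rid X).tensorMap_zero (rlu Y)).comp_zero (ras X L.repMon.unit Y)).eq_of_eq
      ((rru X).tensorMap_zero (rid Y)) rfl (S.triangle hX hY)
  case braid_isIso =>
    exact fun hX hY => hD.isIso (ob hX hY) (ob hY hX) (rbr _ _) (S.braid_isIso hX hY)
  case braid_natural =>
    intro X X' Y Y' hX hX' hY hY' m n f hf g hg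
    obtain ⟨F, hF⟩ := ex hf
    obtain ⟨G, hG⟩ := ex hg
    exact ((rbr X' Y').comp (hF.tensorMap hG)).eq_of_eq
      (((hG.tensorMap hF).comp (rbr X Y)).units_smul _) (by ring)
      (S.braid_natural hX hX' hY hY' m n F hF.1 G hG.1)
  case braid_braid =>
    exact fun {X Y} hX hY => ((rbr Y X).comp_zero (rbr X Y)).eq_of_eq (rid _) rfl
      (S.braid_braid hX hY)
  case hexagon =>
    intro X Y Z hX hY hZ a ha h1 h2
    obtain ⟨A, hA⟩ := ex ha
    refine (rbr (L.repMon.tensorObj X Y) Z).eq_of_eq ((ras Z X Y).comp_zero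
      (((rbr X Z).tensorMap_zero (rid Y)).comp_zero (hA.comp_zero (((rid X).tensorMap_zero (rbr Y Z)).comp_zero
        (ras X Y Z))))) rfl (S.hexagon hX hY hZ A hA.1 ?_ ?_)
    -- The hypothesis that `a` inverts the associator is carried to linear maps by uniqueness of the
    -- representing map.
    · have h := ((ras X Z Y).comp_zero hA)
      rw [show L.comp 0 0 _ a = _ from h1] at h
      exact h.unique (rid _)
    · have h := (hA.comp_zero (ras X Z Y))
      rw [show L.comp 0 0 a _ = _ from h2] at h
      exact h.unique (rid _)

end HomotopyLie


/-! ### Completed semi-free modules -/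

namespace GrSp

variable {K : Type u} [Field K]

/-- The projection onto the part of degree `m`. -/
def proj (V : GrSp K) (m : ℤ) : V →ₗ[K] V :=
  (DirectSum.toModule K ℤ V fun p => if p = m then (V.gr p).subtype else 0) ∘ₗ
    V.decomp.symm.toLinearMap

theorem proj_apply (V : GrSp K) (m : ℤ) {p : ℤ} {x : V} (hx : x ∈ V.gr p) :
    V.proj m x = if p = m then x else 0 := by
  simp only [proj, LinearMap.comp_apply, LinearEquiv.coe_coe, decomp_symm_apply V hx,
    DirectSum.toModule_lof]
  split_ifs <;> simp

theorem proj_mem (V : GrSp K) (m : ℤ) (x : V) : V.proj m x ∈ V.gr m := by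
  induction x using GrSp.induction_on with
  | hom p x hx =>
    rw [proj_apply V m hx]
    split_ifs with h
    · exact gr_congr V h hx
    · exact Submodule.zero_mem _
  | add x y hx hy => rw [map_add]; exact Submodule.add_mem _ hx hy

/-- The inverse of a bijective graded linear map is graded. -/
theorem symm_mem {V W : GrSp K} (e : V ≃ₗ[K] W) (he : ∀ m, ∀ x ∈ V.gr m, e x ∈ W.gr m) {m : ℤ}
    {y : W} (hy : y ∈ W.gr m) : e.symm y ∈ V.gr m := by
  have h : e.toLinearMap ∘ₗ V.proj m = W.proj m ∘ₗ e.toLinearMap := V.hom_ext fun p x hx => by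
    rw [LinearMap.comp_apply, LinearMap.comp_apply, LinearEquiv.coe_coe, proj_apply V m hx,
      proj_apply W m (he p x hx)]
    split_ifs
    · rfl
    · exact map_zero _
  have h1 := LinearMap.congr_fun h (e.symm y)
  rw [LinearMap.comp_apply, LinearMap.comp_apply, LinearEquiv.coe_coe, e.apply_symm_apply,
    proj_apply W m hy, if_pos rfl] at h1
  rw [← h1, e.symm_apply_apply]
  exact proj_mem V m _

end GrSp

namespace DGModData

variable {K : Type u} [Field K] {R : DGAlg K}

/-- Mutually inverse isomorphisms of dg-modules. -/
structure IsInverse {M N : DGModData R} (i : M.M →ₗ[K] N.M) (j : N.M →ₗ[K] M.M) : Prop where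
  mem : i ∈ hom M N 0
  mem' : j ∈ hom N M 0
  d_apply : ∀ x, i (M.d x) = N.d (i x)
  left_inv : ∀ x, j (i x) = x
  right_inv : ∀ y, i (j y) = y

namespace IsInverse

variable {M N : DGModData R} {i : M.M →ₗ[K] N.M} {j : N.M →ₗ[K] M.M} (h : IsInverse i j)

include h

theorem symm : IsInverse j i where
  mem := h.mem'
  mem' := h.mem
  d_apply y := by rw [← h.left_inv (M.d (j y)), h.d_apply, h.right_inv]
  left_inv := h.right_inv
  right_inv := h.left_inv

theorem map_mem {p : ℤ} {x : M.M} (hx : x ∈ M.M.gr p) : i x ∈ N.M.gr p :=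
  GrSp.gr_congr _ (add_zero p) (h.mem.1 p x hx)

theorem map_act {p : ℤ} {a : R.A} (ha : a ∈ R.A.gr p) (x : M.M) : i (M.act a x) = N.act a (i x) := by
  rw [h.mem.2 p a ha, zero_mul, Int.negOnePow_zero, one_smul]

theorem isClosed (P : DGModData R → Prop) : (dgMod R P).IsClosed (X := M) (Y := N) i := by
  refine ⟨h.mem, LinearMap.ext fun x => ?_⟩
  rw [LinearMap.sub_apply, LinearMap.units_int_smul_apply, LinearMap.comp_apply,
    LinearMap.comp_apply, h.d_apply, Int.negOnePow_zero, one_smul, sub_self, LinearMap.zero_apply]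

theorem isIso (P : DGModData R → Prop) : (dgMod R P).IsIso (X := M) (Y := N) i :=
  ⟨h.isClosed P, j, h.symm.isClosed P, LinearMap.ext h.left_inv, LinearMap.ext h.right_inv⟩

end IsInverse
end DGModData

namespace HomotopyLie

variable {K : Type u} [Field K] [CharZero K] {L : HomotopyLie K} {N : ℕ}
  {B : HomogeneousBasis L.g N}

/-- The completed semi-free dg-modules over the Chevalley-Eilenberg algebra. -/
abbrev IsSemiFree (M : DGModData (L.ceAlg B)) : Prop :=
  M.IsDGModule ∧ CE.IsCompletedSemiFree B.deg M

theorem ceModule_isCompletedSemiFree (V : GrSp K) (d : CE.gr B.deg V →ₗ[K] CE.gr B.deg V) :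
    CE.IsCompletedSemiFree B.deg (L.ceModule B V d) :=
  ⟨V, LinearEquiv.refl K _, fun _ _ hx => hx, fun _ _ => rfl⟩

theorem isSemiFree_regular : IsSemiFree (DGModData.regular (L.ceAlg B)) :=
  ⟨L.ceModule_dTriv_isDGModule B (GrSp.ground K),
    ⟨GrSp.ground K, LinearEquiv.refl K _, fun _ _ hx => hx, fun _ _ => rfl⟩⟩

variable {D : ∀ V : L.PreRep, CE.gr B.deg V.V →ₗ[K] CE.gr B.deg V.V}

theorem IsDifferentials.isSemiFree (hD : IsDifferentials B D) {V : L.PreRep} (hV : L.IsRep V) :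
    IsSemiFree (L.ceModule B V.V (D V)) :=
  ⟨hD.isDGModule hV, ceModule_isCompletedSemiFree V.V (D V)⟩

/-- Every completed semi-free dg-module is the Chevalley-Eilenberg module of a representation. -/
theorem IsDifferentials.exists_isInverse (hD : IsDifferentials B D) {M : DGModData (L.ceAlg B)}
    (hM : IsSemiFree M) : ∃ V, L.IsRep V ∧ ∃ i j,
      DGModData.IsInverse (M := L.ceModule B V.V (D V)) (N := M) i j := by
  obtain ⟨hM, V, e, he, he'⟩ := hM
  have hs : ∀ m, ∀ y ∈ M.M.gr m, e.symm y ∈ (CE.gr B.deg V).gr m := fun m y hy =>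
    GrSp.symm_mem (V := CE.gr B.deg V) e he hy
  have hs' : ∀ a y, e.symm (M.act a y) = CE.act B.deg V a (e.symm y) := fun a y => by
    rw [LinearEquiv.symm_apply_eq, he', e.apply_symm_apply]
  have hsu : ∀ (c : ℤˣ) y, e.symm (c • y) = c • e.symm y := fun c y =>
    LinearMap.map_units_int_smul e.symm.toLinearMap c y
  -- The differential of `M` is transported along the isomorphism of graded modules. It is a
  -- derivation over the same `δ` as `dTriv`, so the difference is linear and is represented by some
  -- `ρ`; as `d` squares to zero, `ρ` is a representation.
  let d : CE.gr B.deg V →ₗ[K] CE.gr B.deg V := e.symm.toLinearMap ∘ₗ M.d ∘ₗ e.toLinearMap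
  have hd : ∀ x, d x = e.symm (M.d (e x)) := fun x => rfl
  have hR : CE.IsLin B.deg V V 1 (d - L.dTriv B V) := by
    refine ⟨Submodule.sub_mem _ (fun p x hx => hs _ _ (hM.d_mem _ _ (he _ _ hx)))
      (L.dTriv_mem B V), fun p a ha x => ?_⟩
    rw [LinearMap.sub_apply, LinearMap.sub_apply, L.dTriv_act B V ha, hd, he', hM.d_act p a ha,
      map_add, hsu, hs', hs', e.symm_apply_apply, map_sub, smul_sub, one_mul, hd,
      add_sub_add_left_eq_sub]
  obtain ⟨ρ, hρ⟩ := L.exists_represented hR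
  have hV : L.IsRep ⟨V, ρ⟩ := isRep_of_sq (V := ⟨V, ρ⟩) hρ (LinearMap.ext fun x => by
    rw [LinearMap.comp_apply, hd, hd, e.apply_symm_apply, hM.d_d, map_zero, LinearMap.zero_apply])
  have hDV : D ⟨V, ρ⟩ = d := hD.eq hV hρ
  refine ⟨⟨V, ρ⟩, hV, e.toLinearMap, e.symm.toLinearMap,
    ⟨fun p x hx => GrSp.gr_congr _ (add_zero p).symm (he p x hx), fun p a ha x => ?_⟩,
    ⟨fun p x hx => GrSp.gr_congr _ (add_zero p).symm (hs p x hx), fun p a ha x => ?_⟩,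
    fun x => ?_, e.symm_apply_apply, e.apply_symm_apply⟩
  · rw [zero_mul, Int.negOnePow_zero, one_smul]
    exact he' a x
  · rw [zero_mul, Int.negOnePow_zero, one_smul]
    exact hs' a x
  · change e (D ⟨V, ρ⟩ x) = M.d (e x)
    rw [hDV, hd, e.apply_symm_apply]

/-- The target may be replaced by the isomorphic Chevalley-Eilenberg module of a representation,
where balanced maps have been lifted already. -/
theorem IsDifferentials.exists_lift (hD : IsDifferentials B D) {U V : GrSp K}
    {d₁ : CE.gr B.deg U →ₗ[K] CE.gr B.deg U} {d₂ : CE.gr B.deg V →ₗ[K] CE.gr B.deg V}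
    {d : CE.gr B.deg (U.tensor V) →ₗ[K] CE.gr B.deg (U.tensor V)} {Q : DGModData (L.ceAlg B)}
    (hQ : IsSemiFree Q) {n : ℤ} {b : CE.gr B.deg U →ₗ[K] CE.gr B.deg V →ₗ[K] Q.M}
    (hb : DGModData.IsBalanced (M := L.ceModule B U d₁) (N := L.ceModule B V d₂) n b) :
    ∃ H ∈ DGModData.hom (L.ceModule B (U.tensor V) d) Q n,
      ∀ x y, H (CE.tmul B.deg U V x y) = b x y := by
  obtain ⟨W, -, i, j, h⟩ := hD.exists_isInverse hQ
  have hb' : CE.IsBal B.deg U V W.V n (b.compr₂ j) := by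
    refine ⟨fun p q x hx y hy => h.symm.map_mem (hb.degree p q x hx y hy), fun p a ha x y => ?_,
      fun p q a ha x hx y => ?_⟩
    · rw [LinearMap.compr₂_apply, LinearMap.compr₂_apply]
      exact (congrArg j (hb.act_left p a ha x y)).trans
        ((LinearMap.map_units_int_smul _ _ _).trans (congrArg _ (h.symm.map_act ha _)))
    · rw [LinearMap.compr₂_apply, LinearMap.compr₂_apply]
      exact (congrArg j (hb.balanced p q a ha x hx y)).trans (LinearMap.map_units_int_smul _ _ _)
  obtain ⟨H, hH, hH'⟩ := hb'.exists_lift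
  refine ⟨i ∘ₗ H, DGModData.comp_mem_hom (M := L.ceModule B (U.tensor V) d)
    (N := L.ceModule B W.V (D W)) h.mem hH (zero_add n), fun x y => ?_⟩
  rw [LinearMap.comp_apply, hH', LinearMap.compr₂_apply, h.right_inv]

theorem IsDifferentials.hom_ext_tmul (hD : IsDifferentials B D) {U V : GrSp K}
    {d : CE.gr B.deg (U.tensor V) →ₗ[K] CE.gr B.deg (U.tensor V)} {Q : DGModData (L.ceAlg B)}
    (hQ : IsSemiFree Q) {n : ℤ} {F G : CE.gr B.deg (U.tensor V) →ₗ[K] Q.M}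
    (hF : F ∈ DGModData.hom (L.ceModule B (U.tensor V) d) Q n)
    (hG : G ∈ DGModData.hom (L.ceModule B (U.tensor V) d) Q n)
    (h : ∀ x y, F (CE.tmul B.deg U V x y) = G (CE.tmul B.deg U V x y)) : F = G := by
  obtain ⟨W, -, i, j, hij⟩ := hD.exists_isInverse hQ
  have := CE.IsLin.ext_tmul B.deg (n := n) (W := W.V) (H := j ∘ₗ F) (H' := j ∘ₗ G)
    (DGModData.comp_mem_hom (M := L.ceModule B (U.tensor V) d) hij.mem' hF (zero_add n))
    (DGModData.comp_mem_hom (M := L.ceModule B (U.tensor V) d) hij.mem' hG (zero_add n))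
    fun u v => by rw [LinearMap.comp_apply, LinearMap.comp_apply, h]
  exact LinearMap.ext fun x => by
    have := LinearMap.congr_fun this x
    exact (hij.right_inv _).symm.trans ((congrArg i this).trans (hij.right_inv _))

end HomotopyLie


/-! ### Existence of relative tensor products -/

namespace HomotopyLie

variable {K : Type u} [Field K] [CharZero K] {L : HomotopyLie K} {N : ℕ}
  {B : HomogeneousBasis L.g N} {D : ∀ V : L.PreRep, CE.gr B.deg V.V →ₗ[K] CE.gr B.deg V.V}
  {V : DGModData (L.ceAlg B) → L.PreRep}
  {i : ∀ M : DGModData (L.ceAlg B), CE.gr B.deg (V M).V →ₗ[K] M.M}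
  {j : ∀ M : DGModData (L.ceAlg B), M.M →ₗ[K] CE.gr B.deg (V M).V}

/-- The relative tensor product transported along isomorphisms with the Chevalley-Eilenberg modules
of representations. -/
abbrev modelTensor (D : ∀ V : L.PreRep, CE.gr B.deg V.V →ₗ[K] CE.gr B.deg V.V)
    (i : ∀ M : DGModData (L.ceAlg B), CE.gr B.deg (V M).V →ₗ[K] M.M)
    (j : ∀ M : DGModData (L.ceAlg B), M.M →ₗ[K] CE.gr B.deg (V M).V) :
    RelTensor (L.ceAlg B) where
  obj M N := L.ceModule B ((V M).V.tensor (V N).V) (D (L.repMon.tensorObj (V M) (V N)))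
  tmul M N := (CE.tmul B.deg (V M).V (V N).V).compl₁₂ (j M) (j N)
  hom {M M' N N'} m n f g := CE.tensorMap B.deg m n (j M' ∘ₗ f ∘ₗ i M) (j N' ∘ₗ g ∘ₗ i N)
  assoc M N Q := CE.tensorMap B.deg 0 0 LinearMap.id (j (L.ceModule B ((V N).V.tensor (V Q).V)
      (D (L.repMon.tensorObj (V N) (V Q))))) ∘ₗ
    CE.coeffMap B.deg (GrSp.assoc_mem (V M).V (V N).V (V Q).V) ∘ₗ
    CE.tensorMap B.deg 0 0 (i (L.ceModule B ((V M).V.tensor (V N).V)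
      (D (L.repMon.tensorObj (V M) (V N))))) LinearMap.id
  lunit M := i M ∘ₗ CE.coeffMap B.deg (GrSp.lid_mem (V M).V) ∘ₗ
    CE.tensorMap B.deg 0 0 (i (.regular (L.ceAlg B))) LinearMap.id
  runit M := i M ∘ₗ CE.coeffMap B.deg (GrSp.rid_mem (V M).V) ∘ₗ
    CE.tensorMap B.deg 0 0 LinearMap.id (i (.regular (L.ceAlg B)))
  braid M N := CE.coeffMap B.deg (GrSp.swap_mem (V M).V (V N).V)

set_option maxHeartbeats 1600000 in
-- Each semi-free module is identified with a Chevalley-Eilenberg module through `i` and `j`, and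
-- every clause becomes the corresponding fact about products of series. The product modules are
-- themselves such modules but have their own chosen models, which is why the constraints contain
-- further copies of `i` and `j`.
theorem IsDifferentials.isRelativeTensor (hD : IsDifferentials B D)
    (hV : ∀ M, IsSemiFree M → L.IsRep (V M))
    (h : ∀ M, IsSemiFree M →
      DGModData.IsInverse (M := L.ceModule B (V M).V (D (V M))) (N := M) (i M) (j M)) :
    (modelTensor D i j).IsRelativeTensor (CE.IsCompletedSemiFree B.deg) := by
  have hl : ∀ {M} (_ : IsSemiFree M) {M'} (_ : IsSemiFree M') {n : ℤ} {f : M.M →ₗ[K] M'.M},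
      f ∈ DGModData.hom M M' n →
      CE.IsLin B.deg (V M).V (V M').V n (j M' ∘ₗ f ∘ₗ i M) := fun hM _ hM' _ _ hf =>
    DGModData.comp_mem_hom (M := L.ceModule B _ (D _)) (Q := L.ceModule B _ (D _)) (h _ hM').mem'
      (DGModData.comp_mem_hom hf (h _ hM).mem (add_zero _)) (zero_add _)
  have hid : ∀ W : GrSp K, CE.IsLin B.deg W W 0 LinearMap.id := fun W => (L.represents_id B W).1
  have hij : ∀ {M}, IsSemiFree M → ∀ x, i M (j M x) = x := fun hM => (h _ hM).right_inv
  have hobj : ∀ {M} (_ : IsSemiFree M) {M'} (_ : IsSemiFree M'), IsSemiFree (L.ceModule B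
      ((V M).V.tensor (V M').V) (D (L.repMon.tensorObj (V M) (V M')))) := fun hM _ hM' =>
    hD.isSemiFree (isRep_tensorObj (hV _ hM) (hV _ hM') B)
  have hreg := isSemiFree_regular (L := L) (B := B)
  have cz : ∀ {U V W : GrSp K} {G : CE.gr B.deg V →ₗ[K] CE.gr B.deg W}
      {F : CE.gr B.deg U →ₗ[K] CE.gr B.deg V}, CE.IsLin B.deg V W 0 G → CE.IsLin B.deg U V 0 F →
      CE.IsLin B.deg U W 0 (G ∘ₗ F) := fun hG hF => (hG.comp hF).congr (add_zero 0)
  have tz : ∀ {U U' V V' : GrSp K} {F : CE.gr B.deg U →ₗ[K] CE.gr B.deg U'}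
      {G : CE.gr B.deg V →ₗ[K] CE.gr B.deg V'}, CE.IsLin B.deg U U' 0 F →
      CE.IsLin B.deg V V' 0 G →
      CE.IsLin B.deg (U.tensor V) (U'.tensor V') 0 (CE.tensorMap B.deg 0 0 F G) :=
    fun hF hG => (CE.tensorMap_isLin B.deg hF hG).congr (add_zero 0)
  have tt : ∀ {U U' V V' : GrSp K} {F : CE.gr B.deg U →ₗ[K] CE.gr B.deg U'}
      {G : CE.gr B.deg V →ₗ[K] CE.gr B.deg V'}, CE.IsLin B.deg U U' 0 F →
      CE.IsLin B.deg V V' 0 G → ∀ x y, CE.tensorMap B.deg 0 0 F G (CE.tmul B.deg U V x y) =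
        CE.tmul B.deg U' V' (F x) (G y) := by
    intro U U' V V' F G hF hG x y
    induction x using GrSp.induction_on with
    | add x x' h h' => simp only [map_add, LinearMap.add_apply, h, h']
    | hom p x hx =>
      rw [CE.tensorMap_tmul B.deg hF hG hx, zero_mul, Int.negOnePow_zero, one_smul]
  constructor
  case isObj => exact fun hM hN => hobj hM hN
  case balanced =>
    intro M N hM hN
    have hb := CE.tmul_isBal B.deg (V M).V (V N).V
    refine ⟨fun p q x hx y hy => hb.degree p q _ ((h M hM).symm.map_mem hx) _
      ((h N hN).symm.map_mem hy), fun p a ha x y => ?_, fun p q a ha x hx y => ?_⟩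
    · simp only [LinearMap.compl₁₂_apply]
      exact (congrArg (fun t => CE.tmul B.deg _ _ t _) ((h M hM).symm.map_act ha x)).trans
        (hb.act_left p a ha _ _)
    · simp only [LinearMap.compl₁₂_apply]
      refine (congrArg (CE.tmul B.deg _ _ _) ((h N hN).symm.map_act ha y)).trans
        ((hb.balanced p q a ha _ ((h M hM).symm.map_mem hx) _).trans ?_)
      exact congrArg (fun t => (p * q).negOnePow • CE.tmul B.deg _ _ t (j N y))
        ((h M hM).symm.map_act ha x).symm
  case d_tmul =>
    intro M N hM hN p x hx y
    refine (hD.tmul (hV M hM) (hV N hN) ((h M hM).symm.map_mem hx) (j N y)).trans ?_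
    exact congrArg₂ (fun s t => CE.tmul B.deg _ _ s (j N y) +
      p.negOnePow • CE.tmul B.deg _ _ (j M x) t) ((h M hM).symm.d_apply x).symm
      ((h N hN).symm.d_apply y).symm
  case universal =>
    intro M N Q hM hN hQ n b hb
    have hb' : DGModData.IsBalanced (M := L.ceModule B (V M).V (D (V M)))
        (N := L.ceModule B (V N).V (D (V N))) n (b.compl₁₂ (i M) (i N)) := by
      refine ⟨fun p q x hx y hy => hb.degree p q _ ((h M hM).map_mem hx) _
        ((h N hN).map_mem hy), fun p a ha x y => ?_, fun p q a ha x hx y => ?_⟩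
      · exact (congrArg (fun t => b t _) ((h M hM).map_act ha x)).trans (hb.act_left p a ha _ _)
      · refine (congrArg (b _) ((h N hN).map_act ha y)).trans
          ((hb.balanced p q a ha _ ((h M hM).map_mem hx) _).trans ?_)
        exact congrArg (fun t => (p * q).negOnePow • b t (i N y)) ((h M hM).map_act ha x).symm
    obtain ⟨H, hH, hH'⟩ := hD.exists_lift hQ hb'
      (d := D (L.repMon.tensorObj (V M) (V N)))
    refine ⟨H, ⟨hH, fun x y => (hH' _ _).trans ?_⟩, fun G hG => ?_⟩
    · exact congrArg₂ (fun s t => b s t) (hij hM x) (hij hN y)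
    · refine hD.hom_ext_tmul hQ hG.1 hH fun x y => ?_
      have := hG.2 (i M x) (i N y)
      simp only [LinearMap.compl₁₂_apply, (h M hM).left_inv, (h N hN).left_inv] at this
      exact this.trans (hH' x y).symm
  case hom_mem =>
    exact fun hM hM' hN hN' m n f hf g hg => CE.tensorMap_isLin B.deg (hl hM hM' hf) (hl hN hN' hg)
  case hom_tmul =>
    intro M M' N N' hM hM' hN hN' m n f hf g hg p x hx y
    refine (CE.tensorMap_tmul B.deg (hl hM hM' hf) (hl hN hN' hg)
      ((h M hM).symm.map_mem hx) (j N y)).trans ?_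
    simp only [LinearMap.comp_apply, LinearMap.compl₁₂_apply, hij hM, hij hN]
  case assoc_mem =>
    intro M N Q hM hN hQ
    exact cz (tz (hid _) (h _ (hobj hN hQ)).mem') (cz (CE.coeffMap_isLin B.deg
      (GrSp.assoc_mem (V M).V (V N).V (V Q).V)) (tz (h _ (hobj hM hN)).mem (hid _)))
  case assoc_tmul =>
    intro M N Q hM hN hQ x y z
    simp only [LinearMap.comp_apply, LinearMap.compl₁₂_apply]
    rw [tt (h _ (hobj hM hN)).mem (hid _), hij (hobj hM hN), LinearMap.id_apply, CE.assoc_tmul,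
      tt (hid _) (h _ (hobj hN hQ)).mem', LinearMap.id_apply]
  case lunit_mem =>
    intro M hM
    exact DGModData.comp_mem_hom (N := L.ceModule B (V M).V (D (V M))) (h M hM).mem
      (cz (CE.coeffMap_isLin B.deg (GrSp.lid_mem (V M).V)) (tz (h _ hreg).mem (hid _)))
      (add_zero 0)
  case lunit_tmul =>
    intro M hM a x
    simp only [LinearMap.comp_apply, LinearMap.compl₁₂_apply]
    rw [tt (h _ hreg).mem (hid _), hij hreg, LinearMap.id_apply, CE.lid_tmul]
    have := (hl hM hM (DGModData.id_mem_hom M))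
    induction a using GrSp.induction_on with
    | add a b ha hb => simp only [map_add, LinearMap.add_apply, ha, hb]
    | hom p a ha => exact ((h M hM).map_act ha _).trans (congrArg _ (hij hM x))
  case runit_mem =>
    intro M hM
    exact DGModData.comp_mem_hom (N := L.ceModule B (V M).V (D (V M))) (h M hM).mem
      (cz (CE.coeffMap_isLin B.deg (GrSp.rid_mem (V M).V)) (tz (hid _) (h _ hreg).mem))
      (add_zero 0)
  case runit_tmul =>
    intro M hM p q a ha x hx
    simp only [LinearMap.comp_apply, LinearMap.compl₁₂_apply]
    rw [tt (hid _) (h _ hreg).mem, hij hreg, LinearMap.id_apply,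
      CE.rid_tmul B.deg ha ((h M hM).symm.map_mem hx), LinearMap.map_units_int_smul]
    exact congrArg _ (((h M hM).map_act ha _).trans (congrArg _ (hij hM x)))
  case braid_mem => exact fun hM hN => CE.coeffMap_isLin B.deg (GrSp.swap_mem _ _)
  case braid_tmul =>
    intro M N hM hN p q x hx y hy
    exact CE.swap_tmul B.deg ((h M hM).symm.map_mem hx) ((h N hN).symm.map_mem hy)

variable (L B) in
theorem exists_isRelativeTensor : ∃ T : RelTensor (L.ceAlg B),
    T.IsRelativeTensor (CE.IsCompletedSemiFree B.deg) := by
  obtain ⟨D, hD⟩ := L.exists_isDifferentials B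
  have ex : ∀ M : DGModData (L.ceAlg B), ∃ (V : L.PreRep) (i : CE.gr B.deg V.V →ₗ[K] M.M)
      (j : M.M →ₗ[K] CE.gr B.deg V.V), IsSemiFree M → L.IsRep V ∧
        DGModData.IsInverse (M := L.ceModule B V.V (D V)) (N := M) i j := by
    intro M
    by_cases hM : IsSemiFree M
    · obtain ⟨V, hV, i, j, h⟩ := hD.exists_isInverse hM
      exact ⟨V, i, j, fun _ => ⟨hV, h⟩⟩
    -- Placeholders for modules that are not completed semi-free; no property of them is claimed.
    · exact ⟨L.repMon.unit, 0, 0, fun h => absurd h hM⟩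
  choose V i j h using ex
  exact ⟨_, hD.isRelativeTensor (fun M hM => (h M hM).1) fun M hM => (h M hM).2⟩

end HomotopyLie


/-! ### The monoidal structure given by a relative tensor product -/

namespace RelTensor

variable {K : Type u} [Field K] {R : DGAlg K} {P : DGModData R → Prop} {T : RelTensor R}

/-- A relative tensor product, as the tensor product of the family of all dg-modules. -/
abbrev fam (T : RelTensor R) : DGModData.FamTensor fun M : DGModData R => M where
  obj := T.obj
  tmul := T.tmul
  hom := T.hom
  unit := .regular R
  ι := LinearMap.id
  assoc := T.assoc
  lunit := T.lunit
  runit := T.runit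
  braid := T.braid

theorem IsRelativeTensor.isTensor (hT : T.IsRelativeTensor P)
    (hR : (DGModData.regular R).IsDGModule ∧ P (.regular R)) :
    T.fam.IsTensor fun M => M.IsDGModule ∧ P M where
  isDG h := h.1
  isObj := hT.isObj
  unit_isObj := hR
  balanced := hT.balanced
  d_tmul hX hY _ _ hx y := hT.d_tmul hX hY _ _ hx y
  -- Composing a homomorphism with the universal pairing gives a balanced map, so the uniqueness
  -- half of the universal property yields extensionality.
  ext {X Y Z} hX hY hZ n h hh h' hh' H := by
    have hb := hT.balanced hX hY
    have hb' : DGModData.IsBalanced n ((T.tmul X Y).compr₂ h) := by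
      refine ⟨fun p q x hx y hy => hh.1 _ _ (GrSp.gr_congr _ (add_zero _) (hb.degree p q x hx y hy)),
        fun p a ha x y => ?_, fun p q a ha x hx y => ?_⟩
      · rw [LinearMap.compr₂_apply, LinearMap.compr₂_apply, hb.act_left p a ha, zero_mul,
          Int.negOnePow_zero, one_smul, hh.2 p a ha]
      · rw [LinearMap.compr₂_apply, LinearMap.compr₂_apply, hb.balanced p q a ha x hx,
          LinearMap.map_units_int_smul]
    exact (hT.universal hX hY hZ n _ hb').unique ⟨hh, fun _ _ => rfl⟩ ⟨hh', fun x y => (H x y).symm⟩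
  hom_mem hX hX' hY hY' m n _ _ hf hg := hT.hom_mem hX hX' hY hY' m n _ hf _ hg
  hom_tmul hX hX' hY hY' m n _ _ hf hg _ _ hx y :=
    hT.hom_tmul hX hX' hY hY' m n _ hf _ hg _ _ hx y
  ι_mem h := h
  ι_mul _ _ := rfl
  d_ι _ := rfl
  ι_surjective a := ⟨a, rfl⟩
  ι_injective _ _ h := h
  assoc_mem := hT.assoc_mem
  assoc_tmul := hT.assoc_tmul
  lunit_mem := hT.lunit_mem
  lunit_tmul := hT.lunit_tmul
  runit_mem := hT.runit_mem
  runit_tmul hX _ _ _ _ ha hx := hT.runit_tmul hX _ _ _ ha _ hx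
  braid_mem := hT.braid_mem
  braid_tmul hX hY _ _ _ _ hx hy := hT.braid_tmul hX hY _ _ _ hx _ hy

theorem IsRelativeTensor.isSymmetricMonoidal (hT : T.IsRelativeTensor P) (hA : R.IsCDGA)
    (hR : (DGModData.regular R).IsDGModule ∧ P (.regular R)) : (T.mon P).IsSymmetricMonoidal :=
  (hT.isTensor hR).isSymmetricMonoidal hA

end RelTensor

namespace HomotopyLie

variable {K : Type u} [Field K] [CharZero K] {L : HomotopyLie K} {N : ℕ}
  {B : HomogeneousBasis L.g N} {D : ∀ V : L.PreRep, CE.gr B.deg V.V →ₗ[K] CE.gr B.deg V.V}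
  {T : RelTensor (L.ceAlg B)}

/-- The comparison of the relative tensor product of Chevalley-Eilenberg modules with the
Chevalley-Eilenberg module of the tensor product. -/
theorem IsDifferentials.exists_comparison (hD : IsDifferentials B D)
    (hT : T.IsRelativeTensor (CE.IsCompletedSemiFree B.deg)) {U V : L.PreRep} (hU : L.IsRep U)
    (hV : L.IsRep V) : ∃ μ : (T.obj (L.ceModule B U.V (D U)) (L.ceModule B V.V (D V))).M →ₗ[K]
        CE.gr B.deg (U.V.tensor V.V),
      (∀ x y, μ (T.tmul (L.ceModule B U.V (D U)) (L.ceModule B V.V (D V)) x y) =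
        CE.tmul B.deg U.V V.V x y) ∧
      ∃ ν, DGModData.IsInverse (M := T.obj (L.ceModule B U.V (D U)) (L.ceModule B V.V (D V)))
        (N := L.ceModule B (U.V.tensor V.V) (D (L.repMon.tensorObj U V))) μ ν := by
  have hU' := hD.isSemiFree hU
  have hV' := hD.isSemiFree hV
  have hUV := hD.isSemiFree (isRep_tensorObj hU hV B)
  have hF := hT.isTensor isSemiFree_regular
  -- Both the abstract tensor product and the product of series are universal for balanced maps,
  -- which yields `μ` and `ν`; they are mutually inverse because both composites fix products.
  obtain ⟨μ, ⟨hμ, hμ'⟩, -⟩ := hT.universal hU' hV' hUV 0 (CE.tmul B.deg U.V V.V)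
    (hD.isTensor.balanced hU hV)
  obtain ⟨ν, hν, hν'⟩ := hD.exists_lift (hT.isObj hU' hV') (hT.balanced hU' hV')
    (d := D (L.repMon.tensorObj U V))
  have h1 : ν ∘ₗ μ = LinearMap.id := hF.ext hU' hV' (hT.isObj hU' hV') 0 _
    (DGModData.comp_mem_hom hν hμ (add_zero 0)) _ (DGModData.id_mem_hom _) fun x y => by
      rw [LinearMap.comp_apply, hμ', hν', LinearMap.id_apply]
  have h2 : μ ∘ₗ ν = LinearMap.id := hD.hom_ext_tmul hUV
    (DGModData.comp_mem_hom hμ hν (add_zero 0)) (DGModData.id_mem_hom _) fun x y => by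
      rw [LinearMap.comp_apply, hν', hμ', LinearMap.id_apply]
  have hR := (L.ceAlg_isCDGA B).δ_mem
  -- Both differentials obey the same Leibniz rule on products, so the commutator of `μ` with them
  -- vanishes there and hence everywhere.
  have h3 := hF.ext₂ hU' hV' hUV (DGModData.d_mem_hom hR (hT.isObj hU' hV').1 hUV.1 hμ)
    (Submodule.zero_mem _) fun p q x hx y hy => by
      rw [LinearMap.sub_apply, LinearMap.units_int_smul_apply, LinearMap.comp_apply,
        LinearMap.comp_apply, hμ', hT.d_tmul hU' hV' p x hx, map_add,
        LinearMap.map_units_int_smul, hμ', hμ', Int.negOnePow_zero, one_smul,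
        LinearMap.zero_apply]
      exact sub_eq_zero.2 (hD.tmul hU hV hx y)
  refine ⟨μ, hμ', ν, hμ, hν, fun x => ?_, LinearMap.congr_fun h1, LinearMap.congr_fun h2⟩
  have := LinearMap.congr_fun h3 x
  rw [LinearMap.sub_apply, LinearMap.units_int_smul_apply, LinearMap.comp_apply,
    LinearMap.comp_apply, Int.negOnePow_zero, one_smul] at this
  exact (sub_eq_zero.1 this).symm

/-- Each functor identity compares two linear maps representing the same intertwiner, and these
coincide. -/
theorem IsDifferentials.isDGFunctor (hD : IsDifferentials B D)
    {Φ : ∀ U V : L.PreRep, ℤ → L.Raw U.V V.V → (CE.gr B.deg U.V →ₗ[K] CE.gr B.deg V.V)}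
    (hΦ : ∀ {U V}, L.IsRep U → L.IsRep V → ∀ {n f}, f ∈ L.intertwiner U.V V.V n →
      L.Represents B n f (Φ U V n f)) :
    (L.ceFunctor B (L.dTriv B (GrSp.ground K)) D Φ).IsDGFunctor where
  obj_isObj hX := hD.isSemiFree hX
  map_mem hX hY _ _ hf := (hΦ hX hY hf).1
  map_add hX hY _ _ hf _ hf' :=
    (hΦ hX hY (Submodule.add_mem _ hf hf')).unique ((hΦ hX hY hf).add (hΦ hX hY hf'))
  map_smul hX hY _ c _ hf :=
    (hΦ hX hY (Submodule.smul_mem _ c hf)).unique ((hΦ hX hY hf).smul c)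
  map_d hX hY _ _ hf :=
    have h := hD.represents_d hX hY (hΦ hX hY hf)
    (hΦ hX hY h.mem).unique h
  map_id {X} hX := (hΦ hX hX (L.represents_id B X.V).mem).unique (L.represents_id B X.V)
  map_comp hX hY hZ _ _ _ hg _ hf :=
    have h := (hΦ hY hZ hg).comp (hΦ hX hY hf)
    (hΦ hX hZ h.mem).unique h

theorem bijOn_of_represents {U V : GrSp K} {n : ℤ}
    {φ : L.Raw U V → (CE.gr B.deg U →ₗ[K] CE.gr B.deg V)}
    (h : ∀ {f}, f ∈ L.intertwiner U V n → L.Represents B n f (φ f)) :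
    Set.BijOn φ (L.intertwiner U V n) {F | CE.IsLin B.deg U V n F} := by
  refine ⟨fun f hf => (h hf).1, fun f hf g hg hfg => ?_, fun F hF => ?_⟩
  · have h1 := h hf
    rw [hfg] at h1
    exact h1.eq (h hg)
  · obtain ⟨f, hf⟩ := L.exists_represented (B := B) hF
    exact ⟨f, hf.mem, (h hf.mem).unique hf⟩

end HomotopyLie


/-! ### The symmetric monoidal equivalence -/

namespace HomotopyLie

variable {K : Type u} [Field K] [CharZero K] {L : HomotopyLie K} {N : ℕ}
  {B : HomogeneousBasis L.g N} {D : ∀ V : L.PreRep, CE.gr B.deg V.V →ₗ[K] CE.gr B.deg V.V}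
  {T : RelTensor (L.ceAlg B)}

set_option maxHeartbeats 3200000 in
-- Each monoidal compatibility is an equality of homomorphisms out of a relative tensor product,
-- tested on products of elements. There `μ` becomes the product of series, and the two sides are
-- the formulas for the constraints on series and on abstract products.
theorem IsDifferentials.isEquivalence (hD : IsDifferentials B D)
    (hT : T.IsRelativeTensor (CE.IsCompletedSemiFree B.deg))
    {Φ : ∀ U V : L.PreRep, ℤ → L.Raw U.V V.V → (CE.gr B.deg U.V →ₗ[K] CE.gr B.deg V.V)}
    (hΦ : ∀ {U V}, L.IsRep U → L.IsRep V → ∀ {n f}, f ∈ L.intertwiner U.V V.V n →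
      L.Represents B n f (Φ U V n f))
    {μ : ∀ U V : L.PreRep, (T.obj (L.ceModule B U.V (D U)) (L.ceModule B V.V (D V))).M →ₗ[K]
        CE.gr B.deg (U.V.tensor V.V)}
    (hμ : ∀ {U V}, L.IsRep U → L.IsRep V → ∀ x y,
      μ U V (T.tmul (L.ceModule B U.V (D U)) (L.ceModule B V.V (D V)) x y) =
        CE.tmul B.deg U.V V.V x y)
    (hμ' : ∀ {U V}, L.IsRep U → L.IsRep V → ∃ ν, DGModData.IsInverse
      (M := T.obj (L.ceModule B U.V (D U)) (L.ceModule B V.V (D V)))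
      (N := L.ceModule B (U.V.tensor V.V) (D (L.repMon.tensorObj U V))) (μ U V) ν) :
    (L.ceFunctor B (L.dTriv B (GrSp.ground K)) D Φ).IsSymmetricMonoidalDGEquivalence L.repMon
      (T.mon (CE.IsCompletedSemiFree B.deg)) μ LinearMap.id := by
  have hF := hT.isTensor isSemiFree_regular
  have sf : ∀ {V : L.PreRep}, L.IsRep V → IsSemiFree (L.ceModule B V.V (D V)) :=
    fun hV => hD.isSemiFree hV
  have ob : ∀ {U V : L.PreRep}, L.IsRep U → L.IsRep V → L.IsRep (L.repMon.tensorObj U V) :=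
    fun hU hV => isRep_tensorObj hU hV B
  have μm : ∀ {U V : L.PreRep}, L.IsRep U → L.IsRep V → μ U V ∈ DGModData.hom
      (T.obj (L.ceModule B U.V (D U)) (L.ceModule B V.V (D V)))
      (L.ceModule B (U.V.tensor V.V) (D (L.repMon.tensorObj U V))) 0 := fun hU hV => by
    obtain ⟨ν, h⟩ := hμ' hU hV
    exact h.mem
  -- The constraints of the category of representations are concentrated in arity 0, so the functor
  -- sends them to coefficientwise maps.
  have Φo : ∀ {U V : L.PreRep} (_ : L.IsRep U) (_ : L.IsRep V) {φ : U.V →ₗ[K] V.V}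
      (hφ : φ ∈ GrSp.mapDeg U.V V.V 0), Φ U V 0 (L.ofLin φ) = CE.coeffMap B.deg hφ :=
    fun hU hV _ hφ => (hΦ hU hV (represents_coeffMap (B := B) hφ).mem).unique (represents_coeffMap hφ)
  have hreg : IsSemiFree (L.ceModule B (GrSp.ground K) (L.dTriv B (GrSp.ground K))) :=
    isSemiFree_regular
  have run := isRep_unit (L := L) B
  have idm : ∀ {M : DGModData (L.ceAlg B)}, LinearMap.id ∈ DGModData.hom M M 0 :=
    DGModData.id_mem_hom _
  have hε : DGModData.IsInverse (M := .regular (L.ceAlg B))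
      (N := L.ceModule B (GrSp.ground K) (D L.repMon.unit)) LinearMap.id LinearMap.id :=
    ⟨(DGModData.id_mem_hom (.regular (L.ceAlg B)) :), (DGModData.id_mem_hom (.regular (L.ceAlg B)) :),
      fun x => (LinearMap.congr_fun hD.unit x).symm, fun _ => rfl, fun _ => rfl⟩
  have hz : ∀ {M M' Q Q' : DGModData (L.ceAlg B)} (_ : IsSemiFree M) (_ : IsSemiFree M')
      (_ : IsSemiFree Q) (_ : IsSemiFree Q') {f : M.M →ₗ[K] M'.M} {g : Q.M →ₗ[K] Q'.M}
      (_ : f ∈ DGModData.hom M M' 0) (_ : g ∈ DGModData.hom Q Q' 0),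
      T.hom 0 0 f g ∈ DGModData.hom (T.obj M Q) (T.obj M' Q') 0 ∧
      ∀ {p x}, x ∈ M.M.gr p → ∀ y, T.hom 0 0 f g (T.tmul M Q x y) = T.tmul M' Q' (f x) (g y) := by
    intro M M' Q Q' hM hM' hQ hQ' f g hf hg
    refine ⟨DGModData.hom_congr (add_zero 0) (hF.hom_mem hM hM' hQ hQ' hf hg), fun hx y => ?_⟩
    refine (hF.hom_tmul hM hM' hQ hQ' hf hg hx y).trans ?_
    rw [zero_mul, Int.negOnePow_zero, one_smul]
  constructor
  case toIsDGFunctor => exact hD.isDGFunctor hΦ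
  case fully_faithful =>
    exact fun hX hY n => bijOn_of_represents fun hf => hΦ hX hY hf
  case ess_surj =>
    intro M hM
    obtain ⟨V, hV, i, j, h⟩ := hD.exists_isInverse hM
    exact ⟨V, hV, i, h.isIso _⟩
  case mul_isIso =>
    intro X Y hX hY
    obtain ⟨ν, h⟩ := hμ' hX hY
    exact h.isIso _
  case unit_isIso => exact hε.isIso _
  case map_tensorHom =>
    intro X X' Y Y' hX hX' hY hY' m n f hf g hg
    have h := (hΦ hX hX' hf).tensorMap (hΦ hY hY' hg)
    have e : Φ (L.repMon.tensorObj X Y) (L.repMon.tensorObj X' Y') (m + n) (L.odot m n f g) =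
        CE.tensorMap B.deg m n (Φ X X' m f) (Φ Y Y' n g) :=
      (hΦ (ob hX hY) (ob hX' hY') h.mem).unique h
    have hf' := (hΦ hX hX' hf).1
    have hg' := (hΦ hY hY' hg).1
    change Φ (L.repMon.tensorObj X Y) (L.repMon.tensorObj X' Y') (m + n) (L.odot m n f g) ∘ₗ
      μ X Y = μ X' Y' ∘ₗ T.hom m n (Φ X X' m f) (Φ Y Y' n g)
    rw [e]
    refine hF.ext₂ (sf hX) (sf hY) (sf (ob hX' hY')) (n := m + n)
      (DGModData.comp_mem_hom (N := L.ceModule B _ (D (L.repMon.tensorObj X Y))) h.1 (μm hX hY)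
        (add_zero _))
      (DGModData.comp_mem_hom (μm hX' hY') (hF.hom_mem (sf hX) (sf hX') (sf hY) (sf hY') hf' hg')
        (zero_add _)) fun p q x hx y hy => ?_
    rw [LinearMap.comp_apply, LinearMap.comp_apply]
    refine (congrArg _ (hμ hX hY x y)).trans ((CE.tensorMap_tmul B.deg hf' hg' hx y).trans ?_)
    refine Eq.trans ?_ (congrArg (μ X' Y')
      (hF.hom_tmul (sf hX) (sf hX') (sf hY) (sf hY') hf' hg' hx y)).symm
    rw [LinearMap.map_units_int_smul]
    exact congrArg _ (hμ hX' hY' _ _).symm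
  case map_assoc =>
    intro X Y Z hX hY hZ
    have hXY := ob hX hY
    have hYZ := ob hY hZ
    have h1 := hz (hT.isObj (sf hX) (sf hY)) (sf hXY) (sf hZ) (sf hZ) (μm hX hY) (idm)
    have h2 := hz (sf hX) (sf hX) (hT.isObj (sf hY) (sf hZ)) (sf hYZ) (idm) (μm hY hZ)
    have e : Φ (L.repMon.tensorObj (L.repMon.tensorObj X Y) Z)
        (L.repMon.tensorObj X (L.repMon.tensorObj Y Z)) 0 (L.repMon.assoc X Y Z) =
        CE.coeffMap B.deg (GrSp.assoc_mem X.V Y.V Z.V) := Φo (ob hXY hZ) (ob hX hYZ) _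
    change Φ (L.repMon.tensorObj (L.repMon.tensorObj X Y) Z)
        (L.repMon.tensorObj X (L.repMon.tensorObj Y Z)) 0 (L.repMon.assoc X Y Z) ∘ₗ
        (μ (L.repMon.tensorObj X Y) Z ∘ₗ T.hom 0 0 (μ X Y) LinearMap.id) =
      μ X (L.repMon.tensorObj Y Z) ∘ₗ (T.hom 0 0 LinearMap.id (μ Y Z) ∘ₗ T.assoc _ _ _)
    rw [e]
    refine hF.ext₃ (sf hX) (sf hY) (sf hZ) (sf (ob hX hYZ)) (n := 0)
      (DGModData.comp_mem_hom
        (N := L.ceModule B _ (D (L.repMon.tensorObj (L.repMon.tensorObj X Y) Z)))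
        (CE.coeffMap_isLin B.deg _) (DGModData.comp_mem_hom (μm hXY hZ) h1.1 (add_zero 0))
        (add_zero 0))
      (DGModData.comp_mem_hom (μm hX hYZ) (DGModData.comp_mem_hom h2.1
        (hT.assoc_mem (sf hX) (sf hY) (sf hZ)) (add_zero 0)) (add_zero 0))
      fun p q r x hx y hy z hz => ?_
    simp only [LinearMap.comp_apply]
    have hxy := hF.tmul_mem (sf hX) (sf hY) hx hy
    refine (congrArg _ ((congrArg _ ((h1.2 hxy z).trans (congrArg (fun t => T.tmul
      (L.ceModule B _ (D (L.repMon.tensorObj X Y))) (L.ceModule B Z.V (D Z)) t z)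
      (hμ hX hY x y)))).trans (hμ hXY hZ _ _))).trans ((CE.assoc_tmul B.deg x y z).trans ?_)
    refine Eq.symm ((congrArg _ ((congrArg _ (hT.assoc_tmul (sf hX) (sf hY) (sf hZ) x y z)).trans
      ((h2.2 hx _).trans (congrArg (T.tmul (L.ceModule B X.V (D X))
        (L.ceModule B _ (D (L.repMon.tensorObj Y Z))) x) (hμ hY hZ y z))))).trans (hμ hX hYZ _ _))
  case map_lunit =>
    intro X hX
    have h1 := hz isSemiFree_regular (sf run) (sf hX) (sf hX) hε.mem (idm)
    have e : Φ (L.repMon.tensorObj L.repMon.unit X) X 0 (L.repMon.lunit X) =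
        CE.coeffMap B.deg (GrSp.lid_mem X.V) := Φo (ob run hX) hX _
    change Φ (L.repMon.tensorObj L.repMon.unit X) X 0 (L.repMon.lunit X) ∘ₗ
      (μ L.repMon.unit X ∘ₗ T.hom (M := .regular (L.ceAlg B))
        (M' := L.ceModule B (GrSp.ground K) (D L.repMon.unit)) 0 0 LinearMap.id LinearMap.id) =
      T.lunit (L.ceModule B X.V (D X))
    rw [e]
    refine hF.ext₂ isSemiFree_regular (sf hX) (sf hX) (n := 0)
      (DGModData.comp_mem_hom (N := L.ceModule B _ (D (L.repMon.tensorObj L.repMon.unit X)))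
        (CE.coeffMap_isLin B.deg _) (DGModData.comp_mem_hom (μm run hX) h1.1 (add_zero 0))
        (add_zero 0)) (hT.lunit_mem (sf hX)) fun p q x hx y hy => ?_
    simp only [LinearMap.comp_apply]
    exact (congrArg _ ((congrArg _ (h1.2 hx y)).trans (hμ run hX x y))).trans
      ((CE.lid_tmul B.deg x y).trans (hT.lunit_tmul (sf hX) x y).symm)
  case map_runit =>
    intro X hX
    have h1 := hz (sf hX) (sf hX) isSemiFree_regular (sf run) (idm) hε.mem
    have e : Φ (L.repMon.tensorObj X L.repMon.unit) X 0 (L.repMon.runit X) =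
        CE.coeffMap B.deg (GrSp.rid_mem X.V) := Φo (ob hX run) hX _
    change Φ (L.repMon.tensorObj X L.repMon.unit) X 0 (L.repMon.runit X) ∘ₗ
      (μ X L.repMon.unit ∘ₗ T.hom (N := .regular (L.ceAlg B))
        (N' := L.ceModule B (GrSp.ground K) (D L.repMon.unit)) 0 0 LinearMap.id LinearMap.id) =
      T.runit (L.ceModule B X.V (D X))
    rw [e]
    refine hF.ext₂ (sf hX) isSemiFree_regular (sf hX) (n := 0)
      (DGModData.comp_mem_hom (N := L.ceModule B _ (D (L.repMon.tensorObj X L.repMon.unit)))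
        (CE.coeffMap_isLin B.deg _) (DGModData.comp_mem_hom (μm hX run) h1.1 (add_zero 0))
        (add_zero 0)) (hT.runit_mem (sf hX)) fun p q x hx y hy => ?_
    simp only [LinearMap.comp_apply]
    exact (congrArg _ ((congrArg _ (h1.2 hx y)).trans (hμ hX run x y))).trans
      ((CE.rid_tmul B.deg hy hx).trans (hT.runit_tmul (sf hX) _ _ y hy x hx).symm)
  case map_braid =>
    intro X Y hX hY
    have e : Φ (L.repMon.tensorObj X Y) (L.repMon.tensorObj Y X) 0 (L.repMon.braid X Y) =
        CE.coeffMap B.deg (GrSp.swap_mem X.V Y.V) := Φo (ob hX hY) (ob hY hX) _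
    change Φ (L.repMon.tensorObj X Y) (L.repMon.tensorObj Y X) 0 (L.repMon.braid X Y) ∘ₗ μ X Y =
      μ Y X ∘ₗ T.braid _ _
    rw [e]
    refine hF.ext₂ (sf hX) (sf hY) (sf (ob hY hX)) (n := 0)
      (DGModData.comp_mem_hom (N := L.ceModule B _ (D (L.repMon.tensorObj X Y)))
        (CE.coeffMap_isLin B.deg _) (μm hX hY) (add_zero 0))
      (DGModData.comp_mem_hom (μm hY hX) (hT.braid_mem (sf hX) (sf hY)) (add_zero 0))
      fun p q x hx y hy => ?_
    simp only [LinearMap.comp_apply]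
    refine (congrArg _ (hμ hX hY x y)).trans ((CE.swap_tmul B.deg hx hy).trans ?_)
    refine Eq.symm ((congrArg _ (hT.braid_tmul (sf hX) (sf hY) _ _ x hx y hy)).trans ?_)
    rw [LinearMap.map_units_int_smul]
    exact congrArg _ (hμ hY hX y x)

end HomotopyLie


theorem mainTheorem4 {K : Type u} [Field K] [CharZero K] (L : HomotopyLie K) {N : ℕ}
    (B : HomogeneousBasis L.g N) :
    L.repMon.IsSymmetricMonoidal ∧
    (∃! δ, L.IsCEDifferential B δ) ∧
    ∀ δ, L.IsCEDifferential B δ →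
      (CE.alg B.deg δ).IsCDGA ∧
      (∀ V, L.IsRep V → ∃! d, L.IsCEModuleDifferential B δ V d) ∧
      (∀ (U V : GrSp K) (n : ℤ), ∀ f ∈ L.intertwiner U V n, ∃! φ, L.IsCEMap B U V n f φ) ∧
      (∃ T : RelTensor (CE.alg B.deg δ),
        T.IsRelativeTensor (CE.IsCompletedSemiFree B.deg)) ∧
      ∀ T : RelTensor (CE.alg B.deg δ), T.IsRelativeTensor (CE.IsCompletedSemiFree B.deg) →
        (T.mon (CE.IsCompletedSemiFree B.deg)).IsSymmetricMonoidal ∧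
        ∀ D, (∀ V, L.IsRep V → L.IsCEModuleDifferential B δ V (D V)) →
        ∀ Φ, (∀ U V, L.IsRep U → L.IsRep V → ∀ n, ∀ f ∈ L.intertwiner U.V V.V n,
          L.IsCEMap B U.V V.V n f (Φ U V n f)) →
        ∃ (μ : ∀ U V : L.PreRep,
            (T.obj (CE.mod B.deg δ U.V (D U)) (CE.mod B.deg δ V.V (D V))).M →ₗ[K]
              CE.gr B.deg (U.V.tensor V.V))
          (ε : L.ceGr B →ₗ[K] CE.gr B.deg (GrSp.ground K)),
          (∀ U V, L.IsRep U → L.IsRep V → ∀ u v,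
            μ U V (T.tmul _ _ (CE.gen B.deg U.V u) (CE.gen B.deg V.V v)) =
              CE.gen B.deg (U.V.tensor V.V) (u ⊗ₜ[K] v)) ∧
          (∀ a, ε a = a) ∧
          (L.ceFunctor B δ D Φ).IsSymmetricMonoidalDGEquivalence L.repMon
            (T.mon (CE.IsCompletedSemiFree B.deg)) μ ε := by
  refine ⟨HomotopyLie.repMon_isSymmetricMonoidal B, HomotopyLie.existsUnique_isCEDifferential, ?_⟩
  intro δ hδ
  -- By uniqueness `δ` is the differential constructed above, and all previous results apply
  -- verbatim.
  obtain rfl := L.eq_dTriv B hδ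
  refine ⟨L.ceAlg_isCDGA B, fun V hV => HomotopyLie.existsUnique_isCEModuleDifferential hV.1,
    fun U V n f hf => HomotopyLie.existsUnique_isCEMap hf, L.exists_isRelativeTensor B,
    fun T hT => ⟨hT.isSymmetricMonoidal (L.ceAlg_isCDGA B) HomotopyLie.isSemiFree_regular, ?_⟩⟩
  intro D hD Φ hΦ
  have hD' : HomotopyLie.IsDifferentials B D := fun V hV =>
    (HomotopyLie.isCEModuleDifferential_iff hV.1 (D V)).1 (hD V hV)
  -- The comparison must be defined for all pairs in order to be chosen as a function; on pairs that
  -- are not both representations it is set to zero.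
  have ex : ∀ U V : L.PreRep, ∃ μ : (T.obj (L.ceModule B U.V (D U)) (L.ceModule B V.V (D V))).M →ₗ[K]
      CE.gr B.deg (U.V.tensor V.V), L.IsRep U → L.IsRep V →
        (∀ x y, μ (T.tmul (L.ceModule B U.V (D U)) (L.ceModule B V.V (D V)) x y) =
          CE.tmul B.deg U.V V.V x y) ∧
        ∃ ν, DGModData.IsInverse (M := T.obj (L.ceModule B U.V (D U)) (L.ceModule B V.V (D V)))
          (N := L.ceModule B (U.V.tensor V.V) (D (L.repMon.tensorObj U V))) μ ν := by
    intro U V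
    by_cases hUV : L.IsRep U ∧ L.IsRep V
    · obtain ⟨μ, h⟩ := hD'.exists_comparison hT hUV.1 hUV.2
      exact ⟨μ, fun _ _ => h⟩
    · exact ⟨0, fun hU hV => absurd ⟨hU, hV⟩ hUV⟩
  choose μ hμ using ex
  exact ⟨μ, LinearMap.id, fun U V hU hV u v => ((hμ U V hU hV).1 _ _).trans
    (CE.tmul_gen_gen B.deg U.V V.V u v), fun _ => rfl,
    hD'.isEquivalence hT (fun hU hV _ _ hf =>
      (HomotopyLie.isCEMap_iff hf).1 (hΦ _ _ hU hV _ _ hf))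
      (fun hU hV => (hμ _ _ hU hV).1) fun hU hV => (hμ _ _ hU hV).2⟩
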